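/- **Setting.** Let $1<p<\infty$, $X=L^p(\mathbb R)$ (complex valued), and for $n\in\mathbb N=\{1,2,\dots\}$, $s,t\in\mathbb R$ let $P_n=\chi_{[-n,n]}I$, $(V_su)(x)=u(x-s)$, $(U_tu)(x)=e^{itx}u(x)$, $(Z_nu)(x)=n^{-1/p}u(x/n)$. Let $\dot{\mathbb R}=\mathbb R\cup\{\infty\}$ be the one-point compactification of $\mathbb R$, with $|\infty|:=\infty$. An operator $K\in\mathcal L(X)$ is $\mathcal P$-compact ($K\in\mathcal K(X,\mathcal P)$) if $\|K(I-P_n)\|\to0$ and $\|(I-P_n)K\|\to0$; $\mathcal L(X,\mathcal P)$ is the set of $A\in\mathcal L(X)$ with $AK,KA\in\mathcal K(X,\mathcal P)$ for all $K\in\mathcal K(X,\mathcal P)$. $B\in\mathcal L(X)$ is a $\mathcal P$-regularizer of $A\in\mathcal L(X,\mathcal P)$ if $AB-I,\,BA-I\in\mathcal K(X,\mathcal P)$, and $A$ is $\mathcal P$-Fredholm if it has a $\mathcal P$-regularizer. $A_n\to A$ $\mathcal P$-strongly means $\|K(A_n-A)\|+\|(A_n-A)K\|\to0$ for every $K\in\mathcal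 K(X,\mathcal P)$; $A_n\to A$ $*$-strongly means $A_n\to A$ and $A_n^*\to A^*$ strongly. **Sequence algebras.** Let $\mathcal F$ be the Banach algebra of bounded sequences $\mathbb A=\{A_n\}\subset\mathcal L(X)$ with entrywise operations and the sup norm. For strictly increasing $h:\mathbb N\to\mathbb N$ write $\mathbb A_h=\{A_{h_n}\}$. Let $\mathcal F_h^T$ be the set of all bounded $\mathbb A_h=\{A_{h_n}\}$ for which the $\mathcal P$-strong limits $\mathsf W^c(\mathbb A_h)$, $\mathsf W^\pm(\mathbb A_h)$ of $A_{h_n}$ and $V_{\mp h_n}A_{h_n}V_{\pm h_n}$ exist and belong to $\mathcal L(X,\mathcal P)$, and for which, for every $t\in\mathbb R$, the $*$-strong limit of $Z_{h_n}^{-1}U_tA_{h_n}U_{-t}Z_{h_n}$ exists. Let $\mathcal J_h^T$ be the smallest closed subspace of the bounded sequences containing all sequences tending to $0$ in norm, all $\{K\}$, $\{V_{h_n}KV_{-h_n}\}$, $\{V_{-h_n}KV_{h_n}\}$ with $K$ $\mathcal P$-compact, and all $\{U_{-t}Z_{h_n}KZ_{h_n}^{-1}U_t\}$ with $K$ compact,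 $t\in\mathbb R$. For $\varphi\in C(\dot{\mathbb R})$ put $\varphi_n(x)=\varphi(x/n)$. The algebra $\mathcal L_h^T$ of sequences of local type consists of all $\mathbb A_h\in\mathcal F_h^T$ with $\mathbb A_h\{\varphi_{h_n}I\}-\{\varphi_{h_n}I\}\mathbb A_h\in\mathcal J_h^T$ for all $\varphi\in C(\dot{\mathbb R})$. For $s\in\dot{\mathbb R}$, $\Phi_s$ denotes the canonical homomorphism of $\mathcal L_h^T/\mathcal J_h^T$ onto its quotient by the smallest closed two-sided ideal containing the cosets of all $\{\varphi_{h_n}I\}$ with $\varphi(s)=0$. **Generators.** In $L^\infty(\mathbb R)$ let, for $\lambda\in\dot{\mathbb R}$, $PC^\lambda$ be the functions continuous on $\dot{\mathbb R}\setminus\{\lambda\}$ with finite one-sided limits at $\lambda$, and $SO^\lambda$ the functions continuous on $\dot{\mathbb R}\setminus\{\lambda\}$ such that for every $r\in(0,1)$ the essential oscillation of $f$ over $\lambda+([-x,-rx]\cup[rx,x])$ tends to $0$ as $x\to+0$ (over $[-x,-rx]\cup[rx,x]$ as $x\to+\infty$, if $\lambda=\infty$). Let $[\,\cdot\,]$ denote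 the smallest closed subalgebra of $L^\infty(\mathbb R)$ containing the listed sets, $PC=[PC^\lambda:\lambda\in\dot{\mathbb R}]$, $SO=[SO^\lambda:\lambda\in\dot{\mathbb R}]$, $L_0^\infty$ the functions with limit $0$ at $\pm\infty$, and $BUC$ the bounded uniformly continuous functions. Let $(Fu)(x)=\int u(t)e^{itx}\,dt$. For $1<r<\infty$, $M^r$ is the set of $b\in L^\infty(\mathbb R)$ for which $W^0(b)=F^{-1}bF$ extends boundedly from $L^2\cap L^r$ to $L^r(\mathbb R)$, with norm $\|b\|_{M^r}=\|W^0(b)\|_{\mathcal L(L^r)}$. For $p\neq2$, $M^{<p>}$ is the set of $b\in M^p$ with $b\in M^r$ for all $r$ in some neighbourhood of $p$; $M^{<2>}=L^\infty(\mathbb R)$. For $\mathcal B\subset L^\infty(\mathbb R)$, $\mathcal B_p$ is the closure of $\mathcal B\cap M^{<p>}$ in $M^p$. Let $\mathcal A_1$ be the smallest closed subalgebra of $\mathcal F$ containing $\{P_n\}$ and the constant sequences $\{aI\}$, $\{W^0(b)\}$, $\{K\}$ with $a\in[PC,SO,L_0^\infty]$, $b\in[PC^\lambda,SO,BUC]_p$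 for some $\lambda\in\mathbb R$, and $K\in\mathcal K(X,\mathcal P)$. Let $\mathcal F_{\mathcal A_1}$ be the smallest closed subalgebra of $\mathcal F$ containing all $\{P_nA_nP_n+(I-P_n)\}$ with $\{A_n\}\in\mathcal A_1$. **Proposition.** Let $\mathbb A=\{A_n\}\in\mathcal F_{\mathcal A_1}$. There is a complex number $\mu_{\mathbb A}$ with $A_n=P_nA_nP_n+\mu_{\mathbb A}(I-P_n)$ for all $n$, and for every strictly increasing $g:\mathbb N\to\mathbb N$ there is a subsequence $h$ of $g$ such that $\mathbb A_h\in\mathcal L_h^T$, the sequences $\{\mathsf W^c(\mathbb A_h)\}$ and $\{V_{\pm h_n}\mathsf W^{\pm}(\mathbb A_h)V_{\mp h_n}\}$ belong to $\mathcal L_h^T$, and (a) $\Phi_s(\mathbb A_h+\mathcal J_h^T)=\Phi_s(\{\mathsf W^c(\mathbb A_h)\}+\mathcal J_h^T)$ if $|s|<1$; (b) $\Phi_{\pm1}(\mathbb A_h+\mathcal J_h^T)=\Phi_{\pm1}(\{V_{\pm h_n}\mathsf W^{\pm}(\mathbb A_h)V_{\mp h_n}\}+\mathcal J_h^T)$;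 (c) $\Phi_s(\mathbb A_h+\mathcal J_h^T)=\mu_{\mathbb A}\Phi_s(\{I\}+\mathcal J_h^T)$ if $s\in\dot{\mathbb R}$, $|s|>1$ (including $s=\infty$). Moreover, if $\mathsf W^c(\mathbb A_h)$ is $\mathcal P$-Fredholm and $B$ is any $\mathcal P$-regularizer of it, then $\{B\}_h\in\mathcal L_h^T$; and if $\mathsf W^{\pm}(\mathbb A_h)$ is $\mathcal P$-Fredholm and $B_\pm$ is any $\mathcal P$-regularizer of it, then $\{V_{\pm h_n}B_\pm V_{\mp h_n}\}_h\in\mathcal L_h^T$ (for each sign). -/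

import Mathlib

open MeasureTheory Filter Topology Set
open scoped ENNReal NNReal BoundedContinuousFunction FourierTransform

noncomputable section

namespace ConvType

/-! ## The space `L^p(ℝ)` and elementary operators on it -/

/-- The Banach space `X = L^p(ℝ)` (complex valued, Lebesgue measure). -/
abbrev X (p : ℝ≥0∞) := Lp ℂ p (volume : Measure ℝ)

/-- The algebra `L^∞(ℝ)`, as a normed space; the product of `a` and `b` is `a • b`. -/
abbrev Linf := Lp ℂ ∞ (volume : Measure ℝ)

/-- Bounded linear operators on `L^p(ℝ)`. -/
abbrev Op (p : ℝ≥0∞) [Fact (1 ≤ p)] := X p →L[ℂ] X p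

variable {p : ℝ≥0∞} [Fact (1 ≤ p)]

/-- The operator `aI` of multiplication by `a ∈ L^∞(ℝ)`. -/
def mulOp (p : ℝ≥0∞) [Fact (1 ≤ p)] (a : Linf) : Op p :=
  (ContinuousLinearMap.mul ℂ ℂ).holderL volume ∞ p p a

theorem mulOp_coeFn (a : Linf) (u : X p) : mulOp p a u =ᵐ[volume] fun x => a x * u x :=
  (ContinuousLinearMap.mul ℂ ℂ).coeFn_holder (r := p) a u

theorem norm_mulOp_le (a : Linf) : ‖mulOp p a‖ ≤ ‖a‖ := by
  refine ContinuousLinearMap.opNorm_le_bound _ (norm_nonneg _) fun u => ?_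
  refine ((ContinuousLinearMap.mul ℂ ℂ).norm_holder_apply_apply_le (r := p) a u).trans ?_
  have := ContinuousLinearMap.opNorm_mul_le ℂ ℂ
  have h : 0 ≤ ‖a‖ * ‖u‖ := by positivity
  nlinarith

/-- The characteristic function of `[-r, r]` as an element of `L^∞(ℝ)`. -/
def chi (r : ℝ) : Linf :=
  ((memLp_top_const (1 : ℂ)).indicator (measurableSet_Icc (a := -r) (b := r))).toLp _

/-- The projections `P_n = χ_{[-n,n]} I`. -/
def P (p : ℝ≥0∞) [Fact (1 ≤ p)] (n : ℕ+) : Op p := mulOp p (chi (n : ℝ))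

/-- An auxiliary construction: the isometric isomorphism `(Tu)(x) = w(x) u(σ(x))`, with inverse
`(T⁻¹u)(x) = w'(x) u(σ'(x))`. -/
def wcomp (p : ℝ≥0∞) [Fact (1 ≤ p)] (w w' : ℝ → ℂ) (σ σ' : ℝ → ℝ)
    (hw : Measurable w) (hw' : Measurable w')
    (hσ : Measure.QuasiMeasurePreserving σ volume volume)
    (hσ' : Measure.QuasiMeasurePreserving σ' volume volume)
    (h : ∀ f : ℝ → ℂ, AEStronglyMeasurable f volume →
      eLpNorm (fun x => w x * f (σ x)) p volume = eLpNorm f p volume)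
    (h' : ∀ f : ℝ → ℂ, AEStronglyMeasurable f volume →
      eLpNorm (fun x => w' x * f (σ' x)) p volume = eLpNorm f p volume)
    (h1 : ∀ x, w x * w' (σ x) = 1) (h2 : ∀ x, σ' (σ x) = x)
    (h1' : ∀ x, w' x * w (σ' x) = 1) (h2' : ∀ x, σ (σ' x) = x) :
    X p ≃ₗᵢ[ℂ] X p :=
  have hm : ∀ f : X p, MemLp (fun x => w x * f (σ x)) p volume := fun f =>
    ⟨hw.aestronglyMeasurable.mul ((Lp.aestronglyMeasurable f).comp_quasiMeasurePreserving hσ), by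
      rw [h _ (Lp.aestronglyMeasurable f)]; exact (Lp.memLp f).2⟩
  have hm' : ∀ f : X p, MemLp (fun x => w' x * f (σ' x)) p volume := fun f =>
    ⟨hw'.aestronglyMeasurable.mul ((Lp.aestronglyMeasurable f).comp_quasiMeasurePreserving hσ'), by
      rw [h' _ (Lp.aestronglyMeasurable f)]; exact (Lp.memLp f).2⟩
  { toFun := fun f => (hm f).toLp _
    map_add' := fun f g => by
      rw [← MemLp.toLp_add]
      apply MemLp.toLp_congr
      filter_upwards [hσ.ae (Lp.coeFn_add f g)] with x hx
      rw [Pi.add_apply, hx, Pi.add_apply, mul_add]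
    map_smul' := fun c f => by
      rw [RingHom.id_apply, ← MemLp.toLp_const_smul]
      apply MemLp.toLp_congr
      filter_upwards [hσ.ae (Lp.coeFn_smul c f)] with x hx
      simp [hx, mul_left_comm]
    invFun := fun f => (hm' f).toLp _
    left_inv := fun f => by
      apply Lp.ext
      refine (MemLp.coeFn_toLp _).trans ?_
      filter_upwards [hσ'.ae (MemLp.coeFn_toLp (hm f))] with x hx
      rw [hx, ← mul_assoc, h1', h2', one_mul]
    right_inv := fun f => by
      apply Lp.ext
      refine (MemLp.coeFn_toLp _).trans ?_
      filter_upwards [hσ.ae (MemLp.coeFn_toLp (hm' f))] with x hx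
      rw [hx, ← mul_assoc, h1, h2, one_mul]
    norm_map' := fun f => by
      change ‖(hm f).toLp _‖ = ‖f‖
      rw [Lp.norm_toLp, Lp.norm_def, h _ (Lp.aestronglyMeasurable f)] }

theorem wcomp_coeFn {w w' : ℝ → ℂ} {σ σ' : ℝ → ℝ} (hw hw' hσ hσ' h h' h1 h2 h1' h2') (u : X p) :
    wcomp p w w' σ σ' hw hw' hσ hσ' h h' h1 h2 h1' h2' u
      =ᵐ[volume] fun x => w x * u (σ x) :=
  MemLp.coeFn_toLp (f := fun x => w x * u (σ x))
    ⟨hw.aestronglyMeasurable.mul ((Lp.aestronglyMeasurable u).comp_quasiMeasurePreserving hσ), by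
      rw [h _ (Lp.aestronglyMeasurable u)]; exact (Lp.memLp u).2⟩

/-- The shift `(V_s u)(x) = u(x - s)`. -/
def V (p : ℝ≥0∞) [Fact (1 ≤ p)] (s : ℝ) : X p ≃ₗᵢ[ℂ] X p :=
  wcomp p (fun _ => 1) (fun _ => 1) (fun x => x - s) (fun x => x + s)
    measurable_const measurable_const
    (measurePreserving_sub_right volume s).quasiMeasurePreserving
    (measurePreserving_add_right volume s).quasiMeasurePreserving
    (fun f hf => by
      simpa [Function.comp_def] using
        eLpNorm_comp_measurePreserving (p := p) hf (measurePreserving_sub_right volume s))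
    (fun f hf => by
      simpa [Function.comp_def] using
        eLpNorm_comp_measurePreserving (p := p) hf (measurePreserving_add_right volume s))
    (by simp) (by simp) (by simp) (by simp)

theorem V_coeFn (s : ℝ) (u : X p) : V p s u =ᵐ[volume] fun x => u (x - s) := by
  simpa using! wcomp_coeFn (p := p) (w := fun _ => 1) (σ := fun x => x - s) _ _ _ _ _ _ _ _ _ _ u

/-- The modulation `(U_t u)(x) = e^{itx} u(x)`. -/
def U (p : ℝ≥0∞) [Fact (1 ≤ p)] (t : ℝ) : X p ≃ₗᵢ[ℂ] X p :=
  wcomp p (fun x => Complex.exp (Complex.I * (t * x : ℝ)))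
    (fun x => Complex.exp (Complex.I * (-(t * x) : ℝ))) id id
    (by fun_prop) (by fun_prop) (.id _) (.id _)
    (fun f _ => eLpNorm_congr_norm_ae (.of_forall fun x => by
      rw [norm_mul, mul_comm Complex.I, Complex.norm_exp_ofReal_mul_I, one_mul]; rfl))
    (fun f _ => eLpNorm_congr_norm_ae (.of_forall fun x => by
      rw [norm_mul, mul_comm Complex.I, Complex.norm_exp_ofReal_mul_I, one_mul]; rfl))
    (fun x => by rw [← Complex.exp_add]; simp) (fun _ => rfl)
    (fun x => by rw [← Complex.exp_add]; simp) (fun _ => rfl)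

theorem U_coeFn (t : ℝ) (u : X p) :
    U p t u =ᵐ[volume] fun x => Complex.exp (Complex.I * (t * x : ℝ)) * u x :=
  wcomp_coeFn _ _ _ _ _ _ _ _ _ _ u

theorem quasi_mul {c : ℝ} (hc : c ≠ 0) :
    Measure.QuasiMeasurePreserving (fun x : ℝ => c * x) volume volume :=
  ⟨measurable_const_mul c, by
    rw [Real.map_volume_mul_left hc]; exact Measure.smul_absolutelyContinuous⟩

theorem eLpNorm_dilation (p : ℝ≥0∞) {c : ℝ} (hc : 0 < c) (f : ℝ → ℂ) (hf : AEStronglyMeasurable f volume) :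
    eLpNorm (fun x => ((c ^ (1 / p).toReal : ℝ) : ℂ) * f (c * x)) p volume
      = eLpNorm f p volume := by
  have hmap : Measure.map (fun x : ℝ => c * x) volume = ENNReal.ofReal c⁻¹ • volume := by
    rw [Real.map_volume_mul_left hc.ne', abs_of_pos (inv_pos.2 hc)]
  have h1 : eLpNorm (fun x => f (c * x)) p volume
      = ENNReal.ofReal c⁻¹ ^ (1 / p).toReal • eLpNorm f p volume := by
    have hm := eLpNorm_map_measure (p := p) (μ := (volume : Measure ℝ)) (f := fun x : ℝ => c * x)
      (g := f) (by rw [hmap]; exact hf.mono_ac Measure.smul_absolutelyContinuous)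
      (measurable_const_mul c).aemeasurable
    rw [hmap, eLpNorm_smul_measure_of_ne_zero (by simpa using hc)] at hm
    exact hm.symm
  have h2 : eLpNorm (fun x => ((c ^ (1 / p).toReal : ℝ) : ℂ) * f (c * x)) p volume
      = ‖((c ^ (1 / p).toReal : ℝ) : ℂ)‖ₑ * eLpNorm (fun x => f (c * x)) p volume :=
    eLpNorm_const_smul ((c ^ (1 / p).toReal : ℝ) : ℂ) (fun x => f (c * x)) p volume
  rw [h2, h1, smul_eq_mul, ← mul_assoc]
  have hpos : 0 < c ^ (1 / p).toReal := Real.rpow_pos_of_pos hc _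
  have h3 : ‖((c ^ (1 / p).toReal : ℝ) : ℂ)‖ₑ = ENNReal.ofReal (c ^ (1 / p).toReal) := by
    rw [← ofReal_norm, Complex.norm_real, Real.norm_of_nonneg hpos.le]
  rw [h3, ENNReal.ofReal_rpow_of_pos (inv_pos.2 hc), ← ENNReal.ofReal_mul hpos.le,
    Real.inv_rpow hc.le, mul_inv_cancel₀ hpos.ne', ENNReal.ofReal_one, one_mul]

/-- The dilation `(Z_n u)(x) = n^{-1/p} u(x/n)`. -/
def Z (p : ℝ≥0∞) [Fact (1 ≤ p)] (n : ℕ+) : X p ≃ₗᵢ[ℂ] X p :=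
  have hn : (0 : ℝ) < (n : ℝ) := by exact_mod_cast n.pos
  wcomp p (fun _ => ((((n : ℝ)⁻¹) ^ (1 / p).toReal : ℝ) : ℂ))
    (fun _ => (((n : ℝ) ^ (1 / p).toReal : ℝ) : ℂ))
    (fun x => (n : ℝ)⁻¹ * x) (fun x => (n : ℝ) * x)
    measurable_const measurable_const
    (quasi_mul (inv_pos.2 hn).ne') (quasi_mul hn.ne')
    (fun f hf => eLpNorm_dilation p (inv_pos.2 hn) f hf)
    (fun f hf => eLpNorm_dilation p hn f hf)
    (fun x => by
      rw [← Complex.ofReal_mul, Real.inv_rpow hn.le,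
        inv_mul_cancel₀ (Real.rpow_pos_of_pos hn _).ne', Complex.ofReal_one])
    (fun x => by simp [hn.ne'])
    (fun x => by
      rw [← Complex.ofReal_mul, Real.inv_rpow hn.le,
        mul_inv_cancel₀ (Real.rpow_pos_of_pos hn _).ne', Complex.ofReal_one])
    (fun x => by simp [hn.ne'])

theorem Z_coeFn (n : ℕ+) (u : X p) : Z p n u
    =ᵐ[volume] fun x => ((((n : ℝ)⁻¹) ^ (1 / p).toReal : ℝ) : ℂ) * u ((n : ℝ)⁻¹ * x) := by
  unfold Z
  apply wcomp_coeFn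

/-! ## Function algebras in `L^∞(ℝ)`; the one-point compactification of `ℝ` is `OnePoint ℝ` -/

/-- `S` is a closed subalgebra of `L^∞(ℝ)`. -/
structure IsClosedAlgebra (S : Set Linf) : Prop where
  zero_mem : (0 : Linf) ∈ S
  add_mem : ∀ a ∈ S, ∀ b ∈ S, a + b ∈ S
  smul_mem : ∀ (c : ℂ), ∀ a ∈ S, c • a ∈ S
  mul_mem : ∀ a ∈ S, ∀ b ∈ S, (a • b : Linf) ∈ S
  isClosed : IsClosed S

/-- The smallest closed subalgebra of `L^∞(ℝ)` that contains `G`. -/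
def closedAlg (G : Set Linf) : Set Linf := ⋂₀ {S | G ⊆ S ∧ IsClosedAlgebra S}

/-- Approach to `lam` from the left (for `lam = ∞`: to `+∞`). -/
def leftFilter : OnePoint ℝ → Filter ℝ
  | none => atTop
  | some x => 𝓝[<] x

/-- Approach to `lam` from the right (for `lam = ∞`: to `-∞`). -/
def rightFilter : OnePoint ℝ → Filter ℝ
  | none => atBot
  | some x => 𝓝[>] x

/-- `PC^lam`: functions continuous on `OnePoint ℝ` minus `lam`, with one-sided limits at `lam`. -/
def PCat (lam : OnePoint ℝ) : Set Linf :=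
  {a | ∃ f : OnePoint ℝ → ℂ, (a =ᵐ[volume] fun x : ℝ => f x) ∧ ContinuousOn f {lam}ᶜ ∧
    (∃ l, Tendsto (fun x : ℝ => f x) (leftFilter lam) (𝓝 l)) ∧
    (∃ l, Tendsto (fun x : ℝ => f x) (rightFilter lam) (𝓝 l))}

/-- The essential oscillation `osc(f, I) = ess sup {|f(t) - f(s)| : t, s ∈ I}`. -/
def osc (f : ℝ → ℂ) (I : Set ℝ) : ℝ≥0∞ :=
  essSup (fun q : ℝ × ℝ => ‖f q.1 - f q.2‖ₑ) ((volume.restrict I).prod (volume.restrict I))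

/-- Slow oscillation at a point of `OnePoint ℝ`. -/
def SlowlyOscillating (f : ℝ → ℂ) : OnePoint ℝ → Prop
  | none => ∀ r ∈ Ioo (0 : ℝ) 1,
      Tendsto (fun x : ℝ => osc f (Icc (-x) (-(r * x)) ∪ Icc (r * x) x)) atTop (𝓝 0)
  | some lam => ∀ r ∈ Ioo (0 : ℝ) 1,
      Tendsto (fun x : ℝ => osc f ((fun y => lam + y) '' (Icc (-x) (-(r * x)) ∪ Icc (r * x) x)))
        (𝓝[>] 0) (𝓝 0)

/-- `SO^lam`: bounded functions continuous on `OnePoint ℝ` minus `lam`, slowly oscillating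
at `lam`. -/
def SOat (lam : OnePoint ℝ) : Set Linf :=
  {a | (∃ f : OnePoint ℝ → ℂ, (a =ᵐ[volume] fun x : ℝ => f x) ∧ ContinuousOn f {lam}ᶜ) ∧
    SlowlyOscillating a lam}

/-- `PC`. -/
def PC : Set Linf := closedAlg (⋃ lam, PCat lam)

/-- `SO`. -/
def SO : Set Linf := closedAlg (⋃ lam, SOat lam)

/-- `L^∞_0`: functions with `lim a(x) = 0` as `x → ±∞`. -/
def Linf0 : Set Linf :=
  {a | ∀ ε : ℝ, 0 < ε → ∃ N : ℝ, ∀ᵐ x : ℝ, N < |x| → ‖a x‖ < ε}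

/-- `BUC`: bounded uniformly continuous functions. -/
def BUC : Set Linf := {a | ∃ f : ℝ → ℂ, (a =ᵐ[volume] f) ∧ UniformContinuous f}

/-! ## Fourier multipliers and convolution operators -/

/-- The Fourier transform `(Fu)(x) = ∫ u(t) e^{itx} dt` on `L^2(ℝ)`, as a function; it is
Mathlib's (Plancherel) transform `𝓕`, whose kernel is `e^{-2πitx}`, after rescaling. -/
def F (u : X 2) (x : ℝ) : ℂ := (𝓕 u : X 2) (-x / (2 * Real.pi))

/-- `w = F⁻¹ b F v` for `v, w ∈ L^2(ℝ)`. -/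
def IsConvL2 (b : Linf) (v w : X 2) : Prop := ∀ᵐ x : ℝ, F w x = b x * F v x

/-- `b ∈ M^r`: `‖F⁻¹ b F v‖_r ≤ c ‖v‖_r` for all `v ∈ L^2(ℝ) ∩ L^r(ℝ)`. -/
def IsMultiplier (r : ℝ≥0∞) (b : Linf) : Prop :=
  ∃ c : ℝ≥0, ∀ v w : X 2, MemLp v r volume → IsConvL2 b v w →
    eLpNorm w r volume ≤ c * eLpNorm v r volume

/-- `T` is the convolution operator `W^0(b)` on `L^p(ℝ)`, i.e. the bounded operator which is
`F⁻¹ b F` on the (for `p < ∞` dense) subspace `L^2(ℝ) ∩ L^p(ℝ)`. -/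
def IsW0 (b : Linf) (T : Op p) : Prop :=
  ∀ (u : X p) (v w : X 2), u =ᵐ[volume] v → IsConvL2 b v w → T u =ᵐ[volume] w

/-- The class `M^{<p>}`: all of `L^∞(ℝ)` if `p = 2`; otherwise the multipliers on `L^p(ℝ)` that
are multipliers on `L^r(ℝ)` for all `r` in a neighbourhood of `p`. -/
def Mnear (p : ℝ≥0∞) : Set Linf :=
  {b | p = 2 ∨ (IsMultiplier p b ∧ ∃ δ : ℝ, 0 < δ ∧ ∀ r : ℝ, 1 < r → |r - p.toReal| < δ →
    IsMultiplier (ENNReal.ofReal r) b)}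

/-- `B_p`: the closure in `M^p` of `B ∩ M^{<p>}`, where `‖b‖_{M^p} = ‖W^0(b)‖`. -/
def multClosure (p : ℝ≥0∞) [Fact (1 ≤ p)] (B : Set Linf) : Set Linf :=
  {b | ∃ T : Op p, IsW0 b T ∧ ∀ ε : ℝ, 0 < ε →
    ∃ c ∈ B ∩ Mnear p, ∃ S : Op p, IsW0 c S ∧ ‖T - S‖ < ε}

/-! ## `P`-compactness, `P`-Fredholmness and `P`-strong convergence -/

/-- The `P`-compact operators. -/
def PCompact (p : ℝ≥0∞) [Fact (1 ≤ p)] : Set (Op p) :=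
  {K | Tendsto (fun n : ℕ+ => ‖K * (1 - P p n)‖) atTop (𝓝 0) ∧
    Tendsto (fun n : ℕ+ => ‖(1 - P p n) * K‖) atTop (𝓝 0)}

/-- `L(X, P)`: the operators compatible with the `P`-compact ones. -/
def PBounded (p : ℝ≥0∞) [Fact (1 ≤ p)] : Set (Op p) :=
  {A | ∀ K ∈ PCompact p, A * K ∈ PCompact p ∧ K * A ∈ PCompact p}

/-- `B` is a `P`-regularizer of `A`. -/
def IsPRegularizer (A B : Op p) : Prop :=
  A * B - 1 ∈ PCompact p ∧ B * A - 1 ∈ PCompact p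

/-- `P`-strong convergence `A n → W`. -/
def PStrongTendsto (A : ℕ+ → Op p) (W : Op p) : Prop :=
  ∀ K ∈ PCompact p, Tendsto (fun n => ‖K * (A n - W)‖ + ‖(A n - W) * K‖) atTop (𝓝 0)

/-- `*`-strong convergence `A n → W`; the adjoint of `A` on the dual space is `f ↦ f ∘ A`. -/
def StarStrongTendsto (A : ℕ+ → Op p) (W : Op p) : Prop :=
  (∀ u : X p, Tendsto (fun n => A n u) atTop (𝓝 (W u))) ∧
  ∀ f : StrongDual ℂ (X p), Tendsto (fun n => f.comp (A n)) atTop (𝓝 (f.comp W))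

/-! ## Sequences of operators, directions and snapshots -/

/-- The Banach algebra of bounded sequences of operators (entrywise operations, sup norm). The
same type serves for subsequences: `{A_{h_n}}` is stored as the sequence `n ↦ A_{h_n}`. -/
def OpSeq (p : ℝ≥0∞) [Fact (1 ≤ p)] := ℕ+ →ᵇ Op p

instance : NormedRing (OpSeq p) := inferInstanceAs (NormedRing (ℕ+ →ᵇ Op p))

instance : NormedAlgebra ℂ (OpSeq p) := inferInstanceAs (NormedAlgebra ℂ (ℕ+ →ᵇ Op p))

instance : FunLike (OpSeq p) ℕ+ (Op p) := inferInstanceAs (FunLike (ℕ+ →ᵇ Op p) ℕ+ (Op p))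

theorem OpSeq.add_apply (A B : OpSeq p) (n : ℕ+) : (A + B) n = A n + B n := rfl

theorem OpSeq.mul_apply (A B : OpSeq p) (n : ℕ+) : (A * B) n = A n * B n := rfl

theorem OpSeq.norm_apply_le (A : OpSeq p) (n : ℕ+) : ‖A n‖ ≤ ‖A‖ :=
  BoundedContinuousFunction.norm_coe_le_norm (α := ℕ+) (β := Op p) A n

/-- The index set `T = {-, c, +} ∪ ℝ`. -/
inductive Dir
  | minus
  | center
  | plus
  | freq (t : ℝ)

/-- The isometries which define the transformations `E_n^t`: `V_{-n}`, `I`, `V_n`, and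
`U_{-t} Z_n`, respectively. -/
def frame (p : ℝ≥0∞) [Fact (1 ≤ p)] (n : ℕ+) : Dir → (X p ≃ₗᵢ[ℂ] X p)
  | .minus => V p (-(n : ℝ))
  | .center => LinearIsometryEquiv.refl ℂ (X p)
  | .plus => V p (n : ℝ)
  | .freq t => (Z p n).trans (U p (-t))

/-- A linear isometry of `X` onto itself as a bounded operator. -/
def isoOp (e : X p ≃ₗᵢ[ℂ] X p) : Op p := (e.toContinuousLinearEquiv : X p →L[ℂ] X p)

/-- `E_n^t(K)`; explicitly `V_{-n} K V_n`, `K`, `V_n K V_{-n}`, `U_{-t} Z_n K Z_n⁻¹ U_t`. -/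
def E (n : ℕ+) (t : Dir) (K : Op p) : Op p :=
  isoOp (frame p n t) * K * isoOp (frame p n t).symm

/-- `(E_n^t)⁻¹(A)`; explicitly `V_n A V_{-n}`, `A`, `V_{-n} A V_n`, `Z_n⁻¹ U_t A U_{-t} Z_n`. -/
def Einv (n : ℕ+) (t : Dir) (A : Op p) : Op p :=
  isoOp (frame p n t).symm * A * isoOp (frame p n t)

/-- The ideal `K^t`: `P`-compact operators for `t = -, c, +`, compact operators for `t ∈ ℝ`. -/
def compactAt (p : ℝ≥0∞) [Fact (1 ≤ p)] : Dir → Set (Op p)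
  | .freq _ => {K | IsCompactOperator K}
  | _ => PCompact p

/-- `W` is the `t`-snapshot of the sequence `A_h = {A_{h_n}}`. -/
def HasSnapshot (h : ℕ+ → ℕ+) (A : OpSeq p) (t : Dir) (W : Op p) : Prop :=
  match t with
  | .freq s => StarStrongTendsto (fun n => Einv (h n) (.freq s) (A n)) W
  | t => PStrongTendsto (fun n => Einv (h n) t (A n)) W ∧ W ∈ PBounded p

open Classical in
/-- The `t`-snapshot of `A_h` (the zero operator if there is none). -/
def snapshot (h : ℕ+ → ℕ+) (A : OpSeq p) (t : Dir) : Op p :=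
  if hW : ∃ W, HasSnapshot h A t W then hW.choose else 0

/-- The subsequence `A_h = {A_{h_n}}` of `A`. -/
def subseq (A : OpSeq p) (h : ℕ+ → ℕ+) : OpSeq p :=
  BoundedContinuousFunction.compContinuous (A : ℕ+ →ᵇ Op p) ⟨h, continuous_of_discreteTopology⟩

theorem isoOp_norm_le (e : X p ≃ₗᵢ[ℂ] X p) : ‖isoOp e‖ ≤ 1 :=
  ContinuousLinearMap.opNorm_le_bound _ zero_le_one fun u => by
    rw [one_mul]; exact (e.norm_map u).le

theorem norm_conj_le (e f : X p ≃ₗᵢ[ℂ] X p) (K : Op p) : ‖isoOp e * K * isoOp f‖ ≤ ‖K‖ := by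
  have h1 := norm_mul_le (isoOp e * K) (isoOp f)
  have h2 := norm_mul_le (isoOp e) K
  have h3 := isoOp_norm_le e
  have h4 := isoOp_norm_le f
  have h5 := norm_nonneg K
  have h6 := norm_nonneg (isoOp e)
  have h7 := norm_nonneg (isoOp f)
  have h8 : ‖isoOp e‖ * ‖K‖ ≤ ‖K‖ := by nlinarith
  have h9 := norm_nonneg (isoOp e * K)
  nlinarith

/-- The lifted sequence `{E_{h_n}^t(K)}`; in particular `{K}` for `t = c` and
`{V_{±h_n} K V_{∓h_n}}` for `t = ±`. -/
def lift (h : ℕ+ → ℕ+) (t : Dir) (K : Op p) : OpSeq p :=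
  BoundedContinuousFunction.ofNormedAddCommGroupDiscrete (fun n => E (h n) t K) ‖K‖
    fun _ => norm_conj_le _ _ K

/-- The closed subspace `J_h` spanned by all `{E_{h_n}^t(K)}`, `K ∈ K^t`, and all null
sequences. -/
def J (p : ℝ≥0∞) [Fact (1 ≤ p)] (h : ℕ+ → ℕ+) : Submodule ℂ (OpSeq p) :=
  (Submodule.span ℂ ({G : OpSeq p | ∃ t, ∃ K ∈ compactAt p t, G = lift h t K} ∪
    {G : OpSeq p | Tendsto (fun n => ‖G n‖) atTop (𝓝 0)})).topologicalClosure

/-! ## The algebra of structured sequences, and facts that make the quotients below well defined -/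

theorem pCompact_add {K L : Op p} (hK : K ∈ PCompact p) (hL : L ∈ PCompact p) :
    K + L ∈ PCompact p := by
  constructor
  · refine squeeze_zero (fun _ => norm_nonneg _) (fun n => ?_) (by simpa using hK.1.add hL.1)
    rw [add_mul]; exact norm_add_le _ _
  · refine squeeze_zero (fun _ => norm_nonneg _) (fun n => ?_) (by simpa using hK.2.add hL.2)
    rw [mul_add]; exact norm_add_le _ _

theorem pCompact_smul (c : ℂ) {K : Op p} (hK : K ∈ PCompact p) : c • K ∈ PCompact p := by
  constructor
  · have := hK.1.const_mul ‖c‖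
    simpa [smul_mul_assoc, norm_smul] using this
  · have := hK.2.const_mul ‖c‖
    simpa [mul_smul_comm, norm_smul] using this

theorem isoOp_symm_mul (e : X p ≃ₗᵢ[ℂ] X p) : isoOp e.symm * isoOp e = 1 := by
  ext1 u; exact e.symm_apply_apply u

theorem isoOp_mul_symm (e : X p ≃ₗᵢ[ℂ] X p) : isoOp e * isoOp e.symm = 1 := by
  ext1 u; exact e.apply_symm_apply u

theorem norm_Einv_le (n : ℕ+) (t : Dir) (A : Op p) : ‖Einv n t A‖ ≤ ‖A‖ := norm_conj_le _ _ A

theorem norm_E_le (n : ℕ+) (t : Dir) (A : Op p) : ‖E n t A‖ ≤ ‖A‖ := norm_conj_le _ _ A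

theorem Einv_add (n : ℕ+) (t : Dir) (A B : Op p) :
    Einv n t (A + B) = Einv n t A + Einv n t B := by simp [Einv, mul_add, add_mul]

theorem Einv_mul (n : ℕ+) (t : Dir) (A B : Op p) :
    Einv n t (A * B) = Einv n t A * Einv n t B := by
  have h := isoOp_mul_symm (frame p n t)
  calc Einv n t (A * B) = isoOp (frame p n t).symm * A * 1 * B * isoOp (frame p n t) := by
        simp [Einv, mul_assoc]
    _ = _ := by rw [← h]; simp only [Einv, mul_assoc]

theorem Einv_algebraMap (n : ℕ+) (t : Dir) (c : ℂ) :
    Einv n t (algebraMap ℂ (Op p) c) = algebraMap ℂ (Op p) c := by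
  simp [Einv, Algebra.algebraMap_eq_smul_one, isoOp_symm_mul]

theorem mul_E (n : ℕ+) (t : Dir) (A K : Op p) : A * E n t K = E n t (Einv n t A * K) := by
  have h := isoOp_mul_symm (frame p n t)
  simp only [E, Einv, mul_assoc]
  rw [← mul_assoc (isoOp (frame p n t)) (isoOp (frame p n t).symm), h, one_mul]

theorem E_mul (n : ℕ+) (t : Dir) (A K : Op p) : E n t K * A = E n t (K * Einv n t A) := by
  have h := isoOp_mul_symm (frame p n t)
  simp only [E, Einv, mul_assoc]
  rw [h, mul_one]

theorem E_sub (n : ℕ+) (t : Dir) (A B : Op p) : E n t (A - B) = E n t A - E n t B := by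
  simp [E, mul_sub, sub_mul]

theorem PStrongTendsto.add {A B : ℕ+ → Op p} {W W' : Op p} (hA : PStrongTendsto A W)
    (hB : PStrongTendsto B W') : PStrongTendsto (fun n => A n + B n) (W + W') := by
  intro K hK
  refine squeeze_zero (fun _ => by positivity) (fun n => ?_)
    (by simpa using (hA K hK).add (hB K hK))
  have e : A n + B n - (W + W') = (A n - W) + (B n - W') := by abel
  rw [e, mul_add, add_mul]
  linarith [norm_add_le (K * (A n - W)) (K * (B n - W')),
    norm_add_le ((A n - W) * K) ((B n - W') * K)]

theorem PStrongTendsto.mul {A B : ℕ+ → Op p} {W W' : Op p} {a b : ℝ}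
    (ha : ∀ n, ‖A n‖ ≤ a) (hb : ∀ n, ‖B n‖ ≤ b)
    (hA : PStrongTendsto A W) (hB : PStrongTendsto B W')
    (hW : W ∈ PBounded p) (hW' : W' ∈ PBounded p) :
    PStrongTendsto (fun n => A n * B n) (W * W') := by
  intro K hK
  have l1 := ((hA K hK).mul_const b).add (hB _ (hW K hK).2)
  have l2 := ((hB K hK).const_mul a).add (hA _ (hW' K hK).1)
  refine squeeze_zero (fun _ => by positivity) (fun n => ?_) (by simpa using l1.add l2)
  have e1 : K * (A n * B n - W * W') = K * (A n - W) * B n + K * W * (B n - W') := by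
    noncomm_ring
  have e2 : (A n * B n - W * W') * K = A n * ((B n - W') * K) + (A n - W) * (W' * K) := by
    noncomm_ring
  rw [e1, e2]
  have i1 : ‖K * (A n - W) * B n‖ ≤ ‖K * (A n - W)‖ * b :=
    (norm_mul_le _ _).trans (mul_le_mul_of_nonneg_left (hb n) (norm_nonneg _))
  have i2 : ‖A n * ((B n - W') * K)‖ ≤ a * ‖(B n - W') * K‖ :=
    (norm_mul_le _ _).trans (mul_le_mul_of_nonneg_right (ha n) (norm_nonneg _))
  have b0 : 0 ≤ b := (norm_nonneg _).trans (hb n)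
  have a0 : 0 ≤ a := (norm_nonneg _).trans (ha n)
  have j1 := norm_add_le (K * (A n - W) * B n) (K * W * (B n - W'))
  have j2 := norm_add_le (A n * ((B n - W') * K)) ((A n - W) * (W' * K))
  have k1 : 0 ≤ ‖(A n - W) * K‖ * b := by positivity
  have k2 : 0 ≤ a * ‖K * (B n - W')‖ := by positivity
  have k3 := norm_nonneg ((B n - W') * (K * W))
  have k4 := norm_nonneg (W' * K * (A n - W))
  nlinarith

theorem StarStrongTendsto.add {A B : ℕ+ → Op p} {W W' : Op p} (hA : StarStrongTendsto A W)
    (hB : StarStrongTendsto B W') : StarStrongTendsto (fun n => A n + B n) (W + W') :=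
  ⟨fun u => by simpa using (hA.1 u).add (hB.1 u), fun f => by
    simpa [ContinuousLinearMap.comp_add] using (hA.2 f).add (hB.2 f)⟩

theorem StarStrongTendsto.mul {A B : ℕ+ → Op p} {W W' : Op p} {a b : ℝ}
    (ha : ∀ n, ‖A n‖ ≤ a) (hb : ∀ n, ‖B n‖ ≤ b)
    (hA : StarStrongTendsto A W) (hB : StarStrongTendsto B W') :
    StarStrongTendsto (fun n => A n * B n) (W * W') := by
  constructor
  · intro u
    rw [tendsto_iff_norm_sub_tendsto_zero]
    have l1 := (tendsto_iff_norm_sub_tendsto_zero.1 (hB.1 u)).const_mul a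
    have l2 := tendsto_iff_norm_sub_tendsto_zero.1 (hA.1 (W' u))
    refine squeeze_zero (fun _ => norm_nonneg _) (fun n => ?_) (by simpa using l1.add l2)
    have e : (A n * B n) u - (W * W') u = A n (B n u - W' u) + (A n (W' u) - W (W' u)) := by
      simp
    rw [e]
    refine (norm_add_le _ _).trans (add_le_add ?_ le_rfl)
    exact ((A n).le_opNorm _).trans (mul_le_mul_of_nonneg_right (ha n) (norm_nonneg _))
  · intro f
    rw [tendsto_iff_norm_sub_tendsto_zero]
    have l1 := (tendsto_iff_norm_sub_tendsto_zero.1 (hA.2 f)).mul_const b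
    have l2 := tendsto_iff_norm_sub_tendsto_zero.1 (hB.2 (f.comp W))
    refine squeeze_zero (fun _ => norm_nonneg _) (fun n => ?_) (by simpa using l1.add l2)
    have e : f.comp (A n * B n) - f.comp (W * W') =
        (f.comp (A n) - f.comp W).comp (B n) + ((f.comp W).comp (B n) - (f.comp W).comp W') := by
      ext u; simp
    rw [e]
    refine (norm_add_le _ _).trans (add_le_add ?_ le_rfl)
    exact (ContinuousLinearMap.opNorm_comp_le _ _).trans
      (mul_le_mul_of_nonneg_left (hb n) (norm_nonneg _))

theorem pBounded_add {A B : Op p} (hA : A ∈ PBounded p) (hB : B ∈ PBounded p) :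
    A + B ∈ PBounded p := fun K hK => by
  rw [add_mul, mul_add]
  exact ⟨pCompact_add (hA K hK).1 (hB K hK).1, pCompact_add (hA K hK).2 (hB K hK).2⟩

theorem pBounded_mul {A B : Op p} (hA : A ∈ PBounded p) (hB : B ∈ PBounded p) :
    A * B ∈ PBounded p := fun K hK => by
  rw [mul_assoc, ← mul_assoc K]
  exact ⟨(hA _ (hB K hK).1).1, (hB _ (hA K hK).2).2⟩

theorem pBounded_scalar (c : ℂ) : algebraMap ℂ (Op p) c ∈ PBounded p := fun K hK => by
  rw [Algebra.algebraMap_eq_smul_one, smul_mul_assoc, mul_smul_comm, one_mul, mul_one]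
  exact ⟨pCompact_smul c hK, pCompact_smul c hK⟩

theorem HasSnapshot.add {h : ℕ+ → ℕ+} {A B : OpSeq p} {t : Dir} {W W' : Op p}
    (hA : HasSnapshot h A t W) (hB : HasSnapshot h B t W') :
    HasSnapshot h (A + B) t (W + W') := by
  cases t
  case freq s =>
    have := StarStrongTendsto.add hA hB
    simpa only [HasSnapshot, OpSeq.add_apply, Einv_add] using this
  all_goals
    refine ⟨?_, pBounded_add hA.2 hB.2⟩
    have := PStrongTendsto.add hA.1 hB.1
    simpa only [OpSeq.add_apply, Einv_add] using this

theorem HasSnapshot.mul {h : ℕ+ → ℕ+} {A B : OpSeq p} {t : Dir} {W W' : Op p}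
    (hA : HasSnapshot h A t W) (hB : HasSnapshot h B t W') :
    HasSnapshot h (A * B) t (W * W') := by
  have ha : ∀ n, ‖Einv (h n) t (A n)‖ ≤ ‖A‖ := fun n =>
    (norm_Einv_le _ _ _).trans (A.norm_apply_le n)
  have hb : ∀ n, ‖Einv (h n) t (B n)‖ ≤ ‖B‖ := fun n =>
    (norm_Einv_le _ _ _).trans (B.norm_apply_le n)
  cases t
  case freq s =>
    have := StarStrongTendsto.mul ha hb hA hB
    simpa only [HasSnapshot, OpSeq.mul_apply, Einv_mul] using this
  all_goals
    refine ⟨?_, pBounded_mul hA.2 hB.2⟩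
    have := PStrongTendsto.mul ha hb hA.1 hB.1 hA.2 hB.2
    simpa only [OpSeq.mul_apply, Einv_mul] using this

theorem hasSnapshot_scalar (h : ℕ+ → ℕ+) (t : Dir) (c : ℂ) :
    HasSnapshot h (algebraMap ℂ (OpSeq p) c) t (algebraMap ℂ (Op p) c) := by
  have e : ∀ n, Einv (h n) t ((algebraMap ℂ (OpSeq p) c) n)
      = algebraMap ℂ (Op p) c := fun n => Einv_algebraMap _ _ c
  cases t
  case freq s =>
    simp only [HasSnapshot, e]
    exact ⟨fun _ => tendsto_const_nhds, fun _ => tendsto_const_nhds⟩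
  all_goals
    refine ⟨?_, pBounded_scalar c⟩
    simp only [e]
    intro K _
    simp

/-- The algebra `F^T_h` of `T`-structured sequences `A_h`: all snapshots exist. -/
def structured (p : ℝ≥0∞) [Fact (1 ≤ p)] (h : ℕ+ → ℕ+) : Subalgebra ℂ (OpSeq p) where
  carrier := {A | ∀ t, ∃ W, HasSnapshot h A t W}
  add_mem' hA hB t := ⟨_, (hA t).choose_spec.add (hB t).choose_spec⟩
  mul_mem' hA hB t := ⟨_, (hA t).choose_spec.mul (hB t).choose_spec⟩
  algebraMap_mem' c t := ⟨_, hasSnapshot_scalar h t c⟩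

/-- Strong convergence becomes norm convergence after multiplication by a compact operator. -/
theorem tendsto_mul_compact {D : ℕ+ → Op p} {d : ℝ} (hd : ∀ n, ‖D n‖ ≤ d) {K : Op p}
    (hK : IsCompactOperator K) (hD : ∀ u, Tendsto (fun n => D n u) atTop (𝓝 0)) :
    Tendsto (fun n => ‖D n * K‖) atTop (𝓝 0) := by
  have d0 : 0 ≤ d := (norm_nonneg _).trans (hd 1)
  rw [Metric.tendsto_nhds]
  intro ε hε
  have htb := (hK.isCompact_closure_image_closedBall 1).totallyBounded
  obtain ⟨T, hT, hcov⟩ := Metric.totallyBounded_iff.1 htb (ε / (4 * (d + 1))) (by positivity)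
  have hev : ∀ᶠ n in atTop, ∀ y ∈ T, ‖D n y‖ < ε / 4 := by
    rw [hT.eventually_all]
    intro y _
    have := (hD y).norm
    rw [norm_zero] at this
    exact this.eventually_lt_const (by positivity)
  filter_upwards [hev] with n hn
  rw [dist_zero_right, norm_norm]
  refine lt_of_le_of_lt (ContinuousLinearMap.opNorm_le_of_unit_norm (C := ε / 2) (by positivity)
    fun u hu => ?_) (by linarith)
  have hmem : K u ∈ closure (K '' Metric.closedBall 0 1) :=
    subset_closure ⟨u, by simp [hu], rfl⟩
  obtain ⟨y, hy, hKy⟩ := mem_iUnion₂.1 (hcov hmem)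
  rw [Metric.mem_ball, dist_eq_norm] at hKy
  have e : (D n * K) u = D n (K u - y) + D n y := by simp
  rw [e]
  have i1 : ‖D n (K u - y)‖ ≤ d * (ε / (4 * (d + 1))) :=
    ((D n).le_opNorm _).trans (mul_le_mul (hd n) hKy.le (norm_nonneg _) d0)
  have i2 : d * (ε / (4 * (d + 1))) ≤ ε / 4 := by
    rw [mul_div_assoc', div_le_div_iff₀ (by positivity) (by positivity)]
    nlinarith
  linarith [norm_add_le (D n (K u - y)) (D n y), hn y hy]

theorem tendsto_compact_mul {D : ℕ+ → Op p} {d : ℝ} (hd : ∀ n, ‖D n‖ ≤ d) {K : Op p}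
    (hK : IsCompactOperator K)
    (hD : ∀ f : StrongDual ℂ (X p), Tendsto (fun n => f.comp (D n)) atTop (𝓝 0)) :
    Tendsto (fun n => ‖K * D n‖) atTop (𝓝 0) := by
  have d0 : 0 ≤ d := (norm_nonneg _).trans (hd 1)
  rw [Metric.tendsto_nhds]
  intro ε hε
  have htb := (hK.isCompact_closure_image_closedBall d).totallyBounded
  obtain ⟨T, hT, hcov⟩ := Metric.totallyBounded_iff.1 htb (ε / 8) (by positivity)
  choose f hf1 hf2 using fun y : X p => exists_dual_vector'' ℂ y
  have hev : ∀ᶠ n in atTop, ∀ y ∈ T, ‖((f y).comp K).comp (D n)‖ < ε / 4 := by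
    rw [hT.eventually_all]
    intro y _
    have := (hD ((f y).comp K)).norm
    rw [norm_zero] at this
    exact this.eventually_lt_const (by positivity)
  filter_upwards [hev] with n hn
  rw [dist_zero_right, norm_norm]
  refine lt_of_le_of_lt (ContinuousLinearMap.opNorm_le_of_unit_norm (C := ε / 2) (by positivity)
    fun u hu => ?_) (by linarith)
  have hDu : ‖D n u‖ ≤ d := by
    have := (D n).le_opNorm u
    rw [hu, mul_one] at this
    exact this.trans (hd n)
  have hmem : K (D n u) ∈ closure (K '' Metric.closedBall 0 d) :=
    subset_closure ⟨D n u, by simpa using hDu, rfl⟩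
  obtain ⟨y, hy, hKy⟩ := mem_iUnion₂.1 (hcov hmem)
  rw [Metric.mem_ball, dist_eq_norm] at hKy
  set z := K (D n u) with hz
  have i1 : ‖f y z‖ ≤ ε / 4 := by
    have := (((f y).comp K).comp (D n)).le_opNorm u
    rw [hu, mul_one] at this
    exact this.trans (hn y hy).le
  have i2 : ‖f y (z - y)‖ ≤ ε / 8 := by
    have := (f y).le_opNorm (z - y)
    have h3 := norm_nonneg (z - y)
    have h4 := hf1 y
    nlinarith
  have i3 : ‖y‖ = ‖f y y‖ := by rw [hf2]; simp
  have i4 : f y y = f y z - f y (z - y) := by rw [map_sub]; ring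
  have i5 : ‖y‖ ≤ ε / 4 + ε / 8 := by
    rw [i3, i4]; exact (norm_sub_le _ _).trans (add_le_add i1 i2)
  have i6 : z = (z - y) + y := by abel
  change ‖z‖ ≤ ε / 2
  calc ‖z‖ = ‖(z - y) + y‖ := by rw [← i6]
    _ ≤ ‖z - y‖ + ‖y‖ := norm_add_le _ _
    _ ≤ ε / 2 := by linarith

theorem HasSnapshot.mul_compact {h : ℕ+ → ℕ+} {A : OpSeq p} {t : Dir} {W K : Op p}
    (hA : HasSnapshot h A t W) (hK : K ∈ compactAt p t) :
    W * K ∈ compactAt p t ∧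
      Tendsto (fun n => ‖(Einv (h n) t (A n) - W) * K‖) atTop (𝓝 0) := by
  cases t
  case freq s =>
    refine ⟨hK.clm_comp W, tendsto_mul_compact (d := ‖A‖ + ‖W‖) (fun n => ?_) hK fun u => ?_⟩
    · exact (norm_sub_le _ _).trans
        (add_le_add ((norm_Einv_le _ _ _).trans (A.norm_apply_le n)) le_rfl)
    · simpa using (hA.1 u).sub_const (W u)
  all_goals
    exact ⟨(hA.2 K hK).1, squeeze_zero (fun _ => norm_nonneg _)
      (fun _ => le_add_of_nonneg_left (norm_nonneg _)) (hA.1 K hK)⟩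

theorem HasSnapshot.compact_mul {h : ℕ+ → ℕ+} {A : OpSeq p} {t : Dir} {W K : Op p}
    (hA : HasSnapshot h A t W) (hK : K ∈ compactAt p t) :
    K * W ∈ compactAt p t ∧
      Tendsto (fun n => ‖K * (Einv (h n) t (A n) - W)‖) atTop (𝓝 0) := by
  cases t
  case freq s =>
    refine ⟨hK.comp_clm W, tendsto_compact_mul (d := ‖A‖ + ‖W‖) (fun n => ?_) hK fun f => ?_⟩
    · exact (norm_sub_le _ _).trans
        (add_le_add ((norm_Einv_le _ _ _).trans (A.norm_apply_le n)) le_rfl)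
    · simpa [ContinuousLinearMap.comp_sub] using (hA.2 f).sub_const (f.comp W)
  all_goals
    exact ⟨(hA.2 K hK).2, squeeze_zero (fun _ => norm_nonneg _)
      (fun _ => le_add_of_nonneg_right (norm_nonneg _)) (hA.1 K hK)⟩

theorem J_of_null {h : ℕ+ → ℕ+} {G : OpSeq p} (hG : Tendsto (fun n => ‖G n‖) atTop (𝓝 0)) :
    G ∈ J p h :=
  Submodule.le_topologicalClosure _ (Submodule.subset_span (Or.inr hG))

theorem J_of_lift (h : ℕ+ → ℕ+) {t : Dir} {K : Op p} (hK : K ∈ compactAt p t) :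
    lift h t K ∈ J p h :=
  Submodule.le_topologicalClosure _ (Submodule.subset_span (Or.inl ⟨t, K, hK, rfl⟩))

theorem J_isClosed (h : ℕ+ → ℕ+) : IsClosed (J p h : Set (OpSeq p)) :=
  Submodule.isClosed_topologicalClosure _

/-- To map `J_h` into itself, a continuous linear map only has to map the generators there. -/
theorem J_map {h : ℕ+ → ℕ+} (f : OpSeq p →L[ℂ] OpSeq p)
    (h1 : ∀ t, ∀ K ∈ compactAt p t, f (lift h t K) ∈ J p h)
    (h2 : ∀ G : OpSeq p, Tendsto (fun n => ‖G n‖) atTop (𝓝 0) → f G ∈ J p h)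
    {B : OpSeq p} (hB : B ∈ J p h) : f B ∈ J p h := by
  have hle : J p h ≤ (J p h).comap (f : OpSeq p →ₗ[ℂ] OpSeq p) := by
    refine Submodule.topologicalClosure_minimal _ (Submodule.span_le.2 ?_)
      ((J_isClosed h).preimage f.continuous)
    rintro G (⟨t, K, hK, rfl⟩ | hG)
    · exact h1 t K hK
    · exact h2 G hG
  exact hle hB

theorem structured_mul_J {h : ℕ+ → ℕ+} {A B : OpSeq p} (hA : A ∈ structured p h) (hB : B ∈ J p h) :
    A * B ∈ J p h := by
  refine J_map (ContinuousLinearMap.mul ℂ (OpSeq p) A) (fun t K hK => ?_) (fun G hG => ?_) hB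
  · obtain ⟨W, hW⟩ : ∃ W, HasSnapshot h A t W := hA t
    obtain ⟨m1, m2⟩ := hW.mul_compact hK
    have e : A * lift h t K = lift h t (W * K) + (A * lift h t K - lift h t (W * K)) := by abel
    change A * lift h t K ∈ J p h
    rw [e]
    refine add_mem (J_of_lift h m1) (J_of_null (squeeze_zero (fun _ => norm_nonneg _) ?_ m2))
    intro n
    have : (A * lift h t K - lift h t (W * K)) n
        = E (h n) t ((Einv (h n) t (A n) - W) * K) := by
      change A n * E (h n) t K - E (h n) t (W * K) = _
      rw [mul_E, sub_mul, E_sub]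
    rw [this]
    exact norm_E_le _ _ _
  · refine J_of_null (squeeze_zero (fun _ => norm_nonneg _) (fun n => ?_)
      (by simpa using hG.const_mul ‖A‖))
    exact (norm_mul_le _ _).trans
      (mul_le_mul_of_nonneg_right (A.norm_apply_le n) (norm_nonneg _))

theorem J_mul_structured {h : ℕ+ → ℕ+} {A B : OpSeq p} (hA : A ∈ structured p h) (hB : B ∈ J p h) :
    B * A ∈ J p h := by
  refine J_map ((ContinuousLinearMap.mul ℂ (OpSeq p)).flip A) (fun t K hK => ?_) (fun G hG => ?_) hB
  · obtain ⟨W, hW⟩ : ∃ W, HasSnapshot h A t W := hA t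
    obtain ⟨m1, m2⟩ := hW.compact_mul hK
    have e : lift h t K * A = lift h t (K * W) + (lift h t K * A - lift h t (K * W)) := by abel
    change lift h t K * A ∈ J p h
    rw [e]
    refine add_mem (J_of_lift h m1) (J_of_null (squeeze_zero (fun _ => norm_nonneg _) ?_ m2))
    intro n
    have : (lift h t K * A - lift h t (K * W)) n
        = E (h n) t (K * (Einv (h n) t (A n) - W)) := by
      change E (h n) t K * A n - E (h n) t (K * W) = _
      rw [E_mul, mul_sub, E_sub]
    rw [this]
    exact norm_E_le _ _ _
  · refine J_of_null (squeeze_zero (fun _ => norm_nonneg _) (fun n => ?_)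
      (by simpa using hG.mul_const ‖A‖))
    exact (norm_mul_le _ _).trans
      (mul_le_mul_of_nonneg_left (A.norm_apply_le n) (norm_nonneg _))

/-! ## Sequences of local type and the local algebras -/

theorem norm_inflated_le (φ : C(OnePoint ℝ, ℂ)) (n : ℕ+) (x : ℝ) :
    ‖φ ((x / (n : ℝ) : ℝ) : OnePoint ℝ)‖ ≤ ‖φ‖ := φ.norm_coe_le_norm _

theorem memLp_inflated (φ : C(OnePoint ℝ, ℂ)) (n : ℕ+) :
    MemLp (fun x : ℝ => φ ((x / (n : ℝ) : ℝ) : OnePoint ℝ)) ∞ (volume : Measure ℝ) := by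
  refine memLp_top_of_bound (Continuous.aestronglyMeasurable ?_) ‖φ‖
    (.of_forall (norm_inflated_le φ n))
  exact φ.continuous.comp (OnePoint.continuous_coe.comp (continuous_id.div_const _))

/-- The inflated function `φ_n(x) = φ(x/n)`, for `φ` continuous on `OnePoint ℝ`. -/
def inflated (φ : C(OnePoint ℝ, ℂ)) (n : ℕ+) : Linf := (memLp_inflated φ n).toLp _

theorem norm_inflated (φ : C(OnePoint ℝ, ℂ)) (n : ℕ+) : ‖inflated φ n‖ ≤ ‖φ‖ := by
  rw [inflated, Lp.norm_toLp, eLpNorm_exponent_top]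
  refine ENNReal.toReal_le_of_le_ofReal (norm_nonneg _) ?_
  exact eLpNormEssSup_le_of_ae_bound (.of_forall (norm_inflated_le φ n))

/-- The element `{φ_{h_n} I}` of `C_h`. -/
def cSeq (p : ℝ≥0∞) [Fact (1 ≤ p)] (h : ℕ+ → ℕ+) (φ : C(OnePoint ℝ, ℂ)) : OpSeq p :=
  BoundedContinuousFunction.ofNormedAddCommGroupDiscrete
    (fun n => mulOp p (inflated φ (h n))) ‖φ‖
    fun _ => (norm_mulOp_le _).trans (norm_inflated φ _)

/-- The algebra `L^T_h` of sequences of local type: the structured sequences which commute with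
every `{φ_{h_n} I}` modulo `J_h`. -/
def localType (p : ℝ≥0∞) [Fact (1 ≤ p)] (h : ℕ+ → ℕ+) : Subalgebra ℂ (OpSeq p) where
  carrier := {A | A ∈ structured p h ∧
    ∀ φ : C(OnePoint ℝ, ℂ), A * cSeq p h φ - cSeq p h φ * A ∈ J p h}
  add_mem' := by
    rintro A B ⟨hA, hA'⟩ ⟨hB, hB'⟩
    refine ⟨add_mem hA hB, fun φ => ?_⟩
    have e : (A + B) * cSeq p h φ - cSeq p h φ * (A + B)
        = (A * cSeq p h φ - cSeq p h φ * A) + (B * cSeq p h φ - cSeq p h φ * B) := by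
      rw [add_mul, mul_add]; abel
    rw [e]; exact add_mem (hA' φ) (hB' φ)
  mul_mem' := by
    rintro A B ⟨hA, hA'⟩ ⟨hB, hB'⟩
    refine ⟨mul_mem hA hB, fun φ => ?_⟩
    have e : A * B * cSeq p h φ - cSeq p h φ * (A * B)
        = A * (B * cSeq p h φ - cSeq p h φ * B) + (A * cSeq p h φ - cSeq p h φ * A) * B := by
      rw [mul_sub, sub_mul, mul_assoc, mul_assoc, mul_assoc]; abel
    rw [e]; exact add_mem (structured_mul_J hA (hB' φ)) (J_mul_structured hB (hA' φ))
  algebraMap_mem' c := by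
    refine ⟨Subalgebra.algebraMap_mem _ c, fun φ => ?_⟩
    rw [Algebra.commutes c (cSeq p h φ), sub_self]; exact zero_mem _

theorem localType_le {h : ℕ+ → ℕ+} {A : OpSeq p} (hA : A ∈ localType p h) :
    A ∈ structured p h := by
  obtain ⟨h1, _⟩ : A ∈ structured p h ∧ _ := hA
  exact h1

/-- `J_h` as a two-sided ideal of `L^T_h`. -/
def jIdeal (p : ℝ≥0∞) [Fact (1 ≤ p)] (h : ℕ+ → ℕ+) : TwoSidedIdeal (localType p h) :=
  TwoSidedIdeal.mk' {A | (A : OpSeq p) ∈ J p h} (zero_mem (J p h))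
    (fun {x y} hx hy => (J p h).add_mem (x := (x : OpSeq p)) (y := (y : OpSeq p)) hx hy)
    (fun {x} hx => (J p h).neg_mem (x := (x : OpSeq p)) hx)
    (fun {x _} hy => structured_mul_J (localType_le x.2) hy)
    (fun {_ y} hx => J_mul_structured (localType_le y.2) hx)

/-- The quotient algebra `L^T_h / J_h`. -/
abbrev LmodJ (p : ℝ≥0∞) [Fact (1 ≤ p)] (h : ℕ+ → ℕ+) := (jIdeal p h).ringCon.Quotient

/-- The coset `A_h + J_h` of a sequence of local type. -/
def coset {h : ℕ+ → ℕ+} {A : OpSeq p} (hA : A ∈ localType p h) : LmodJ p h :=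
  (jIdeal p h).ringCon.mk' ⟨A, hA⟩

/-- The local ideal at `s`: the smallest two-sided ideal of `L^T_h / J_h`, closed in the quotient
topology, which contains the cosets of all `{φ_{h_n} I}` with `φ(s) = 0`. (Each `{φ_{h_n} I}` is of local type, so
the condition `hφ` only gives access to its coset.) -/
def localIdeal (p : ℝ≥0∞) [Fact (1 ≤ p)] (h : ℕ+ → ℕ+) (s : OnePoint ℝ) :
    TwoSidedIdeal (LmodJ p h) :=
  sInf {I | IsClosed ((jIdeal p h).ringCon.mk' ⁻¹' (I : Set (LmodJ p h))) ∧
    ∀ φ : C(OnePoint ℝ, ℂ), φ s = 0 → ∀ hφ : cSeq p h φ ∈ localType p h, coset hφ ∈ I}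

/-- The canonical homomorphism `Φ_s` of `L^T_h / J_h` onto its local algebra at `s`, i.e. onto
the quotient by the local ideal at `s`. -/
def Phi (p : ℝ≥0∞) [Fact (1 ≤ p)] (h : ℕ+ → ℕ+) (s : OnePoint ℝ) :
    LmodJ p h →+* (localIdeal p h s).ringCon.Quotient :=
  (localIdeal p h s).ringCon.mk'

/-! ## The sequence algebras -/

/-- The closed algebra `A_1`, generated by the constant sequences `{aI}`, `{W^0(b)}`, `{K}` and
by `{P_n}`, where `a ∈ [PC, SO, L^∞_0]`, `b ∈ [PC^lam, SO, BUC]_p` with `lam ∈ ℝ`, and `K` is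
`P`-compact. -/
def A1 (p : ℝ≥0∞) [Fact (1 ≤ p)] : Subalgebra ℂ (OpSeq p) :=
  (Algebra.adjoin ℂ ({S : OpSeq p | ∃ a ∈ closedAlg (PC ∪ SO ∪ Linf0), ∀ n, S n = mulOp p a} ∪
    {S : OpSeq p | ∃ lam : ℝ, ∃ b ∈ multClosure p (closedAlg (PCat (lam : OnePoint ℝ) ∪ SO ∪ BUC)),
      ∃ T : Op p, IsW0 b T ∧ ∀ n, S n = T} ∪
    {S : OpSeq p | ∃ K ∈ PCompact p, ∀ n, S n = K} ∪
    {S : OpSeq p | ∀ n, S n = P p n})).topologicalClosure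

/-- The finite section algebra: the smallest closed algebra containing all sequences
`{P_n A_n P_n + (I - P_n)}` with `{A_n}` in `A_1`. -/
def FA1 (p : ℝ≥0∞) [Fact (1 ≤ p)] : Subalgebra ℂ (OpSeq p) :=
  (Algebra.adjoin ℂ {S : OpSeq p | ∃ A ∈ A1 p,
    ∀ n, S n = P p n * A n * P p n + (1 - P p n)}).topologicalClosure

end ConvType

end

open ConvType

noncomputable section

namespace ConvType

variable {p : ℝ≥0∞} [Fact (1 ≤ p)]

/-! ## Multiplication operators -/

/-- `T` is the operator of multiplication by the function `f`. -/
def IsMul (T : Op p) (f : ℝ → ℂ) : Prop := ∀ u : X p, T u =ᵐ[volume] fun x => f x * u x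

theorem isMul_mulOp (a : Linf) : IsMul (mulOp p a) a := mulOp_coeFn a

theorem isMul_one : IsMul (1 : Op p) fun _ => 1 := fun u => by simp

theorem isMul_zero : IsMul (0 : Op p) fun _ => 0 := fun u => by
  filter_upwards [Lp.coeFn_zero ℂ p volume] with x hx
  rw [zero_mul]; exact hx

theorem IsMul.congr {T : Op p} {f g : ℝ → ℂ} (hT : IsMul T f) (h : f =ᵐ[volume] g) :
    IsMul T g := fun u => by
  filter_upwards [hT u, h] with x h1 h2
  rw [h1, h2]

theorem IsMul.mul {T S : Op p} {f g : ℝ → ℂ} (hT : IsMul T f) (hS : IsMul S g) :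
    IsMul (T * S) fun x => f x * g x := fun u => by
  filter_upwards [hT (S u), hS u] with x h1 h2
  rw [mul_apply_eq_comp, h1, h2, mul_assoc]

theorem IsMul.add {T S : Op p} {f g : ℝ → ℂ} (hT : IsMul T f) (hS : IsMul S g) :
    IsMul (T + S) fun x => f x + g x := fun u => by
  filter_upwards [hT u, hS u, Lp.coeFn_add (T u) (S u)] with x h1 h2 h3
  rw [_root_.add_apply, h3, Pi.add_apply, h1, h2, add_mul]

theorem IsMul.sub {T S : Op p} {f g : ℝ → ℂ} (hT : IsMul T f) (hS : IsMul S g) :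
    IsMul (T - S) fun x => f x - g x := fun u => by
  filter_upwards [hT u, hS u, Lp.coeFn_sub (T u) (S u)] with x h1 h2 h3
  rw [_root_.sub_apply, h3, Pi.sub_apply, h1, h2, sub_mul]

theorem IsMul.smul {T : Op p} {f : ℝ → ℂ} (c : ℂ) (hT : IsMul T f) :
    IsMul (c • T) fun x => c * f x := fun u => by
  filter_upwards [hT u, Lp.coeFn_smul c (T u)] with x h1 h3
  rw [_root_.smul_apply, h3, Pi.smul_apply, h1, smul_eq_mul, mul_assoc]

theorem IsMul.ext {T S : Op p} {f g : ℝ → ℂ} (hT : IsMul T f) (hS : IsMul S g)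
    (h : f =ᵐ[volume] g) : T = S := by
  ext1 u
  refine Lp.ext ?_
  filter_upwards [hT u, hS u, h] with x h1 h2 h3
  rw [h1, h2, h3]

theorem IsMul.commute {T S : Op p} {f g : ℝ → ℂ} (hT : IsMul T f) (hS : IsMul S g) :
    T * S = S * T :=
  (hT.mul hS).ext (hS.mul hT) (.of_forall fun _ => mul_comm _ _)

theorem IsMul.norm_apply_le {T : Op p} {f : ℝ → ℂ} (hT : IsMul T f) {c : ℝ}
    (h : ∀ᵐ x, ‖f x‖ ≤ c) (u : X p) : ‖T u‖ ≤ c * ‖u‖ := by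
  refine Lp.norm_le_mul_norm_of_ae_le_mul ?_
  filter_upwards [hT u, h] with x h1 h2
  rw [h1, norm_mul]
  gcongr

theorem IsMul.norm_le {T : Op p} {f : ℝ → ℂ} (hT : IsMul T f) {c : ℝ} (hc : 0 ≤ c)
    (h : ∀ᵐ x, ‖f x‖ ≤ c) : ‖T‖ ≤ c :=
  ContinuousLinearMap.opNorm_le_bound _ hc (hT.norm_apply_le h)

theorem mulOp_of_memLp {f : ℝ → ℂ} (hf : MemLp f ∞ volume) : IsMul (mulOp p hf.toLp) f :=
  (isMul_mulOp _).congr hf.coeFn_toLp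

theorem exists_isMul {f : ℝ → ℂ} (hf : AEStronglyMeasurable f volume) {c : ℝ}
    (h : ∀ᵐ x, ‖f x‖ ≤ c) : ∃ T : Op p, IsMul T f :=
  ⟨_, mulOp_of_memLp (memLp_top_of_bound hf c h)⟩

/-! ## Conjugation with the frames -/

/-- The change of variable that belongs to `frame p n t`. -/
def Dir.act (n : ℕ+) : Dir → ℝ → ℝ
  | .minus => fun x => x - -(n : ℝ)
  | .center => fun x => x
  | .plus => fun x => x - (n : ℝ)
  | .freq _ => fun x => (n : ℝ)⁻¹ * x

/-- The inverse change of variable. -/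
def Dir.actInv (n : ℕ+) : Dir → ℝ → ℝ
  | .minus => fun x => x + -(n : ℝ)
  | .center => fun x => x
  | .plus => fun x => x + (n : ℝ)
  | .freq _ => fun x => (n : ℝ) * x

theorem pnat_pos (n : ℕ+) : (0 : ℝ) < (n : ℝ) := by exact_mod_cast n.pos

theorem Dir.act_actInv (n : ℕ+) (t : Dir) (x : ℝ) : t.act n (t.actInv n x) = x := by
  cases t <;> simp [act, actInv]

theorem Dir.quasi_act (n : ℕ+) (t : Dir) :
    Measure.QuasiMeasurePreserving (t.act n) volume volume := by
  cases t
  · exact (measurePreserving_sub_right volume _).quasiMeasurePreserving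
  · exact .id _
  · exact (measurePreserving_sub_right volume _).quasiMeasurePreserving
  · exact quasi_mul (inv_pos.2 (pnat_pos n)).ne'

theorem Dir.quasi_actInv (n : ℕ+) (t : Dir) :
    Measure.QuasiMeasurePreserving (t.actInv n) volume volume := by
  cases t
  · exact (measurePreserving_add_right volume _).quasiMeasurePreserving
  · exact .id _
  · exact (measurePreserving_add_right volume _).quasiMeasurePreserving
  · exact quasi_mul (pnat_pos n).ne'

/-- The oscillating factor in `frame p n t`. -/
def frameE : Dir → ℝ → ℂ
  | .freq t => fun x => Complex.exp (Complex.I * (-t * x : ℝ))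
  | _ => fun _ => 1

theorem norm_frameE (t : Dir) (x : ℝ) : ‖frameE t x‖ = 1 := by
  cases t
  case freq s =>
    change ‖Complex.exp _‖ = 1
    rw [mul_comm, Complex.norm_exp_ofReal_mul_I]
  all_goals exact norm_one

theorem frameE_ne_zero (t : Dir) (x : ℝ) : frameE t x ≠ 0 :=
  norm_ne_zero_iff.1 (by rw [norm_frameE]; exact one_ne_zero)

theorem frame_coeFn (n : ℕ+) (t : Dir) : ∃ c : ℂ, c ≠ 0 ∧
    ∀ u : X p, frame p n t u =ᵐ[volume] fun x => c * frameE t x * u (t.act n x) := by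
  cases t with
  | minus => exact ⟨1, one_ne_zero, fun u => by
      simp only [frameE, one_mul]; exact V_coeFn (p := p) (-(n : ℝ)) u⟩
  | center => exact ⟨1, one_ne_zero, fun u => by simp [frame, Dir.act, frameE]⟩
  | plus => exact ⟨1, one_ne_zero, fun u => by
      simp only [frameE, one_mul]; exact V_coeFn (p := p) (n : ℝ) u⟩
  | freq t =>
    refine ⟨((((n : ℝ)⁻¹) ^ (1 / p).toReal : ℝ) : ℂ), ?_, fun u => ?_⟩
    · have := Real.rpow_pos_of_pos (inv_pos.2 (pnat_pos n)) (1 / p).toReal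
      exact_mod_cast this.ne'
    · filter_upwards [U_coeFn (-t) (Z p n u), Z_coeFn n u] with x h1 h2
      change (U p (-t) (Z p n u)) x = _
      rw [h1, h2, mul_comm _ (frameE _ _), mul_assoc]
      rfl

theorem IsMul.E {T : Op p} {f : ℝ → ℂ} (hT : IsMul T f) (n : ℕ+) (t : Dir) :
    IsMul (E n t T) fun x => f (t.act n x) := fun u => by
  obtain ⟨c, -, hw⟩ := frame_coeFn (p := p) n t
  set v : X p := (frame p n t).symm u with hv
  have hu : frame p n t v = u := (frame p n t).apply_symm_apply u
  change (frame p n t) (T v) =ᵐ[volume] _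
  have h1 := hw v
  rw [hu] at h1
  filter_upwards [hw (T v), h1, (Dir.quasi_act n t).ae (hT v)] with x h2 h3 h4
  rw [h2, h3, h4]; ring

theorem IsMul.Einv {T : Op p} {f : ℝ → ℂ} (hT : IsMul T f) (n : ℕ+) (t : Dir) :
    IsMul (Einv n t T) fun x => f (t.actInv n x) := fun u => by
  obtain ⟨c, hc, hw⟩ := frame_coeFn (p := p) n t
  set g : X p := (ConvType.Einv n t T) u with hg
  have hu : frame p n t g = T (frame p n t u) :=
    (frame p n t).apply_symm_apply _
  have h1 := hw g
  rw [hu] at h1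
  have h2 : ∀ᵐ x, g (t.act n x) = f x * u (t.act n x) := by
    filter_upwards [h1, hT (frame p n t u), hw u] with x h1 h2 h3
    rw [h2, h3] at h1
    apply mul_left_cancel₀ (mul_ne_zero hc (frameE_ne_zero t x))
    rw [← h1]; ring
  filter_upwards [(Dir.quasi_actInv n t).ae h2] with x hx
  simpa only [Dir.act_actInv] using hx

theorem Einv_E (n : ℕ+) (t : Dir) (A : Op p) : Einv n t (E n t A) = A := by
  have h := isoOp_symm_mul (frame p n t)
  calc Einv n t (E n t A) = (isoOp (frame p n t).symm * isoOp (frame p n t)) * A *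
        (isoOp (frame p n t).symm * isoOp (frame p n t)) := by simp only [E, Einv, mul_assoc]
    _ = A := by rw [h, one_mul, mul_one]

theorem E_Einv (n : ℕ+) (t : Dir) (A : Op p) : E n t (Einv n t A) = A := by
  have h := isoOp_mul_symm (frame p n t)
  calc E n t (Einv n t A) = (isoOp (frame p n t) * isoOp (frame p n t).symm) * A *
        (isoOp (frame p n t) * isoOp (frame p n t).symm) := by simp only [E, Einv, mul_assoc]
    _ = A := by rw [h, one_mul, mul_one]

theorem E_mul_E (n : ℕ+) (t : Dir) (A B : Op p) : E n t (A * B) = E n t A * E n t B := by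
  rw [mul_E, Einv_E]

theorem E_one (n : ℕ+) (t : Dir) : E n t (1 : Op p) = 1 := by
  simp [E, isoOp_mul_symm]

theorem E_add (n : ℕ+) (t : Dir) (A B : Op p) : E n t (A + B) = E n t A + E n t B := by
  simp [E, mul_add, add_mul]

theorem E_smul (n : ℕ+) (t : Dir) (c : ℂ) (A : Op p) : E n t (c • A) = c • E n t A := by
  simp [E]

theorem Einv_sub (n : ℕ+) (t : Dir) (A B : Op p) :
    Einv n t (A - B) = Einv n t A - Einv n t B := by
  simp [Einv, mul_sub, sub_mul]

theorem norm_E (n : ℕ+) (t : Dir) (A : Op p) : ‖E n t A‖ = ‖A‖ :=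
  le_antisymm (norm_E_le _ _ _) (by simpa only [Einv_E] using norm_Einv_le n t (E n t A))

theorem E_center (n : ℕ+) (A : Op p) : E n .center A = A := by
  ext1 u; rfl

/-! ## Dominated convergence -/

theorem tendsto_eLpNorm_mul_zero {q : ℝ≥0∞} (hq0 : q ≠ 0) (hq : q ≠ ∞) {g : ℝ → ℂ}
    (hg : MemLp g q volume) {f : ℕ+ → ℝ → ℂ}
    (hm : ∀ n, AEStronglyMeasurable (fun x => f n x * g x) volume) {C : ℝ}
    (hC : ∀ n, ∀ᵐ x, ‖f n x‖ ≤ C) (hf : ∀ᵐ x, Tendsto (fun n => f n x) atTop (𝓝 0)) :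
    Tendsto (fun n => eLpNorm (fun x => f n x * g x) q volume) atTop (𝓝 0) := by
  have hq' : 0 < q.toReal := ENNReal.toReal_pos hq0 hq
  have key : Tendsto (fun n => ∫⁻ x, ‖f n x * g x‖ₑ ^ q.toReal) atTop (𝓝 (∫⁻ _ : ℝ, 0)) := by
    refine tendsto_lintegral_filter_of_dominated_convergence'
      (fun x => (ENNReal.ofReal C * ‖g x‖ₑ) ^ q.toReal)
      (.of_forall fun n => ((hm n).enorm.pow_const _)) (.of_forall fun n => ?_) ?_ ?_
    · filter_upwards [hC n] with x hx
      rw [enorm_mul]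
      gcongr
      rw [← ofReal_norm]
      exact ENNReal.ofReal_le_ofReal hx
    · simp_rw [ENNReal.mul_rpow_of_nonneg _ _ hq'.le]
      rw [lintegral_const_mul' _ _ (ENNReal.rpow_ne_top_of_nonneg hq'.le ENNReal.ofReal_ne_top)]
      refine ENNReal.mul_ne_top (ENNReal.rpow_ne_top_of_nonneg hq'.le ENNReal.ofReal_ne_top) ?_
      exact (lintegral_rpow_enorm_lt_top_of_eLpNorm_lt_top hq0 hq hg.2).ne
    · filter_upwards [hf] with x hx
      have h1 : Tendsto (fun n => ‖f n x * g x‖ₑ) atTop (𝓝 0) := by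
        simpa using (hx.mul_const (g x)).enorm
      have := (ENNReal.continuous_rpow_const (y := q.toReal)).tendsto 0 |>.comp h1
      simpa [ENNReal.zero_rpow_of_pos hq'] using! this
  simp_rw [eLpNorm_eq_lintegral_rpow_enorm_toReal hq0 hq]
  rw [lintegral_zero] at key
  have := (ENNReal.continuous_rpow_const (y := 1 / q.toReal)).tendsto 0 |>.comp key
  simpa [ENNReal.zero_rpow_of_pos, hq'] using! this

theorem fact_ne_zero : p ≠ 0 := (zero_lt_one.trans_le (Fact.out : 1 ≤ p)).ne'

theorem tendsto_isMul_apply (hp : p ≠ ∞) {T : ℕ+ → Op p} {f : ℕ+ → ℝ → ℂ}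
    (hT : ∀ n, IsMul (T n) (f n)) {C : ℝ} (hC : ∀ n, ∀ᵐ x, ‖f n x‖ ≤ C)
    (hf : ∀ᵐ x, Tendsto (fun n => f n x) atTop (𝓝 0)) (u : X p) :
    Tendsto (fun n => T n u) atTop (𝓝 0) := by
  rw [tendsto_zero_iff_norm_tendsto_zero]
  have h1 := tendsto_eLpNorm_mul_zero (q := p) fact_ne_zero hp (Lp.memLp u)
    (fun n => (Lp.aestronglyMeasurable (T n u)).congr (hT n u)) hC hf
  have h2 := (ENNReal.tendsto_toReal ENNReal.zero_ne_top).comp h1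
  refine h2.congr fun n => ?_
  rw [Lp.norm_def, eLpNorm_congr_ae (hT n u)]; rfl

/-! ## The projections `P_n` -/

/-- The characteristic function of `[-r, r]`. -/
def box (r : ℝ) : ℝ → ℂ := (Icc (-r) r).indicator fun _ => 1

theorem box_of_mem {r x : ℝ} (h : |x| ≤ r) : box r x = 1 :=
  indicator_of_mem (s := Icc (-r) r) (abs_le.1 h) _

theorem box_of_notMem {r x : ℝ} (h : r < |x|) : box r x = 0 :=
  indicator_of_notMem (s := Icc (-r) r) (fun h' => absurd (abs_le.2 h') (not_le.2 h)) _

theorem norm_box_le (r x : ℝ) : ‖box r x‖ ≤ 1 := by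
  rcases le_or_gt |x| r with h | h
  · simp [box_of_mem h]
  · simp [box_of_notMem h]

theorem norm_one_sub_box_le (r x : ℝ) : ‖1 - box r x‖ ≤ 1 := by
  rcases le_or_gt |x| r with h | h
  · simp [box_of_mem h]
  · simp [box_of_notMem h]

theorem isMul_P (n : ℕ+) : IsMul (P p n) (box n) :=
  (isMul_mulOp _).congr (MemLp.coeFn_toLp _)

theorem isMul_one_sub_P (n : ℕ+) : IsMul (1 - P p n) fun x => 1 - box n x := isMul_one.sub (isMul_P n)

theorem norm_P_le (n : ℕ+) : ‖P p n‖ ≤ 1 :=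
  (isMul_P n).norm_le zero_le_one (.of_forall fun _ => norm_box_le _ _)

theorem norm_one_sub_P_le (n : ℕ+) : ‖1 - P p n‖ ≤ 1 :=
  (isMul_one_sub_P n).norm_le zero_le_one (.of_forall fun _ => norm_one_sub_box_le _ _)

theorem box_mul_box {r s : ℝ} (h : r ≤ s) (x : ℝ) : box r x * box s x = box r x := by
  rcases le_or_gt |x| r with h' | h'
  · simp [box_of_mem h', box_of_mem (h'.trans h)]
  · simp [box_of_notMem h']

theorem P_mul_P {m n : ℕ+} (h : m ≤ n) : P p m * P p n = P p m :=
  ((isMul_P m).mul (isMul_P n)).ext (isMul_P m)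
    (.of_forall fun x => box_mul_box (by exact_mod_cast h) x)

theorem P_mul_P' {m n : ℕ+} (h : m ≤ n) : P p n * P p m = P p m := by
  rw [(isMul_P n).commute (isMul_P m), P_mul_P h]

theorem P_mul_self (n : ℕ+) : P p n * P p n = P p n := P_mul_P le_rfl

theorem P_mul_one_sub {m n : ℕ+} (h : m ≤ n) : P p m * (1 - P p n) = 0 := by
  rw [mul_sub, mul_one, P_mul_P h, sub_self]

theorem one_sub_mul_P {m n : ℕ+} (h : m ≤ n) : (1 - P p n) * P p m = 0 := by
  rw [sub_mul, one_mul, P_mul_P' h, sub_self]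

theorem P_mem_PCompact (m : ℕ+) : P p m ∈ PCompact p := by
  constructor
  · refine tendsto_const_nhds.congr' ?_
    filter_upwards [eventually_ge_atTop m] with n hn
    rw [P_mul_one_sub hn, norm_zero]
  · refine tendsto_const_nhds.congr' ?_
    filter_upwards [eventually_ge_atTop m] with n hn
    rw [one_sub_mul_P hn, norm_zero]

theorem tendsto_pnat_cast : Tendsto (fun n : ℕ+ => (n : ℝ)) atTop atTop :=
  tendsto_natCast_atTop_atTop.comp tendsto_PNat_val_atTop_atTop

theorem tendsto_one_sub_P_apply (hp : p ≠ ∞) (u : X p) :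
    Tendsto (fun n => (1 - P p n) u) atTop (𝓝 0) := by
  refine tendsto_isMul_apply hp isMul_one_sub_P (fun n => .of_forall fun _ => norm_one_sub_box_le _ _)
    (.of_forall fun x => ?_) u
  refine tendsto_const_nhds.congr' ?_
  filter_upwards [tendsto_pnat_cast.eventually_ge_atTop |x|] with n hn
  rw [box_of_mem hn, sub_self]

theorem tendsto_P_apply (hp : p ≠ ∞) (u : X p) : Tendsto (fun n => P p n u) atTop (𝓝 u) := by
  have := (tendsto_one_sub_P_apply hp u).const_sub u
  simpa using this

/-! ## Bounded functions with compact support -/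

/-- Bounded measurable functions with bounded support. -/
def IsNice (g : ℝ → ℂ) : Prop :=
  AEStronglyMeasurable g volume ∧ ∃ C R : ℝ, (∀ x, ‖g x‖ ≤ C) ∧ ∀ x, R < |x| → g x = 0

theorem IsNice.memLp {g : ℝ → ℂ} (hg : IsNice g) (q : ℝ≥0∞) : MemLp g q volume := by
  obtain ⟨hm, C, R, hC, hR⟩ := hg
  have e : g = (Icc (-R) R).indicator g := by
    funext x
    by_cases hx : x ∈ Icc (-R) R
    · rw [indicator_of_mem hx]
    · rw [indicator_of_notMem hx]
      exact hR x (not_le.1 fun h => hx (abs_le.1 h))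
  rw [e, memLp_indicator_iff_restrict measurableSet_Icc]
  exact MemLp.of_bound hm.restrict C (.of_forall hC)

/-- The factor which truncates `u` to a bounded function with bounded support. -/
def trunc (u : ℝ → ℂ) (m : ℝ) : ℝ → ℂ := fun x => if |x| ≤ m ∧ ‖u x‖ ≤ m then 1 else 0

theorem norm_trunc_le (u : ℝ → ℂ) (m x : ℝ) : ‖trunc u m x‖ ≤ 1 := by
  unfold trunc; split_ifs <;> simp

theorem stronglyMeasurable_trunc {u : ℝ → ℂ} (hu : Measurable u) (m : ℝ) :
    StronglyMeasurable (trunc u m) := by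
  refine (Measurable.ite ?_ measurable_const measurable_const).stronglyMeasurable
  exact (measurableSet_le measurable_norm measurable_const).inter
    (measurableSet_le hu.norm measurable_const)

/-- Bounded functions with bounded support are dense, with control of the norm. -/
theorem exists_nice_near (hp : p ≠ ∞) (u : X p) {ε : ℝ} (hε : 0 < ε) :
    ∃ v : X p, ∃ k : ℝ → ℂ, IsNice k ∧ Measurable k ∧ v =ᵐ[volume] k ∧ ‖v‖ ≤ ‖u‖ ∧
      ‖v - u‖ < ε := by
  obtain ⟨u', hu', huu⟩ := (Lp.aestronglyMeasurable u)
  have hm := hu'.measurable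
  choose T hT using fun m : ℕ+ => exists_isMul (p := p)
    (stronglyMeasurable_trunc hm m).aestronglyMeasurable (.of_forall (norm_trunc_le u' m))
  have hlim := tendsto_isMul_apply hp (fun m => (isMul_one (p := p)).sub (hT m)) (C := 2)
    (fun m => .of_forall fun x => (norm_sub_le _ _).trans (by
      have := norm_trunc_le u' m x
      simp only [norm_one]; linarith)) (.of_forall fun x => by
      refine tendsto_const_nhds.congr' ?_
      filter_upwards [tendsto_pnat_cast.eventually_ge_atTop |x|,
        tendsto_pnat_cast.eventually_ge_atTop ‖u' x‖] with m h1 h2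
      simp [trunc, h1, h2]) u
  obtain ⟨m, hm'⟩ := ((tendsto_zero_iff_norm_tendsto_zero.1 hlim).eventually_lt_const hε).exists
  refine ⟨T m u, fun x => trunc u' m x * u' x, ⟨?_, m, m, fun x => ?_, fun x hx => ?_⟩,
    (stronglyMeasurable_trunc hm m).measurable.mul hm, ?_, ?_, ?_⟩
  · exact (stronglyMeasurable_trunc hm m).aestronglyMeasurable.mul hu'.aestronglyMeasurable
  · have h0 := pnat_pos m
    by_cases h : |x| ≤ m ∧ ‖u' x‖ ≤ m
    · simp only [trunc, if_pos h, one_mul]; exact h.2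
    · simp only [trunc, if_neg h, zero_mul, norm_zero]; exact h0.le
  · simp [trunc, not_le.2 hx]
  · filter_upwards [hT m u, huu] with x h1 h2
    rw [h1, h2]
  · simpa using (hT m).norm_apply_le (.of_forall (norm_trunc_le u' m)) u
  · rw [norm_sub_rev]; simpa using hm'

/-! ## Functionals given by functions -/

/-- The functional `v ↦ ∫ g v`. -/
def pairF (p : ℝ≥0∞) [Fact (1 ≤ p)] {g : ℝ → ℂ} (hg : MemLp g p.conjExponent volume) :
    StrongDual ℂ (X p) :=
  have : Fact (1 ≤ p.conjExponent) := ⟨by unfold ENNReal.conjExponent; exact le_self_add⟩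
  have : p.conjExponent.HolderConjugate p := ENNReal.HolderConjugate.symm
  (ContinuousLinearMap.mul ℂ ℂ).lpPairing volume p.conjExponent p hg.toLp

theorem pairF_apply {g : ℝ → ℂ} (hg : MemLp g p.conjExponent volume) (v : X p) :
    pairF p hg v = ∫ x, g x * v x := by
  have : Fact (1 ≤ p.conjExponent) := ⟨by unfold ENNReal.conjExponent; exact le_self_add⟩
  have : p.conjExponent.HolderConjugate p := ENNReal.HolderConjugate.symm
  refine ((ContinuousLinearMap.mul ℂ ℂ).lpPairing_eq_integral _ _).trans (integral_congr_ae ?_)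
  filter_upwards [hg.coeFn_toLp] with x hx
  rw [hx]; rfl

theorem norm_pairF_le {g : ℝ → ℂ} (hg : MemLp g p.conjExponent volume) :
    ‖pairF p hg‖ ≤ (eLpNorm g p.conjExponent volume).toReal := by
  have : p.conjExponent.HolderConjugate p := ENNReal.HolderConjugate.symm
  refine ContinuousLinearMap.opNorm_le_bound _ ENNReal.toReal_nonneg fun v => ?_
  rw [pairF_apply, Lp.norm_def, ← ENNReal.toReal_mul]
  have h1 := eLpNorm_smul_le_mul_eLpNorm (r := 1) (Lp.aestronglyMeasurable v) hg.1
    (p := p.conjExponent) (q := p)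
  have h2 : eLpNorm g p.conjExponent volume * eLpNorm v p volume ≠ ∞ :=
    ENNReal.mul_ne_top hg.2.ne (Lp.eLpNorm_ne_top v)
  refine (norm_integral_le_lintegral_norm _).trans (ENNReal.toReal_mono h2 (le_trans ?_ h1))
  rw [eLpNorm_one_eq_lintegral_enorm]
  refine lintegral_mono fun x => ?_
  rw [ofReal_norm]; rfl

/-! ## Uniform smoothness of `L^p` -/

theorem smooth_norm_rpow {r : ℝ} (hr : 1 < r) {η : ℝ} (hη : 0 < η) :
    ∃ τ : ℝ, 0 < τ ∧ ∀ a b : ℂ,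
      ‖a + τ • b‖ ^ r + ‖a - τ • b‖ ^ r ≤ 2 * ‖a‖ ^ r + η * τ * (‖a‖ ^ r + ‖b‖ ^ r) := by
  have hC := contDiff_norm_rpow (E := ℂ) hr
  set G : ℂ → ℝ := fun z => ‖z‖ ^ r with hG
  have hd : Differentiable ℝ G := hC.differentiable (by simp)
  have huc := (isCompact_closedBall (0 : ℂ) 2).uniformContinuousOn_of_continuous
    ((hC.continuous_fderiv (by simp)).continuousOn)
  obtain ⟨δ, hδ, hδ'⟩ := Metric.uniformContinuousOn_iff.1 huc (η / 2) (by positivity)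
  set τ := min (δ / 2) 1 with hτ
  have τ0 : 0 < τ := by positivity
  have τ1 : τ ≤ 1 := min_le_right _ _
  have τδ : τ < δ := (min_le_left _ _).trans_lt (by linarith)
  have unit : ∀ a b : ℂ, ‖a‖ ≤ 1 → ‖b‖ ≤ 1 →
      G (a + τ • b) + G (a - τ • b) ≤ 2 * G a + η * τ := by
    intro a b ha hb
    have key : ∀ c : ℂ, ‖c‖ ≤ 1 → G (a + τ • c) - G a - fderiv ℝ G a (τ • c) ≤ η / 2 * τ := by
      intro c hc
      have hnc : ‖τ • c‖ ≤ τ := by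
        rw [norm_smul, Real.norm_of_nonneg τ0.le]; nlinarith
      have := (convex_closedBall a τ).norm_image_sub_le_of_norm_fderiv_le' (f := G)
        (φ := fderiv ℝ G a) (C := η / 2) (x := a) (y := a + τ • c) (fun x _ => hd x)
        (fun x hx => by
          rw [mem_closedBall_iff_norm] at hx
          have hx2 : ‖x‖ ≤ 2 := by
            have := norm_le_norm_add_norm_sub' x a
            linarith
          have := hδ' x (by simpa using hx2) a (by simpa using ha.trans (by norm_num))
            (by rw [dist_eq_norm]; linarith)
          rw [dist_eq_norm] at this
          exact this.le) (by simp [τ0.le]) (by simpa using hnc)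
      rw [add_sub_cancel_left, Real.norm_eq_abs] at this
      refine (le_abs_self _).trans (this.trans ?_)
      gcongr
    have h1 := key b hb
    have h2 := key (-b) (by simpa using hb)
    rw [smul_neg, map_neg, ← sub_eq_add_neg] at h2
    linarith
  refine ⟨τ, τ0, fun a b => ?_⟩
  rcases eq_or_lt_of_le (le_max_of_le_left (norm_nonneg a) : 0 ≤ max ‖a‖ ‖b‖) with hM | hM
  · have ha : a = 0 := norm_le_zero_iff.1 (hM ▸ le_max_left _ _)
    have hb : b = 0 := norm_le_zero_iff.1 (hM ▸ le_max_right _ _)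
    simp [ha, hb, Real.zero_rpow (by linarith : r ≠ 0)]
  set M := max ‖a‖ ‖b‖ with hMdef
  have sc : ∀ z : ℂ, ‖z‖ ^ r = M ^ r * ‖M⁻¹ • z‖ ^ r := by
    intro z
    rw [← Real.mul_rpow hM.le (norm_nonneg _), norm_smul, Real.norm_of_nonneg (inv_pos.2 hM).le,
      ← mul_assoc, mul_inv_cancel₀ hM.ne', one_mul]
  have nz : ∀ z : ℂ, ‖z‖ ≤ M → ‖M⁻¹ • z‖ ≤ 1 := fun z hz => by
    rw [norm_smul, Real.norm_of_nonneg (inv_pos.2 hM).le]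
    exact inv_mul_le_one_of_le₀ hz hM.le
  have h := unit (M⁻¹ • a) (M⁻¹ • b) (nz a (le_max_left _ _)) (nz b (le_max_right _ _))
  have e1 : M⁻¹ • a + τ • M⁻¹ • b = M⁻¹ • (a + τ • b) := by rw [smul_add, smul_comm τ]
  have e2 : M⁻¹ • a - τ • M⁻¹ • b = M⁻¹ • (a - τ • b) := by rw [smul_sub, smul_comm τ]
  rw [e1, e2] at h
  have hMr : 0 < M ^ r := Real.rpow_pos_of_pos hM r
  have hMle : M ^ r ≤ ‖a‖ ^ r + ‖b‖ ^ r := by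
    have ha0 := Real.rpow_nonneg (norm_nonneg a) r
    have hb0 := Real.rpow_nonneg (norm_nonneg b) r
    rcases max_choice ‖a‖ ‖b‖ with h' | h' <;> rw [hMdef, h'] <;> linarith
  calc _ = M ^ r * (G (M⁻¹ • (a + τ • b)) + G (M⁻¹ • (a - τ • b))) := by
        rw [sc (a + τ • b), sc (a - τ • b)]; ring
    _ ≤ M ^ r * (2 * G (M⁻¹ • a) + η * τ) := by gcongr
    _ = 2 * ‖a‖ ^ r + η * τ * M ^ r := by rw [sc a]; ring
    _ ≤ _ := by gcongr

theorem norm_rpow_eq (hp : p ≠ ∞) (u : X p) :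
    ‖u‖ ^ p.toReal = ∫ x, ‖u x‖ ^ p.toReal := by
  have h0 : 0 < p.toReal := ENNReal.toReal_pos fact_ne_zero hp
  rw [Lp.norm_def, (Lp.memLp u).eLpNorm_eq_integral_rpow_norm fact_ne_zero hp,
    ENNReal.toReal_ofReal (by positivity), ← Real.rpow_mul (by positivity),
    inv_mul_cancel₀ h0.ne', Real.rpow_one]

theorem one_lt_toReal (hp1 : 1 < p) (hp : p ≠ ∞) : 1 < p.toReal := by
  rw [← ENNReal.toReal_one]; exact (ENNReal.toReal_lt_toReal (by simp) hp).2 hp1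

theorem uniform_smooth (hp1 : 1 < p) (hp : p ≠ ∞) {η : ℝ} (hη : 0 < η) :
    ∃ τ : ℝ, 0 < τ ∧ ∀ u v : X p, ‖u‖ ≤ 1 → ‖v‖ ≤ 1 →
      ‖u + (τ : ℂ) • v‖ + ‖u - (τ : ℂ) • v‖ ≤ 2 + η * τ := by
  have hr := one_lt_toReal hp1 hp
  set r := p.toReal with hrdef
  obtain ⟨τ, τ0, hτ⟩ := smooth_norm_rpow hr (half_pos hη)
  refine ⟨τ, τ0, fun u v hu hv => ?_⟩
  have int : ∀ w : X p, Integrable (fun x => ‖w x‖ ^ r) volume := fun w =>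
    (Lp.memLp w).integrable_norm_rpow fact_ne_zero hp
  have e : ∀ c : ℂ, (fun x => ‖(u + c • v) x‖ ^ r) =ᵐ[volume] fun x => ‖u x + c • v x‖ ^ r := by
    intro c
    filter_upwards [Lp.coeFn_add u (c • v), Lp.coeFn_smul c v] with x h1 h2
    rw [h1, Pi.add_apply, h2, Pi.smul_apply]
  have hsum : ‖u + (τ : ℂ) • v‖ ^ r + ‖u - (τ : ℂ) • v‖ ^ r ≤ 2 + η * τ := by
    have e2 : u - (τ : ℂ) • v = u + (-τ : ℂ) • v := by rw [neg_smul, sub_eq_add_neg]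
    rw [e2, norm_rpow_eq hp, norm_rpow_eq hp, ← integral_add (int _) (int _)]
    have h1 : ∫ x, (‖(u + (τ : ℂ) • v) x‖ ^ r + ‖(u + (-τ : ℂ) • v) x‖ ^ r) ≤
        ∫ x, (2 * ‖u x‖ ^ r + η / 2 * τ * (‖u x‖ ^ r + ‖v x‖ ^ r)) := by
      refine integral_mono_ae ((int _).add (int _))
        (((int u).const_mul _).add (((int u).add (int v)).const_mul _)) ?_
      filter_upwards [e τ, e (-τ)] with x h1 h2
      simp only [h1, h2]
      have := hτ (u x) (v x)
      simpa [sub_eq_add_neg] using this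
    refine h1.trans ?_
    have h5 : ∫ x, (2 * ‖u x‖ ^ r + η / 2 * τ * (‖u x‖ ^ r + ‖v x‖ ^ r))
        = 2 * ‖u‖ ^ r + η / 2 * τ * (‖u‖ ^ r + ‖v‖ ^ r) := by
      rw [norm_rpow_eq hp, norm_rpow_eq hp, ← integral_add (int u) (int v), ← integral_const_mul,
        ← integral_const_mul]
      exact integral_add ((int u).const_mul _) (((int u).add (int v)).const_mul _)
    rw [h5]
    have h2 : ‖u‖ ^ r ≤ 1 := Real.rpow_le_one (norm_nonneg _) hu (by linarith)
    have h3 : ‖v‖ ^ r ≤ 1 := Real.rpow_le_one (norm_nonneg _) hv (by linarith)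
    have h4 : 0 < η / 2 * τ := by positivity
    nlinarith
  have bern : ∀ x : ℝ, 0 ≤ x → x ≤ 1 + (x ^ r - 1) / r := by
    intro x hx
    have := one_add_mul_self_le_rpow_one_add (s := x - 1) (by linarith) hr.le
    rw [add_sub_cancel] at this
    have h2 : r * (x - 1) ≤ x ^ r - 1 := by linarith
    have h3 : x - 1 ≤ (x ^ r - 1) / r := by rw [le_div_iff₀ (by linarith)]; linarith
    linarith
  have b1 := bern _ (norm_nonneg (u + (τ : ℂ) • v))
  have b2 := bern _ (norm_nonneg (u - (τ : ℂ) • v))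
  have b3 : (‖u + (τ : ℂ) • v‖ ^ r - 1) / r + (‖u - (τ : ℂ) • v‖ ^ r - 1) / r ≤ η * τ := by
    rw [← add_div, div_le_iff₀ (by linarith)]
    have : 0 < η * τ := by positivity
    nlinarith
  linarith

/-! ## Density of the functionals given by functions -/

theorem exists_norming (hp1 : 1 < p) (hp : p ≠ ∞) {k : ℝ → ℂ} (hk : IsNice k) {u : X p}
    (hu : u =ᵐ[volume] k) (hu1 : ‖u‖ ≤ 1) :
    ∃ g : ℝ → ℂ, ∃ hg : IsNice g, ‖pairF p (hg.memLp _)‖ ≤ 1 ∧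
      pairF p (hg.memLp _) u = (‖u‖ ^ p.toReal : ℝ) := by
  have hr := one_lt_toReal hp1 hp
  set r := p.toReal with hrdef
  have hr0 : 0 < r := by linarith
  set g : ℝ → ℂ := fun x => ((‖k x‖ ^ (r - 2) : ℝ) : ℂ) * (starRingEnd ℂ) (k x) with hgdef
  have hgn : ∀ x, ‖g x‖ = ‖k x‖ ^ (r - 1) := by
    intro x
    rw [hgdef]
    simp only [norm_mul, RCLike.norm_conj, Complex.norm_real]
    rw [Real.norm_of_nonneg (by positivity)]
    rcases eq_or_lt_of_le (norm_nonneg (k x)) with h | h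
    · rw [← h, mul_zero, Real.zero_rpow (by linarith)]
    · conv_lhs => rw [← Real.rpow_one ‖k x‖, ← Real.rpow_mul h.le, one_mul, ← Real.rpow_add h]
      ring_nf
  have hg : IsNice g := by
    obtain ⟨hm, C, R, hC, hR⟩ := hk
    refine ⟨?_, C ^ (r - 1), R, fun x => ?_, fun x hx => by simp [hgdef, hR x hx]⟩
    · refine AEStronglyMeasurable.mul ?_
        (Complex.continuous_conj.comp_aestronglyMeasurable hm)
      exact (Complex.measurable_ofReal.comp_aemeasurable
        (hm.norm.aemeasurable.pow_const _)).aestronglyMeasurable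
    · rw [hgn]
      exact Real.rpow_le_rpow (norm_nonneg _) (hC x) (by linarith)
  refine ⟨g, hg, ?_, ?_⟩
  · refine (norm_pairF_le _).trans ?_
    have hpt : p = ENNReal.ofReal r := (ENNReal.ofReal_toReal hp).symm
    have hq : p.conjExponent = ENNReal.ofReal r.conjExponent :=
      haveI := (Real.HolderConjugate.conjExponent hr).ennrealOfReal
      haveI : p.HolderConjugate (ENNReal.ofReal r.conjExponent) := by rw [hpt]; exact this
      ENNReal.HolderConjugate.conjExponent_eq
    have hcr : 0 < r.conjExponent := (Real.HolderConjugate.conjExponent hr).symm.pos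
    have hmul : (r - 1) * r.conjExponent = r := (Real.HolderConjugate.conjExponent hr).sub_one_mul_conj
    rw [(hg.memLp _).eLpNorm_eq_integral_rpow_norm (by rw [hq]; simpa using hcr)
      (by rw [hq]; exact ENNReal.ofReal_ne_top), ENNReal.toReal_ofReal (by positivity), hq,
      ENNReal.toReal_ofReal hcr.le]
    refine Real.rpow_le_one (integral_nonneg fun x => by positivity) ?_ (inv_nonneg.2 hcr.le)
    have : ∫ x, ‖g x‖ ^ r.conjExponent = ‖u‖ ^ r := by
      rw [norm_rpow_eq hp]
      refine integral_congr_ae ?_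
      filter_upwards [hu] with x hx
      rw [hgn, hx, ← Real.rpow_mul (norm_nonneg _), hmul]
    rw [this]
    exact Real.rpow_le_one (norm_nonneg _) hu1 hr0.le
  · rw [pairF_apply, norm_rpow_eq hp, ← integral_complex_ofReal]
    refine integral_congr_ae ?_
    filter_upwards [hu] with x hx
    rw [hx, hgdef]
    simp only
    rw [mul_assoc, mul_comm ((starRingEnd ℂ) (k x)), Complex.mul_conj, Complex.normSq_eq_norm_sq,
      ← Complex.ofReal_mul]
    congr 1
    rcases eq_or_lt_of_le (norm_nonneg (k x)) with h | h
    · rw [← h, Real.zero_rpow hr0.ne']; norm_num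
    · rw [← Real.rpow_natCast, ← Real.rpow_add h]; norm_num [hrdef]

theorem exists_unit_rotation (z : ℂ) : ∃ c : ℂ, ‖c‖ = 1 ∧ c * z = ‖z‖ := by
  rcases eq_or_ne z 0 with h | h
  · exact ⟨1, by simp, by simp [h]⟩
  · have hz : (‖z‖ : ℂ) ≠ 0 := by simpa using h
    refine ⟨(starRingEnd ℂ) z / ‖z‖, by simp [h], ?_⟩
    rw [div_mul_eq_mul_div, mul_comm, Complex.mul_conj, Complex.normSq_eq_norm_sq,
      div_eq_iff hz]
    push_cast; ring

/-- The functionals `v ↦ ∫ g v`, with `g` bounded and of bounded support, are dense. -/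
theorem exists_pairF_near (hp1 : 1 < p) (hp : p ≠ ∞) (f : StrongDual ℂ (X p)) {ε : ℝ}
    (hε : 0 < ε) : ∃ g : ℝ → ℂ, ∃ hg : IsNice g, ∃ c : ℂ, ‖f - c • pairF p (hg.memLp _)‖ ≤ ε := by
  rcases eq_or_ne f 0 with rfl | hf0
  · have h0 : IsNice fun _ => 0 := ⟨aestronglyMeasurable_const, 0, 0, by simp, by simp⟩
    refine ⟨_, h0, 0, ?_⟩
    have e : (0 : StrongDual ℂ (X p)) - (0 : ℂ) • pairF p (h0.memLp _) = 0 := by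
      ext1 v
      change (0 : ℂ) - 0 * _ = 0
      ring
    exact (congrArg norm e).trans_le (norm_zero.trans_le hε.le)
  have hfn : 0 < ‖f‖ := norm_pos_iff.2 hf0
  have hr := one_lt_toReal hp1 hp
  set r := p.toReal with hrdef
  set η := ε / (2 * ‖f‖) with hη
  have η0 : 0 < η := by positivity
  obtain ⟨τ, τ0, hτ⟩ := uniform_smooth hp1 hp η0
  set δ := min (η * τ / (1 + r)) (1 / 2) with hδ
  have δ0 : 0 < δ := by positivity
  have δ1 : δ * (1 + r) ≤ η * τ := by
    have := min_le_left (η * τ / (1 + r)) (1 / 2)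
    rwa [← hδ, le_div_iff₀ (by positivity)] at this
  have δ2 : δ ≤ 1 / 2 := min_le_right _ _
  -- a normalized functional and an almost norming nice vector
  set F : StrongDual ℂ (X p) := (‖f‖⁻¹ : ℂ) • f with hF
  have hFn : ‖F‖ = 1 := by
    rw [hF, norm_smul]; simp [hfn.ne']
  obtain ⟨u0, hu0, hFu0⟩ : ∃ u : X p, ‖u‖ ≤ 1 ∧ 1 - δ / 2 < ‖F u‖ := by
    by_contra! hcon
    have : ‖F‖ ≤ 1 - δ / 2 := ContinuousLinearMap.opNorm_le_of_unit_norm (by linarith)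
      fun u hu => hcon u hu.le
    linarith
  obtain ⟨u1, k1, hk1, -, hu1k, hu1n, hu1u⟩ := exists_nice_near hp u0 (half_pos δ0)
  obtain ⟨c, hc, hcF⟩ := exists_unit_rotation (F u1)
  set u := c • u1 with hu
  have hun : ‖u‖ ≤ 1 := by rw [hu, norm_smul, hc, one_mul]; exact hu1n.trans hu0
  have hFu : F u = (‖F u1‖ : ℂ) := by rw [hu, map_smul, smul_eq_mul, hcF]
  have hFu' : 1 - δ ≤ ‖F u1‖ := by
    have h1 : ‖F (u1 - u0)‖ ≤ ‖u1 - u0‖ := by simpa [hFn] using F.le_opNorm (u1 - u0)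
    have h2 : ‖F u0‖ ≤ ‖F u1‖ + ‖F (u1 - u0)‖ := by
      have : F u0 = F u1 - F (u1 - u0) := by rw [map_sub]; ring
      rw [this]; exact norm_sub_le _ _
    linarith
  have hk : IsNice fun x => c * k1 x := by
    obtain ⟨hm, C, R, hC, hR⟩ := hk1
    exact ⟨hm.const_mul c, C, R, fun x => by rw [norm_mul, hc, one_mul]; exact hC x,
      fun x hx => by simp only [hR x hx, mul_zero]⟩
  have huk : u =ᵐ[volume] fun x => c * k1 x := by
    filter_upwards [Lp.coeFn_smul c u1, hu1k] with x h1 h2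
    rw [hu, h1, Pi.smul_apply, h2, smul_eq_mul]
  obtain ⟨g, hg, hgn, hgu⟩ := exists_norming hp1 hp hk huk hun
  set G := pairF p (hg.memLp _) with hG
  have hunl : 1 - δ ≤ ‖u‖ := by
    have h1 : ‖F u‖ ≤ ‖u‖ := by simpa [hFn] using F.le_opNorm u
    rw [hFu] at h1
    simp only [Complex.norm_real, norm_norm] at h1
    linarith
  have hgu' : 1 - r * δ ≤ ‖u‖ ^ r := by
    have h1 := one_add_mul_self_le_rpow_one_add (s := -δ) (by linarith) hr.le
    have h2 : (1 + -δ) ^ r ≤ ‖u‖ ^ r := Real.rpow_le_rpow (by linarith) (by linarith) (by linarith)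
    linarith
  have main : ∀ v : X p, ‖v‖ ≤ 1 → ((F - G) v).re ≤ 2 * η := by
    intro v hv
    have h1 := hτ u v hun hv
    have h2 : (F (u + (τ : ℂ) • v)).re ≤ ‖u + (τ : ℂ) • v‖ :=
      (Complex.re_le_norm _).trans (by simpa [hFn] using F.le_opNorm (u + (τ : ℂ) • v))
    have h3 : (G (u - (τ : ℂ) • v)).re ≤ ‖u - (τ : ℂ) • v‖ :=
      (Complex.re_le_norm _).trans ((G.le_opNorm _).trans
        (mul_le_of_le_one_left (norm_nonneg _) hgn))
    rw [map_add, hFu, map_smul, smul_eq_mul, Complex.add_re, Complex.re_ofReal_mul,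
      Complex.ofReal_re] at h2
    rw [map_sub, hgu, map_smul, smul_eq_mul, Complex.sub_re, Complex.re_ofReal_mul,
      Complex.ofReal_re] at h3
    have h4 : ((F - G) v).re = (F v).re - (G v).re := by simp
    rw [h4]
    have h5 : τ * ((F v).re - (G v).re) ≤ τ * (2 * η) := by nlinarith
    exact le_of_mul_le_mul_left h5 τ0
  have main2 : ‖F - G‖ ≤ 2 * η := by
    refine ContinuousLinearMap.opNorm_le_of_unit_norm (by positivity) fun v hv => ?_
    obtain ⟨d, hd, hdv⟩ := exists_unit_rotation ((F - G) v)
    have := main (d • v) (by rw [norm_smul, hd, hv, one_mul])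
    rwa [map_smul, smul_eq_mul, hdv, Complex.ofReal_re] at this
  refine ⟨g, hg, ‖f‖, ?_⟩
  have e : f - (‖f‖ : ℂ) • G = (‖f‖ : ℂ) • (F - G) := by
    rw [smul_sub, hF, smul_smul, mul_inv_cancel₀ (by exact_mod_cast hfn.ne'), one_smul]
  rw [e, norm_smul]
  simp only [Complex.norm_real, norm_norm]
  calc ‖f‖ * ‖F - G‖ ≤ ‖f‖ * (2 * η) := by gcongr
    _ = ε := by rw [hη]; field_simp

theorem pairF_comp_isMul {T : Op p} {f : ℝ → ℂ} (hT : IsMul T f) {g : ℝ → ℂ} (hg : IsNice g)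
    (hfg : MemLp (fun x => f x * g x) p.conjExponent volume) :
    (pairF p (hg.memLp _)).comp T = pairF p hfg := by
  ext1 v
  rw [ContinuousLinearMap.comp_apply, pairF_apply, pairF_apply]
  refine integral_congr_ae ?_
  filter_upwards [hT v] with x hx
  rw [hx]; ring

/-- Dominated convergence for the adjoints of multiplication operators. -/
theorem tendsto_dual_comp_isMul (hp1 : 1 < p) (hp : p ≠ ∞) {T : ℕ+ → Op p} {f : ℕ+ → ℝ → ℂ}
    (hT : ∀ n, IsMul (T n) (f n)) {C : ℝ} (hC : ∀ n, ∀ᵐ x, ‖f n x‖ ≤ C)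
    (hf : ∀ᵐ x, Tendsto (fun n => f n x) atTop (𝓝 0)) (F : StrongDual ℂ (X p)) :
    Tendsto (fun n => F.comp (T n)) atTop (𝓝 0) := by
  have hq0 : p.conjExponent ≠ 0 := by
    unfold ENNReal.conjExponent; exact (zero_lt_one.trans_le le_self_add).ne'
  have hq : p.conjExponent ≠ ∞ := by
    unfold ENNReal.conjExponent
    simpa [tsub_eq_zero_iff_le] using hp1
  have hC0 : 0 ≤ C := by
    obtain ⟨x, hx⟩ := (hC 1).exists
    exact (norm_nonneg _).trans hx
  have hTn : ∀ n, ‖T n‖ ≤ C := fun n => (hT n).norm_le hC0 (hC n)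
  rw [Metric.tendsto_nhds]
  intro ε hε
  obtain ⟨g, hg, c, hgc⟩ := exists_pairF_near hp1 hp F (ε := ε / (2 * (C + 1))) (by positivity)
  have hm : ∀ n, AEStronglyMeasurable (fun x => f n x * g x) volume := fun n => by
    refine (Lp.aestronglyMeasurable (T n (hg.memLp p).toLp)).congr ?_
    filter_upwards [hT n (hg.memLp p).toLp, (hg.memLp p).coeFn_toLp] with x h1 h2
    rw [h1, h2]
  have hmem : ∀ n, MemLp (fun x => f n x * g x) p.conjExponent volume := fun n => by
    refine (hg.memLp p.conjExponent).of_le_mul (c := C) (hm n) ?_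
    filter_upwards [hC n] with x hx
    rw [norm_mul]; gcongr
  have h1 := (ENNReal.tendsto_toReal ENNReal.zero_ne_top).comp
    (tendsto_eLpNorm_mul_zero hq0 hq (hg.memLp _) hm hC hf)
  have h2 := h1.const_mul ‖c‖
  rw [ENNReal.toReal_zero, mul_zero] at h2
  filter_upwards [h2.eventually_lt_const (half_pos hε)] with n hn
  rw [dist_zero_right]
  have e : F.comp (T n) = (F - c • pairF p (hg.memLp _)).comp (T n) + c • pairF p (hmem n) := by
    rw [← pairF_comp_isMul (hT n) hg, ContinuousLinearMap.sub_comp,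
      ContinuousLinearMap.smul_comp, sub_add_cancel]
  rw [e]
  refine (norm_add_le _ _).trans_lt ?_
  have i1 : ‖(F - c • pairF p (hg.memLp _)).comp (T n)‖ ≤ ε / (2 * (C + 1)) * C :=
    (ContinuousLinearMap.opNorm_comp_le _ _).trans
      (mul_le_mul hgc (hTn n) (norm_nonneg _) (by positivity))
  have i2 : ε / (2 * (C + 1)) * C ≤ ε / 2 := by
    rw [div_mul_eq_mul_div, div_le_div_iff₀ (by positivity) (by positivity)]
    nlinarith
  have i3 : ‖c • pairF p (hmem n)‖ ≤ ‖c‖ * (eLpNorm (fun x => f n x * g x) p.conjExponent volume).toReal := by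
    rw [norm_smul]; gcongr; exact norm_pairF_le _
  simp only [Function.comp_apply] at hn
  linarith

/-! ## Interpolation -/

theorem lintegral_rpow_below {c s : ℝ} (hc : 0 < c) (hs : 0 ≤ s) :
    ∫⁻ t in Ioo 0 s, ENNReal.ofReal (t ^ (c - 1)) = ENNReal.ofReal (s ^ c / c) := by
  have hint : IntegrableOn (fun t : ℝ => t ^ (c - 1)) (Ioc 0 s) := by
    rw [← intervalIntegrable_iff_integrableOn_Ioc_of_le hs]
    exact intervalIntegral.intervalIntegrable_rpow' (by linarith)
  rw [restrict_Ioo_eq_restrict_Ioc, ← ofReal_integral_eq_lintegral_ofReal hint]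
  · rw [← intervalIntegral.integral_of_le hs, integral_rpow (Or.inl (by linarith))]
    rw [sub_add_cancel, Real.zero_rpow hc.ne', sub_zero]
  · filter_upwards [ae_restrict_mem measurableSet_Ioc] with t ht
    exact Real.rpow_nonneg ht.1.le _

theorem lintegral_rpow_above {c s : ℝ} (hc : 0 < c) (hs : 0 < s) :
    ∫⁻ t in Ici s, ENNReal.ofReal (t ^ (-c - 1)) = ENNReal.ofReal (s ^ (-c) / c) := by
  have hint : IntegrableOn (fun t : ℝ => t ^ (-c - 1)) (Ioi s) :=
    integrableOn_Ioi_rpow_of_lt (by linarith) hs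
  rw [← restrict_Ioi_eq_restrict_Ici, ← ofReal_integral_eq_lintegral_ofReal hint]
  · rw [integral_Ioi_rpow_of_lt (by linarith) hs, sub_add_cancel, neg_div_neg_eq]
  · filter_upwards [ae_restrict_mem measurableSet_Ioi] with t ht
    exact Real.rpow_nonneg (hs.trans ht).le _

/-- The part of the function `k` where it is large. -/
def bigPart (k : ℝ → ℂ) (s : ℝ) : ℝ → ℂ := {x | s < ‖k x‖}.indicator k

/-- The part of the function `k` where it is small. -/
def smallPart (k : ℝ → ℂ) (s : ℝ) : ℝ → ℂ := {x | ‖k x‖ ≤ s}.indicator k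

theorem bigPart_add_smallPart (k : ℝ → ℂ) (s x : ℝ) : bigPart k s x + smallPart k s x = k x := by
  rcases lt_or_ge s ‖k x‖ with h | h
  · simp [bigPart, smallPart, h]
  · simp [bigPart, smallPart, h]

theorem IsNice.indicator {k : ℝ → ℂ} (hk : IsNice k) {S : Set ℝ} (hS : MeasurableSet S) :
    IsNice (S.indicator k) := by
  obtain ⟨hm, C, R, hC, hR⟩ := hk
  refine ⟨hm.indicator hS, C, R, fun x => ?_, fun x hx => ?_⟩
  · exact (norm_indicator_le_norm_self _ _).trans (hC x)
  · by_cases h : x ∈ S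
    · rw [indicator_of_mem h, hR x hx]
    · rw [indicator_of_notMem h]

theorem lintegral_bigPart {k : ℝ → ℂ} (hk : Measurable k) {a r γ A : ℝ} (ha : 0 < a) (har : a < r)
    (hγ : 0 < γ) (hA : 0 ≤ A) :
    ∫⁻ t in Ioi 0, ENNReal.ofReal (t ^ (r - 1)) * (ENNReal.ofReal ((2 / t) ^ a * A) *
      ∫⁻ x, ‖bigPart k (γ * t) x‖ₑ ^ a) ≤
    ENNReal.ofReal (2 ^ a * A * γ ^ (a - r) / (r - a)) * ∫⁻ x, ‖k x‖ₑ ^ r := by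
  set f : ℝ → ℝ → ℝ≥0∞ := fun t x => (Ioo 0 (‖k x‖ / γ)).indicator
    (fun t => ENNReal.ofReal (t ^ (r - a - 1))) t * (ENNReal.ofReal (2 ^ a * A) * ‖k x‖ₑ ^ a) with hf
  have h1 : ∀ t ∈ Ioi (0 : ℝ), ENNReal.ofReal (t ^ (r - 1)) * (ENNReal.ofReal ((2 / t) ^ a * A) *
      ∫⁻ x, ‖bigPart k (γ * t) x‖ₑ ^ a) = ∫⁻ x, f t x := by
    intro t ht
    have ht0 : (0 : ℝ) < t := ht
    rw [← mul_assoc, ← ENNReal.ofReal_mul (by positivity),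
      ← lintegral_const_mul' _ _ ENNReal.ofReal_ne_top]
    refine lintegral_congr fun x => ?_
    have hiff : γ * t < ‖k x‖ ↔ t ∈ Ioo 0 (‖k x‖ / γ) := by
      rw [mem_Ioo, lt_div_iff₀ hγ, mul_comm]; exact ⟨fun h => ⟨ht, h⟩, fun h => h.2⟩
    by_cases hx : γ * t < ‖k x‖
    · simp only [hf, bigPart]
      rw [indicator_of_mem (hiff.1 hx), indicator_of_mem (by exact hx),
        ← mul_assoc (ENNReal.ofReal (t ^ (r - a - 1))), ← ENNReal.ofReal_mul (by positivity)]
      congr 2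
      rw [Real.div_rpow (by norm_num) ht0.le, show r - a - 1 = (r - 1) - a by ring,
        Real.rpow_sub ht0 (r - 1) a]
      field_simp
    · simp only [hf, bigPart]
      rw [indicator_of_notMem (fun h => hx (hiff.2 h)), indicator_of_notMem (by exact hx), enorm_zero,
        ENNReal.zero_rpow_of_pos ha, mul_zero, zero_mul]
  rw [setLIntegral_congr_fun measurableSet_Ioi h1, lintegral_lintegral_swap, ← lintegral_const_mul']
  · refine lintegral_mono fun x => ?_
    simp only [hf]
    rw [lintegral_mul_const' _ _ (ENNReal.mul_ne_top ENNReal.ofReal_ne_top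
      (ENNReal.rpow_ne_top_of_nonneg ha.le enorm_ne_top)), lintegral_indicator measurableSet_Ioo,
      Measure.restrict_restrict measurableSet_Ioo, inter_eq_left.2 (fun t ht => ht.1),
      lintegral_rpow_below (by linarith) (by positivity), ← ofReal_norm (k x),
      ENNReal.ofReal_rpow_of_nonneg (norm_nonneg _) ha.le,
      ENNReal.ofReal_rpow_of_nonneg (norm_nonneg _) (ha.trans har).le,
      ← ENNReal.ofReal_mul (by positivity), ← ENNReal.ofReal_mul (by
        have : 0 < r - a := by linarith
        positivity), ← ENNReal.ofReal_mul (by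
        have : 0 < r - a := by linarith
        positivity)]
    refine ENNReal.ofReal_le_ofReal (le_of_eq ?_)
    rw [Real.div_rpow (norm_nonneg _) hγ.le, show a - r = -(r - a) by ring, Real.rpow_neg hγ.le]
    rcases eq_or_lt_of_le (norm_nonneg (k x)) with h | h
    · rw [← h, Real.zero_rpow (by linarith), Real.zero_rpow ha.ne', Real.zero_rpow (by linarith)]
      simp
    · have : ‖k x‖ ^ r = ‖k x‖ ^ (r - a) * ‖k x‖ ^ a := by
        rw [← Real.rpow_add h, sub_add_cancel]
      rw [this]; field_simp
  · exact ENNReal.ofReal_ne_top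
  · refine (Measurable.mul ?_ ?_).aemeasurable
    · refine Measurable.indicator (s := {q : ℝ × ℝ | q.1 ∈ Ioo 0 (‖k q.2‖ / γ)}) ?_ ?_
      · fun_prop
      · exact (measurableSet_lt measurable_const measurable_fst).inter
          (measurableSet_lt measurable_fst (by fun_prop))
    · fun_prop

theorem lintegral_smallPart {k : ℝ → ℂ} (hk : Measurable k) {b r γ B : ℝ} (hr : 0 < r) (hrb : r < b)
    (hγ : 0 < γ) (hB : 0 ≤ B) :
    ∫⁻ t in Ioi 0, ENNReal.ofReal (t ^ (r - 1)) * (ENNReal.ofReal ((2 / t) ^ b * B) *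
      ∫⁻ x, ‖smallPart k (γ * t) x‖ₑ ^ b) ≤
    ENNReal.ofReal (2 ^ b * B * γ ^ (b - r) / (b - r)) * ∫⁻ x, ‖k x‖ₑ ^ r := by
  have hb : 0 < b := hr.trans hrb
  set f : ℝ → ℝ → ℝ≥0∞ := fun t x => (Ici (‖k x‖ / γ)).indicator
    (fun t => ENNReal.ofReal (t ^ (-(b - r) - 1))) t * (ENNReal.ofReal (2 ^ b * B) * ‖k x‖ₑ ^ b) with hf
  have h1 : ∀ t ∈ Ioi (0 : ℝ), ENNReal.ofReal (t ^ (r - 1)) * (ENNReal.ofReal ((2 / t) ^ b * B) *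
      ∫⁻ x, ‖smallPart k (γ * t) x‖ₑ ^ b) = ∫⁻ x, f t x := by
    intro t ht
    have ht0 : (0 : ℝ) < t := ht
    rw [← mul_assoc, ← ENNReal.ofReal_mul (by positivity),
      ← lintegral_const_mul' _ _ ENNReal.ofReal_ne_top]
    refine lintegral_congr fun x => ?_
    have hiff : ‖k x‖ ≤ γ * t ↔ t ∈ Ici (‖k x‖ / γ) := by
      rw [mem_Ici, div_le_iff₀ hγ, mul_comm]
    by_cases hx : ‖k x‖ ≤ γ * t
    · simp only [hf, smallPart]
      rw [indicator_of_mem (hiff.1 hx), indicator_of_mem (by exact hx),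
        ← mul_assoc (ENNReal.ofReal (t ^ (-(b - r) - 1))), ← ENNReal.ofReal_mul (by positivity)]
      congr 2
      rw [Real.div_rpow (by norm_num) ht0.le, show -(b - r) - 1 = (r - 1) - b by ring,
        Real.rpow_sub ht0 (r - 1) b]
      field_simp
    · simp only [hf, smallPart]
      rw [indicator_of_notMem (fun h => hx (hiff.2 h)), indicator_of_notMem (by exact hx), enorm_zero,
        ENNReal.zero_rpow_of_pos hb, mul_zero, zero_mul]
  rw [setLIntegral_congr_fun measurableSet_Ioi h1, lintegral_lintegral_swap, ← lintegral_const_mul']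
  · refine lintegral_mono fun x => ?_
    simp only [hf]
    rcases eq_or_lt_of_le (norm_nonneg (k x)) with h | h
    · rw [lintegral_mul_const' _ _ (ENNReal.mul_ne_top ENNReal.ofReal_ne_top
        (ENNReal.rpow_ne_top_of_nonneg hb.le enorm_ne_top)), norm_eq_zero.1 h.symm, enorm_zero,
        ENNReal.zero_rpow_of_pos hb, mul_zero, mul_zero]
      exact zero_le
    rw [lintegral_mul_const' _ _ (ENNReal.mul_ne_top ENNReal.ofReal_ne_top
      (ENNReal.rpow_ne_top_of_nonneg hb.le enorm_ne_top)), lintegral_indicator measurableSet_Ici,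
      Measure.restrict_restrict measurableSet_Ici,
      inter_eq_left.2 (show Ici (‖k x‖ / γ) ⊆ Ioi 0 from fun t ht => (div_pos h hγ).trans_le ht),
      lintegral_rpow_above (by linarith) (div_pos h hγ), ← ofReal_norm (k x),
      ENNReal.ofReal_rpow_of_nonneg (norm_nonneg _) hb.le,
      ENNReal.ofReal_rpow_of_nonneg (norm_nonneg _) hr.le,
      ← ENNReal.ofReal_mul (by positivity), ← ENNReal.ofReal_mul (by
        have : 0 < b - r := by linarith
        positivity), ← ENNReal.ofReal_mul (by
        have : 0 < b - r := by linarith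
        positivity)]
    refine ENNReal.ofReal_le_ofReal (le_of_eq ?_)
    rw [Real.rpow_neg (by positivity), Real.div_rpow (norm_nonneg _) hγ.le]
    have : ‖k x‖ ^ b = ‖k x‖ ^ (b - r) * ‖k x‖ ^ r := by
      rw [← Real.rpow_add h, sub_add_cancel]
    have h0 : ‖k x‖ ^ (b - r) ≠ 0 := (Real.rpow_pos_of_pos h _).ne'
    rw [this]; field_simp
  · exact ENNReal.ofReal_ne_top
  · refine (Measurable.mul ?_ ?_).aemeasurable
    · refine Measurable.indicator (s := {q : ℝ × ℝ | q.1 ∈ Ici (‖k q.2‖ / γ)}) ?_ ?_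
      · fun_prop
      · exact measurableSet_le (by fun_prop) measurable_fst
    · fun_prop

/-- The Marcinkiewicz interpolation theorem for an operator of strong type. -/
theorem marcinkiewicz {R : Op 2} {a b r γ A B : ℝ} (ha : 0 < a) (har : a < r) (hrb : r < b)
    (hγ : 0 < γ) (hA : 0 ≤ A) (hB : 0 ≤ B)
    (HA : ∀ k, IsNice k → ∀ v : X 2, v =ᵐ[volume] k →
      ∫⁻ x, ‖R v x‖ₑ ^ a ≤ ENNReal.ofReal A * ∫⁻ x, ‖k x‖ₑ ^ a)
    (HB : ∀ k, IsNice k → ∀ v : X 2, v =ᵐ[volume] k →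
      ∫⁻ x, ‖R v x‖ₑ ^ b ≤ ENNReal.ofReal B * ∫⁻ x, ‖k x‖ₑ ^ b)
    {k : ℝ → ℂ} (hk : IsNice k) (hkm : Measurable k) {v : X 2} (hv : v =ᵐ[volume] k) :
    ∫⁻ x, ‖R v x‖ₑ ^ r ≤ ENNReal.ofReal (r * (2 ^ a * A * γ ^ (a - r) / (r - a) +
      2 ^ b * B * γ ^ (b - r) / (b - r))) * ∫⁻ x, ‖k x‖ₑ ^ r := by
  have hr : 0 < r := ha.trans har
  have cheb : ∀ (w : X 2) (c t : ℝ), 0 < c → 0 < t →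
      volume {x | t / 2 ≤ ‖w x‖} ≤ ENNReal.ofReal ((2 / t) ^ c) * ∫⁻ x, ‖w x‖ₑ ^ c := by
    intro w c t hc ht
    have h0 : ENNReal.ofReal ((t / 2) ^ c) ≠ 0 := by
      have : 0 < (t / 2) ^ c := by positivity
      simpa using this
    have h1 := meas_ge_le_lintegral_div (μ := volume) (f := fun x => ‖w x‖ₑ ^ c)
      ((Lp.aestronglyMeasurable w).enorm.pow_const _) h0 ENNReal.ofReal_ne_top
    have h2 : {x | t / 2 ≤ ‖w x‖} ⊆ {x | ENNReal.ofReal ((t / 2) ^ c) ≤ ‖w x‖ₑ ^ c} := by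
      intro x hx
      rw [mem_ofPred_eq, ← ofReal_norm (w x), ENNReal.ofReal_rpow_of_nonneg (norm_nonneg _) hc.le]
      exact ENNReal.ofReal_le_ofReal (Real.rpow_le_rpow (by positivity) hx hc.le)
    refine (measure_mono h2).trans (h1.trans (le_of_eq ?_))
    rw [div_eq_mul_inv, mul_comm, ← ENNReal.ofReal_inv_of_pos (by positivity),
      ← Real.inv_rpow (by positivity), inv_div]
  have split : ∀ t ∈ Ioi (0 : ℝ), volume {x | t < ‖R v x‖} * ENNReal.ofReal (t ^ (r - 1)) ≤
      ENNReal.ofReal (t ^ (r - 1)) * (ENNReal.ofReal ((2 / t) ^ a * A) *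
        ∫⁻ x, ‖bigPart k (γ * t) x‖ₑ ^ a) +
      ENNReal.ofReal (t ^ (r - 1)) * (ENNReal.ofReal ((2 / t) ^ b * B) *
        ∫⁻ x, ‖smallPart k (γ * t) x‖ₑ ^ b) := by
    intro t ht
    have ht0 : (0 : ℝ) < t := ht
    rw [← mul_add, mul_comm]
    gcongr
    have n1 : IsNice (bigPart k (γ * t)) :=
      hk.indicator (measurableSet_lt measurable_const hkm.norm)
    have n2 : IsNice (smallPart k (γ * t)) :=
      hk.indicator (measurableSet_le hkm.norm measurable_const)
    set v1 : X 2 := (n1.memLp 2).toLp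
    set v2 : X 2 := (n2.memLp 2).toLp
    have hv12 : v = v1 + v2 := by
      refine Lp.ext ?_
      filter_upwards [hv, Lp.coeFn_add v1 v2, (n1.memLp 2).coeFn_toLp, (n2.memLp 2).coeFn_toLp]
        with x h1 h2 h3 h4
      rw [h1, h2, Pi.add_apply, h3, h4, bigPart_add_smallPart]
    have hsub : volume {x | t < ‖R v x‖} ≤
        volume {x | t / 2 ≤ ‖R v1 x‖} + volume {x | t / 2 ≤ ‖R v2 x‖} := by
      refine (measure_mono_ae ?_).trans (measure_union_le _ _)
      filter_upwards [Lp.coeFn_add (R v1) (R v2)] with x hx h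
      rw [hv12, map_add] at h
      change t < ‖(R v1 + R v2 : X 2) x‖ at h
      rw [hx, Pi.add_apply] at h
      by_contra hcon
      have h5 : ¬ (t / 2 ≤ ‖R v1 x‖ ∨ t / 2 ≤ ‖R v2 x‖) := hcon
      push Not at h5
      linarith [norm_add_le (R v1 x) (R v2 x)]
    refine hsub.trans (add_le_add ((cheb _ a t ha ht0).trans ?_)
      ((cheb _ b t (hr.trans hrb) ht0).trans ?_))
    · rw [ENNReal.ofReal_mul (by positivity), mul_assoc]
      gcongr
      exact HA _ n1 v1 (n1.memLp 2).coeFn_toLp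
    · rw [ENNReal.ofReal_mul (by positivity), mul_assoc]
      gcongr
      exact HB _ n2 v2 (n2.memLp 2).coeFn_toLp
  have lc := lintegral_rpow_eq_lintegral_meas_lt_mul volume (f := fun x => ‖R v x‖)
    (.of_forall fun x => norm_nonneg _) (Lp.aestronglyMeasurable (R v)).norm.aemeasurable hr
  have e : ∫⁻ x, ‖R v x‖ₑ ^ r = ∫⁻ x, ENNReal.ofReal (‖R v x‖ ^ r) := by
    refine lintegral_congr fun x => ?_
    rw [← ofReal_norm, ENNReal.ofReal_rpow_of_nonneg (norm_nonneg _) hr.le]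
  rw [e, lc, ENNReal.ofReal_mul hr.le, mul_assoc]
  gcongr
  refine (setLIntegral_mono' measurableSet_Ioi split).trans ?_
  have hbig := lintegral_bigPart hkm ha har hγ hA
  have hsmall := lintegral_smallPart hkm hr hrb hγ hB
  rw [lintegral_add_left', ENNReal.ofReal_add, add_mul]
  · exact add_le_add hbig hsmall
  · have : 0 < r - a := by linarith
    positivity
  · have : 0 < b - r := by linarith
    positivity
  · have hmeas : Measurable fun q : ℝ × ℝ => ‖bigPart k (γ * q.1) q.2‖ₑ ^ a := by
      refine Measurable.pow_const (Measurable.enorm ?_) _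
      refine Measurable.indicator (f := fun q : ℝ × ℝ => k q.2)
        (s := {q : ℝ × ℝ | γ * q.1 < ‖k q.2‖}) (by fun_prop) ?_
      exact measurableSet_lt (by fun_prop) (by fun_prop)
    have := hmeas.lintegral_prod_right' (ν := volume)
    fun_prop

/-! ## Operators which act on `L^p` and on `L^2` -/

/-- `T` on `L^p` and `R` on `L^2` agree on `L^p ∩ L^2`. -/
def Compat (T : Op p) (R : Op 2) : Prop :=
  ∀ (u : X p) (v : X 2), u =ᵐ[volume] v → T u =ᵐ[volume] R v

/-- `R` is bounded by `C` on `L^2 ∩ L^r` with respect to the norm of `L^r`. -/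
def BddOn (r : ℝ≥0∞) (C : ℝ≥0) (R : Op 2) : Prop :=
  ∀ v : X 2, MemLp v r volume → eLpNorm (R v) r volume ≤ C * eLpNorm v r volume

theorem compat_one : Compat (1 : Op p) 1 := fun _ _ h => h

theorem Compat.add {T T' : Op p} {R R' : Op 2} (h : Compat T R) (h' : Compat T' R') :
    Compat (T + T') (R + R') := fun u v huv => by
  filter_upwards [h u v huv, h' u v huv, Lp.coeFn_add (T u) (T' u), Lp.coeFn_add (R v) (R' v)]
    with x h1 h2 h3 h4
  change (T u + T' u : X p) x = (R v + R' v : X 2) x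
  rw [h3, h4, Pi.add_apply, Pi.add_apply, h1, h2]

theorem Compat.smul {T : Op p} {R : Op 2} (c : ℂ) (h : Compat T R) :
    Compat (c • T) (c • R) := fun u v huv => by
  filter_upwards [h u v huv, Lp.coeFn_smul c (T u), Lp.coeFn_smul c (R v)] with x h1 h3 h4
  change (c • T u : X p) x = (c • R v : X 2) x
  rw [h3, h4, Pi.smul_apply, Pi.smul_apply, h1]

theorem Compat.sub {T T' : Op p} {R R' : Op 2} (h : Compat T R) (h' : Compat T' R') :
    Compat (T - T') (R - R') := by
  simpa [sub_eq_add_neg] using h.add (h'.smul (-1))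

theorem Compat.mul {T T' : Op p} {R R' : Op 2} (h : Compat T R) (h' : Compat T' R') :
    Compat (T * T') (R * R') := fun u v huv => h _ _ (h' u v huv)

theorem IsMul.compat {T : Op p} {R : Op 2} {f : ℝ → ℂ} (hT : IsMul T f) (hR : IsMul R f) :
    Compat T R := fun u v huv => by
  filter_upwards [hT u, hR v, huv] with x h1 h2 h3
  rw [h1, h2, h3]

theorem frame_proportional (n : ℕ+) (t : Dir) : ∃ c : ℂ, c ≠ 0 ∧
    (∀ (u : X p) (v : X 2), u =ᵐ[volume] v →
      frame p n t u =ᵐ[volume] (c • frame 2 n t v : X 2)) ∧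
    ∀ (u : X p) (v : X 2), u =ᵐ[volume] v →
      (frame p n t).symm u =ᵐ[volume] (c⁻¹ • (frame 2 n t).symm v : X 2) := by
  obtain ⟨a, ha, hp⟩ := frame_coeFn (p := p) n t
  obtain ⟨b, hb, h2⟩ := frame_coeFn (p := 2) n t
  refine ⟨a / b, div_ne_zero ha hb, fun u v huv => ?_, fun u v huv => ?_⟩
  · filter_upwards [hp u, h2 v, Lp.coeFn_smul (a / b) (frame 2 n t v),
      (Dir.quasi_act n t).ae huv] with x h1 h3 h4 h5
    rw [h1, h4, Pi.smul_apply, h3, h5, smul_eq_mul]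
    field_simp
  · set u' := (frame p n t).symm u with hu'
    set v' := (frame 2 n t).symm v with hv'
    have e1 : frame p n t u' = u := (frame p n t).apply_symm_apply u
    have e2 : frame 2 n t v' = v := (frame 2 n t).apply_symm_apply v
    have h1 := hp u'
    have h3 := h2 v'
    rw [e1] at h1
    rw [e2] at h3
    have key : ∀ᵐ x, u' (t.act n x) = (a / b)⁻¹ * v' (t.act n x) := by
      filter_upwards [h1, h3, huv] with x h1 h3 h4
      rw [h1, h3] at h4
      have hE := frameE_ne_zero t x
      field_simp
      apply mul_left_cancel₀ hE
      linear_combination h4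
    filter_upwards [(Dir.quasi_actInv n t).ae key, Lp.coeFn_smul (a / b)⁻¹ v'] with x h5 h6
    rw [h6, Pi.smul_apply, smul_eq_mul]
    simpa only [Dir.act_actInv] using h5

theorem Compat.E {T : Op p} {R : Op 2} (h : Compat T R) (n : ℕ+) (t : Dir) :
    Compat (E n t T) (E n t R) := fun u v huv => by
  obtain ⟨c, hc, h1, h2⟩ := frame_proportional (p := p) n t
  have h3 := h1 _ _ (h _ _ (h2 u v huv))
  have e : (c • frame 2 n t (R (c⁻¹ • (frame 2 n t).symm v)) : X 2) = (ConvType.E n t R) v := by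
    rw [map_smul, map_smul, smul_smul, mul_inv_cancel₀ hc, one_smul]; rfl
  rw [e] at h3
  exact h3

theorem Compat.Einv {T : Op p} {R : Op 2} (h : Compat T R) (n : ℕ+) (t : Dir) :
    Compat (Einv n t T) (Einv n t R) := fun u v huv => by
  obtain ⟨c, hc, h1, h2⟩ := frame_proportional (p := p) n t
  have h3 := h2 _ _ (h _ _ (h1 u v huv))
  have e : (c⁻¹ • (frame 2 n t).symm (R (c • frame 2 n t v)) : X 2) = (ConvType.Einv n t R) v := by
    rw [map_smul, map_smul, smul_smul, inv_mul_cancel₀ hc, one_smul]; rfl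
  rw [e] at h3
  exact h3

theorem ext_of_nice (hp : p ≠ ∞) {T T' : Op p}
    (h : ∀ u : X p, ∀ k, IsNice k → u =ᵐ[volume] k → T u = T' u) : T = T' := by
  ext1 u
  choose v k hk _ hvk _ hv using fun n : ℕ => exists_nice_near hp u (ε := 1 / ((n : ℝ) + 1)) (by positivity)
  have hlim : Tendsto v atTop (𝓝 u) := by
    rw [tendsto_iff_norm_sub_tendsto_zero]
    exact squeeze_zero (fun _ => norm_nonneg _) (fun n => (hv n).le) tendsto_one_div_add_atTop_nhds_zero_nat
  refine tendsto_nhds_unique ((T.continuous.tendsto u).comp hlim)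
    (((T'.continuous.tendsto u).comp hlim).congr fun n => ?_)
  exact (h _ _ (hk n) (hvk n)).symm

theorem Compat.unique (hp : p ≠ ∞) {T T' : Op p} {R : Op 2} (h : Compat T R) (h' : Compat T' R) :
    T = T' := by
  refine ext_of_nice hp fun u k hk huk => Lp.ext ?_
  have huv : u =ᵐ[volume] (hk.memLp 2).toLp := huk.trans (hk.memLp 2).coeFn_toLp.symm
  exact (h _ _ huv).trans (h' _ _ huv).symm

theorem bddOn_one (r : ℝ≥0∞) : BddOn r 1 1 := fun v _ => by simp

theorem BddOn.memLp {r : ℝ≥0∞} {C : ℝ≥0} {R : Op 2} (h : BddOn r C R) {v : X 2}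
    (hv : MemLp v r volume) : MemLp (R v) r volume :=
  ⟨Lp.aestronglyMeasurable _, (h v hv).trans_lt (ENNReal.mul_lt_top ENNReal.coe_lt_top hv.2)⟩

theorem BddOn.mul {r : ℝ≥0∞} {C C' : ℝ≥0} {R R' : Op 2} (h : BddOn r C R) (h' : BddOn r C' R') :
    BddOn r (C * C') (R * R') := fun v hv => by
  refine (h _ (h'.memLp hv)).trans ?_
  rw [ENNReal.coe_mul, mul_assoc]
  gcongr
  exact h' v hv

theorem BddOn.add {r : ℝ≥0∞} (hr : 1 ≤ r) {C C' : ℝ≥0} {R R' : Op 2} (h : BddOn r C R)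
    (h' : BddOn r C' R') : BddOn r (C + C') (R + R') := fun v hv => by
  rw [ENNReal.coe_add, add_mul]
  refine le_trans ?_ (add_le_add (h v hv) (h' v hv))
  refine le_trans (le_of_eq (eLpNorm_congr_ae (Lp.coeFn_add (R v) (R' v)))) ?_
  exact eLpNorm_add_le (Lp.aestronglyMeasurable _) (Lp.aestronglyMeasurable _) hr

theorem BddOn.smul {r : ℝ≥0∞} {C : ℝ≥0} {R : Op 2} (c : ℂ) (h : BddOn r C R) :
    BddOn r (‖c‖₊ * C) (c • R) := fun v hv => by
  refine le_trans (le_of_eq (eLpNorm_congr_ae (Lp.coeFn_smul c (R v)))) ?_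
  rw [eLpNorm_const_smul, ENNReal.coe_mul, mul_assoc]
  exact mul_le_mul' le_rfl (h v hv)

theorem BddOn.sub {r : ℝ≥0∞} (hr : 1 ≤ r) {C C' : ℝ≥0} {R R' : Op 2} (h : BddOn r C R)
    (h' : BddOn r C' R') : BddOn r (C + C') (R - R') := by
  have := h.add hr (h'.smul (-1))
  simpa [sub_eq_add_neg] using this

theorem IsMul.bddOn {R : Op 2} {f : ℝ → ℂ} (hR : IsMul R f) {C : ℝ≥0} (hf : ∀ᵐ x, ‖f x‖ ≤ C)
    (r : ℝ≥0∞) : BddOn r C R := fun v _ => by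
  have := eLpNorm_le_nnreal_smul_eLpNorm_of_ae_le_mul (f := R v) (g := v) (c := C) (μ := volume) (by
    filter_upwards [hR v, hf] with x h1 h2
    rw [h1, nnnorm_mul]
    gcongr
    exact_mod_cast h2) r
  simpa [ENNReal.smul_def] using this

theorem bddOn_two {R : Op 2} {C : ℝ≥0} (h : ‖R‖ ≤ C) : BddOn 2 C R := fun v _ => by
  have h1 := R.le_of_opNorm_le h v
  rw [Lp.norm_def, Lp.norm_def] at h1
  have h2 := ENNReal.ofReal_le_ofReal h1
  rwa [ENNReal.ofReal_toReal (Lp.eLpNorm_ne_top _), ENNReal.ofReal_mul C.coe_nonneg,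
    ENNReal.ofReal_coe_nnreal, ENNReal.ofReal_toReal (Lp.eLpNorm_ne_top _)] at h2

theorem eLpNorm_frame (r : ℝ≥0∞) (n : ℕ+) (t : Dir) : ∃ κ : ℝ≥0∞, κ ≠ 0 ∧ κ ≠ ∞ ∧
    ∀ w : X 2, eLpNorm (frame 2 n t w) r volume = κ * eLpNorm w r volume := by
  obtain ⟨c, hc, h⟩ := frame_coeFn (p := 2) n t
  have key : ∃ κ : ℝ≥0∞, κ ≠ 0 ∧ κ ≠ ∞ ∧ ∀ w : X 2,
      eLpNorm (fun x => w (t.act n x)) r volume = κ * eLpNorm w r volume := by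
    cases t
    case freq t =>
      have hn := inv_pos.2 (pnat_pos n)
      set d : ℝ := ((n : ℝ)⁻¹) ^ (1 / r).toReal with hd
      have d0 : 0 < d := Real.rpow_pos_of_pos hn _
      refine ⟨(‖(d : ℂ)‖ₑ)⁻¹, by simp, by simp [d0.ne'], fun w => ?_⟩
      have h2 := eLpNorm_dilation r hn w (Lp.aestronglyMeasurable w)
      have h3 := eLpNorm_const_smul (d : ℂ) (fun x => w ((n : ℝ)⁻¹ * x)) r volume
      rw [← h2]
      have h4 : eLpNorm (fun x => (d : ℂ) * w ((n : ℝ)⁻¹ * x)) r volume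
        = ‖(d : ℂ)‖ₑ * eLpNorm (fun x => w ((n : ℝ)⁻¹ * x)) r volume := h3
      rw [h4, ← mul_assoc, ENNReal.inv_mul_cancel (by simp [d0.ne']) (by simp), one_mul]
      rfl
    case center => exact ⟨1, by simp, by simp, fun w => by simp [Dir.act]⟩
    all_goals
      refine ⟨1, by simp, by simp, fun w => ?_⟩
      rw [one_mul]
      exact eLpNorm_comp_measurePreserving (Lp.aestronglyMeasurable w)
        (measurePreserving_sub_right volume _)
  obtain ⟨κ, h0, h1, hκ⟩ := key
  refine ⟨‖c‖ₑ * κ, mul_ne_zero (by simpa using hc) h0, ENNReal.mul_ne_top (by simp) h1, fun w => ?_⟩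
  rw [mul_assoc, ← hκ w, eLpNorm_congr_ae (h w), ← eLpNorm_const_smul]
  refine eLpNorm_congr_norm_ae (.of_forall fun x => ?_)
  rw [norm_mul, norm_mul, norm_frameE, Pi.smul_apply, norm_smul, mul_one]

theorem BddOn.E {r : ℝ≥0∞} {C : ℝ≥0} {R : Op 2} (h : BddOn r C R) (n : ℕ+) (t : Dir) :
    BddOn r C (E n t R) := fun v hv => by
  obtain ⟨κ, h0, h1, hκ⟩ := eLpNorm_frame r n t
  set v' := (frame 2 n t).symm v with hv'
  have e : frame 2 n t v' = v := (frame 2 n t).apply_symm_apply v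
  have h2 := hκ v'
  rw [e] at h2
  have hm : MemLp v' r volume := by
    refine ⟨Lp.aestronglyMeasurable _, lt_top_iff_ne_top.2 fun h3 => ?_⟩
    rw [h3, ENNReal.mul_top h0] at h2
    exact hv.2.ne h2
  change eLpNorm (frame 2 n t (R v')) r volume ≤ _
  rw [hκ, h2, mul_left_comm]
  gcongr
  exact h v' hm

theorem BddOn.Einv {r : ℝ≥0∞} {C : ℝ≥0} {R : Op 2} (h : BddOn r C R) (n : ℕ+) (t : Dir) :
    BddOn r C (Einv n t R) := fun v hv => by
  obtain ⟨κ, h0, h1, hκ⟩ := eLpNorm_frame r n t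
  have hm : MemLp (frame 2 n t v) r volume :=
    ⟨Lp.aestronglyMeasurable _, by rw [hκ]; exact ENNReal.mul_lt_top h1.lt_top hv.2⟩
  have h2 := h _ hm
  rw [hκ, mul_left_comm] at h2
  have e : frame 2 n t (ConvType.Einv n t R v) = R (frame 2 n t v) :=
    (frame 2 n t).apply_symm_apply _
  rw [← e, hκ] at h2
  exact (ENNReal.mul_le_mul_iff_right h0 h1).1 h2

/-! ## Interpolation between `L^2` and `L^r` -/

/-- `p` lies strictly between `2` and `r`, or all three agree. -/
def Between (p r : ℝ≥0∞) : Prop :=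
  (p = 2 ∧ r = 2) ∨ (2 < p ∧ p < r ∧ r ≠ ∞) ∨ (1 ≤ r ∧ r < p ∧ p < 2)

theorem Between.one_le {p r : ℝ≥0∞} (h : Between p r) : 1 ≤ r := by
  rcases h with ⟨-, rfl⟩ | ⟨h1, h2, -⟩ | ⟨h, -, -⟩
  · exact Fact.out
  · exact (Fact.out : (1 : ℝ≥0∞) ≤ 2).trans (h1.trans h2).le
  · exact h

theorem BddOn.lintegral {r : ℝ≥0∞} (hr0 : r ≠ 0) (hr : r ≠ ∞) {C : ℝ≥0} {R : Op 2}
    (h : BddOn r C R) (k : ℝ → ℂ) (hk : IsNice k) (v : X 2) (hv : v =ᵐ[volume] k) :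
    ∫⁻ x, ‖R v x‖ₑ ^ r.toReal ≤
      ENNReal.ofReal ((C : ℝ) ^ r.toReal) * ∫⁻ x, ‖k x‖ₑ ^ r.toReal := by
  have h0 : 0 < r.toReal := ENNReal.toReal_pos hr0 hr
  have h1 := h v ((hk.memLp r).ae_eq hv.symm)
  rw [eLpNorm_congr_ae hv, eLpNorm_eq_lintegral_rpow_enorm_toReal hr0 hr,
    eLpNorm_eq_lintegral_rpow_enorm_toReal hr0 hr] at h1
  have h2 := ENNReal.rpow_le_rpow h1 h0.le
  rwa [ENNReal.mul_rpow_of_nonneg _ _ h0.le, ← ENNReal.rpow_mul, ← ENNReal.rpow_mul,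
    one_div_mul_cancel h0.ne', ENNReal.rpow_one, ENNReal.rpow_one, ← ENNReal.ofReal_coe_nnreal,
    ENNReal.ofReal_rpow_of_nonneg C.coe_nonneg h0.le] at h2

theorem Compat.norm_le (hp : p ≠ ∞) {T : Op p} {R : Op 2} (hTR : Compat T R) {K η : ℝ}
    (hη : 0 ≤ η) (hK : K ≤ η ^ p.toReal)
    (h : ∀ k, IsNice k → Measurable k → ∀ v : X 2, v =ᵐ[volume] k →
      ∫⁻ x, ‖R v x‖ₑ ^ p.toReal ≤ ENNReal.ofReal K * ∫⁻ x, ‖k x‖ₑ ^ p.toReal) : ‖T‖ ≤ η := by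
  have h0 : 0 < p.toReal := ENNReal.toReal_pos fact_ne_zero hp
  have nice : ∀ u : X p, ∀ k, IsNice k → Measurable k → u =ᵐ[volume] k → ‖T u‖ ≤ η * ‖u‖ := by
    intro u k hk hkm huk
    have huv : u =ᵐ[volume] (hk.memLp 2).toLp := huk.trans (hk.memLp 2).coeFn_toLp.symm
    have h1 := h k hk hkm _ (hk.memLp 2).coeFn_toLp
    have h2 : eLpNorm (T u) p volume ≤ ENNReal.ofReal η * eLpNorm u p volume := by
      rw [eLpNorm_congr_ae (hTR _ _ huv), eLpNorm_congr_ae huk,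
        eLpNorm_eq_lintegral_rpow_enorm_toReal fact_ne_zero hp,
        eLpNorm_eq_lintegral_rpow_enorm_toReal fact_ne_zero hp,
        ← ENNReal.rpow_le_rpow_iff h0, ENNReal.mul_rpow_of_nonneg _ _ h0.le, ← ENNReal.rpow_mul,
        ← ENNReal.rpow_mul, one_div_mul_cancel h0.ne', ENNReal.rpow_one, ENNReal.rpow_one,
        ENNReal.ofReal_rpow_of_nonneg hη h0.le]
      exact h1.trans (by gcongr)
    rw [Lp.norm_def, Lp.norm_def, ← ENNReal.toReal_ofReal hη, ← ENNReal.toReal_mul]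
    exact ENNReal.toReal_mono (ENNReal.mul_ne_top ENNReal.ofReal_ne_top (Lp.eLpNorm_ne_top _)) h2
  refine ContinuousLinearMap.opNorm_le_bound _ hη fun u => ?_
  choose v k hk hkm hvk hvn hv using fun n : ℕ =>
    exists_nice_near hp u (ε := 1 / ((n : ℝ) + 1)) (by positivity)
  have hlim : Tendsto v atTop (𝓝 u) := by
    rw [tendsto_iff_norm_sub_tendsto_zero]
    exact squeeze_zero (fun _ => norm_nonneg _) (fun n => (hv n).le) tendsto_one_div_add_atTop_nhds_zero_nat
  refine le_of_tendsto ((T.continuous.tendsto u).comp hlim).norm (.of_forall fun n => ?_)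
  exact (nice _ _ (hk n) (hkm n) (hvk n)).trans (by gcongr; exact hvn n)

theorem exists_mul_rpow_le {c K δ : ℝ} (hc : 0 < c) (hK : 0 ≤ K) (hδ : 0 < δ) :
    ∃ γ : ℝ, 0 < γ ∧ K * γ ^ c ≤ δ := by
  refine ⟨(δ / (K + 1)) ^ (1 / c), by positivity, ?_⟩
  rw [← Real.rpow_mul (by positivity), one_div_mul_cancel hc.ne', Real.rpow_one, mul_div_assoc',
    div_le_iff₀ (by positivity)]
  nlinarith

/-- Operators that are small on `L^2` and bounded on `L^r` are small on `L^p`. -/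
theorem interpolate (hp : p ≠ ∞) {r : ℝ≥0∞} (hb : Between p r) (C : ℝ≥0) {η : ℝ} (hη : 0 < η) :
    ∃ ε : ℝ, 0 < ε ∧ ∀ (T : Op p) (R : Op 2), Compat T R → ‖R‖ ≤ ε → BddOn r C R → ‖T‖ ≤ η := by
  rcases hb with ⟨hp2, -⟩ | ⟨h2p, hpr, hr⟩ | ⟨hr0, hrp, hp2⟩
  · subst hp2
    refine ⟨η, hη, fun T R hTR hR _ => ?_⟩
    have : T = R := ContinuousLinearMap.ext fun u => Lp.ext (hTR u u (.refl _ _))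
    rwa [this]
  · set a : ℝ := (2 : ℝ≥0∞).toReal with ha
    set q := p.toReal with hq
    set b := r.toReal with hb
    have a0 : 0 < a := by simp [ha]
    have haq : a < q := (ENNReal.toReal_lt_toReal (by simp) hp).2 h2p
    have hqb : q < b := (ENNReal.toReal_lt_toReal hp hr).2 hpr
    have hr0 : r ≠ 0 := (zero_le.trans_lt hpr).ne'
    have q0 : 0 < q := a0.trans haq
    have d1 : 0 < q - a := by linarith
    have d2 : 0 < b - q := by linarith
    obtain ⟨γ, γ0, hγ⟩ := exists_mul_rpow_le (K := q * (2 ^ b * (C : ℝ) ^ b / (b - q))) d2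
      (by positivity) (half_pos (Real.rpow_pos_of_pos hη q))
    obtain ⟨ε, ε0, hε⟩ := exists_mul_rpow_le (K := q * (2 ^ a * γ ^ (a - q) / (q - a))) a0
      (by positivity) (half_pos (Real.rpow_pos_of_pos hη q))
    refine ⟨ε, ε0, fun T R hTR hR hRC => ?_⟩
    refine hTR.norm_le hp hη.le (K := q * (2 ^ a * ε ^ a * γ ^ (a - q) / (q - a) +
      2 ^ b * (C : ℝ) ^ b * γ ^ (b - q) / (b - q))) ?_ fun k hk hkm v hv => ?_
    · refine le_trans (le_of_eq ?_) ((add_le_add hε hγ).trans (by rw [add_halves]))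
      ring
    · exact marcinkiewicz a0 haq hqb γ0 (by positivity) (by positivity)
        ((bddOn_two (C := ⟨ε, ε0.le⟩) hR).lintegral (by simp) (by simp))
        (hRC.lintegral hr0 hr) hk hkm hv
  · set a := r.toReal with ha
    set q := p.toReal with hq
    set b : ℝ := (2 : ℝ≥0∞).toReal with hb
    have hr1 : r ≠ 0 := (zero_lt_one.trans_le hr0).ne'
    have hrt : r ≠ ∞ := (hrp.trans_le le_top).ne
    have a0 : 0 < a := ENNReal.toReal_pos hr1 hrt
    have haq : a < q := (ENNReal.toReal_lt_toReal hrt hp).2 hrp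
    have hqb : q < b := (ENNReal.toReal_lt_toReal hp (by simp)).2 hp2
    have q0 : 0 < q := a0.trans haq
    have b0 : 0 < b := q0.trans hqb
    have d1 : 0 < q - a := by linarith
    have d2 : 0 < b - q := by linarith
    obtain ⟨γ, γ0, hγ⟩ := exists_mul_rpow_le (K := q * (2 ^ a * (C : ℝ) ^ a / (q - a))) d1
      (by positivity) (half_pos (Real.rpow_pos_of_pos hη q))
    obtain ⟨ε, ε0, hε⟩ := exists_mul_rpow_le (K := q * (2 ^ b * (γ⁻¹) ^ (b - q) / (b - q))) b0
      (by positivity) (half_pos (Real.rpow_pos_of_pos hη q))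
    refine ⟨ε, ε0, fun T R hTR hR hRC => ?_⟩
    refine hTR.norm_le hp hη.le (K := q * (2 ^ a * (C : ℝ) ^ a * (γ⁻¹) ^ (a - q) / (q - a) +
      2 ^ b * ε ^ b * (γ⁻¹) ^ (b - q) / (b - q))) ?_ fun k hk hkm v hv => ?_
    · have e : (γ⁻¹) ^ (a - q) = γ ^ (q - a) := by
        rw [Real.inv_rpow γ0.le, ← Real.rpow_neg γ0.le, neg_sub]
      rw [e]
      refine le_trans (le_of_eq ?_) ((add_le_add hγ hε).trans (by rw [add_halves]))
      ring
    · exact marcinkiewicz a0 haq hqb (inv_pos.2 γ0) (by positivity) (by positivity)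
        (hRC.lintegral hr1 hrt)
        ((bddOn_two (C := ⟨ε, ε0.le⟩) hR).lintegral (by simp) (by simp)) hk hkm hv

theorem tendsto_of_interpolate (hp : p ≠ ∞) {r : ℝ≥0∞} (hb : Between p r) (C : ℝ≥0) {ι : Type*}
    {l : Filter ι} {T : ι → Op p} {R : ι → Op 2} (hTR : ∀ i, Compat (T i) (R i))
    (hC : ∀ i, BddOn r C (R i)) (hR : Tendsto (fun i => ‖R i‖) l (𝓝 0)) :
    Tendsto (fun i => ‖T i‖) l (𝓝 0) := by
  rw [Metric.tendsto_nhds]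
  intro η hη
  obtain ⟨ε, ε0, hε⟩ := interpolate hp hb C (half_pos hη)
  filter_upwards [hR.eventually_lt_const ε0] with i hi
  rw [dist_zero_right, norm_norm]
  exact (hε _ _ (hTR i) hi.le (hC i)).trans_lt (by linarith)

/-! ## Conjugation by isometries -/

/-- Conjugation `A ↦ e A e⁻¹` by an isometry. -/
def conj (e : X p ≃ₗᵢ[ℂ] X p) (A : Op p) : Op p := isoOp e * A * isoOp e.symm

theorem conj_apply (e : X p ≃ₗᵢ[ℂ] X p) (A : Op p) (u : X p) : conj e A u = e (A (e.symm u)) := rfl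

theorem conj_mul (e : X p ≃ₗᵢ[ℂ] X p) (A B : Op p) : conj e (A * B) = conj e A * conj e B := by
  ext1 u
  simp only [conj_apply, mul_apply_eq_comp, LinearIsometryEquiv.symm_apply_apply]

theorem conj_one (e : X p ≃ₗᵢ[ℂ] X p) : conj e 1 = 1 := by
  simp [conj, isoOp_mul_symm]

theorem conj_add (e : X p ≃ₗᵢ[ℂ] X p) (A B : Op p) : conj e (A + B) = conj e A + conj e B := by
  simp [conj, mul_add, add_mul]

theorem conj_sub (e : X p ≃ₗᵢ[ℂ] X p) (A B : Op p) : conj e (A - B) = conj e A - conj e B := by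
  simp [conj, mul_sub, sub_mul]

theorem conj_smul (e : X p ≃ₗᵢ[ℂ] X p) (c : ℂ) (A : Op p) : conj e (c • A) = c • conj e A := by
  simp [conj]

theorem conj_symm_conj (e : X p ≃ₗᵢ[ℂ] X p) (A : Op p) : conj e.symm (conj e A) = A := by
  ext1 u
  simp [conj_apply]

theorem conj_conj_symm (e : X p ≃ₗᵢ[ℂ] X p) (A : Op p) : conj e (conj e.symm A) = A := by
  ext1 u
  simp [conj_apply]

theorem norm_conj (e : X p ≃ₗᵢ[ℂ] X p) (A : Op p) : ‖conj e A‖ = ‖A‖ :=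
  le_antisymm (norm_conj_le _ _ _) (by
    have := norm_conj_le e.symm e.symm.symm (conj e A)
    change ‖conj e.symm (conj e A)‖ ≤ _ at this
    rwa [conj_symm_conj] at this)

theorem IsMul.conj {e : X p ≃ₗᵢ[ℂ] X p} {w : ℝ → ℂ} {σ : ℝ → ℝ}
    (he : ∀ u, e u =ᵐ[volume] fun x => w x * u (σ x))
    (hσ : Measure.QuasiMeasurePreserving σ volume volume) {T : Op p} {f : ℝ → ℂ}
    (hT : IsMul T f) : IsMul (conj e T) fun x => f (σ x) := fun u => by
  set v : X p := e.symm u with hv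
  have hu : e v = u := e.apply_symm_apply u
  change e (T v) =ᵐ[volume] _
  have h1 := he v
  rw [hu] at h1
  filter_upwards [he (T v), h1, hσ.ae (hT v)] with x h2 h3 h4
  rw [h2, h3, h4]; ring

theorem symm_coeFn {e : X p ≃ₗᵢ[ℂ] X p} {w : ℝ → ℂ} {σ σ' : ℝ → ℝ} (hw : ∀ x, w x ≠ 0)
    (he : ∀ u, e u =ᵐ[volume] fun x => w x * u (σ x))
    (hσ' : Measure.QuasiMeasurePreserving σ' volume volume) (h : ∀ x, σ (σ' x) = x) (u : X p) :
    e.symm u =ᵐ[volume] fun x => (w (σ' x))⁻¹ * u (σ' x) := by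
  have h1 := he (e.symm u)
  rw [e.apply_symm_apply] at h1
  filter_upwards [hσ'.ae h1] with x hx
  rw [hx, h, inv_mul_cancel_left₀ (hw _)]

theorem V_symm (s : ℝ) : (V p s).symm = V p (-s) := by
  ext1 u
  refine Lp.ext ?_
  filter_upwards [symm_coeFn (w := fun _ => 1) (e := V p s) (fun _ => one_ne_zero)
    (fun u => by simpa only [one_mul] using V_coeFn s u)
    (measurePreserving_add_right volume s).quasiMeasurePreserving (by simp) u,
    V_coeFn (-s) u] with x h1 h2
  rw [h1, h2, sub_neg_eq_add, inv_one, one_mul]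

theorem U_symm (s : ℝ) : (U p s).symm = U p (-s) := by
  ext1 u
  refine Lp.ext ?_
  filter_upwards [symm_coeFn (e := U p s) (fun _ => Complex.exp_ne_zero _) (U_coeFn s)
    (.id _) (fun _ => rfl) u, U_coeFn (-s) u] with x h1 h2
  rw [h1, h2, ← Complex.exp_neg]
  congr 2
  simp

theorem isMul_V {T : Op p} {f : ℝ → ℂ} (hT : IsMul T f) (s : ℝ) :
    IsMul (conj (V p s) T) fun x => f (x - s) :=
  hT.conj (w := fun _ => 1) (fun u => by simpa only [one_mul] using V_coeFn s u)
    (measurePreserving_sub_right volume s).quasiMeasurePreserving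

theorem isMul_Z {T : Op p} {f : ℝ → ℂ} (hT : IsMul T f) (n : ℕ+) :
    IsMul (conj (Z p n) T) fun x => f ((n : ℝ)⁻¹ * x) :=
  hT.conj (Z_coeFn n) (quasi_mul (inv_pos.2 (pnat_pos n)).ne')

theorem isMul_U_op (t : ℝ) : IsMul (isoOp (U p t)) fun x => Complex.exp (Complex.I * (t * x : ℝ)) :=
  fun u => U_coeFn t u

theorem Z_symm_coeFn (n : ℕ+) (u : X p) : (Z p n).symm u
    =ᵐ[volume] fun x => ((((n : ℝ)⁻¹) ^ (1 / p).toReal : ℝ) : ℂ)⁻¹ * u ((n : ℝ) * x) :=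
  symm_coeFn (w := fun _ => ((((n : ℝ)⁻¹) ^ (1 / p).toReal : ℝ) : ℂ)) (fun _ => by
    have := Real.rpow_pos_of_pos (inv_pos.2 (pnat_pos n)) (1 / p).toReal
    exact_mod_cast this.ne') (Z_coeFn n) (quasi_mul (pnat_pos n).ne')
    (fun x => by rw [inv_mul_cancel_left₀ (pnat_pos n).ne']) u

theorem isMul_Z_symm {T : Op p} {f : ℝ → ℂ} (hT : IsMul T f) (n : ℕ+) :
    IsMul (conj (Z p n).symm T) fun x => f ((n : ℝ) * x) :=
  hT.conj (w := fun _ => ((((n : ℝ)⁻¹) ^ (1 / p).toReal : ℝ) : ℂ)⁻¹)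
    (Z_symm_coeFn n) (quasi_mul (pnat_pos n).ne')

/-! ## The Fourier transform and the frames -/

/-- The Fourier transform on `L^2(ℝ)`. -/
def Fe : X 2 ≃ₗᵢ[ℂ] X 2 := Lp.fourierTransformₗᵢ ℝ ℂ

theorem Fe_apply (u : X 2) : Fe u = 𝓕 u := by
  unfold Fe FourierTransform.fourier Lp.instFourierTransform
  rfl

theorem Fe_symm_apply (u : X 2) : Fe.symm u = 𝓕⁻ u := by
  unfold Fe FourierTransformInv.fourierInv Lp.instFourierTransformInv
  rfl

theorem ext_of_schwartz {e e' : X 2 ≃ₗᵢ[ℂ] X 2}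
    (h : ∀ f : SchwartzMap ℝ ℂ, e (f.toLp 2) = e' (f.toLp 2)) (u : X 2) : e u = e' u := by
  have := (SchwartzMap.denseRange_toLpCLM (E := ℝ) (F := ℂ) (p := 2) (μ := volume)
    ENNReal.ofNat_ne_top).equalizer e.continuous e'.continuous (funext h)
  exact congrFun this u

theorem V_schwartz (s : ℝ) (f : SchwartzMap ℝ ℂ) :
    V 2 s (f.toLp 2) = (f.compSubConstCLM ℂ s).toLp 2 := by
  refine Lp.ext ?_
  filter_upwards [V_coeFn s (f.toLp 2), (f.compSubConstCLM ℂ s).coeFn_toLp 2,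
    (measurePreserving_sub_right volume s).quasiMeasurePreserving.ae_eq_comp (f.coeFn_toLp 2)]
    with x h1 h2 h3
  rw [h1, h2, SchwartzMap.compSubConstCLM_apply]
  exact h3

theorem Fe_V (s : ℝ) (u : X 2) : Fe (V 2 s u) = U 2 (-(2 * Real.pi * s)) (Fe u) := by
  have := ext_of_schwartz (e := (V 2 s).trans Fe) (e' := Fe.trans (U 2 (-(2 * Real.pi * s)))) (fun f => ?_) u
  · rwa [LinearIsometryEquiv.trans_apply, LinearIsometryEquiv.trans_apply] at this
  rw [LinearIsometryEquiv.trans_apply, LinearIsometryEquiv.trans_apply]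
  rw [V_schwartz, Fe_apply, Fe_apply, SchwartzMap.toLp_fourier_eq, SchwartzMap.toLp_fourier_eq]
  refine Lp.ext ?_
  filter_upwards [(𝓕 (f.compSubConstCLM ℂ s)).coeFn_toLp 2,
    U_coeFn (-(2 * Real.pi * s)) ((𝓕 f).toLp 2), (𝓕 f).coeFn_toLp 2] with x h1 h2 h3
  rw [h1, h2, h3, SchwartzMap.fourier_coe, SchwartzMap.fourier_coe,
    Real.fourier_real_eq_integral_exp_smul, Real.fourier_real_eq_integral_exp_smul,
    ← integral_const_mul, ← integral_add_right_eq_self _ s]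
  refine integral_congr_ae (.of_forall fun y => ?_)
  simp only [SchwartzMap.compSubConstCLM_apply, smul_eq_mul, add_sub_cancel_right]
  rw [← mul_assoc, ← Complex.exp_add]
  congr 2
  push_cast; ring

theorem Fe_symm_V (s : ℝ) (u : X 2) : Fe.symm (V 2 s u) = U 2 (2 * Real.pi * s) (Fe.symm u) := by
  have := ext_of_schwartz (e := (V 2 s).trans Fe.symm) (e' := Fe.symm.trans (U 2 (2 * Real.pi * s))) (fun f => ?_) u
  · rwa [LinearIsometryEquiv.trans_apply, LinearIsometryEquiv.trans_apply] at this
  rw [LinearIsometryEquiv.trans_apply, LinearIsometryEquiv.trans_apply]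
  rw [V_schwartz, Fe_symm_apply, Fe_symm_apply, SchwartzMap.toLp_fourierInv_eq,
    SchwartzMap.toLp_fourierInv_eq]
  refine Lp.ext ?_
  filter_upwards [(𝓕⁻ (f.compSubConstCLM ℂ s)).coeFn_toLp 2,
    U_coeFn (2 * Real.pi * s) ((𝓕⁻ f).toLp 2), (𝓕⁻ f).coeFn_toLp 2] with x h1 h2 h3
  rw [h1, h2, h3, SchwartzMap.fourierInv_coe, SchwartzMap.fourierInv_coe,
    Real.fourierInv_eq', Real.fourierInv_eq', ← integral_const_mul, ← integral_add_right_eq_self _ s]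
  refine integral_congr_ae (.of_forall fun y => ?_)
  simp only [SchwartzMap.compSubConstCLM_apply, smul_eq_mul, add_sub_cancel_right]
  rw [← mul_assoc, ← Complex.exp_add]
  congr 2
  simp only [RCLike.inner_apply, conj_trivial]
  push_cast; ring

theorem Fe_U (t : ℝ) (u : X 2) : Fe (U 2 t u) = V 2 (t / (2 * Real.pi)) (Fe u) := by
  apply Fe.symm.injective
  rw [Fe_symm_V, Fe.symm_apply_apply, Fe.symm_apply_apply, mul_div_cancel₀ _ (by positivity)]

theorem Fe_Z (n : ℕ+) (u : X 2) : Fe (Z 2 n u) = (Z 2 n).symm (Fe u) := by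
  have hn := pnat_pos n
  have := ext_of_schwartz (e := (Z 2 n).trans Fe) (e' := Fe.trans (Z 2 n).symm) (fun f => ?_) u
  · rwa [LinearIsometryEquiv.trans_apply, LinearIsometryEquiv.trans_apply] at this
  rw [LinearIsometryEquiv.trans_apply, LinearIsometryEquiv.trans_apply]
  set c : ℂ := ((((n : ℝ)⁻¹) ^ (1 / (2 : ℝ≥0∞)).toReal : ℝ) : ℂ) with hc
  have c2 : c * c = (n : ℂ)⁻¹ := by
    rw [hc, ← Complex.ofReal_mul, ← Real.rpow_add (inv_pos.2 hn)]
    norm_num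
  have c0 : c ≠ 0 := by
    intro h
    rw [h, mul_zero] at c2
    exact inv_ne_zero (by simp) c2.symm
  have ninv : (n : ℂ) ≠ 0 := by simp
  set g : SchwartzMap ℝ ℂ := c • SchwartzMap.compCLMOfContinuousLinearEquiv ℂ
    (ContinuousLinearEquiv.smulLeft (Units.mk0 (n : ℝ)⁻¹ (inv_pos.2 hn).ne')) f with hg
  have hgx : ∀ x, g x = c * f ((n : ℝ)⁻¹ * x) := fun x => rfl
  have e1 : Z 2 n (f.toLp 2) = g.toLp 2 := by
    refine Lp.ext ?_
    filter_upwards [Z_coeFn n (f.toLp 2), g.coeFn_toLp 2,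
      (quasi_mul (inv_pos.2 hn).ne').ae_eq_comp (f.coeFn_toLp 2)] with x h1 h2 h3
    rw [h1, h2, hgx]
    exact congrArg (c * ·) h3
  rw [e1, Fe_apply, Fe_apply, SchwartzMap.toLp_fourier_eq, SchwartzMap.toLp_fourier_eq]
  refine Lp.ext ?_
  filter_upwards [(𝓕 g).coeFn_toLp 2, Z_symm_coeFn n ((𝓕 f).toLp 2),
    (quasi_mul hn.ne').ae_eq_comp ((𝓕 f).coeFn_toLp 2)] with x h1 h2 h3
  simp only [Function.comp_apply] at h3
  rw [h1, h2, h3, SchwartzMap.fourier_coe, SchwartzMap.fourier_coe,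
    Real.fourier_real_eq_integral_exp_smul, Real.fourier_real_eq_integral_exp_smul]
  have h4 := Measure.integral_comp_mul_left (fun v : ℝ => Complex.exp (↑(-2 * Real.pi * v * (n * x)) * Complex.I) • f v) (n : ℝ)⁻¹
  rw [inv_inv, abs_of_pos hn] at h4
  have h5 : ∫ v : ℝ, Complex.exp (↑(-2 * Real.pi * v * x) * Complex.I) • g v
      = c * ∫ v : ℝ, Complex.exp (↑(-2 * Real.pi * ((n : ℝ)⁻¹ * v) * (n * x)) * Complex.I) • f ((n : ℝ)⁻¹ * v) := by
    rw [← integral_const_mul]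
    refine integral_congr_ae (.of_forall fun y => ?_)
    simp only [hgx, smul_eq_mul]
    have e : -2 * Real.pi * ((n : ℝ)⁻¹ * y) * (n * x) = -2 * Real.pi * y * x := by
      field_simp
    rw [e]; ring
  rw [h5, h4, Complex.real_smul, ← mul_assoc]
  congr 1
  change c * (((n : ℝ) : ℂ)) = c⁻¹
  have : c * (n : ℂ) * c = 1 := by
    rw [mul_right_comm, c2, inv_mul_cancel₀ ninv]
  exact eq_inv_of_mul_eq_one_left this

/-! ## Fourier multipliers on `L^2` -/

/-- `R = F⁻¹ f F` with the Fourier transform `(Fu)(x) = ∫ u(t) e^{itx} dt`. -/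
def IsFM (R : Op 2) (f : ℝ → ℂ) : Prop :=
  IsMul (conj Fe R) fun y => f (-(2 * Real.pi) * y)

theorem quasi_neg_two_pi :
    Measure.QuasiMeasurePreserving (fun y : ℝ => -(2 * Real.pi) * y) volume volume :=
  quasi_mul (neg_ne_zero.2 (by positivity))

theorem IsFM.congr {R : Op 2} {f g : ℝ → ℂ} (hR : IsFM R f) (h : f =ᵐ[volume] g) : IsFM R g :=
  IsMul.congr hR (quasi_neg_two_pi.ae_eq_comp h)

theorem isFM_one : IsFM 1 fun _ => 1 := by
  unfold IsFM
  rw [conj_one]; exact isMul_one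

theorem IsFM.mul {R S : Op 2} {f g : ℝ → ℂ} (hR : IsFM R f) (hS : IsFM S g) :
    IsFM (R * S) fun x => f x * g x := by
  unfold IsFM
  rw [conj_mul]; exact IsMul.mul hR hS

theorem IsFM.add {R S : Op 2} {f g : ℝ → ℂ} (hR : IsFM R f) (hS : IsFM S g) :
    IsFM (R + S) fun x => f x + g x := by
  unfold IsFM
  rw [conj_add]; exact IsMul.add hR hS

theorem IsFM.sub {R S : Op 2} {f g : ℝ → ℂ} (hR : IsFM R f) (hS : IsFM S g) :
    IsFM (R - S) fun x => f x - g x := by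
  unfold IsFM
  rw [conj_sub]; exact IsMul.sub hR hS

theorem IsFM.smul {R : Op 2} {f : ℝ → ℂ} (c : ℂ) (hR : IsFM R f) :
    IsFM (c • R) fun x => c * f x := by
  unfold IsFM
  rw [conj_smul]; exact IsMul.smul c hR

theorem IsFM.sum {ι : Type*} (s : Finset ι) {R : ι → Op 2} {f : ι → ℝ → ℂ}
    (h : ∀ i, IsFM (R i) (f i)) : IsFM (∑ i ∈ s, R i) fun x => ∑ i ∈ s, f i x := by
  classical
  induction s using Finset.induction_on with
  | empty => simpa using isFM_one.smul 0
  | insert a s ha ih => simp only [Finset.sum_insert ha]; exact (h a).add ih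

theorem IsFM.ext {R S : Op 2} {f g : ℝ → ℂ} (hR : IsFM R f) (hS : IsFM S g)
    (h : f =ᵐ[volume] g) : R = S := by
  rw [← conj_symm_conj Fe R, IsMul.ext hR hS (quasi_neg_two_pi.ae_eq_comp h), conj_symm_conj]

theorem IsFM.commute {R S : Op 2} {f g : ℝ → ℂ} (hR : IsFM R f) (hS : IsFM S g) :
    R * S = S * R :=
  (hR.mul hS).ext (hS.mul hR) (.of_forall fun _ => mul_comm _ _)

theorem IsFM.norm_le {R : Op 2} {f : ℝ → ℂ} (hR : IsFM R f) {c : ℝ} (hc : 0 ≤ c)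
    (h : ∀ᵐ x, ‖f x‖ ≤ c) : ‖R‖ ≤ c := by
  rw [← norm_conj Fe R]
  exact IsMul.norm_le hR hc (quasi_neg_two_pi.ae h)

theorem IsFM.V {R : Op 2} {f : ℝ → ℂ} (hR : IsFM R f) (s : ℝ) : conj (V 2 s) R = R := by
  ext1 u
  rw [conj_apply]
  apply Fe.injective
  rw [Fe_V, V_symm]
  have h1 : ∀ w, Fe (R w) = conj Fe R (Fe w) := fun w => by
    rw [conj_apply, Fe.symm_apply_apply]
  rw [h1, h1, Fe_V]
  have h2 := (isMul_U_op (-(2 * Real.pi * s))).commute hR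
  have h3 := congrArg (fun T : Op 2 => T (U 2 (-(2 * Real.pi * -s)) (Fe u))) h2
  refine h3.trans ?_
  change conj Fe R (U 2 _ (U 2 _ (Fe u))) = _
  rw [← U_symm]
  congr 1
  have : -(2 * Real.pi * -s) = 2 * Real.pi * s := by ring
  rw [this]
  exact (ConvType.U 2 (2 * Real.pi * s)).symm_apply_apply _

theorem IsFM.U {R : Op 2} {f : ℝ → ℂ} (hR : IsFM R f) (t : ℝ) :
    IsFM (conj (U 2 t) R) fun x => f (x + t) := by
  have e : conj Fe (conj (ConvType.U 2 t) R) = conj (ConvType.V 2 (t / (2 * Real.pi))) (conj Fe R) := by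
    ext1 u
    simp only [conj_apply, V_symm, U_symm]
    rw [Fe_U]
    congr 3
    apply Fe.injective
    rw [Fe_U, Fe.apply_symm_apply, Fe.apply_symm_apply, neg_div]
  unfold IsFM
  rw [e]
  convert isMul_V hR (t / (2 * Real.pi)) using 3 with y
  field_simp
  ring

theorem IsFM.Z {R : Op 2} {f : ℝ → ℂ} (hR : IsFM R f) (n : ℕ+) :
    IsFM (conj (Z 2 n) R) fun x => f ((n : ℝ) * x) := by
  have e : conj Fe (conj (ConvType.Z 2 n) R) = conj (ConvType.Z 2 n).symm (conj Fe R) := by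
    ext1 u
    simp only [conj_apply, LinearIsometryEquiv.symm_symm]
    rw [Fe_Z]
    congr 3
    apply (ConvType.Z 2 n).injective
    rw [LinearIsometryEquiv.apply_symm_apply]
    apply Fe.injective
    rw [Fe_Z, Fe.apply_symm_apply, Fe.apply_symm_apply, LinearIsometryEquiv.symm_apply_apply]
  unfold IsFM
  rw [e]
  convert isMul_Z_symm hR n using 3 with y
  ring

theorem conj_trans (e e' : X p ≃ₗᵢ[ℂ] X p) (A : Op p) : conj (e.trans e') A = conj e' (conj e A) := rfl

theorem conj_symm_trans (e e' : X p ≃ₗᵢ[ℂ] X p) (A : Op p) :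
    conj (e.trans e').symm A = conj e.symm (conj e'.symm A) := rfl

theorem E_eq_conj (n : ℕ+) (t : Dir) (A : Op p) : E n t A = conj (frame p n t) A := rfl

theorem Einv_eq_conj (n : ℕ+) (t : Dir) (A : Op p) : Einv n t A = conj (frame p n t).symm A := rfl

theorem frame_freq (n : ℕ+) (t : ℝ) : frame p n (.freq t) = (Z p n).trans (U p (-t)) := rfl

theorem IsFM.E {R : Op 2} {f : ℝ → ℂ} (hR : IsFM R f) (n : ℕ+) (t : ℝ) :
    IsFM (E n (.freq t) R) fun x => f ((n : ℝ) * (x - t)) :=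
  by rw [E_eq_conj, frame_freq, conj_trans]; exact (hR.Z n).U (-t)

theorem IsFM.Z_symm {R : Op 2} {f : ℝ → ℂ} (hR : IsFM R f) (n : ℕ+) :
    IsFM (conj (ConvType.Z 2 n).symm R) fun x => f ((n : ℝ)⁻¹ * x) := by
  have e : conj Fe (conj (ConvType.Z 2 n).symm R) = conj (ConvType.Z 2 n) (conj Fe R) := by
    ext1 u
    have h : ∀ w, Fe ((ConvType.Z 2 n).symm w) = ConvType.Z 2 n (Fe w) := fun w => by
      apply (ConvType.Z 2 n).symm.injective
      rw [← Fe_Z, LinearIsometryEquiv.apply_symm_apply, LinearIsometryEquiv.symm_apply_apply]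
    simp only [conj_apply, LinearIsometryEquiv.symm_symm]
    rw [h]
    congr 3
    apply Fe.injective
    rw [Fe_Z, Fe.apply_symm_apply, Fe.apply_symm_apply]
  unfold IsFM
  rw [e]
  convert isMul_Z hR n using 3 with y
  ring

theorem IsFM.Einv {R : Op 2} {f : ℝ → ℂ} (hR : IsFM R f) (n : ℕ+) (t : ℝ) :
    IsFM (Einv n (.freq t) R) fun x => f ((n : ℝ)⁻¹ * x + t) := by
  rw [Einv_eq_conj, frame_freq, conj_symm_trans, U_symm, neg_neg]
  exact (hR.U t).Z_symm n

theorem ae_norm_le_norm (b : Linf) : ∀ᵐ x, ‖b x‖ ≤ ‖b‖ := by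
  have h := ae_le_eLpNormEssSup (f := b) (μ := (volume : Measure ℝ))
  filter_upwards [h] with x hx
  rw [Lp.norm_def, eLpNorm_exponent_top, ← toReal_enorm]
  refine ENNReal.toReal_mono ?_ hx
  rw [← eLpNorm_exponent_top]
  exact Lp.eLpNorm_ne_top b

theorem exists_isFM {f : ℝ → ℂ} (hf : AEStronglyMeasurable f volume) {c : ℝ}
    (h : ∀ᵐ x, ‖f x‖ ≤ c) : ∃ R : Op 2, IsFM R f := by
  obtain ⟨T, hT⟩ := exists_isMul (p := 2) (f := fun y => f (-(2 * Real.pi) * y))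
    (hf.comp_quasiMeasurePreserving quasi_neg_two_pi) (quasi_neg_two_pi.ae h)
  exact ⟨conj Fe.symm T, by unfold IsFM; rwa [conj_conj_symm]⟩

theorem isConvL2_iff {b : Linf} {R : Op 2} (hR : IsFM R b) (v w : X 2) :
    IsConvL2 b v w ↔ w = R v := by
  have h1 : Fe (R v) = conj Fe R (Fe v) := by rw [conj_apply, Fe.symm_apply_apply]
  have h2 := hR (Fe v)
  rw [← h1] at h2
  have q : Measure.QuasiMeasurePreserving (fun x : ℝ => -x / (2 * Real.pi)) volume volume := by
    convert quasi_mul (c := -(2 * Real.pi)⁻¹) (neg_ne_zero.2 (by positivity)) using 2 with x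
    field_simp
  have e1 : ∀ x : ℝ, -(2 * Real.pi) * (-x / (2 * Real.pi)) = x := fun x => by field_simp
  have e2 : ∀ x : ℝ, -(-(2 * Real.pi) * x) / (2 * Real.pi) = x := fun x => by field_simp
  unfold IsConvL2 F
  rw [← Fe_apply, ← Fe_apply]
  constructor
  · intro h
    apply Fe.injective
    refine Lp.ext ?_
    filter_upwards [h2, quasi_neg_two_pi.ae h] with y h3 h4
    rw [e2] at h4
    rw [h3, h4]
  · rintro rfl
    filter_upwards [q.ae h2] with x hx
    rw [hx, e1]

theorem isFM_exists (b : Linf) : ∃ R : Op 2, IsFM R b := by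
  refine exists_isFM (Lp.aestronglyMeasurable b) (c := ‖b‖) ?_
  exact ae_norm_le_norm b

theorem isW0_iff {b : Linf} {R : Op 2} (hR : IsFM R b) (T : Op p) : IsW0 b T ↔ Compat T R := by
  constructor
  · exact fun h u v huv => h u v _ huv ((isConvL2_iff hR v _).2 rfl)
  · intro h u v w huv hw
    rw [(isConvL2_iff hR v w).1 hw]
    exact h u v huv

theorem isMultiplier_iff {b : Linf} {R : Op 2} (hR : IsFM R b) (r : ℝ≥0∞) :
    IsMultiplier r b ↔ ∃ C, BddOn r C R := by
  constructor
  · rintro ⟨c, hc⟩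
    exact ⟨c, fun v hv => hc v _ hv ((isConvL2_iff hR v _).2 rfl)⟩
  · rintro ⟨C, hC⟩
    refine ⟨C, fun v w hv hw => ?_⟩
    rw [(isConvL2_iff hR v w).1 hw]
    exact hC v hv

/-! ## Averaging over unit intervals -/

/-- The average of `u` over `[x, x + 1]`. -/
def avg (u : ℝ → ℂ) (x : ℝ) : ℂ := ∫ s in Ioc (0 : ℝ) 1, u (x + s)

instance : IsProbabilityMeasure (volume.restrict (Ioc (0 : ℝ) 1)) := ⟨by simp⟩

theorem avg_congr {u v : ℝ → ℂ} (h : u =ᵐ[volume] v) (x : ℝ) : avg u x = avg v x := by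
  refine integral_congr_ae (ae_restrict_of_ae ?_)
  exact (measurePreserving_add_left volume x).quasiMeasurePreserving.ae_eq_comp h

theorem stronglyMeasurable_avg {u : ℝ → ℂ} (hu : StronglyMeasurable u) :
    StronglyMeasurable (avg u) :=
  StronglyMeasurable.integral_prod_right (f := fun x s : ℝ => u (x + s))
    (hu.comp_measurable (measurable_fst.add measurable_snd))

theorem memLp_translate {u : ℝ → ℂ} {q : ℝ≥0∞} (hu : MemLp u q volume) (x : ℝ) :
    MemLp (fun s => u (x + s)) q (volume.restrict (Ioc (0 : ℝ) 1)) :=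
  (hu.comp_measurePreserving (measurePreserving_add_left volume x)).restrict _

theorem integrable_translate (u : X p) (x : ℝ) :
    Integrable (fun s => u (x + s)) (volume.restrict (Ioc (0 : ℝ) 1)) :=
  (memLp_translate (Lp.memLp u) x).integrable Fact.out

theorem eLpNorm_avg_le {q : ℝ≥0∞} (hq1 : 1 ≤ q) (hq : q ≠ ∞) {u : ℝ → ℂ}
    (hu : StronglyMeasurable u) : eLpNorm (avg u) q volume ≤ eLpNorm u q volume := by
  have hq0 : q ≠ 0 := (zero_lt_one.trans_le hq1).ne'
  have hr : 0 < q.toReal := ENNReal.toReal_pos hq0 hq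
  have hr1 : 1 ≤ q.toReal := by
    rw [← ENNReal.toReal_one]; exact ENNReal.toReal_mono hq hq1
  rw [eLpNorm_eq_lintegral_rpow_enorm_toReal hq0 hq, eLpNorm_eq_lintegral_rpow_enorm_toReal hq0 hq]
  refine ENNReal.rpow_le_rpow ?_ (by positivity)
  set r := q.toReal with hrdef
  have hm : Measurable fun z : ℝ × ℝ => ‖u (z.1 + z.2)‖ₑ ^ r :=
    ((hu.comp_measurable (measurable_fst.add measurable_snd)).measurable.enorm).pow_const _
  calc ∫⁻ x, ‖avg u x‖ₑ ^ r
      ≤ ∫⁻ x, ∫⁻ s in Ioc (0 : ℝ) 1, ‖u (x + s)‖ₑ ^ r := by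
        refine lintegral_mono fun x => ?_
        have h1 : ‖avg u x‖ₑ ≤ ∫⁻ s in Ioc (0 : ℝ) 1, ‖u (x + s)‖ₑ := enorm_integral_le_lintegral_enorm _
        have h2 := eLpNorm'_le_eLpNorm'_of_exponent_le zero_lt_one hr1
          (volume.restrict (Ioc (0 : ℝ) 1)) (f := fun s => u (x + s))
          (hu.comp_measurable (measurable_const_add x)).aestronglyMeasurable
        rw [eLpNorm'_eq_lintegral_enorm, eLpNorm'_eq_lintegral_enorm] at h2
        simp only [ENNReal.rpow_one, div_one] at h2
        have h3 := ENNReal.rpow_le_rpow (h1.trans h2) hr.le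
        rwa [← ENNReal.rpow_mul, one_div_mul_cancel hr.ne', ENNReal.rpow_one] at h3
    _ = ∫⁻ s in Ioc (0 : ℝ) 1, ∫⁻ x, ‖u (x + s)‖ₑ ^ r :=
        lintegral_lintegral_swap hm.aemeasurable
    _ = ∫⁻ s in Ioc (0 : ℝ) 1, ∫⁻ x, ‖u x‖ₑ ^ r := by
        refine lintegral_congr fun s => ?_
        exact lintegral_add_right_eq_self (fun x => ‖u x‖ₑ ^ r) s
    _ = ∫⁻ x, ‖u x‖ₑ ^ r := by simp

/-- `T` is the operator `(Tu)(x) = ∫_x^{x+1} u`. -/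
def IsAvg (T : Op p) : Prop := ∀ u : X p, T u =ᵐ[volume] avg u

theorem memLp_avg (hp : p ≠ ∞) (u : X p) : MemLp (avg u) p volume :=
  ⟨(stronglyMeasurable_avg (Lp.stronglyMeasurable u)).aestronglyMeasurable,
    (eLpNorm_avg_le Fact.out hp (Lp.stronglyMeasurable u)).trans_lt (Lp.memLp u).2⟩

theorem exists_isAvg (hp : p ≠ ∞) : ∃ T : Op p, IsAvg T := by
  refine ⟨LinearMap.mkContinuous
    { toFun := fun u => (memLp_avg hp u).toLp _
      map_add' := fun u v => ?_
      map_smul' := fun c u => ?_ } 1 fun u => ?_, fun u => (memLp_avg hp u).coeFn_toLp⟩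
  · rw [← MemLp.toLp_add]
    refine MemLp.toLp_congr _ _ (.of_forall fun x => ?_)
    rw [avg_congr (Lp.coeFn_add u v), Pi.add_apply]
    exact integral_add (integrable_translate u x) (integrable_translate v x)
  · rw [RingHom.id_apply, ← MemLp.toLp_const_smul]
    refine MemLp.toLp_congr _ _ (.of_forall fun x => ?_)
    rw [avg_congr (Lp.coeFn_smul c u), Pi.smul_apply]
    exact integral_const_mul c _
  · rw [one_mul]
    change ‖(memLp_avg hp u).toLp _‖ ≤ _
    rw [Lp.norm_toLp, Lp.norm_def]
    exact ENNReal.toReal_mono (Lp.eLpNorm_ne_top u) (eLpNorm_avg_le Fact.out hp (Lp.stronglyMeasurable u))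

theorem IsAvg.compat {T : Op p} {R : Op 2} (hT : IsAvg T) (hR : IsAvg R) : Compat T R :=
  fun u v huv => by
    filter_upwards [hT u, hR v] with x h1 h2
    rw [h1, h2, avg_congr huv]

theorem IsAvg.bddOn {R : Op 2} (hR : IsAvg R) {r : ℝ≥0∞} (hr1 : 1 ≤ r) (hr : r ≠ ∞) :
    BddOn r 1 R := fun v _ => by
  rw [ENNReal.coe_one, one_mul, eLpNorm_congr_ae (hR v)]
  exact eLpNorm_avg_le hr1 hr (Lp.stronglyMeasurable v)

/-! ## Compactness of the averages on bounded intervals -/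

theorem memLp_indicator_Ioc (a b : ℝ) (q : ℝ≥0∞) :
    MemLp ((Ioc a b).indicator fun _ => (1 : ℂ)) q (volume : Measure ℝ) :=
  memLp_indicator_const q measurableSet_Ioc 1 (Or.inr (by simp))

/-- The functional `u ↦ ∫_a^b u`. -/
def intF (p : ℝ≥0∞) [Fact (1 ≤ p)] (a b : ℝ) : StrongDual ℂ (X p) :=
  pairF p (memLp_indicator_Ioc a b _)

theorem intF_apply {a b : ℝ} (u : X p) : intF p a b u = ∫ x in Ioc a b, u x := by
  rw [intF, pairF_apply, ← integral_indicator measurableSet_Ioc]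
  refine integral_congr_ae (.of_forall fun x => ?_)
  by_cases hx : x ∈ Ioc a b
  · simp [indicator_of_mem hx]
  · simp [indicator_of_notMem hx]

theorem avg_eq_intF (u : X p) (x : ℝ) : avg u x = intF p x (x + 1) u := by
  rw [intF_apply, ← intervalIntegral.integral_of_le (by linarith), avg,
    ← intervalIntegral.integral_of_le zero_le_one]
  have := intervalIntegral.integral_comp_add_left (fun y => u y) x (a := 0) (b := 1)
  rw [this, add_zero]

theorem integrableOn_Lp (u : X p) (a b : ℝ) : IntegrableOn u (Ioc a b) volume := by
  have := (Lp.memLp u).restrict (Ioc a b)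
  exact this.integrable Fact.out

omit [Fact (1 ≤ p)] in
theorem conjExponent_facts (hp1 : 1 < p) : p.conjExponent ≠ 0 ∧ p.conjExponent ≠ ∞ := by
  have h0 : p - 1 ≠ 0 := (tsub_pos_of_lt hp1).ne'
  unfold ENNReal.conjExponent
  exact ⟨(zero_lt_one.trans_le le_self_add).ne', by simp [h0]⟩

theorem norm_intF_le (hp1 : 1 < p) {a b : ℝ} (hab : a ≤ b) :
    ‖intF p a b‖ ≤ (b - a) ^ (1 / p.conjExponent.toReal) := by
  obtain ⟨h0, h1⟩ := conjExponent_facts hp1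
  refine (norm_pairF_le _).trans (le_of_eq ?_)
  rw [eLpNorm_indicator_const measurableSet_Ioc h0 h1, enorm_one, one_mul, Real.volume_Ioc,
    ← ENNReal.toReal_rpow, ENNReal.toReal_ofReal (by linarith)]

theorem norm_avg_sub_le (hp1 : 1 < p) (u : X p) {x y : ℝ} (h : x ≤ y) :
    ‖avg u y - avg u x‖ ≤ 2 * (y - x) ^ (1 / p.conjExponent.toReal) * ‖u‖ := by
  have hi : ∀ a b : ℝ, IntervalIntegrable u volume a b := fun a b =>
    ⟨integrableOn_Lp u a b, integrableOn_Lp u b a⟩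
  have e : ∀ a b : ℝ, a ≤ b → intF p a b u = ∫ s in a..b, u s := fun a b hab => by
    rw [intF_apply, intervalIntegral.integral_of_le hab]
  have key : avg u y - avg u x = intF p (x + 1) (y + 1) u - intF p x y u := by
    rw [avg_eq_intF, avg_eq_intF, e _ _ (by linarith), e _ _ (by linarith), e _ _ (by linarith),
      e _ _ h, ← intervalIntegral.integral_add_adjacent_intervals (hi x y) (hi y (x + 1)),
      ← intervalIntegral.integral_add_adjacent_intervals (hi y (x + 1)) (hi (x + 1) (y + 1))]
    ring
  rw [key]
  have h1 := (intF p (x + 1) (y + 1)).le_of_opNorm_le (norm_intF_le hp1 (by linarith)) u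
  have h2 := (intF p x y).le_of_opNorm_le (norm_intF_le hp1 h) u
  rw [add_sub_add_right_eq_sub] at h1
  refine (norm_sub_le _ _).trans ((add_le_add h1 h2).trans (le_of_eq (by ring)))

theorem isCompactOperator_smulRight (f : StrongDual ℂ (X p)) (v : X p) :
    IsCompactOperator (f.smulRight v : Op p) := by
  have h : IsCompactOperator (f : X p → ℂ) := isCompactOperator_of_locallyCompactSpace_dom f
  exact h.clm_comp ((ContinuousLinearMap.id ℂ ℂ).smulRight v)

theorem isCompactOperator_sum {ι : Type*} (s : Finset ι) (T : ι → Op p)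
    (h : ∀ i, IsCompactOperator (T i)) : IsCompactOperator (∑ i ∈ s, T i : Op p) := by
  classical
  induction s using Finset.induction_on with
  | empty => simpa using! isCompactOperator_zero
  | insert a s ha ih => rw [Finset.sum_insert ha]; exact (h a).add ih

theorem isCompactOperator_of_near {T : Op p}
    (h : ∀ ε : ℝ, 0 < ε → ∃ S : Op p, IsCompactOperator S ∧ ‖T - S‖ ≤ ε) :
    IsCompactOperator T := by
  have hc := isClosed_setOfPred_isCompactOperator (𝕜₁ := ℂ) (σ₁₂ := RingHom.id ℂ) (M₁ := X p) (M₂ := X p)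
  have : T ∈ closure {S : Op p | IsCompactOperator S} := by
    rw [Metric.mem_closure_iff]
    intro ε hε
    obtain ⟨S, hS, hd⟩ := h (ε / 2) (by positivity)
    exact ⟨S, hS, by rw [dist_eq_norm]; linarith⟩
  exact hc.closure_subset this

theorem isCompactOperator_P_mul_avg (hp1 : 1 < p) {T : Op p} (hT : IsAvg T) (m : ℕ+) :
    IsCompactOperator (P p m * T : Op p) := by
  obtain ⟨hq0, hq⟩ := conjExponent_facts hp1
  set κ := 1 / p.conjExponent.toReal with hκ
  have κ0 : 0 < κ := one_div_pos.2 (ENNReal.toReal_pos hq0 hq)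
  have hbox : MemLp (box m) p volume :=
    memLp_indicator_const p measurableSet_Icc 1 (Or.inr (by simp))
  set B : X p := hbox.toLp with hB
  have hlim : Tendsto (fun k : ℕ+ => 2 * ((k : ℝ)⁻¹) ^ κ * ‖B‖) atTop (𝓝 0) := by
    have h1 : Tendsto (fun k : ℕ+ => ((k : ℝ)⁻¹)) atTop (𝓝 0) :=
      tendsto_inv_atTop_zero.comp tendsto_pnat_cast
    have h2 := (Real.continuousAt_rpow_const 0 κ (Or.inr κ0.le)).tendsto.comp h1
    rw [Real.zero_rpow κ0.ne'] at h2
    simpa using (h2.const_mul 2).mul_const ‖B‖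
  refine isCompactOperator_of_near fun ε hε => ?_
  obtain ⟨k, hk⟩ := (hlim.eventually_lt_const hε).exists
  have k0 := pnat_pos k
  have hI : ∀ j : ℤ, MemLp ((Ico ((j : ℝ) / k) ((j + 1 : ℝ) / k)).indicator (box m)) p volume := fun j =>
    hbox.indicator measurableSet_Ico
  refine ⟨∑ j ∈ Finset.Icc (-((m : ℤ) * k)) ((m : ℤ) * k),
    (intF p ((j : ℝ) / k) ((j : ℝ) / k + 1)).smulRight (hI j).toLp,
    isCompactOperator_sum _ _ fun j => isCompactOperator_smulRight _ _, ?_⟩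
  refine le_trans (ContinuousLinearMap.opNorm_le_bound (M := 2 * ((k : ℝ)⁻¹) ^ κ * ‖B‖) _ (by positivity)
    fun u => ?_) hk.le
  have hsum : ∀ s : Finset ℤ, (∑ j ∈ s, (intF p ((j : ℝ) / k) ((j : ℝ) / k + 1)).smulRight (hI j).toLp : Op p) u
      =ᵐ[volume] fun x => ∑ j ∈ s, avg u ((j : ℝ) / k) *
        (Ico ((j : ℝ) / k) ((j + 1 : ℝ) / k)).indicator (box m) x := by
    intro s
    classical
    induction s using Finset.induction_on with
    | empty =>
      filter_upwards with x
      simp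
    | insert a s ha ih =>
      simp only [Finset.sum_insert ha]
      filter_upwards [ih, (hI a).coeFn_toLp, Lp.coeFn_smul (intF p ((a : ℝ) / k) ((a : ℝ) / k + 1) u) (hI a).toLp,
        Lp.coeFn_add (intF p ((a : ℝ) / k) ((a : ℝ) / k + 1) u • (hI a).toLp) ((∑ j ∈ s, (intF p ((j : ℝ) / k) ((j : ℝ) / k + 1)).smulRight (hI j).toLp : Op p) u)]
        with x h1 h2 h3 h4
      rw [← h1, ← h2, avg_eq_intF]
      refine h4.trans ?_
      rw [Pi.add_apply, h3, Pi.smul_apply, smul_eq_mul]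
  have e : 2 * ((k : ℝ)⁻¹) ^ κ * ‖B‖ * ‖u‖ = 2 * ((k : ℝ)⁻¹) ^ κ * ‖u‖ * ‖B‖ := by ring
  rw [e]
  refine Lp.norm_le_mul_norm_of_ae_le_mul ?_
  rw [_root_.sub_apply]
  filter_upwards [hsum (Finset.Icc (-((m : ℤ) * k)) ((m : ℤ) * k)), hbox.coeFn_toLp, isMul_P m (T u), hT u,
    Lp.coeFn_sub ((P p m * T) u) ((∑ j ∈ Finset.Icc (-((m : ℤ) * k)) ((m : ℤ) * k), (intF p ((j : ℝ) / k) ((j : ℝ) / k + 1)).smulRight (hI j).toLp : Op p) u)] with x h1 h2 h3 h4 h5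
  rw [h5, Pi.sub_apply, h1, mul_apply_eq_comp, h3, h4, h2]
  set i := ⌊(k : ℝ) * x⌋ with hi
  have i1 : (i : ℝ) ≤ k * x := Int.floor_le _
  have i2 : (k : ℝ) * x < i + 1 := Int.lt_floor_add_one _
  have hmem : x ∈ Ico ((i : ℝ) / k) ((i + 1 : ℝ) / k) :=
    ⟨by rw [div_le_iff₀ k0]; linarith, by rw [lt_div_iff₀ k0]; linarith⟩
  have hsing : ∑ j ∈ Finset.Icc (-((m : ℤ) * k)) ((m : ℤ) * k), avg u ((j : ℝ) / k) *
        (Ico ((j : ℝ) / k) ((j + 1 : ℝ) / k)).indicator (box m) x = avg u ((i : ℝ) / k) * box m x := by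
    rw [Finset.sum_eq_single i]
    · rw [indicator_of_mem hmem]
    · intro j _ hj
      rw [indicator_of_notMem, mul_zero]
      rintro ⟨j1, j2⟩
      apply hj
      rw [hi, eq_comm, Int.floor_eq_iff]
      rw [div_le_iff₀ k0] at j1
      rw [lt_div_iff₀ k0] at j2
      constructor <;> linarith
    · intro hni
      rw [indicator_of_mem hmem, box_of_notMem, mul_zero]
      by_contra hle
      apply hni
      have := abs_le.1 (not_lt.1 hle)
      rw [Finset.mem_Icc, hi, Int.le_floor, Int.floor_le_iff]
      push_cast
      constructor <;> nlinarith
  rw [hsing, mul_comm (box _ _), ← sub_mul, norm_mul]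
  refine mul_le_mul_of_nonneg_right ?_ (norm_nonneg _)
  refine (norm_avg_sub_le hp1 u hmem.1).trans ?_
  have h6 : x - i / k ≤ (k : ℝ)⁻¹ := by
    have := hmem.2.le
    rw [add_div] at this
    simp only [one_div] at this
    linarith
  have h7 : 0 ≤ x - i / k := sub_nonneg.2 hmem.1
  gcongr

theorem IsAvg.mul_P {T : Op p} (hT : IsAvg T) (m : ℕ+) : T * P p m = P p (m + 1) * T * P p m := by
  ext1 u
  refine Lp.ext ?_
  have h1 := hT (P p m u)
  filter_upwards [h1, isMul_P (m + 1) (T (P p m u))] with x h1 h2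
  rw [mul_apply_eq_comp, mul_assoc, mul_apply_eq_comp, mul_apply_eq_comp, h2, h1]
  rcases le_or_gt |x| ((m + 1 : ℕ+) : ℝ) with h | h
  · rw [box_of_mem h, one_mul]
  · rw [box_of_notMem h, zero_mul, avg_congr (isMul_P m u)]
    have : avg (fun y => box m y * u y) x = ∫ s in Ioc (0 : ℝ) 1, (0 : ℂ) := by
      refine setIntegral_congr_fun measurableSet_Ioc fun s hs => ?_
      simp only
      rw [box_of_notMem, zero_mul]
      push_cast at h
      rcases abs_cases x with ⟨e, _⟩ | ⟨e, _⟩ <;> rw [e] at h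
      · rw [abs_of_nonneg (by linarith [hs.1])]; linarith [hs.1]
      · exact lt_of_lt_of_le (by linarith [hs.2]) (neg_le_abs _)
    rw [this, integral_zero]

theorem isCompactOperator_avg_mul_P (hp1 : 1 < p) {T : Op p} (hT : IsAvg T) (m : ℕ+) :
    IsCompactOperator (T * P p m : Op p) := by
  rw [hT.mul_P]
  exact (isCompactOperator_P_mul_avg hp1 hT (m + 1)).comp_clm (P p m)

/-! ## Weak integrals of families in `L^2` -/

theorem inner_weak_integral {L : ℝ} {Φ : ℝ → X 2} {H : ℝ → ℝ → ℂ}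
    (hH : StronglyMeasurable (Function.uncurry H)) (hΦ : ∀ s, Φ s =ᵐ[volume] H s) {C : ℝ}
    (hC : ∀ s, ‖Φ s‖ ≤ C) {w : X 2} (hw : w =ᵐ[volume] fun x => ∫ s in Ioc (0 : ℝ) L, H s x) (g : X 2) :
    inner ℂ g w = ∫ s in Ioc (0 : ℝ) L, inner ℂ g (Φ s) := by
  have hg := Lp.stronglyMeasurable g
  have hm : StronglyMeasurable fun z : ℝ × ℝ => inner ℂ (g z.2) (H z.1 z.2) :=
    (hg.comp_measurable measurable_snd).inner hH
  have e1 : ∀ s, (fun x => inner ℂ (g x) (H s x)) =ᵐ[volume] fun x => inner ℂ (g x) (Φ s x) := fun s => by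
    filter_upwards [hΦ s] with x hx
    rw [hx]
  have hint : Integrable (fun z : ℝ × ℝ => inner ℂ (g z.2) (H z.1 z.2))
      ((volume.restrict (Ioc (0 : ℝ) L)).prod volume) := by
    rw [integrable_prod_iff hm.aestronglyMeasurable]
    refine ⟨.of_forall fun s => (L2.integrable_inner g (Φ s)).congr (e1 s).symm, ?_⟩
    refine Integrable.of_bound (C := ‖g‖ * C) ?_ (.of_forall fun s => ?_)
    · exact (StronglyMeasurable.integral_prod_right (f := fun s x => ‖inner ℂ (g x) (H s x)‖)
        hm.norm).aestronglyMeasurable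
    · have h1 : ∀ u : X 2, ∃ u' : X 2, ‖u'‖ = ‖u‖ ∧ u' =ᵐ[volume] fun x => ((‖u x‖ : ℝ) : ℂ) := by
        intro u
        have hu : MemLp (fun x => ((‖u x‖ : ℝ) : ℂ)) 2 volume := (Lp.memLp u).norm.ofReal
        refine ⟨hu.toLp, ?_, hu.coeFn_toLp⟩
        rw [Lp.norm_toLp, Lp.norm_def]
        congr 1
        exact eLpNorm_congr_norm_ae (.of_forall fun x => by simp)
      obtain ⟨g', hg1, hg2⟩ := h1 g
      obtain ⟨f', hf1, hf2⟩ := h1 (Φ s)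
      have h2 : (inner ℂ g' f' : ℂ) = ((∫ x, ‖inner ℂ (g x) (H s x)‖ : ℝ) : ℂ) := by
        rw [L2.inner_def, ← integral_complex_ofReal]
        refine integral_congr_ae ?_
        filter_upwards [hg2, hf2, hΦ s] with x h3 h4 h5
        rw [h3, h4, h5]
        simp
      have h3 := norm_inner_le_norm (𝕜 := ℂ) g' f'
      rw [h2, Complex.norm_real, hg1, hf1] at h3
      exact h3.trans (by gcongr; exact hC s)
  have h4 := integral_integral_swap (f := fun s x => inner ℂ (g x) (H s x)) hint
  calc inner ℂ g w = ∫ x, inner ℂ (g x) (∫ s in Ioc (0 : ℝ) L, H s x) := by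
        rw [L2.inner_def]
        refine integral_congr_ae ?_
        filter_upwards [hw] with x hx
        rw [hx]
    _ = ∫ x, ∫ s in Ioc (0 : ℝ) L, inner ℂ (g x) (H s x) := by
        refine integral_congr_ae (.of_forall fun x => ?_)
        simp only [RCLike.inner_apply]
        rw [← integral_mul_const]
    _ = ∫ s in Ioc (0 : ℝ) L, ∫ x, inner ℂ (g x) (H s x) := h4.symm
    _ = ∫ s in Ioc (0 : ℝ) L, inner ℂ g (Φ s) := by
        refine integral_congr_ae (.of_forall fun s => ?_)
        simp only
        rw [L2.inner_def, integral_congr_ae (e1 s)]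

/-- The transform `∫_0^L e^{isx} ds` of an interval. -/
def expInt (L x : ℝ) : ℂ := ∫ s in Ioc (0 : ℝ) L, Complex.exp (Complex.I * (s * x : ℝ))

theorem inner_expInt {L : ℝ} {M : Op 2} {c : ℝ} (hM : IsMul M fun x => expInt L (c * x)) (g v : X 2) :
    inner ℂ g (M v) = ∫ s in Ioc (0 : ℝ) L, inner ℂ g (U 2 (s * c) v) := by
  refine inner_weak_integral (H := fun s x => Complex.exp (Complex.I * ((s * c) * x : ℝ)) * v x)
    ?_ (fun s => U_coeFn (s * c) v) (C := ‖v‖) (fun s => ((U 2 (s * c)).norm_map v).le) ?_ g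
  · refine StronglyMeasurable.mul (Continuous.stronglyMeasurable (by fun_prop))
      ((Lp.stronglyMeasurable v).comp_measurable measurable_snd)
  · filter_upwards [hM v] with x hx
    rw [hx, expInt, ← integral_mul_const]
    simp only [mul_assoc]

theorem inner_avg {R : Op 2} (hR : IsAvg R) (g v : X 2) :
    inner ℂ g (R v) = ∫ s in Ioc (0 : ℝ) 1, inner ℂ g (V 2 (-s) v) := by
  refine inner_weak_integral (H := fun s x => v (x + s)) ?_
    (fun s => by simpa only [sub_neg_eq_add] using V_coeFn (-s) v) (C := ‖v‖)
    (fun s => ((V 2 (-s)).norm_map v).le) (hR v) g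
  exact (Lp.stronglyMeasurable v).comp_measurable (measurable_snd.add measurable_fst)

theorem norm_expInt_le {L : ℝ} (hL : 0 ≤ L) (x : ℝ) : ‖expInt L x‖ ≤ L := by
  have := norm_setIntegral_le_of_norm_le_const (C := 1) (μ := (volume : Measure ℝ)) (s := Ioc (0 : ℝ) L)
    (f := fun s => Complex.exp (Complex.I * (s * x : ℝ))) (by simp) (fun s _ => by
      rw [mul_comm, Complex.norm_exp_ofReal_mul_I])
  simpa [expInt, hL] using this

theorem expInt_zero {L : ℝ} (hL : 0 ≤ L) : expInt L 0 = L := by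
  simp [expInt, hL]

theorem norm_exp_sub_exp_le (a b : ℝ) :
    ‖Complex.exp (Complex.I * (a : ℝ)) - Complex.exp (Complex.I * (b : ℝ))‖ ≤ |a - b| := by
  have e : Complex.exp (Complex.I * (a : ℝ)) - Complex.exp (Complex.I * (b : ℝ))
      = Complex.exp (Complex.I * (b : ℝ)) * (Complex.exp (Complex.I * ((a - b : ℝ) : ℂ)) - 1) := by
    rw [mul_sub, ← Complex.exp_add, mul_one]
    congr 2
    push_cast; ring
  rw [e, norm_mul, mul_comm Complex.I, Complex.norm_exp_ofReal_mul_I, one_mul]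
  exact Real.norm_exp_I_mul_ofReal_sub_one_le

theorem norm_expInt_sub_le {L : ℝ} (hL : 0 ≤ L) (x y : ℝ) :
    ‖expInt L x - expInt L y‖ ≤ L * (L * |x - y|) := by
  have hi : ∀ x : ℝ, Integrable (fun s : ℝ => Complex.exp (Complex.I * (s * x : ℝ)))
      (volume.restrict (Ioc (0 : ℝ) L)) := fun x =>
    (Continuous.integrableOn_Icc (by fun_prop)).mono_set Ioc_subset_Icc_self
  rw [expInt, expInt, ← integral_sub (hi x) (hi y)]
  have := norm_setIntegral_le_of_norm_le_const (C := L * |x - y|) (μ := (volume : Measure ℝ)) (s := Ioc (0 : ℝ) L)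
    (f := fun s => Complex.exp (Complex.I * (s * x : ℝ)) - Complex.exp (Complex.I * (s * y : ℝ))) (by simp) (fun s hs => by
      refine (norm_exp_sub_exp_le _ _).trans ?_
      rw [← mul_sub, abs_mul, abs_of_pos hs.1]
      gcongr
      exact hs.2)
  refine this.trans (le_of_eq ?_)
  simp [hL, mul_comm]

theorem norm_expInt_mul_le {L : ℝ} (hL : 0 ≤ L) (x : ℝ) : ‖expInt L x‖ * |x| ≤ 2 := by
  rcases eq_or_ne x 0 with rfl | hx
  · simp
  have hc : Complex.I * (x : ℂ) ≠ 0 := mul_ne_zero Complex.I_ne_zero (by exact_mod_cast hx)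
  have h1 := integral_exp_mul_complex (a := 0) (b := L) hc
  have e : expInt L x = ∫ s in (0 : ℝ)..L, Complex.exp (Complex.I * x * s) := by
    rw [intervalIntegral.integral_of_le hL, expInt]
    congr 1
    funext s
    congr 1
    push_cast; ring
  rw [e, h1, norm_div, norm_mul, Complex.norm_I, one_mul, Complex.norm_real, Real.norm_eq_abs,
    div_mul_cancel₀ _ (abs_ne_zero.2 hx)]
  refine (norm_sub_le _ _).trans ?_
  have h2 : ∀ s : ℝ, ‖Complex.exp (Complex.I * x * s)‖ = 1 := fun s => by
    have := Complex.norm_exp_ofReal_mul_I (x * s)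
    rw [← this]; congr 2; push_cast; ring
  rw [h2, h2]; norm_num

theorem continuous_expInt {L : ℝ} (hL : 0 ≤ L) : Continuous (expInt L) := by
  refine LipschitzWith.continuous (K := ⟨L * L, by positivity⟩)
    (LipschitzWith.of_dist_le_mul fun x y => ?_)
  rw [dist_eq_norm, Real.dist_eq]
  refine (norm_expInt_sub_le hL x y).trans (le_of_eq ?_)
  rw [← mul_assoc]; rfl

theorem IsAvg.isFM {R : Op 2} (hR : IsAvg R) : IsFM R fun x => expInt 1 (-x) := by
  obtain ⟨M, hM⟩ := exists_isMul (p := 2) (f := fun x => expInt 1 (2 * Real.pi * x))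
    ((continuous_expInt zero_le_one).comp (continuous_const_mul _)).aestronglyMeasurable
    (.of_forall fun x => norm_expInt_le zero_le_one _)
  have key : conj Fe R = M := by
    ext1 v
    rw [conj_apply]
    refine ext_inner_left ℂ fun g => ?_
    have e : inner ℂ g (Fe (R (Fe.symm v))) = inner ℂ (Fe.symm g) (R (Fe.symm v)) := by
      rw [← Fe.inner_map_map (Fe.symm g), Fe.apply_symm_apply]
    rw [e, inner_avg hR, inner_expInt hM]
    refine integral_congr_ae (.of_forall fun s => ?_)
    simp only
    rw [← Fe.inner_map_map (Fe.symm g), Fe.apply_symm_apply, Fe_V, Fe.apply_symm_apply]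
    congr 3
    ring
  unfold IsFM
  rw [key]
  refine hM.congr (.of_forall fun x => ?_)
  simp only
  congr 1
  ring

/-- The commutator of a Fourier multiplier with the transform of an interval is controlled by
the modulus of continuity of the symbol. -/
theorem norm_commutator_le {L c ε : ℝ} (hL : 0 ≤ L) {M : Op 2}
    (hM : IsMul M fun x => expInt L (c * x)) {R : Op 2} {f : ℝ → ℂ} (hR : IsFM R f) (hε : 0 ≤ ε)
    (hf : ∀ s : ℝ, 0 < s → s ≤ L → ∀ᵐ x, ‖f (x + s * c) - f x‖ ≤ ε) : ‖R * M - M * R‖ ≤ L * ε := by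
  refine ContinuousLinearMap.opNorm_le_bound _ (by positivity) fun v => ?_
  set w := (R * M - M * R) v with hw
  have hi : ∀ g v : X 2, Integrable (fun s => inner ℂ g (U 2 (s * c) v))
      (volume.restrict (Ioc (0 : ℝ) L)) := by
    intro g v
    refine Integrable.of_bound (C := ‖g‖ * ‖v‖) ?_ (.of_forall fun s => ?_)
    · have h1 : StronglyMeasurable (Function.uncurry fun s x : ℝ =>
          inner ℂ (g x) (Complex.exp (Complex.I * ((s * c) * x : ℝ)) * v x)) :=
        ((Lp.stronglyMeasurable g).comp_measurable measurable_snd).inner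
          (StronglyMeasurable.mul (Continuous.stronglyMeasurable (by fun_prop))
            ((Lp.stronglyMeasurable v).comp_measurable measurable_snd))
      refine (h1.integral_prod_right (ν := (volume : Measure ℝ))).aestronglyMeasurable.congr (.of_forall fun s => ?_)
      simp only
      rw [L2.inner_def]
      refine integral_congr_ae ?_
      filter_upwards [U_coeFn (s * c) v] with x hx
      rw [hx]
    · exact (norm_inner_le_norm _ _).trans (by rw [LinearIsometryEquiv.norm_map])
  have key : inner ℂ w w = ∫ s in Ioc (0 : ℝ) L, inner ℂ w (R (U 2 (s * c) v) - U 2 (s * c) (R v)) := by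
    have e1 : inner ℂ w w = inner ℂ ((ContinuousLinearMap.adjoint R) w) (M v) - inner ℂ w (M (R v)) := by
      rw [ContinuousLinearMap.adjoint_inner_left, ← inner_sub_right]; rfl
    rw [e1, inner_expInt hM, inner_expInt hM, ← integral_sub (hi _ _) (hi _ _)]
    refine integral_congr_ae (.of_forall fun s => ?_)
    simp only
    rw [ContinuousLinearMap.adjoint_inner_left, ← inner_sub_right]
  have hb : ∀ s ∈ Ioc (0 : ℝ) L, ‖R (U 2 (s * c) v) - U 2 (s * c) (R v)‖ ≤ ε * ‖v‖ := by
    rintro s ⟨s0, sL⟩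
    have h1 := (hR.U (s * c)).sub hR
    have h2 := h1.norm_le hε (hf s s0 sL)
    have h3 := (conj (U 2 (s * c)) R - R).le_of_opNorm_le h2 (U 2 (s * c) v)
    rw [_root_.sub_apply, conj_apply, LinearIsometryEquiv.symm_apply_apply,
      LinearIsometryEquiv.norm_map, norm_sub_rev] at h3
    exact h3
  have h4 := norm_setIntegral_le_of_norm_le_const (C := ‖w‖ * (ε * ‖v‖)) (μ := (volume : Measure ℝ))
    (s := Ioc (0 : ℝ) L) (f := fun s => inner ℂ w (R (U 2 (s * c) v) - U 2 (s * c) (R v))) (by simp)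
    (fun s hs => (norm_inner_le_norm _ _).trans (by gcongr; exact hb s hs))
  rw [← key, inner_self_eq_norm_sq_to_K] at h4
  have h5 : ‖((‖w‖ : ℂ)) ^ 2‖ = ‖w‖ ^ 2 := by simp
  have h6 : ‖w‖ ^ 2 ≤ ‖w‖ * (ε * ‖v‖) * L := by
    rw [← h5]
    refine h4.trans (le_of_eq ?_)
    simp [hL]
  rcases (norm_nonneg w).eq_or_lt with h0 | h0
  · rw [← h0]; positivity
  · have : ‖w‖ * ‖w‖ ≤ ‖w‖ * (L * ε * ‖v‖) := by nlinarith
    exact le_of_mul_le_mul_left this h0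

/-! ## Small oscillation -/

/-- The essential oscillation of `f` on `S` is at most `ε`. -/
def PairOsc (f : ℝ → ℂ) (S : Set ℝ) (ε : ℝ) : Prop :=
  ∀ᵐ x, x ∈ S → ∀ᵐ y, y ∈ S → ‖f x - f y‖ ≤ ε

theorem PairOsc.mono {f : ℝ → ℂ} {S S' : Set ℝ} {ε : ℝ} (h : PairOsc f S ε) (hS : S' ⊆ S) :
    PairOsc f S' ε := by
  filter_upwards [h] with x hx hxS
  filter_upwards [hx (hS hxS)] with y hy hyS
  exact hy (hS hyS)

theorem PairOsc.congr {f g : ℝ → ℂ} {S : Set ℝ} {ε : ℝ} (h : PairOsc f S ε) (hfg : f =ᵐ[volume] g) :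
    PairOsc g S ε := by
  filter_upwards [h, hfg] with x hx hx' hxS
  filter_upwards [hx hxS, hfg] with y hy hy' hyS
  rw [← hx', ← hy']
  exact hy hyS

theorem pairOsc_of_osc_le {f : ℝ → ℂ} {I : Set ℝ} (hI : MeasurableSet I) {ε : ℝ} (hε : 0 ≤ ε)
    (h : osc f I ≤ ENNReal.ofReal ε) : PairOsc f I ε := by
  have h1 := Measure.ae_ae_of_ae_prod (ENNReal.ae_le_essSup (μ := (volume.restrict I).prod (volume.restrict I))
    fun q : ℝ × ℝ => ‖f q.1 - f q.2‖ₑ)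
  rw [ae_restrict_iff' hI] at h1
  filter_upwards [h1] with x hx hxI
  have h2 := hx hxI
  rw [ae_restrict_iff' hI] at h2
  filter_upwards [h2] with y hy hyI
  have h3 := (hy hyI).trans h
  rwa [← ofReal_norm, ENNReal.ofReal_le_ofReal_iff hε] at h3

theorem PairOsc.exists_const {f : ℝ → ℂ} {S : Set ℝ} {ε : ℝ} (h : PairOsc f S ε) :
    ∃ c, ∀ᵐ x, x ∈ S → ‖f x - c‖ ≤ ε := by
  by_cases h0 : volume S = 0
  · exact ⟨0, by filter_upwards [measure_eq_zero_iff_ae_notMem.1 h0] with x hx hxS using absurd hxS hx⟩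
  · obtain ⟨x, hxS, hx⟩ : ∃ x ∈ S, ∀ᵐ y, y ∈ S → ‖f x - f y‖ ≤ ε := by
      by_contra hcon
      apply h0
      rw [measure_eq_zero_iff_ae_notMem]
      filter_upwards [h] with x hx hxS
      exact hcon ⟨x, hxS, hx hxS⟩
    refine ⟨f x, ?_⟩
    filter_upwards [hx] with y hy hyS
    rw [norm_sub_rev]
    exact hy hyS

/-- The functions whose oscillation on the sets `S i` tends to zero. -/
def SmallOsc {ι : Type*} (l : Filter ι) (S : ι → Set ℝ) : Set Linf :=
  {a | ∀ ε : ℝ, 0 < ε → ∀ᶠ i in l, PairOsc a (S i) ε}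

theorem isClosedAlgebra_smallOsc {ι : Type*} (l : Filter ι) (S : ι → Set ℝ) :
    IsClosedAlgebra (SmallOsc l S) where
  zero_mem ε hε := by
    refine .of_forall fun i => ?_
    have h0 := Lp.coeFn_zero ℂ ∞ (volume : Measure ℝ)
    filter_upwards [h0] with x hx _
    filter_upwards [h0] with y hy _
    rw [hx, hy]; simpa using hε.le
  add_mem a ha b hb ε hε := by
    filter_upwards [ha (ε / 2) (by positivity), hb (ε / 2) (by positivity)] with i h1 h2
    filter_upwards [h1, h2, Lp.coeFn_add a b] with x h3 h4 h5 hxS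
    filter_upwards [h3 hxS, h4 hxS, Lp.coeFn_add a b] with y h6 h7 h8 hyS
    rw [h5, h8, Pi.add_apply, Pi.add_apply, add_sub_add_comm]
    exact (norm_add_le _ _).trans (by linarith [h6 hyS, h7 hyS])
  smul_mem c a ha ε hε := by
    filter_upwards [ha (ε / (‖c‖ + 1)) (by positivity)] with i h1
    filter_upwards [h1, Lp.coeFn_smul c a] with x h3 h5 hxS
    filter_upwards [h3 hxS, Lp.coeFn_smul c a] with y h6 h8 hyS
    rw [h5, h8, Pi.smul_apply, Pi.smul_apply, ← smul_sub, norm_smul]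
    have h9 := h6 hyS
    rw [le_div_iff₀ (by positivity)] at h9
    nlinarith [norm_nonneg (a x - a y)]
  mul_mem a ha b hb ε hε := by
    filter_upwards [ha (ε / (2 * (‖b‖ + 1))) (by positivity), hb (ε / (2 * (‖a‖ + 1))) (by positivity)]
      with i h1 h2
    filter_upwards [h1, h2, Lp.coeFn_lpSMul a b (r := ∞), ae_norm_le_norm b] with x h3 h4 h5 hbx hxS
    filter_upwards [h3 hxS, h4 hxS, Lp.coeFn_lpSMul a b (r := ∞), ae_norm_le_norm a] with y h6 h7 h8 hay hyS
    rw [h5, h8, Pi.smul_apply', Pi.smul_apply', smul_eq_mul, smul_eq_mul]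
    have e : a x * b x - a y * b y = (a x - a y) * b x + a y * (b x - b y) := by ring
    rw [e]
    refine (norm_add_le _ _).trans ?_
    rw [norm_mul, norm_mul]
    have i1 : ‖a x - a y‖ * ‖b x‖ ≤ ε / (2 * (‖b‖ + 1)) * (‖b‖ + 1) :=
      mul_le_mul (h6 hyS) (by linarith) (norm_nonneg _) (by positivity)
    have i2 : ‖a y‖ * ‖b x - b y‖ ≤ (‖a‖ + 1) * (ε / (2 * (‖a‖ + 1))) :=
      mul_le_mul (by linarith) (h7 hyS) (norm_nonneg _) (by positivity)
    have e1 : ε / (2 * (‖b‖ + 1)) * (‖b‖ + 1) = ε / 2 := by field_simp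
    have e2 : (‖a‖ + 1) * (ε / (2 * (‖a‖ + 1))) = ε / 2 := by field_simp
    linarith
  isClosed := by
    refine isClosed_of_closure_subset fun a ha ε hε => ?_
    obtain ⟨b, hb, hab⟩ := Metric.mem_closure_iff.1 ha (ε / 3) (by positivity)
    rw [dist_eq_norm] at hab
    have h0 : ∀ᵐ x, ‖a x - b x‖ ≤ ε / 3 := by
      filter_upwards [ae_norm_le_norm (a - b), Lp.coeFn_sub a b] with x h1 h2
      rw [h2, Pi.sub_apply] at h1
      linarith
    filter_upwards [hb (ε / 3) (by positivity)] with i h1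
    filter_upwards [h1, h0] with x h3 h5 hxS
    filter_upwards [h3 hxS, h0] with y h6 h8 hyS
    have e : a x - a y = (a x - b x) + (b x - b y) - (a y - b y) := by ring
    rw [e]
    exact (norm_sub_le _ _).trans (by linarith [norm_add_le (a x - b x) (b x - b y), h6 hyS])

theorem closedAlg_subset {G S : Set Linf} (h : G ⊆ S) (hS : IsClosedAlgebra S) : closedAlg G ⊆ S :=
  sInter_subset_of_mem ⟨h, hS⟩

theorem smallOsc_of_tendsto {ι : Type*} {l : Filter ι} {S : ι → Set ℝ} {L : Filter ℝ}
    (hS : Tendsto S l L.smallSets) {a : Linf} {f : ℝ → ℂ} (haf : a =ᵐ[volume] f) {c : ℂ}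
    (hf : Tendsto f L (𝓝 c)) : a ∈ SmallOsc l S := fun ε hε => by
  have h1 : {x | ‖f x - c‖ < ε / 2} ∈ L := by
    have := hf (Metric.ball_mem_nhds c (half_pos hε))
    filter_upwards [this] with x hx
    simpa [dist_eq_norm] using hx
  filter_upwards [hS.eventually (eventually_smallSets_subset.2 h1)] with i hi
  refine PairOsc.congr (.of_forall fun x hx => .of_forall fun y hy => ?_) haf.symm
  have hx' : ‖f x - c‖ < ε / 2 := hi hx
  have hy' : ‖f y - c‖ < ε / 2 := hi hy
  have e : f x - f y = (f x - c) - (f y - c) := by ring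
  rw [e]
  exact (norm_sub_le _ _).trans (by linarith)

/-- The sets `S i` approach the point `s` along `L`, at a scale on which slowly oscillating
functions become constant. -/
structure IsApproach {ι : Type*} (s : OnePoint ℝ) (L : Filter ℝ) (l : Filter ι) (S : ι → Set ℝ) : Prop where
  tendsto_coe : Tendsto (fun x : ℝ => (x : OnePoint ℝ)) L (𝓝 s)
  small : Tendsto S l L.smallSets
  slow : ∀ f : ℝ → ℂ, SlowlyOscillating f s → ∀ ε : ℝ, 0 < ε → ∀ᶠ i in l, PairOsc f (S i) ε

theorem IsApproach.tendsto_of_continuousOn {ι : Type*} {s lam : OnePoint ℝ} {L : Filter ℝ} {l : Filter ι}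
    {S : ι → Set ℝ} (h : IsApproach s L l S) (hs : s ≠ lam) {f : OnePoint ℝ → ℂ}
    (hf : ContinuousOn f {lam}ᶜ) : Tendsto (fun x : ℝ => f x) L (𝓝 (f s)) :=
  (hf.continuousAt (isOpen_compl_singleton.mem_nhds hs)).tendsto.comp h.tendsto_coe

theorem IsApproach.PCat_subset {ι : Type*} {s lam : OnePoint ℝ} {L : Filter ℝ} {l : Filter ι}
    {S : ι → Set ℝ} (h : IsApproach s L l S)
    (hL : s = lam → L ≤ leftFilter s ∨ L ≤ rightFilter s) : PCat lam ⊆ SmallOsc l S := by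
  rintro a ⟨f, haf, hf, ⟨c, hc⟩, ⟨d, hd⟩⟩
  by_cases hs : s = lam
  · rw [← hs] at hc hd
    rcases hL hs with h1 | h1
    · exact smallOsc_of_tendsto h.small haf (hc.mono_left h1)
    · exact smallOsc_of_tendsto h.small haf (hd.mono_left h1)
  · exact smallOsc_of_tendsto h.small haf (h.tendsto_of_continuousOn hs hf)

theorem IsApproach.SOat_subset {ι : Type*} {s lam : OnePoint ℝ} {L : Filter ℝ} {l : Filter ι}
    {S : ι → Set ℝ} (h : IsApproach s L l S) : SOat lam ⊆ SmallOsc l S := by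
  rintro a ⟨⟨f, haf, hf⟩, hslow⟩
  by_cases hs : s = lam
  · rw [← hs] at hslow
    exact h.slow _ hslow
  · exact smallOsc_of_tendsto h.small haf (h.tendsto_of_continuousOn hs hf)

theorem IsApproach.SO_subset {ι : Type*} {s : OnePoint ℝ} {L : Filter ℝ} {l : Filter ι}
    {S : ι → Set ℝ} (h : IsApproach s L l S) : SO ⊆ SmallOsc l S :=
  closedAlg_subset (iUnion_subset fun _ => h.SOat_subset) (isClosedAlgebra_smallOsc l S)

theorem slow_subset {f : ℝ → ℂ} {ι : Type*} {l : Filter ι} {I S : ι → Set ℝ}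
    (hI : ∀ i, MeasurableSet (I i)) (hS : ∀ᶠ i in l, S i ⊆ I i)
    (h : Tendsto (fun i => osc f (I i)) l (𝓝 0)) {ε : ℝ} (hε : 0 < ε) :
    ∀ᶠ i in l, PairOsc f (S i) ε := by
  filter_upwards [hS, h.eventually_le_const (ENNReal.ofReal_pos.2 hε)] with i h1 h2
  exact (pairOsc_of_osc_le (hI i) hε.le h2).mono h1

theorem measurableSet_annulus (r x : ℝ) : MeasurableSet (Icc (-x) (-(r * x)) ∪ Icc (r * x) x) :=
  measurableSet_Icc.union measurableSet_Icc

theorem measurableSet_annulus_image (t r x : ℝ) :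
    MeasurableSet ((fun y => t + y) '' (Icc (-x) (-(r * x)) ∪ Icc (r * x) x)) :=
  (MeasurableEquiv.addLeft t).measurableSet_image.2 (measurableSet_annulus r x)

theorem coe_tendsto_infty : Tendsto (fun x : ℝ => (x : OnePoint ℝ)) (cocompact ℝ) (𝓝 OnePoint.infty) := by
  rw [← Filter.coclosedCompact_eq_cocompact]
  exact OnePoint.tendsto_coe_infty

theorem approach_atTop {R : ℝ} (hR : 1 < R) :
    IsApproach OnePoint.infty atTop atTop fun y : ℝ => Icc (y / R) y where
  tendsto_coe := coe_tendsto_infty.mono_left atTop_le_cocompact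
  small := by
    rw [tendsto_smallSets_iff]
    intro t ht
    obtain ⟨N, hN⟩ := mem_atTop_sets.1 ht
    filter_upwards [eventually_ge_atTop (R * N)] with y hy x hx
    refine hN x (le_trans ?_ hx.1)
    rw [le_div_iff₀ (by linarith)]; linarith
  slow f hf ε hε := by
    have hr : R⁻¹ ∈ Ioo (0 : ℝ) 1 := ⟨by positivity, inv_lt_one_of_one_lt₀ hR⟩
    refine slow_subset (measurableSet_annulus _) (.of_forall fun y => ?_) (hf _ hr) hε
    rw [div_eq_inv_mul]
    exact subset_union_right

theorem approach_atBot {R : ℝ} (hR : 1 < R) :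
    IsApproach OnePoint.infty atBot atTop fun y : ℝ => Icc (-y) (-(y / R)) where
  tendsto_coe := coe_tendsto_infty.mono_left atBot_le_cocompact
  small := by
    rw [tendsto_smallSets_iff]
    intro t ht
    obtain ⟨N, hN⟩ := mem_atBot_sets.1 ht
    filter_upwards [eventually_ge_atTop (R * -N)] with y hy x hx
    refine hN x (hx.2.trans ?_)
    rw [neg_le, le_div_iff₀ (by linarith)]; linarith
  slow f hf ε hε := by
    have hr : R⁻¹ ∈ Ioo (0 : ℝ) 1 := ⟨by positivity, inv_lt_one_of_one_lt₀ hR⟩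
    refine slow_subset (measurableSet_annulus _) (.of_forall fun y => ?_) (hf _ hr) hε
    rw [div_eq_inv_mul]
    exact subset_union_left

theorem approach_right (t : ℝ) {R : ℝ} (hR : 1 < R) :
    IsApproach (t : OnePoint ℝ) (𝓝[>] t) (𝓝[>] 0) fun y : ℝ => Icc (t + y / R) (t + y) where
  tendsto_coe := (OnePoint.continuous_coe.tendsto t).mono_left nhdsWithin_le_nhds
  small := by
    rw [tendsto_smallSets_iff]
    intro u hu
    obtain ⟨v, hv, hvu⟩ := (mem_nhdsGT_iff_exists_Ioo_subset).1 hu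
    have h0 : Ioo (0 : ℝ) (v - t) ∈ 𝓝[>] (0 : ℝ) := Ioo_mem_nhdsGT (sub_pos.2 hv)
    filter_upwards [h0] with y hy x hx
    refine hvu ⟨?_, ?_⟩
    · have : 0 < y / R := div_pos hy.1 (by linarith)
      linarith [hx.1]
    · linarith [hx.2, hy.2]
  slow f hf ε hε := by
    have hr : R⁻¹ ∈ Ioo (0 : ℝ) 1 := ⟨by positivity, inv_lt_one_of_one_lt₀ hR⟩
    refine slow_subset (measurableSet_annulus_image t _) (.of_forall fun y => ?_) (hf _ hr) hε
    rw [div_eq_inv_mul]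
    intro x hx
    exact ⟨x - t, Or.inr ⟨by linarith [hx.1], by linarith [hx.2]⟩, by ring⟩

theorem approach_left (t : ℝ) {R : ℝ} (hR : 1 < R) :
    IsApproach (t : OnePoint ℝ) (𝓝[<] t) (𝓝[>] 0) fun y : ℝ => Icc (t - y) (t - y / R) where
  tendsto_coe := (OnePoint.continuous_coe.tendsto t).mono_left nhdsWithin_le_nhds
  small := by
    rw [tendsto_smallSets_iff]
    intro u hu
    obtain ⟨v, hv, hvu⟩ := (mem_nhdsLT_iff_exists_Ioo_subset).1 hu
    have h0 : Ioo (0 : ℝ) (t - v) ∈ 𝓝[>] (0 : ℝ) := Ioo_mem_nhdsGT (sub_pos.2 hv)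
    filter_upwards [h0] with y hy x hx
    refine hvu ⟨?_, ?_⟩
    · linarith [hx.1, hy.2]
    · have : 0 < y / R := div_pos hy.1 (by linarith)
      linarith [hx.2]
  slow f hf ε hε := by
    have hr : R⁻¹ ∈ Ioo (0 : ℝ) 1 := ⟨by positivity, inv_lt_one_of_one_lt₀ hR⟩
    refine slow_subset (measurableSet_annulus_image t _) (.of_forall fun y => ?_) (hf _ hr) hε
    rw [div_eq_inv_mul]
    intro x hx
    exact ⟨x - t, Or.inl ⟨by linarith [hx.1], by linarith [hx.2]⟩, by ring⟩

theorem approach_punctured (t : ℝ) {R : ℝ} (hR : 1 < R) :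
    IsApproach (t : OnePoint ℝ) (𝓝[≠] t) (𝓝[>] 0)
      fun y : ℝ => Icc (t - y) (t - y / R) ∪ Icc (t + y / R) (t + y) where
  tendsto_coe := (OnePoint.continuous_coe.tendsto t).mono_left nhdsWithin_le_nhds
  small := by
    rw [tendsto_smallSets_iff]
    intro u hu
    rw [← nhdsLT_sup_nhdsGT, mem_sup] at hu
    filter_upwards [(tendsto_smallSets_iff.1 (approach_left t hR).small) u hu.1,
      (tendsto_smallSets_iff.1 (approach_right t hR).small) u hu.2] with y h1 h2
    exact union_subset h1 h2
  slow f hf ε hε := by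
    have hr : R⁻¹ ∈ Ioo (0 : ℝ) 1 := ⟨by positivity, inv_lt_one_of_one_lt₀ hR⟩
    refine slow_subset (measurableSet_annulus_image t _) (.of_forall fun y => ?_) (hf _ hr) hε
    rw [div_eq_inv_mul]
    rintro x (hx | hx)
    · exact ⟨x - t, Or.inl ⟨by linarith [hx.1], by linarith [hx.2]⟩, by ring⟩
    · exact ⟨x - t, Or.inr ⟨by linarith [hx.1], by linarith [hx.2]⟩, by ring⟩

theorem approach_far : IsApproach OnePoint.infty (cocompact ℝ) ((𝓝[>] (0 : ℝ)) ×ˢ cocompact ℝ)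
    fun z : ℝ × ℝ => Icc (z.2 - z.1) (z.2 + z.1) where
  tendsto_coe := coe_tendsto_infty
  small := by
    rw [tendsto_smallSets_iff]
    intro u hu
    obtain ⟨r, hr⟩ := (Metric.hasBasis_cobounded_compl_closedBall (0 : ℝ)).mem_iff.1
      (by rwa [Metric.cobounded_eq_cocompact])
    have h0 : Ioo (0 : ℝ) 1 ∈ 𝓝[>] (0 : ℝ) := Ioo_mem_nhdsGT one_pos
    have h1 := (tendsto_norm_cocompact_atTop (E := ℝ)).eventually_gt_atTop (r + 1)
    filter_upwards [prod_mem_prod h0 h1] with z hz x hx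
    refine hr.2 ?_
    have hz2 : r + 1 < |z.2| := hz.2
    have hz1 := hz.1.2
    simp only [mem_compl_iff, Metric.mem_closedBall, dist_zero_right, not_le, Real.norm_eq_abs]
    have h3 := abs_sub_abs_le_abs_sub z.2 x
    have h4 : |z.2 - x| ≤ z.1 := abs_le.2 ⟨by linarith [hx.2], by linarith [hx.1]⟩
    linarith
  slow f hf ε hε := by
    have h0 : Ioo (0 : ℝ) 1 ∈ 𝓝[>] (0 : ℝ) := Ioo_mem_nhdsGT one_pos
    have h1 := (tendsto_norm_cocompact_atTop (E := ℝ)).eventually_gt_atTop 2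
    have h2 : Tendsto (fun z : ℝ × ℝ => 2 * ‖z.2‖) ((𝓝[>] (0 : ℝ)) ×ˢ cocompact ℝ) atTop :=
      (tendsto_norm_cocompact_atTop.comp tendsto_snd).const_mul_atTop two_pos
    refine slow_subset (fun z => measurableSet_annulus (1 / 4) (2 * ‖z.2‖)) ?_
      ((hf (1 / 4) (by norm_num)).comp h2) hε
    filter_upwards [prod_mem_prod h0 h1] with z hz x hx
    have hz1 := hz.1.2
    have hz2 : 2 < |z.2| := hz.2
    rw [Real.norm_eq_abs]
    rcases abs_cases z.2 with ⟨e, _⟩ | ⟨e, _⟩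
    · right; constructor <;> linarith [hx.1, hx.2]
    · left; constructor <;> linarith [hx.1, hx.2]

/-! ## Multipliers and symbols -/

theorem mem_smallOsc_of_multiplication {ι : Type*} {L : Filter ℝ} {l : Filter ι} {S : ι → Set ℝ}
    (h : IsApproach OnePoint.infty L l S) (hL : L = atTop ∨ L = atBot) {a : Linf}
    (ha : a ∈ closedAlg (PC ∪ SO ∪ Linf0)) : a ∈ SmallOsc l S := by
  have hA := isClosedAlgebra_smallOsc l S
  have hL' : L ≤ leftFilter OnePoint.infty ∨ L ≤ rightFilter OnePoint.infty := by
    rcases hL with rfl | rfl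
    · exact Or.inl le_rfl
    · exact Or.inr le_rfl
  have hc : L ≤ cocompact ℝ := by
    rcases hL with rfl | rfl
    · exact atTop_le_cocompact
    · exact atBot_le_cocompact
  refine closedAlg_subset (union_subset (union_subset ?_ h.SO_subset) ?_) hA ha
  · exact closedAlg_subset (iUnion_subset fun lam => h.PCat_subset fun _ => hL') hA
  · intro a ha ε hε
    obtain ⟨N, hN⟩ := ha (ε / 2) (by positivity)
    have h1 := ((tendsto_norm_cocompact_atTop (E := ℝ)).eventually_gt_atTop N).filter_mono hc
    filter_upwards [h.small.eventually (eventually_smallSets_subset.2 h1)] with i hi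
    filter_upwards [hN] with x hx hxS
    filter_upwards [hN] with y hy hyS
    exact (norm_sub_le _ _).trans (by linarith [hx (hi hxS), hy (hi hyS)])

/-- The symbols whose oscillation vanishes at every point of `OnePoint ℝ`, on the relevant scale;
only at `lam` the two sides are not compared. -/
structure IsSymbol (lam : ℝ) (b : Linf) : Prop where
  right : ∀ t R : ℝ, 1 < R → b ∈ SmallOsc (𝓝[>] 0) fun y : ℝ => Icc (t + y / R) (t + y)
  left : ∀ t R : ℝ, 1 < R → b ∈ SmallOsc (𝓝[>] 0) fun y : ℝ => Icc (t - y) (t - y / R)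
  punctured : ∀ t R : ℝ, t ≠ lam → 1 < R →
    b ∈ SmallOsc (𝓝[>] 0) fun y : ℝ => Icc (t - y) (t - y / R) ∪ Icc (t + y / R) (t + y)
  far : b ∈ SmallOsc ((𝓝[>] (0 : ℝ)) ×ˢ cocompact ℝ) fun z : ℝ × ℝ => Icc (z.2 - z.1) (z.2 + z.1)

theorem BUC_subset {ι : Type*} {t : ℝ} {L : Filter ℝ} {l : Filter ι} {S : ι → Set ℝ}
    (h : IsApproach (t : OnePoint ℝ) L l S) (hL : L ≤ 𝓝 t) : BUC ⊆ SmallOsc l S := by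
  rintro a ⟨f, haf, hf⟩
  exact smallOsc_of_tendsto h.small haf ((hf.continuous.tendsto t).mono_left hL)

theorem isSymbol_of_mem {lam : ℝ} {b : Linf}
    (hb : b ∈ closedAlg (PCat (lam : OnePoint ℝ) ∪ SO ∪ BUC)) : IsSymbol lam b where
  right t R hR := by
    have h := approach_right t hR
    refine closedAlg_subset (union_subset (union_subset ?_ h.SO_subset)
      (BUC_subset h nhdsWithin_le_nhds)) (isClosedAlgebra_smallOsc _ _) hb
    exact h.PCat_subset fun _ => Or.inr le_rfl
  left t R hR := by
    have h := approach_left t hR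
    refine closedAlg_subset (union_subset (union_subset ?_ h.SO_subset)
      (BUC_subset h nhdsWithin_le_nhds)) (isClosedAlgebra_smallOsc _ _) hb
    exact h.PCat_subset fun _ => Or.inl le_rfl
  punctured t R ht hR := by
    have h := approach_punctured t hR
    refine closedAlg_subset (union_subset (union_subset ?_ h.SO_subset)
      (BUC_subset h nhdsWithin_le_nhds)) (isClosedAlgebra_smallOsc _ _) hb
    exact h.PCat_subset fun e => absurd (OnePoint.coe_injective e) ht
  far := by
    have h := approach_far
    refine closedAlg_subset (union_subset (union_subset ?_ h.SO_subset) ?_)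
      (isClosedAlgebra_smallOsc _ _) hb
    · exact h.PCat_subset fun e => absurd e (OnePoint.infty_ne_coe lam)
    · rintro a ⟨f, haf, hf⟩ ε hε
      obtain ⟨δ, hδ, hfδ⟩ := Metric.uniformContinuous_iff.1 hf ε hε
      have h0 : Ioo (0 : ℝ) (δ / 2) ∈ 𝓝[>] (0 : ℝ) := Ioo_mem_nhdsGT (half_pos hδ)
      filter_upwards [prod_mem_prod h0 univ_mem] with z hz
      refine PairOsc.congr (.of_forall fun x hx => .of_forall fun y hy => ?_) haf.symm
      rw [← dist_eq_norm]
      refine (hfδ ?_).le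
      have := hz.1.2
      rw [Real.dist_eq, abs_lt]
      constructor <;> linarith [hx.1, hx.2, hy.1, hy.2]

/-- Away from finitely many points, the oscillation on small intervals is small. -/
theorem IsSymbol.exists_finset {lam : ℝ} {b : Linf} (hb : IsSymbol lam b) {ε : ℝ} (hε : 0 < ε) :
    ∃ F : Finset ℝ, ∃ δ : ℝ, 0 < δ ∧ ∀ ξ : ℝ, ξ ∉ F →
      ∃ r : ℝ, 0 < r ∧ (∀ σ : ℝ, 0 < σ → σ < δ → (∀ τ ∈ F, 2 * σ ≤ |ξ - τ|) → σ < r) ∧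
        PairOsc b (Ioo (ξ - r) (ξ + r)) ε := by
  obtain ⟨U, hU, W, hW, hUW⟩ := mem_prod_iff.1 (hb.far ε hε)
  obtain ⟨δ₀, hδ₀, hU⟩ := (mem_nhdsGT_iff_exists_Ioo_subset).1 hU
  obtain ⟨N, -, hN⟩ := (Metric.hasBasis_cobounded_compl_closedBall (0 : ℝ)).mem_iff.1
      (by rwa [Metric.cobounded_eq_cocompact])
  have h1 : ∀ t : ℝ, ∃ η : ℝ, 0 < η ∧ ∀ y, 0 < y → y < η →
      PairOsc b (Icc (t + y / 8) (t + y)) ε ∧ PairOsc b (Icc (t - y) (t - y / 8)) ε := by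
    intro t
    obtain ⟨η, hη, h⟩ := (mem_nhdsGT_iff_exists_Ioo_subset).1
      ((hb.right t 8 (by norm_num) ε hε).and (hb.left t 8 (by norm_num) ε hε))
    exact ⟨η, hη, fun y h1 h2 => h ⟨h1, h2⟩⟩
  choose η η0 hη using h1
  obtain ⟨F, -, hF⟩ := (isCompact_closedBall (0 : ℝ) N).elim_nhds_subcover
    (fun t => Metric.ball t (η t / 2)) fun t _ => Metric.ball_mem_nhds t (half_pos (η0 t))
  have hδ₀' : 0 < δ₀ := hδ₀
  refine ⟨F, δ₀ / 2, half_pos hδ₀', fun ξ hξ => ?_⟩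
  by_cases hξN : ξ ∈ Metric.closedBall (0 : ℝ) N
  · obtain ⟨τ, hτ, hξτ⟩ := mem_iUnion₂.1 (hF hξN)
    rw [Metric.mem_ball, Real.dist_eq] at hξτ
    have hne : ξ ≠ τ := fun e => hξ (e ▸ hτ)
    have hd : 0 < |ξ - τ| := abs_pos.2 (sub_ne_zero.2 hne)
    refine ⟨3 / 4 * |ξ - τ|, by positivity, fun σ s0 _ hσ => ?_, ?_⟩
    · linarith [hσ τ hτ]
    · obtain ⟨h2, h3⟩ := hη τ (2 * |ξ - τ|) (by positivity) (by linarith)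
      rcases abs_cases (ξ - τ) with ⟨e, _⟩ | ⟨e, _⟩ <;> rw [e] at h2 h3 hd ⊢
      · refine h2.mono fun x hx => ⟨?_, ?_⟩ <;> linarith [hx.1, hx.2]
      · refine h3.mono fun x hx => ⟨?_, ?_⟩ <;> linarith [hx.1, hx.2]
  · refine ⟨δ₀ / 2, half_pos hδ₀', fun σ _ h _ => h, ?_⟩
    have h2 : (δ₀ / 2, ξ) ∈ U ×ˢ W := ⟨hU ⟨half_pos hδ₀', by simpa using hδ₀'⟩, hN hξN⟩
    exact PairOsc.mono (hUW h2) Ioo_subset_Icc_self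

/-- Away from finitely many points, small translations move the symbol only little. -/
theorem IsSymbol.translate {lam : ℝ} {b : Linf} (hb : IsSymbol lam b) {ε : ℝ} (hε : 0 < ε) :
    ∃ F : Finset ℝ, ∃ δ : ℝ, 0 < δ ∧ ∀ σ : ℝ, 0 < σ → σ < δ →
      ∀ᵐ ξ, (∀ τ ∈ F, 2 * σ ≤ |ξ - τ|) → ‖b (ξ + σ) - b ξ‖ ≤ ε := by
  obtain ⟨F, δ, hδ, h⟩ := hb.exists_finset (half_pos hε)
  refine ⟨F, δ, hδ, fun σ s0 hσ => ?_⟩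
  refine measure_null_of_locally_null _ fun ξ hξ => ?_
  simp only [mem_compl_iff, mem_ofPred_eq, Classical.not_imp] at hξ
  have hξF : ξ ∉ F := fun hm => by
    have := hξ.1 ξ hm
    simp only [sub_self, abs_zero] at this
    linarith
  obtain ⟨r, r0, hr, hosc⟩ := h ξ hξF
  have hσr := hr σ s0 hσ hξ.1
  obtain ⟨c, hc⟩ := hosc.exists_const
  refine ⟨_, inter_mem_nhdsWithin _ (Ioo_mem_nhds (a := ξ - (r - σ)) (b := ξ + (r - σ)) (by linarith) (by linarith)), ?_⟩
  have hq := (measurePreserving_add_right (volume : Measure ℝ) σ).quasiMeasurePreserving.ae hc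
  have : ∀ᵐ x, x ∈ Ioo (ξ - (r - σ)) (ξ + (r - σ)) → ‖b (x + σ) - b x‖ ≤ ε := by
    filter_upwards [hc, hq] with x h1 h2 hx
    have h3 := h1 ⟨by linarith [hx.1], by linarith [hx.2]⟩
    have h4 := h2 ⟨by linarith [hx.1], by linarith [hx.2]⟩
    have e : b (x + σ) - b x = (b (x + σ) - c) - (b x - c) := by ring
    rw [e]
    exact (norm_sub_le _ _).trans (by linarith)
  refine measure_mono_null ?_ this
  rintro x ⟨hx1, hx2⟩
  simp only [mem_compl_iff, mem_ofPred_eq, Classical.not_imp] at hx1 ⊢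
  exact ⟨hx2, hx1.2⟩

/-- A symbol is essentially continuous off a countable set. -/
theorem IsSymbol.exists_countable {lam : ℝ} {b : Linf} (hb : IsSymbol lam b) :
    ∃ D : Set ℝ, D.Countable ∧ ∀ t ∉ D, ∀ ε : ℝ, 0 < ε →
      ∃ r : ℝ, 0 < r ∧ PairOsc b (Ioo (t - r) (t + r)) ε := by
  choose F δ hδ h using fun k : ℕ => hb.exists_finset (ε := 1 / ((k : ℝ) + 1)) (by positivity)
  refine ⟨⋃ k, (F k : Set ℝ), countable_iUnion fun k => (F k).countable_toSet, fun t ht ε hε => ?_⟩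
  obtain ⟨k, hk⟩ := exists_nat_one_div_lt hε
  obtain ⟨r, r0, -, hr⟩ := h k t fun hm => ht (mem_iUnion.2 ⟨k, hm⟩)
  refine ⟨r, r0, ?_⟩
  filter_upwards [hr] with x hx hxS
  filter_upwards [hx hxS] with y hy hyS
  exact (hy hyS).trans hk.le

/-! ## Limits of rescaled functions -/

/-- The function which is `c` on `(0, ∞)` and `d` on `(-∞, 0]`. -/
def step (c d : ℂ) (x : ℝ) : ℂ := if 0 < x then c else d

theorem stronglyMeasurable_step (c d : ℂ) : StronglyMeasurable (step c d) :=
  StronglyMeasurable.ite (measurableSet_lt measurable_const measurable_id)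
    stronglyMeasurable_const stronglyMeasurable_const

theorem norm_step_le (c d : ℂ) (x : ℝ) : ‖step c d x‖ ≤ max ‖c‖ ‖d‖ := by
  unfold step
  split_ifs
  · exact le_max_left _ _
  · exact le_max_right _ _

/-- The functions `f n` converge to `step c d`, uniformly away from `0` and `∞`. -/
def SymLim (f : ℕ+ → ℝ → ℂ) (c d : ℂ) : Prop :=
  ∀ ε : ℝ, 0 < ε → ∀ R : ℝ, 1 < R → ∀ᶠ n in atTop, ∀ᵐ x,
    (x ∈ Icc (1 / R) R → ‖f n x - c‖ ≤ ε) ∧ (x ∈ Icc (-R) (-(1 / R)) → ‖f n x - d‖ ≤ ε)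

theorem SymLim.ae_tendsto {f : ℕ+ → ℝ → ℂ} {c d : ℂ} (h : SymLim f c d) :
    ∀ᵐ x, Tendsto (fun n => f n x - step c d x) atTop (𝓝 0) := by
  have h1 := fun k : ℕ => eventually_atTop.1
    (h (1 / ((k : ℝ) + 1)) (by positivity) ((k : ℝ) + 2) (by linarith [(Nat.cast_nonneg k : (0 : ℝ) ≤ k)]))
  choose N hN using h1
  have h2 : ∀ᵐ x, ∀ k : ℕ, ∀ n : ℕ+, N k ≤ n →
      (x ∈ Icc (1 / ((k : ℝ) + 2)) (k + 2) → ‖f n x - c‖ ≤ 1 / ((k : ℝ) + 1)) ∧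
      (x ∈ Icc (-((k : ℝ) + 2)) (-(1 / ((k : ℝ) + 2))) → ‖f n x - d‖ ≤ 1 / ((k : ℝ) + 1)) := by
    rw [ae_all_iff]; intro k
    rw [ae_all_iff]; intro n
    by_cases hn : N k ≤ n
    · filter_upwards [hN k n hn] with x hx _ using hx
    · exact .of_forall fun x hx => absurd hx hn
  have h3 : ∀ᵐ x : ℝ, x ≠ 0 := by simp [ae_iff]
  filter_upwards [h2, h3] with x hx hx0
  rw [Metric.tendsto_nhds]
  intro ε hε
  obtain ⟨k, hk1, hk2, hk3⟩ : ∃ k : ℕ, 1 / ((k : ℝ) + 1) < ε ∧ 1 / ((k : ℝ) + 2) ≤ |x| ∧ |x| ≤ k + 2 := by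
    have e1 := tendsto_one_div_add_atTop_nhds_zero_nat (𝕜 := ℝ)
    have e2 := (tendsto_natCast_atTop_atTop (R := ℝ)).eventually_ge_atTop |x|
    obtain ⟨k, ⟨a1, a2⟩, a3⟩ := ((e1.eventually_lt_const hε).and
      (e1.eventually_lt_const (abs_pos.2 hx0))).and e2 |>.exists
    refine ⟨k, a1, le_trans ?_ a2.le, by linarith⟩
    gcongr; norm_num
  filter_upwards [eventually_ge_atTop (N k)] with n hn
  rw [dist_zero_right]
  refine lt_of_le_of_lt ?_ hk1
  rcases lt_or_gt_of_ne hx0 with hneg | hpos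
  · rw [abs_of_neg hneg] at hk2 hk3
    rw [step, if_neg (not_lt.2 hneg.le)]
    exact (hx k n hn).2 ⟨by linarith, by linarith⟩
  · rw [abs_of_pos hpos] at hk2 hk3
    rw [step, if_pos hpos]
    exact (hx k n hn).1 ⟨hk2, hk3⟩

/-- The mean value of `f` over `[a, a + 1]`. -/
def mean (f : ℝ → ℂ) (a : ℝ) : ℂ := ∫ x in Ioc a (a + 1), f x

theorem norm_mean_sub_le {f : ℝ → ℂ} {a : ℝ} (hf : AEStronglyMeasurable f volume) {c : ℂ} {ε : ℝ}
    (h : ∀ᵐ x, x ∈ Ioc a (a + 1) → ‖f x - c‖ ≤ ε) : ‖mean f a - c‖ ≤ ε := by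
  have hi : Integrable (fun x => f x - c) (volume.restrict (Ioc a (a + 1))) := by
    refine Integrable.of_bound (C := ε) (hf.restrict.sub aestronglyMeasurable_const) ?_
    rwa [ae_restrict_iff' measurableSet_Ioc]
  have hfi : Integrable f (volume.restrict (Ioc a (a + 1))) := by
    refine (hi.add (integrable_const c)).congr (.of_forall fun x => ?_)
    simp
  have e : mean f a - c = ∫ x in Ioc a (a + 1), (f x - c) := by
    rw [integral_sub hfi (integrable_const c)]
    simp [mean]
  rw [e]
  have := norm_setIntegral_le_of_norm_le_const_ae' (C := ε) (μ := (volume : Measure ℝ))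
    (s := Ioc a (a + 1)) (f := fun x => f x - c) (by simp) h
  simpa using this

theorem norm_mean_le {f : ℝ → ℂ} {a C : ℝ} (hf : AEStronglyMeasurable f volume)
    (h : ∀ᵐ x, ‖f x‖ ≤ C) : ‖mean f a‖ ≤ C := by
  have := norm_mean_sub_le (a := a) (c := 0) (ε := C) hf (by
    filter_upwards [h] with x hx _
    rwa [sub_zero])
  rwa [sub_zero] at this

theorem PairOsc.norm_sub_mean_le {f : ℝ → ℂ} {S : Set ℝ} {ε a : ℝ} (h : PairOsc f S ε)
    (hf : AEStronglyMeasurable f volume) (hS : Ioc a (a + 1) ⊆ S) :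
    ∀ᵐ x, x ∈ S → ‖f x - mean f a‖ ≤ 2 * ε := by
  obtain ⟨c, hc⟩ := h.exists_const
  have h1 := norm_mean_sub_le (a := a) hf (by filter_upwards [hc] with x hx hxS using hx (hS hxS))
  filter_upwards [hc] with x hx hxS
  have e : f x - mean f a = (f x - c) - (mean f a - c) := by ring
  rw [e]
  exact (norm_sub_le _ _).trans (by linarith [hx hxS])

theorem PairOsc.comp {f : ℝ → ℂ} {S : Set ℝ} {ε : ℝ} (h : PairOsc f S ε) {σ : ℝ → ℝ}
    (hσ : Measure.QuasiMeasurePreserving σ volume volume) : PairOsc (fun x => f (σ x)) (σ ⁻¹' S) ε := by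
  filter_upwards [hσ.ae h] with x hx hxS
  filter_upwards [hσ.ae (hx hxS)] with y hy hyS
  exact hy hyS

/-- The oscillation of `f n` vanishes in the limit, uniformly away from `0` and `∞`. -/
def Windowed (f : ℕ+ → ℝ → ℂ) : Prop :=
  ∀ ε : ℝ, 0 < ε → ∀ R : ℝ, 1 < R → ∀ᶠ n in atTop,
    PairOsc (f n) (Icc (1 / R) R) ε ∧ PairOsc (f n) (Icc (-R) (-(1 / R))) ε

theorem Windowed.symLim {f : ℕ+ → ℝ → ℂ} (h : Windowed f) (hm : ∀ n, AEStronglyMeasurable (f n) volume)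
    {c d : ℂ} (hc : Tendsto (fun n => mean (f n) 1) atTop (𝓝 c))
    (hd : Tendsto (fun n => mean (f n) (-2)) atTop (𝓝 d)) : SymLim f c d := by
  intro ε hε R hR
  set R' := max R 2 with hR'
  have h2 : 2 ≤ R' := le_max_right _ _
  have hRR : R ≤ R' := le_max_left _ _
  have hinv : 1 / R' ≤ 1 / R := one_div_le_one_div_of_le (by linarith) hRR
  have hle1 : 1 / R' ≤ 1 := by rw [div_le_one (by linarith)]; linarith
  have hc' := Metric.tendsto_nhds.1 hc (ε / 2) (by positivity)
  have hd' := Metric.tendsto_nhds.1 hd (ε / 2) (by positivity)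
  filter_upwards [h (ε / 4) (by positivity) R' (by linarith), hc', hd'] with n hn h3 h4
  rw [dist_eq_norm] at h3 h4
  have h5 := hn.1.norm_sub_mean_le (a := 1) (hm n) fun x hx => ⟨by linarith [hx.1], by linarith [hx.2]⟩
  have h6 := hn.2.norm_sub_mean_le (a := -2) (hm n) fun x hx => ⟨by linarith [hx.1], by linarith [hx.2]⟩
  filter_upwards [h5, h6] with x h7 h8
  constructor <;> intro hx
  · have e : f n x - c = (f n x - mean (f n) 1) + (mean (f n) 1 - c) := by ring
    rw [e]
    refine (norm_add_le _ _).trans ?_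
    linarith [h7 ⟨by linarith [hx.1], by linarith [hx.2]⟩]
  · have e : f n x - d = (f n x - mean (f n) (-2)) + (mean (f n) (-2) - d) := by ring
    rw [e]
    refine (norm_add_le _ _).trans ?_
    linarith [h8 ⟨by linarith [hx.1], by linarith [hx.2]⟩]

theorem windowed_multiplication {a : Linf} (ha : a ∈ closedAlg (PC ∪ SO ∪ Linf0)) {h : ℕ+ → ℕ+}
    (hh : Tendsto (fun n => (h n : ℝ)) atTop atTop) : Windowed fun n x => a ((h n : ℝ) * x) := by
  intro ε hε R hR
  have hR2 : 1 < R * R := by nlinarith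
  have hy : Tendsto (fun n => (h n : ℝ) * R) atTop atTop := hh.atTop_mul_const (by linarith)
  filter_upwards [hy.eventually (mem_smallOsc_of_multiplication (approach_atTop hR2) (Or.inl rfl) ha ε hε),
    hy.eventually (mem_smallOsc_of_multiplication (approach_atBot hR2) (Or.inr rfl) ha ε hε)] with n h1 h2
  have hn := pnat_pos (h n)
  have e : (h n : ℝ) * R / (R * R) = h n * (1 / R) := by field_simp
  rw [e] at h1 h2
  constructor
  · refine (h1.comp (quasi_mul hn.ne')).mono fun x hx => ⟨?_, ?_⟩ <;> dsimp only
    · exact mul_le_mul_of_nonneg_left hx.1 hn.le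
    · exact mul_le_mul_of_nonneg_left hx.2 hn.le
  · refine (h2.comp (quasi_mul hn.ne')).mono fun x hx => ⟨?_, ?_⟩ <;> dsimp only
    · rw [← mul_neg]; exact mul_le_mul_of_nonneg_left hx.1 hn.le
    · rw [← mul_neg]; exact mul_le_mul_of_nonneg_left hx.2 hn.le

theorem quasi_affine {c : ℝ} (hc : c ≠ 0) (t : ℝ) :
    Measure.QuasiMeasurePreserving (fun x : ℝ => c * x + t) volume volume :=
  (measurePreserving_add_right volume t).quasiMeasurePreserving.comp (quasi_mul hc)

theorem tendsto_div_nhdsGT {h : ℕ+ → ℕ+} (hh : Tendsto (fun n => (h n : ℝ)) atTop atTop) {R : ℝ}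
    (hR : 0 < R) : Tendsto (fun n => R / (h n : ℝ)) atTop (𝓝[>] 0) :=
  tendsto_nhdsWithin_iff.2 ⟨hh.const_div_atTop R, .of_forall fun n => div_pos hR (pnat_pos (h n))⟩

theorem IsSymbol.windowed {lam : ℝ} {b : Linf} (hb : IsSymbol lam b) (t : ℝ) {h : ℕ+ → ℕ+}
    (hh : Tendsto (fun n => (h n : ℝ)) atTop atTop) :
    Windowed fun n x => b ((h n : ℝ)⁻¹ * x + t) := by
  intro ε hε R hR
  have hR2 : 1 < R * R := by nlinarith
  have hy := tendsto_div_nhdsGT hh (R := R) (by linarith)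
  filter_upwards [hy.eventually (hb.right t (R * R) hR2 ε hε),
    hy.eventually (hb.left t (R * R) hR2 ε hε)] with n h1 h2
  have hn := inv_pos.2 (pnat_pos (h n))
  have e : R / (h n : ℝ) / (R * R) = (h n : ℝ)⁻¹ * (1 / R) := by field_simp
  have e' : R / (h n : ℝ) = (h n : ℝ)⁻¹ * R := by field_simp
  rw [e, e'] at h1 h2
  constructor
  · refine (h1.comp (quasi_affine hn.ne' t)).mono fun x hx => ⟨?_, ?_⟩ <;> dsimp only
    · linarith [mul_le_mul_of_nonneg_left hx.1 hn.le]
    · linarith [mul_le_mul_of_nonneg_left hx.2 hn.le]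
  · refine (h2.comp (quasi_affine hn.ne' t)).mono fun x hx => ⟨?_, ?_⟩ <;> dsimp only
    · linarith [mul_le_mul_of_nonneg_left hx.1 hn.le]
    · linarith [mul_le_mul_of_nonneg_left hx.2 hn.le]

theorem exists_mem_of_ae {P : ℝ → Prop} (h : ∀ᵐ x, P x) {a b : ℝ} (hab : a < b) :
    ∃ x ∈ Icc a b, P x := by
  by_contra hcon
  push Not at hcon
  have : volume (Icc a b) = 0 := by
    rw [measure_eq_zero_iff_ae_notMem]
    filter_upwards [h] with x hx hxS using hcon x hxS hx
  rw [Real.volume_Icc, ENNReal.ofReal_eq_zero] at this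
  linarith

theorem IsSymbol.symLim_eq {lam : ℝ} {b : Linf} (hb : IsSymbol lam b) {t : ℝ} (ht : t ≠ lam)
    {h : ℕ+ → ℕ+} (hh : Tendsto (fun n => (h n : ℝ)) atTop atTop) {c d : ℂ}
    (hcd : SymLim (fun n x => b ((h n : ℝ)⁻¹ * x + t)) c d) : c = d := by
  by_contra hne
  have hpos : 0 < ‖c - d‖ := norm_pos_iff.2 (sub_ne_zero.2 hne)
  have hy := tendsto_div_nhdsGT hh (R := 2) (by norm_num)
  obtain ⟨n, h1, h2⟩ := ((hy.eventually (hb.punctured t (2 * 2) ht (by norm_num) (‖c - d‖ / 4) (by positivity))).and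
    (hcd (‖c - d‖ / 4) (by positivity) 2 (by norm_num))).exists
  have hn := inv_pos.2 (pnat_pos (h n))
  have e : 2 / (h n : ℝ) / (2 * 2) = (h n : ℝ)⁻¹ * (1 / 2) := by field_simp
  have e' : 2 / (h n : ℝ) = (h n : ℝ)⁻¹ * 2 := by field_simp
  dsimp only at h1 h2
  rw [e, e'] at h1
  have h3 := h1.comp (quasi_affine hn.ne' t)
  obtain ⟨x, hx, h4, h5⟩ := exists_mem_of_ae (h3.and h2) (a := 1 / 2) (b := 2) (by norm_num)
  obtain ⟨y, hy, h6, h7⟩ := exists_mem_of_ae ((h4 (Or.inr ⟨by dsimp only; linarith [mul_le_mul_of_nonneg_left hx.1 hn.le],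
    by dsimp only; linarith [mul_le_mul_of_nonneg_left hx.2 hn.le]⟩)).and h2) (a := -2) (b := -(1 / 2)) (by norm_num)
  have h8 := h6 (Or.inl ⟨by linarith [mul_le_mul_of_nonneg_left hy.1 hn.le],
    by linarith [mul_le_mul_of_nonneg_left hy.2 hn.le]⟩)
  have h9 := h5.1 hx
  have h10 := h7.2 hy
  set u := b ((h n : ℝ)⁻¹ * x + t)
  set v := b ((h n : ℝ)⁻¹ * y + t)
  have e2 : c - d = (u - v) - (u - c) + (v - d) := by ring
  have : ‖c - d‖ ≤ ‖c - d‖ / 4 + ‖c - d‖ / 4 + ‖c - d‖ / 4 := by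
    calc ‖c - d‖ = ‖(u - v) - (u - c) + (v - d)‖ := by rw [← e2]
      _ ≤ _ := (norm_add_le _ _).trans (add_le_add ((norm_sub_le _ _).trans (add_le_add h8 h9)) h10)
  linarith

theorem aestronglyMeasurable_affine (b : Linf) {c : ℝ} (hc : c ≠ 0) (t : ℝ) :
    AEStronglyMeasurable (fun x => b (c * x + t)) volume :=
  (Lp.aestronglyMeasurable b).comp_quasiMeasurePreserving (quasi_affine hc t)

/-- Where a symbol is essentially continuous, the mean values converge. -/
theorem mean_converges {b : Linf} {t : ℝ}
    (hb : ∀ ε : ℝ, 0 < ε → ∃ r : ℝ, 0 < r ∧ PairOsc b (Ioo (t - r) (t + r)) ε)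
    {h : ℕ+ → ℕ+} (hh : Tendsto (fun n => (h n : ℝ)) atTop atTop) (a : ℝ) :
    ∃ c, Tendsto (fun n => mean (fun x => b ((h n : ℝ)⁻¹ * x + t)) a) atTop (𝓝 c) := by
  apply cauchySeq_tendsto_of_complete
  rw [Metric.cauchySeq_iff']
  intro ε hε
  obtain ⟨r, r0, hr⟩ := hb (ε / 3) (by positivity)
  obtain ⟨c, hc⟩ := hr.exists_const
  have key : ∀ᶠ n in atTop, ‖mean (fun x => b ((h n : ℝ)⁻¹ * x + t)) a - c‖ ≤ ε / 3 := by
    filter_upwards [hh.eventually_gt_atTop ((|a| + 1) / r)] with n hn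
    have h0 := pnat_pos (h n)
    refine norm_mean_sub_le (aestronglyMeasurable_affine b (inv_pos.2 h0).ne' t) ?_
    filter_upwards [(quasi_affine (inv_pos.2 h0).ne' t).ae hc] with x hx hxS
    rw [div_lt_iff₀ r0] at hn
    have h1 : |x| ≤ |a| + 1 := abs_le.2 ⟨by linarith [hxS.1, neg_abs_le a], by linarith [hxS.2, le_abs_self a]⟩
    have h2 : |(h n : ℝ)⁻¹ * x| < r := by
      rw [abs_mul, abs_of_pos (inv_pos.2 h0), inv_mul_lt_iff₀ h0]
      linarith
    rw [abs_lt] at h2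
    exact hx ⟨by linarith [h2.1], by linarith [h2.2]⟩
  obtain ⟨N, hN⟩ := eventually_atTop.1 key
  refine ⟨N, fun n hn => ?_⟩
  rw [dist_eq_norm]
  have e : mean (fun x => b ((h n : ℝ)⁻¹ * x + t)) a - mean (fun x => b ((h N : ℝ)⁻¹ * x + t)) a
    = (mean (fun x => b ((h n : ℝ)⁻¹ * x + t)) a - c) - (mean (fun x => b ((h N : ℝ)⁻¹ * x + t)) a - c) := by ring
  rw [e]
  exact (norm_sub_le _ _).trans_lt (by linarith [hN n hn, hN N le_rfl])

/-! ## Strong limits of rescaled multipliers -/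

theorem IsFM.tendsto_apply {R : ℕ+ → Op 2} {S : Op 2} {f : ℕ+ → ℝ → ℂ} {g : ℝ → ℂ}
    (hR : ∀ n, IsFM (R n) (f n)) (hS : IsFM S g) {C : ℝ} (hC : ∀ n, ∀ᵐ x, ‖f n x - g x‖ ≤ C)
    (hf : ∀ᵐ x, Tendsto (fun n => f n x - g x) atTop (𝓝 0)) (u : X 2) :
    Tendsto (fun n => R n u) atTop (𝓝 (S u)) := by
  have h1 : Tendsto (fun n => conj Fe (R n - S) (Fe u)) atTop (𝓝 0) :=
    tendsto_isMul_apply (by simp) (fun n => (hR n).sub hS)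
      (fun n => quasi_neg_two_pi.ae (hC n)) (quasi_neg_two_pi.ae hf) (Fe u)
  have h2 := (Fe.symm.continuous.tendsto 0).comp h1
  rw [map_zero] at h2
  have h3 : Tendsto (fun n => R n u - S u) atTop (𝓝 0) := by
    refine h2.congr fun n => ?_
    simp only [Function.comp_apply, conj_apply, LinearIsometryEquiv.symm_apply_apply, _root_.sub_apply]
  simpa using h3.add_const (S u)

theorem IsFM.tendsto_dual {R : ℕ+ → Op 2} {S : Op 2} {f : ℕ+ → ℝ → ℂ} {g : ℝ → ℂ}
    (hR : ∀ n, IsFM (R n) (f n)) (hS : IsFM S g) {C : ℝ} (hC : ∀ n, ∀ᵐ x, ‖f n x - g x‖ ≤ C)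
    (hf : ∀ᵐ x, Tendsto (fun n => f n x - g x) atTop (𝓝 0)) (F : StrongDual ℂ (X 2)) :
    Tendsto (fun n => F.comp (R n)) atTop (𝓝 (F.comp S)) := by
  set G : StrongDual ℂ (X 2) := F.comp (isoOp Fe.symm) with hG
  have h1 : Tendsto (fun n => G.comp (conj Fe (R n - S))) atTop (𝓝 0) :=
    tendsto_dual_comp_isMul (by norm_num) (by simp) (fun n => (hR n).sub hS)
      (fun n => quasi_neg_two_pi.ae (hC n)) (quasi_neg_two_pi.ae hf) G
  have h2 : Tendsto (fun n => ‖F.comp (R n) - F.comp S‖) atTop (𝓝 0) := by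
    refine squeeze_zero (fun _ => norm_nonneg _) (fun n => ?_) (tendsto_zero_iff_norm_tendsto_zero.1 h1)
    have e : F.comp (R n) - F.comp S = (G.comp (conj Fe (R n - S))).comp (isoOp Fe) := by
      ext1 u
      change F (R n u) - F (S u) = F (Fe.symm (conj Fe (R n - S) (Fe u)))
      rw [conj_apply, LinearIsometryEquiv.symm_apply_apply, LinearIsometryEquiv.symm_apply_apply,
        _root_.sub_apply, map_sub]
    rw [e]
    refine (ContinuousLinearMap.opNorm_comp_le _ _).trans ?_
    exact mul_le_of_le_one_right (norm_nonneg _) (isoOp_norm_le _)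
  exact tendsto_iff_norm_sub_tendsto_zero.2 h2

/-- The operator `v ↦ (∫ g v) k`. -/
def rankOne (p : ℝ≥0∞) [Fact (1 ≤ p)] {g k : ℝ → ℂ} (hg : IsNice g) (hk : IsNice k) : Op p :=
  (pairF p (hg.memLp _)).smulRight ((hk.memLp p).toLp)

theorem rankOne_apply {g k : ℝ → ℂ} (hg : IsNice g) (hk : IsNice k) (v : X p) :
    rankOne p hg hk v = (∫ x, g x * v x) • (hk.memLp p).toLp := by
  rw [← pairF_apply (hg.memLp p.conjExponent) v]; rfl

theorem compat_rankOne {g k : ℝ → ℂ} (hg : IsNice g) (hk : IsNice k) :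
    Compat (rankOne p hg hk) (rankOne 2 hg hk) := fun u v huv => by
  have e : ∫ x, g x * u x = ∫ x, g x * v x := integral_congr_ae (by
    filter_upwards [huv] with x hx
    rw [hx])
  rw [rankOne_apply, rankOne_apply, e]
  filter_upwards [Lp.coeFn_smul (∫ x, g x * v x) (hk.memLp p).toLp,
    Lp.coeFn_smul (∫ x, g x * v x) (hk.memLp 2).toLp, (hk.memLp p).coeFn_toLp, (hk.memLp 2).coeFn_toLp]
    with x h1 h2 h3 h4
  rw [h1, h2, Pi.smul_apply, Pi.smul_apply, h3, h4]

theorem bddOn_of_compat {r : ℝ≥0∞} [Fact (1 ≤ r)] {T : Op r} {R : Op 2} (h : Compat T R) :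
    BddOn r ‖T‖₊ R := fun v hv => by
  have h1 := h (hv.toLp) v hv.coeFn_toLp
  have h2 := T.le_opNorm hv.toLp
  rw [Lp.norm_def, Lp.norm_def] at h2
  rw [← eLpNorm_congr_ae h1, ← eLpNorm_congr_ae hv.coeFn_toLp]
  have h3 := ENNReal.ofReal_le_ofReal h2
  rwa [ENNReal.ofReal_toReal (Lp.eLpNorm_ne_top _), ENNReal.ofReal_mul (norm_nonneg _),
    ENNReal.ofReal_toReal (Lp.eLpNorm_ne_top _), ofReal_norm] at h3

theorem norm_mul_rankOne_le {g k : ℝ → ℂ} (hg : IsNice g) (hk : IsNice k) (T : Op p) :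
    ‖T * rankOne p hg hk‖ ≤ ‖pairF p (hg.memLp _)‖ * ‖T ((hk.memLp p).toLp)‖ := by
  refine ContinuousLinearMap.opNorm_le_bound _ (by positivity) fun u => ?_
  have e : (T * rankOne p hg hk) u = pairF p (hg.memLp _) u • T ((hk.memLp p).toLp) := by
    change T (pairF p (hg.memLp _) u • _) = _
    rw [map_smul]
  rw [e, norm_smul]
  have := (pairF p (hg.memLp _)).le_opNorm u
  calc _ ≤ _ := mul_le_mul_of_nonneg_right this (norm_nonneg _)
    _ = _ := by ring

theorem norm_rankOne_mul_le {g k : ℝ → ℂ} (hg : IsNice g) (hk : IsNice k) (T : Op p) :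
    ‖rankOne p hg hk * T‖ ≤ ‖(pairF p (hg.memLp _)).comp T‖ * ‖(hk.memLp p).toLp‖ := by
  refine ContinuousLinearMap.opNorm_le_bound _ (by positivity) fun u => ?_
  have e : (rankOne p hg hk * T) u = ((pairF p (hg.memLp _)).comp T) u • (hk.memLp p).toLp := rfl
  rw [e, norm_smul]
  have := ((pairF p (hg.memLp _)).comp T).le_opNorm u
  calc _ ≤ _ := mul_le_mul_of_nonneg_right this (norm_nonneg _)
    _ = _ := by ring

theorem isNice_box : IsNice (box 1) :=
  ⟨(aestronglyMeasurable_const).indicator measurableSet_Icc, 1, 1, norm_box_le 1,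
    fun _ h => box_of_notMem h⟩

theorem integral_box_mul_box : ∫ x, box 1 x * box 1 x = 2 := by
  simp_rw [box_mul_box le_rfl]
  rw [box, integral_indicator measurableSet_Icc]
  simp
  norm_num

theorem cauchy_prod {E : Type*} [SeminormedAddCommGroup E] {x : ℕ+ → E}
    (h : Tendsto (fun z : ℕ+ × ℕ+ => ‖x z.1 - x z.2‖) (atTop ×ˢ atTop) (𝓝 0)) : CauchySeq x := by
  rw [Metric.cauchySeq_iff]
  intro ε hε
  have h1 := h.eventually_lt_const hε
  rw [prod_atTop_atTop_eq, eventually_atTop] at h1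
  obtain ⟨⟨a, b⟩, hab⟩ := h1
  refine ⟨max a b, fun m hm n hn => ?_⟩
  rw [dist_eq_norm]
  exact hab (m, n) ⟨(le_max_left _ _).trans hm, (le_max_right _ _).trans hn⟩

/-- Uniformly bounded operators on `L^p`, whose counterparts are bounded on `L^r` and converge
`*`-strongly on `L^2`, converge `*`-strongly. -/
theorem exists_starStrong (hp1 : 1 < p) (hp : p ≠ ∞) {r : ℝ≥0∞} (hr : Between p r) {C : ℝ≥0}
    {T : ℕ+ → Op p} {R : ℕ+ → Op 2} (hTR : ∀ n, Compat (T n) (R n)) (hC : ∀ n, BddOn r C (R n))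
    {c : ℝ} (hT : ∀ n, ‖T n‖ ≤ c) {S : Op 2} (hRS : ∀ u, Tendsto (fun n => R n u) atTop (𝓝 (S u)))
    (hRS' : ∀ F : StrongDual ℂ (X 2), Tendsto (fun n => F.comp (R n)) atTop (𝓝 (F.comp S))) :
    ∃ W, StarStrongTendsto T W := by
  have : Fact (1 ≤ r) := ⟨hr.one_le⟩
  have hr1 : 1 ≤ r := hr.one_le
  have c0 : 0 ≤ c := (norm_nonneg _).trans (hT 1)
  have hprod : ∀ {E : Type} [SeminormedAddCommGroup E] {x : ℕ+ → E} {y : E}, Tendsto x atTop (𝓝 y) →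
      Tendsto (fun z : ℕ+ × ℕ+ => ‖x z.1 - x z.2‖) (atTop ×ˢ atTop) (𝓝 0) := by
    intro E _ x y hx
    have := (hx.comp (tendsto_fst (f := (atTop : Filter ℕ+)) (g := (atTop : Filter ℕ+)))).sub
      (hx.comp (tendsto_snd (f := (atTop : Filter ℕ+)) (g := (atTop : Filter ℕ+))))
    simpa using this.norm
  have nice : ∀ k, ∀ hk : IsNice k,
      Tendsto (fun z : ℕ+ × ℕ+ => ‖T z.1 (hk.memLp p).toLp - T z.2 (hk.memLp p).toLp‖)
        (atTop ×ˢ atTop) (𝓝 0) := by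
    intro k hk
    have h1 : Tendsto (fun z : ℕ+ × ℕ+ => ‖(T z.1 - T z.2) * rankOne p isNice_box hk‖)
        (atTop ×ˢ atTop) (𝓝 0) := by
      refine tendsto_of_interpolate hp hr ((C + C) * ‖rankOne r isNice_box hk‖₊)
        (R := fun z => (R z.1 - R z.2) * rankOne 2 isNice_box hk)
        (fun z => ((hTR _).sub (hTR _)).mul (compat_rankOne _ _))
        (fun z => ((hC _).sub hr1 (hC _)).mul (bddOn_of_compat (compat_rankOne _ _))) ?_
      refine squeeze_zero (fun _ => norm_nonneg _) (fun z => norm_mul_rankOne_le _ _ _) ?_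
      simpa using (hprod (hRS (hk.memLp 2).toLp)).const_mul ‖pairF 2 (isNice_box.memLp _)‖
    refine squeeze_zero (fun _ => norm_nonneg _) (fun z => ?_)
      (by have h2 := h1.mul_const ‖(isNice_box.memLp p).toLp‖; rwa [zero_mul] at h2)
    have h2 := ((T z.1 - T z.2) * rankOne p isNice_box hk).le_opNorm ((isNice_box.memLp p).toLp)
    have e : ((T z.1 - T z.2) * rankOne p isNice_box hk) ((isNice_box.memLp p).toLp)
        = (2 : ℂ) • (T z.1 (hk.memLp p).toLp - T z.2 (hk.memLp p).toLp) := by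
      rw [mul_apply_eq_comp, rankOne_apply, map_smul, _root_.sub_apply]
      congr 1
      rw [← integral_box_mul_box]
      refine integral_congr_ae ?_
      filter_upwards [(isNice_box.memLp p).coeFn_toLp] with x hx
      rw [hx]
    rw [e, norm_smul] at h2
    have h3 : ‖(2 : ℂ)‖ = 2 := by simp
    rw [h3] at h2
    linarith [norm_nonneg (T z.1 (hk.memLp p).toLp - T z.2 (hk.memLp p).toLp)]
  have cauchy : ∀ u, CauchySeq fun n => T n u := by
    intro u
    apply cauchy_prod
    rw [Metric.tendsto_nhds]
    intro ε hε
    obtain ⟨v, k, hk, -, hvk, -, hv⟩ := exists_nice_near hp u (ε := ε / (4 * (c + 1))) (by positivity)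
    have hv' : v = (hk.memLp p).toLp := Lp.ext (hvk.trans (hk.memLp p).coeFn_toLp.symm)
    filter_upwards [(nice k hk).eventually_lt_const (half_pos hε)] with z hz
    rw [← hv'] at hz
    rw [dist_zero_right, norm_norm]
    have hn : ∀ n, ‖T n (u - v)‖ ≤ ε / 4 := fun n => by
      refine ((T n).le_of_opNorm_le (hT n) _).trans ?_
      rw [norm_sub_rev]
      calc c * ‖v - u‖ ≤ (c + 1) * (ε / (4 * (c + 1))) :=
            mul_le_mul (by linarith) hv.le (norm_nonneg _) (by positivity)
        _ = ε / 4 := by field_simp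
    have e : T z.1 u - T z.2 u = T z.1 (u - v) - T z.2 (u - v) + (T z.1 v - T z.2 v) := by
      simp only [map_sub]; abel
    rw [e]
    refine (norm_add_le _ _).trans_lt ?_
    linarith [norm_sub_le (T z.1 (u - v)) (T z.2 (u - v)), hn z.1, hn z.2]
  choose w hw using fun u => cauchySeq_tendsto_of_complete (cauchy u)
  have hw' : Tendsto (fun n u => T n u) atTop (𝓝 w) := tendsto_pi_nhds.2 hw
  set W : Op p := LinearMap.mkContinuous
    { toFun := w
      map_add' := fun u v => tendsto_nhds_unique (hw (u + v)) (by simpa using (hw u).add (hw v))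
      map_smul' := fun a u => tendsto_nhds_unique (hw (a • u)) (by simpa using (hw u).const_smul a) } c
    fun u => le_of_tendsto (hw u).norm (.of_forall fun n => (T n).le_of_opNorm_le (hT n) u) with hW
  have hWa : ∀ u, W u = w u := fun u => rfl
  have niceDual : ∀ g, ∀ hg : IsNice g,
      Tendsto (fun z : ℕ+ × ℕ+ => ‖(pairF p (hg.memLp _)).comp (T z.1) - (pairF p (hg.memLp _)).comp (T z.2)‖)
        (atTop ×ˢ atTop) (𝓝 0) := by
    intro g hg
    have h1 : Tendsto (fun z : ℕ+ × ℕ+ => ‖rankOne p hg isNice_box * (T z.1 - T z.2)‖)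
        (atTop ×ˢ atTop) (𝓝 0) := by
      refine tendsto_of_interpolate hp hr (‖rankOne r hg isNice_box‖₊ * (C + C))
        (R := fun z => rankOne 2 hg isNice_box * (R z.1 - R z.2))
        (fun z => (compat_rankOne _ _).mul ((hTR _).sub (hTR _)))
        (fun z => (bddOn_of_compat (compat_rankOne _ _)).mul ((hC _).sub hr1 (hC _))) ?_
      refine squeeze_zero (fun _ => norm_nonneg _) (fun z => norm_rankOne_mul_le _ _ _) ?_
      have := (hprod (hRS' (pairF 2 (hg.memLp _)))).mul_const ‖(isNice_box.memLp 2).toLp‖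
      simpa [ContinuousLinearMap.comp_sub] using this
    set κ := ‖pairF p (isNice_box.memLp _)‖ with hκ
    refine squeeze_zero (fun _ => norm_nonneg _) (fun z => ?_) (by simpa using h1.const_mul κ)
    refine ContinuousLinearMap.opNorm_le_bound _ (by positivity) fun u => ?_
    have h2 := (rankOne p hg isNice_box * (T z.1 - T z.2)).le_opNorm u
    have h3 := (pairF p (isNice_box.memLp _)).le_opNorm ((rankOne p hg isNice_box * (T z.1 - T z.2)) u)
    have e : pairF p (isNice_box.memLp _) ((rankOne p hg isNice_box * (T z.1 - T z.2)) u)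
        = ((pairF p (hg.memLp _)).comp (T z.1) - (pairF p (hg.memLp _)).comp (T z.2)) u * 2 := by
      have e1 : (rankOne p hg isNice_box * (T z.1 - T z.2)) u =
        ((pairF p (hg.memLp _)).comp (T z.1) - (pairF p (hg.memLp _)).comp (T z.2)) u • (isNice_box.memLp p).toLp := by
        rw [← ContinuousLinearMap.comp_sub]; rfl
      rw [e1, map_smul, smul_eq_mul, pairF_apply]
      congr 1
      rw [← integral_box_mul_box]
      refine integral_congr_ae ?_
      filter_upwards [(isNice_box.memLp p).coeFn_toLp] with x hx
      rw [hx]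
    rw [e, norm_mul, Complex.norm_ofNat] at h3
    have h4 := mul_le_mul_of_nonneg_left h2 (norm_nonneg (pairF p (isNice_box.memLp _)))
    rw [← hκ] at h3 h4
    linarith [norm_nonneg (((pairF p (hg.memLp _)).comp (T z.1) - (pairF p (hg.memLp _)).comp (T z.2)) u)]
  refine ⟨W, hw, fun f => ?_⟩
  have cauchy' : CauchySeq fun n => f.comp (T n) := by
    apply cauchy_prod
    rw [Metric.tendsto_nhds]
    intro ε hε
    obtain ⟨g, hg, a, hfg⟩ := exists_pairF_near hp1 hp f (ε := ε / (4 * (c + 1))) (by positivity)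
    set G := pairF p (hg.memLp _) with hG
    have h5 : Tendsto (fun z : ℕ+ × ℕ+ => ‖a‖ * ‖G.comp (T z.1) - G.comp (T z.2)‖) (atTop ×ˢ atTop) (𝓝 0) := by
      simpa using (niceDual g hg).const_mul ‖a‖
    filter_upwards [h5.eventually_lt_const (half_pos hε)] with z hz
    rw [dist_zero_right, norm_norm]
    have hn : ∀ n, ‖(f - a • G).comp (T n)‖ ≤ ε / 4 := fun n => by
      refine (ContinuousLinearMap.opNorm_comp_le _ _).trans ?_
      calc ‖f - a • G‖ * ‖T n‖ ≤ (ε / (4 * (c + 1))) * (c + 1) :=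
            mul_le_mul hfg (by linarith [hT n]) (norm_nonneg _) (by positivity)
        _ = ε / 4 := by field_simp
    have e : f.comp (T z.1) - f.comp (T z.2) = (f - a • G).comp (T z.1) - (f - a • G).comp (T z.2)
        + a • (G.comp (T z.1) - G.comp (T z.2)) := by
      simp only [ContinuousLinearMap.sub_comp, ContinuousLinearMap.smul_comp, smul_sub]; abel
    rw [e]
    refine (norm_add_le _ _).trans_lt ?_
    rw [norm_smul]
    linarith [norm_sub_le ((f - a • G).comp (T z.1)) ((f - a • G).comp (T z.2)), hn z.1, hn z.2]
  obtain ⟨L, hL⟩ := cauchySeq_tendsto_of_complete cauchy'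
  have : L = f.comp W := by
    ext1 u
    have h1 : Tendsto (fun n => f (T n u)) atTop (𝓝 (L u)) :=
      ((ContinuousLinearMap.apply ℂ ℂ u).continuous.tendsto L).comp hL
    exact tendsto_nhds_unique h1 ((f.continuous.tendsto _).comp (hw u))
  rwa [this] at hL

/-! ## Commutators of convolutions and inflated functions -/

theorem exists_separation (F : Finset ℝ) :
    ∃ d : ℝ, 0 < d ∧ ∀ t ∈ F, ∀ t' ∈ F, t ≠ t' → d ≤ |t - t'| := by
  have h : ∀ᶠ d in 𝓝[>] (0 : ℝ), ∀ x ∈ F.offDiag, d ≤ |x.1 - x.2| := by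
    rw [Filter.eventually_all_finset]
    intro x hx
    have : 0 < |x.1 - x.2| := abs_pos.2 (sub_ne_zero.2 (Finset.mem_offDiag.1 hx).2.2)
    exact (eventually_le_nhds this).filter_mono nhdsWithin_le_nhds
  have h0 : ∀ᶠ d in 𝓝[>] (0 : ℝ), 0 < d := self_mem_nhdsWithin
  obtain ⟨d, hd, h⟩ := (h0.and h).exists
  exact ⟨d, hd, fun t ht t' ht' hne => h (t, t') (Finset.mem_offDiag.2 ⟨ht, ht', hne⟩)⟩

/-- A function which is `1` at `0` and decays at infinity, dilated and translated to the points of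
a finite set. -/
theorem exists_comb_bound {Θ : ℝ → ℂ} (h1 : ∀ y, ‖Θ y‖ ≤ 1) (h2 : ∀ y, ‖Θ y‖ * |y| ≤ 2)
    (h3 : ∀ x y, ‖Θ x - Θ y‖ ≤ |x - y|) (h0 : Θ 0 = 1) (F : Finset ℝ) :
    ∃ K : ℝ, 0 ≤ K ∧ ∀ ρ : ℝ, 0 < ρ → ∀ ξ : ℝ, ‖1 - ∑ t ∈ F, Θ (ρ * (ξ - t))‖ ≤ 2 + K / ρ ∧
      ∀ t ∈ F, ‖1 - ∑ t ∈ F, Θ (ρ * (ξ - t))‖ ≤ ρ * |ξ - t| + K / ρ := by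
  obtain ⟨d, hd, hsep⟩ := exists_separation F
  refine ⟨F.card * (4 / d) + 2 / d, by positivity, fun ρ hρ ξ => ?_⟩
  have far : ∀ t, d / 2 ≤ |ξ - t| → ‖Θ (ρ * (ξ - t))‖ ≤ 4 / d / ρ := by
    intro t ht
    have := h2 (ρ * (ξ - t))
    rw [abs_mul, abs_of_pos hρ] at this
    rw [div_div, le_div_iff₀ (by positivity)]
    have h5 : ‖Θ (ρ * (ξ - t))‖ * (ρ * (d / 2)) ≤ ‖Θ (ρ * (ξ - t))‖ * (ρ * |ξ - t|) := by gcongr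
    linarith
  have key : ∀ t, d / 2 ≤ |ξ - t| → 2 ≤ ρ * |ξ - t| + 2 / d / ρ := by
    intro t ht
    have h5 : ρ * (d / 2) ≤ ρ * |ξ - t| := by gcongr
    have h6 : 2 / d / ρ = (ρ * (d / 2))⁻¹ := by field_simp
    have h7 : 0 < ρ * (d / 2) := by positivity
    have h8 := two_mul_le_add_sq (1 : ℝ) (ρ * (d / 2))
    have h9 : 2 ≤ ρ * (d / 2) + (ρ * (d / 2))⁻¹ := by
      rw [← sub_nonneg]
      have : ρ * (d / 2) + (ρ * (d / 2))⁻¹ - 2 = (ρ * (d / 2) - 1) ^ 2 / (ρ * (d / 2)) := by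
        field_simp; ring
      rw [this]; positivity
    linarith
  have e : (F.card * (4 / d) + 2 / d) / ρ = F.card * (4 / d / ρ) + 2 / d / ρ := by ring
  have hsum : ∀ S ⊆ F, (∀ t ∈ S, d / 2 ≤ |ξ - t|) →
      ‖∑ t ∈ S, Θ (ρ * (ξ - t))‖ ≤ F.card * (4 / d / ρ) := by
    intro S hS hSd
    refine (norm_sum_le _ _).trans ?_
    refine (Finset.sum_le_card_nsmul _ _ _ fun t ht => far t (hSd t ht)).trans ?_
    rw [nsmul_eq_mul]
    have : (S.card : ℝ) ≤ F.card := by exact_mod_cast Finset.card_le_card hS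
    gcongr
  have pos : 0 ≤ 2 / d / ρ := by positivity
  rw [e]
  by_cases hne : ∃ t ∈ F, |ξ - t| < d / 2
  · obtain ⟨t, ht, hξ⟩ := hne
    have h4 := hsum (F.erase t) (Finset.erase_subset _ _) fun t' ht' => by
      obtain ⟨h5, h6⟩ := Finset.mem_erase.1 ht'
      have h7 := hsep t' h6 t ht h5
      have h8 : |t' - t| ≤ |ξ - t| + |ξ - t'| := by
        have := abs_sub_le t' ξ t
        rw [abs_sub_comm t' ξ] at this; linarith
      linarith
    have h5 : 1 - ∑ t ∈ F, Θ (ρ * (ξ - t)) = (1 - Θ (ρ * (ξ - t)))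
        - ∑ t ∈ F.erase t, Θ (ρ * (ξ - t)) := by
      rw [← Finset.add_sum_erase F _ ht]; ring
    have h6 : ‖1 - Θ (ρ * (ξ - t))‖ ≤ ρ * |ξ - t| := by
      have := h3 0 (ρ * (ξ - t))
      rwa [h0, zero_sub, abs_neg, abs_mul, abs_of_pos hρ] at this
    have h7 : ‖1 - Θ (ρ * (ξ - t))‖ ≤ 2 := by
      refine (norm_sub_le _ _).trans ?_
      rw [norm_one]; linarith [h1 (ρ * (ξ - t))]
    have h8 := norm_sub_le (1 - Θ (ρ * (ξ - t))) (∑ t ∈ F.erase t, Θ (ρ * (ξ - t)))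
    rw [h5]
    refine ⟨by linarith, fun t' ht' => ?_⟩
    by_cases htt : t' = t
    · subst htt; linarith
    · have h9 := hsep t' ht' t ht htt
      have h10 : |t' - t| ≤ |ξ - t| + |ξ - t'| := by
        have := abs_sub_le t' ξ t
        rw [abs_sub_comm t' ξ] at this; linarith
      linarith [key t' (by linarith)]
  · push Not at hne
    have h4 := hsum F subset_rfl hne
    have h5 := norm_sub_le (1 : ℂ) (∑ t ∈ F, Θ (ρ * (ξ - t)))
    rw [norm_one] at h5
    exact ⟨by linarith, fun t ht => by linarith [key t (hne t ht)]⟩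

theorem IsSymbol.translate_abs {lam : ℝ} {b : Linf} (hb : IsSymbol lam b) {ε : ℝ} (hε : 0 < ε) :
    ∃ F : Finset ℝ, ∃ δ : ℝ, 0 < δ ∧ ∀ τ : ℝ, |τ| < δ →
      ∀ᵐ ξ, (∀ t ∈ F, 3 * |τ| ≤ |ξ - t|) → ‖b (ξ + τ) - b ξ‖ ≤ ε := by
  obtain ⟨F, δ, hδ, h⟩ := hb.translate hε
  refine ⟨F, δ, hδ, fun τ hτ => ?_⟩
  rcases lt_trichotomy τ 0 with h0 | rfl | h0
  · rw [abs_of_neg h0] at hτ ⊢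
    have h1 := h (-τ) (by linarith) hτ
    have h2 := (measurePreserving_add_right volume τ).quasiMeasurePreserving.ae h1
    filter_upwards [h2] with ξ h3 h4
    have h5 := h3 fun t ht => by
      have h6 := h4 t ht
      have h7 : |ξ - t| ≤ |ξ + τ - t| + |τ| := by
        have := abs_sub (ξ + τ - t) τ
        rwa [show ξ + τ - t - τ = ξ - t by ring] at this
      rw [abs_of_neg h0] at h7
      linarith
    rwa [add_neg_cancel_right, norm_sub_rev] at h5
  · exact .of_forall fun ξ _ => by simpa using hε.le
  · rw [abs_of_pos h0] at hτ ⊢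
    filter_upwards [h τ h0 hτ] with ξ h1 h2
    exact h1 fun t ht => by linarith [h2 t ht]

theorem IsAvg.isFM_freq {B : Op 2} (hB : IsAvg B) (k n : ℕ+) (t : ℝ) :
    IsFM (E n (.freq t) (Einv k (.freq 0) B)) fun ξ => expInt 1 (-((n : ℝ) / k * (ξ - t))) := by
  have := (hB.isFM.Einv k 0).E n t
  refine this.congr (.of_forall fun ξ => ?_)
  dsimp only
  congr 1; ring

theorem norm_expInt_one_sub_le (x y : ℝ) : ‖expInt 1 (-x) - expInt 1 (-y)‖ ≤ |x - y| := by
  have := norm_expInt_sub_le zero_le_one (-x) (-y)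
  rwa [one_mul, one_mul, show -x - -y = -(x - y) by ring, abs_neg] at this

theorem tendsto_const_div_pnat (c : ℝ) : Tendsto (fun k : ℕ+ => c / (k : ℝ)) atTop (𝓝 0) :=
  tendsto_const_nhds.div_atTop tendsto_pnat_cast

theorem IsSymbol.norm_commutator_comb_le {lam : ℝ} {b : Linf} (hb : IsSymbol lam b) {R B : Op 2}
    (hR : IsFM R b) (hB : IsAvg B) {L σ : ℝ} (hL : 0 ≤ L) (hσ : |σ| ≤ 1) {h : ℕ+ → ℕ+}
    (hh : Tendsto (fun n => (h n : ℝ)) atTop atTop) {M : ℕ+ → Op 2}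
    (hM : ∀ n, IsMul (M n) fun x => expInt L (σ * (h n : ℝ)⁻¹ * x)) {ε : ℝ} (hε : 0 < ε) :
    ∃ F : Finset ℝ, lam ∈ F ∧ ∀ᶠ k : ℕ+ in atTop, ∀ᶠ n in atTop,
      ‖R * (1 - ∑ t ∈ F, E (h n) (.freq t) (Einv k (.freq 0) B)) * M n
        - M n * (R * (1 - ∑ t ∈ F, E (h n) (.freq t) (Einv k (.freq 0) B)))‖ ≤ ε := by
  classical
  set ε₁ := ε / (4 * (L + 1)) with hε₁
  have ε₁0 : 0 < ε₁ := by positivity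
  obtain ⟨F₀, δ, hδ, htr⟩ := hb.translate_abs ε₁0
  set F := insert lam F₀ with hF
  refine ⟨F, Finset.mem_insert_self _ _, ?_⟩
  obtain ⟨K, K0, hK⟩ := exists_comb_bound (Θ := fun y => expInt 1 (-y))
    (fun y => norm_expInt_le zero_le_one _)
    (fun y => by simpa using norm_expInt_mul_le zero_le_one (-y))
    norm_expInt_one_sub_le (by simp [expInt_zero]) F
  set β := ‖b‖ with hβ
  have β0 : 0 ≤ β := norm_nonneg _
  filter_upwards [(tendsto_const_div_pnat (β * (F.card * L))).eventually_le_const ε₁0,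
    (tendsto_const_div_pnat (6 * β * L)).eventually_le_const ε₁0] with k hk1 hk2
  have kpos := pnat_pos k
  have lim : ∀ c : ℝ, Tendsto (fun n => c / (h n : ℝ)) atTop (𝓝 0) := fun c =>
    tendsto_const_nhds.div_atTop hh
  filter_upwards [(lim (K * k)).eventually_le_const zero_lt_one,
    (lim (2 * β * (K * k))).eventually_le_const ε₁0, (lim L).eventually_lt_const hδ]
    with n hn1 hn2 hn3
  have npos := pnat_pos (h n)
  set ρ : ℝ := (h n : ℝ) / k with hρ
  have ρ0 : 0 < ρ := by positivity
  have hKρ : K / ρ = K * k / (h n : ℝ) := by rw [hρ]; field_simp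
  have hfm := hR.mul (isFM_one.sub (IsFM.sum F fun t => hB.isFM_freq k (h n) t))
  have hc := norm_commutator_le hL (hM n) hfm (ε := 4 * ε₁) (by positivity) ?_
  · refine hc.trans ?_
    rw [hε₁]
    have : L * (4 * (ε / (4 * (L + 1)))) = L / (L + 1) * ε := by field_simp
    rw [this]
    have : L / (L + 1) ≤ 1 := by rw [div_le_one (by positivity)]; linarith
    nlinarith
  intro s hs hsL
  set τ := s * (σ * (h n : ℝ)⁻¹) with hτ
  have hτ1 : |τ| ≤ L / (h n : ℝ) := by
    rw [hτ, abs_mul, abs_mul, abs_of_pos hs, abs_of_pos (inv_pos.2 npos), div_eq_mul_inv]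
    calc s * (|σ| * (h n : ℝ)⁻¹) ≤ L * (1 * (h n : ℝ)⁻¹) := by gcongr
      _ = _ := by ring
  have hρτ : ρ * |τ| ≤ L / k := by
    calc ρ * |τ| ≤ ρ * (L / (h n : ℝ)) := by gcongr
      _ = L / k := by rw [hρ]; field_simp
  have hbt := (measurePreserving_add_right volume τ).quasiMeasurePreserving.ae (ae_norm_le_norm b)
  filter_upwards [htr τ (hτ1.trans_lt hn3), ae_norm_le_norm b, hbt] with ξ h1 h2 h3
  set ψ : ℝ → ℂ := fun ξ => 1 - ∑ t ∈ F, expInt 1 (-(ρ * (ξ - t))) with hψ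
  obtain ⟨hψ1, hψ2⟩ := hK ρ ρ0 ξ
  have hψd : ‖ψ (ξ + τ) - ψ ξ‖ ≤ F.card * (L / k) := by
    have e : ψ (ξ + τ) - ψ ξ = ∑ t ∈ F, (expInt 1 (-(ρ * (ξ - t)))
        - expInt 1 (-(ρ * (ξ + τ - t)))) := by
      rw [hψ, Finset.sum_sub_distrib]; ring
    rw [e]
    refine (norm_sum_le _ _).trans ?_
    rw [← nsmul_eq_mul]
    refine Finset.sum_le_card_nsmul _ _ _ fun t _ => (norm_expInt_one_sub_le _ _).trans ?_
    rw [show ρ * (ξ - t) - ρ * (ξ + τ - t) = -(ρ * τ) by ring, abs_neg, abs_mul, abs_of_pos ρ0]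
    exact hρτ
  have e : b (ξ + τ) * ψ (ξ + τ) - b ξ * ψ ξ
      = b (ξ + τ) * (ψ (ξ + τ) - ψ ξ) + (b (ξ + τ) - b ξ) * ψ ξ := by ring
  change ‖b (ξ + τ) * ψ (ξ + τ) - b ξ * ψ ξ‖ ≤ 4 * ε₁
  rw [e]
  refine (norm_add_le _ _).trans ?_
  rw [norm_mul, norm_mul]
  have i1 : ‖b (ξ + τ)‖ * ‖ψ (ξ + τ) - ψ ξ‖ ≤ ε₁ := by
    calc _ ≤ β * (F.card * (L / k)) := mul_le_mul h3 hψd (norm_nonneg _) β0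
      _ = β * (F.card * L) / k := by ring
      _ ≤ _ := hk1
  have i2 : ‖b (ξ + τ) - b ξ‖ * ‖ψ ξ‖ ≤ 3 * ε₁ := by
    by_cases hfar : ∀ t ∈ F₀, 3 * |τ| ≤ |ξ - t|
    · have h4 : ‖ψ ξ‖ ≤ 3 := by
        refine hψ1.trans ?_
        rw [hKρ]; linarith
      calc _ ≤ ε₁ * 3 := mul_le_mul (h1 hfar) h4 (norm_nonneg _) ε₁0.le
        _ = _ := by ring
    · push Not at hfar
      obtain ⟨t, ht, htξ⟩ := hfar
      have h4 := hψ2 t (Finset.mem_insert_of_mem ht)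
      have h5 : ‖ψ ξ‖ ≤ 3 * (L / k) + K * k / (h n : ℝ) := by
        refine h4.trans ?_
        rw [hKρ]
        have : ρ * |ξ - t| ≤ ρ * (3 * |τ|) := by gcongr
        linarith
      have h6 : ‖b (ξ + τ) - b ξ‖ ≤ 2 * β := by
        refine (norm_sub_le _ _).trans ?_; linarith
      calc _ ≤ 2 * β * (3 * (L / k) + K * k / (h n : ℝ)) :=
            mul_le_mul h6 h5 (norm_nonneg _) (by positivity)
        _ = 6 * β * L / k + 2 * β * (K * k) / (h n : ℝ) := by ring
        _ ≤ 3 * ε₁ := by linarith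
  linarith

theorem tendsto_commutator_sub {t : ℝ} {h : ℕ+ → ℕ+} {T W A N : Op p}
    (hW : StarStrongTendsto (fun n => Einv (h n) (.freq t) T) W)
    (hc : ∀ n, Einv (h n) (.freq t) T * A = A * Einv (h n) (.freq t) T)
    (h1 : IsCompactOperator (A * N : Op p)) (h2 : IsCompactOperator (N * A : Op p)) :
    Tendsto (fun n => ‖T * E (h n) (.freq t) A * E (h n) (.freq t) N
        - E (h n) (.freq t) N * (T * E (h n) (.freq t) A)
        - E (h n) (.freq t) (W * (A * N) - N * A * W)‖) atTop (𝓝 0) := by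
  have d : ∀ n, ‖Einv (h n) (.freq t) T - W‖ ≤ ‖T‖ + ‖W‖ := fun n =>
    (norm_sub_le _ _).trans (add_le_add (norm_Einv_le _ _ _) le_rfl)
  have l1 := tendsto_mul_compact d h1 fun u => by simpa using (hW.1 u).sub_const (W u)
  have l2 := tendsto_compact_mul d h2 fun f => by
    simpa [ContinuousLinearMap.comp_sub] using (hW.2 f).sub_const (f.comp W)
  refine squeeze_zero (fun _ => norm_nonneg _) (fun n => ?_) (by simpa using l1.add l2)
  have e : T * E (h n) (.freq t) A * E (h n) (.freq t) N
        - E (h n) (.freq t) N * (T * E (h n) (.freq t) A)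
        - E (h n) (.freq t) (W * (A * N) - N * A * W)
      = E (h n) (.freq t) ((Einv (h n) (.freq t) T - W) * (A * N)
        - N * A * (Einv (h n) (.freq t) T - W)) := by
    have e1 : T * E (h n) (.freq t) A = E (h n) (.freq t) (Einv (h n) (.freq t) T * A) := mul_E _ _ _ _
    rw [e1, ← E_mul_E, ← E_mul_E, ← E_sub, ← E_sub]
    congr 1
    rw [show N * (Einv (h n) (.freq t) T * A) = N * A * Einv (h n) (.freq t) T by
      rw [hc n, mul_assoc]]
    noncomm_ring
  rw [e, norm_E]
  exact norm_sub_le _ _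

theorem isCompactOperator_of_decay (hp1 : 1 < p) {B M : Op p} (hB : IsAvg B) {g : ℝ → ℂ}
    (hM : IsMul M g) (hg : ∀ ε : ℝ, 0 < ε → ∃ m : ℕ+, ∀ x, (m : ℝ) < |x| → ‖g x‖ ≤ ε) :
    IsCompactOperator (B * M : Op p) ∧ IsCompactOperator (M * B : Op p) := by
  have key : ∀ ε : ℝ, 0 < ε → ∃ m : ℕ+, ‖(1 - P p m) * M‖ ≤ ε := by
    intro ε hε
    obtain ⟨m, hm⟩ := hg ε hε
    refine ⟨m, ((isMul_one_sub_P m).mul hM).norm_le hε.le (.of_forall fun x => ?_)⟩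
    rcases le_or_gt |x| m with h | h
    · simpa [box_of_mem h] using hε.le
    · simpa [box_of_notMem h] using hm x h
  constructor <;> refine isCompactOperator_of_near fun ε hε => ?_ <;>
    obtain ⟨m, hm⟩ := key (ε / (‖B‖ + 1)) (by positivity)
  · refine ⟨B * P p m * M, (isCompactOperator_avg_mul_P hp1 hB m).comp_clm M, ?_⟩
    have e : B * M - B * P p m * M = B * ((1 - P p m) * M) := by noncomm_ring
    rw [e]
    refine (norm_mul_le _ _).trans ?_
    calc ‖B‖ * ‖(1 - P p m) * M‖ ≤ (‖B‖ + 1) * (ε / (‖B‖ + 1)) :=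
          mul_le_mul (by linarith) hm (norm_nonneg _) (by positivity)
      _ = ε := by field_simp
  · refine ⟨M * (P p m * B), (isCompactOperator_P_mul_avg hp1 hB m).clm_comp M, ?_⟩
    have e : M * B - M * (P p m * B) = (1 - P p m) * M * B := by
      rw [(isMul_one_sub_P m).commute hM]; noncomm_ring
    rw [e]
    refine (norm_mul_le _ _).trans ?_
    calc ‖(1 - P p m) * M‖ * ‖B‖ ≤ (ε / (‖B‖ + 1)) * (‖B‖ + 1) :=
          mul_le_mul hm (by linarith) (norm_nonneg _) (by positivity)
      _ = ε := by field_simp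

theorem isCompactOperator_Einv {A : Op p} (hA : IsCompactOperator A) (n : ℕ+) (t : Dir) :
    IsCompactOperator (Einv n t A : Op p) :=
  (hA.clm_comp (isoOp (frame p n t).symm)).comp_clm (isoOp (frame p n t))

theorem isCompactOperator_dilated_avg (hp1 : 1 < p) {B M : Op p} (hB : IsAvg B) {L σ : ℝ} (hL : 0 ≤ L)
    (hσ : |σ| = 1) (hM : IsMul M fun x => expInt L (σ * x)) (k : ℕ+) :
    IsCompactOperator (Einv k (.freq 0) B * M : Op p) ∧
      IsCompactOperator (M * Einv k (.freq 0) B : Op p) := by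
  have hM' := hM.E k (.freq 0)
  have dec : ∀ ε : ℝ, 0 < ε → ∃ m : ℕ+, ∀ x : ℝ, (m : ℝ) < |x| →
      ‖expInt L (σ * (Dir.freq 0).act k x)‖ ≤ ε := by
    intro ε hε
    obtain ⟨m, hm⟩ := (tendsto_pnat_cast.eventually_ge_atTop (2 * k / ε)).exists
    refine ⟨m, fun x hx => ?_⟩
    have h1 := norm_expInt_mul_le hL (σ * (Dir.freq 0).act k x)
    have kpos := pnat_pos k
    have mpos := pnat_pos m
    rw [Dir.act, abs_mul, hσ, one_mul, abs_mul, abs_of_pos (inv_pos.2 kpos)] at h1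
    rw [div_le_iff₀ hε] at hm
    by_contra! hlt
    have h2 : ε * ((k : ℝ)⁻¹ * m) < ‖expInt L (σ * (Dir.freq 0).act k x)‖ * ((k : ℝ)⁻¹ * |x|) := by
      gcongr
    rw [Dir.act] at h2
    have h3 : ε * ((k : ℝ)⁻¹ * m) < 2 := h2.trans_le h1
    have h4 : ε * ((k : ℝ)⁻¹ * m) = (m * ε) / k := by field_simp
    rw [h4, div_lt_iff₀ kpos] at h3
    linarith
  obtain ⟨c1, c2⟩ := isCompactOperator_of_decay hp1 hB hM' dec
  have e : M = Einv k (.freq 0) (E k (.freq 0) M) := (Einv_E _ _ _).symm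
  rw [e, ← Einv_mul, ← Einv_mul]
  exact ⟨isCompactOperator_Einv c1 _ _, isCompactOperator_Einv c2 _ _⟩

theorem starStrong_two {b : Linf} {R S : Op 2} (hR : IsFM R b) {h : ℕ+ → ℕ+} {t : ℝ} {c d : ℂ}
    (hlim : SymLim (fun n x => b ((h n : ℝ)⁻¹ * x + t)) c d) (hS : IsFM S (step c d)) :
    StarStrongTendsto (fun n => Einv (h n) (.freq t) R) S := by
  have hf := hlim.ae_tendsto
  have hC : ∀ n, ∀ᵐ x, ‖b ((h n : ℝ)⁻¹ * x + t) - step c d x‖ ≤ ‖b‖ + max ‖c‖ ‖d‖ := fun n => by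
    filter_upwards [(quasi_affine (inv_pos.2 (pnat_pos (h n))).ne' t).ae (ae_norm_le_norm b)] with x hx
    exact (norm_sub_le _ _).trans (add_le_add hx (norm_step_le _ _ _))
  exact ⟨IsFM.tendsto_apply (fun n => hR.Einv (h n) t) hS hC hf,
    IsFM.tendsto_dual (fun n => hR.Einv (h n) t) hS hC hf⟩

theorem E_freq_eq {N : Op p} {g : ℝ → ℂ} (hN : IsMul N g) (n : ℕ+) (s t : ℝ) :
    E n (.freq s) N = E n (.freq t) N :=
  (hN.E n (.freq s)).ext (hN.E n (.freq t)) .rfl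

/-- Away from `lam`, a symbol looks constant on small scales. -/
theorem IsSymbol.norm_commutator_le_of_ne {lam : ℝ} {b : Linf} (hb : IsSymbol lam b) {R B N : Op 2}
    (hR : IsFM R b) (hB : IsAvg B) {L σ : ℝ} (hL : 0 ≤ L) (hσ : |σ| = 1) {h : ℕ+ → ℕ+}
    (hh : Tendsto (fun n => (h n : ℝ)) atTop atTop) {t : ℝ} (ht : t ≠ lam) {c d : ℂ}
    (hlim : SymLim (fun n x => b ((h n : ℝ)⁻¹ * x + t)) c d)
    (hN : IsMul N fun x => expInt L (σ * x)) (k : ℕ+) {ε : ℝ} (hε : 0 < ε) :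
    ∀ᶠ n in atTop, ‖R * E (h n) (.freq t) (Einv k (.freq 0) B) * E (h n) (.freq t) N
      - E (h n) (.freq t) N * (R * E (h n) (.freq t) (Einv k (.freq 0) B))‖
        ≤ ‖c‖ * (L * L) / k + ε := by
  have hcd := hb.symLim_eq ht hh hlim
  subst hcd
  have hS : IsFM (c • 1) (step c c) :=
    (isFM_one.smul c).congr (.of_forall fun x => by simp [step])
  obtain ⟨c1, c2⟩ := isCompactOperator_dilated_avg (p := 2) (by norm_num) hB hL hσ hN k
  have lim := tendsto_commutator_sub (starStrong_two hR hlim hS)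
    (fun n => (hR.Einv (h n) t).commute (hB.isFM.Einv k 0)) c1 c2
  have hcomm : ‖Einv k (.freq 0) B * N - N * Einv k (.freq 0) B‖ ≤ L * (L / k) := by
    refine norm_commutator_le hL hN (hB.isFM.Einv k 0) (by positivity) fun s hs hsL =>
      .of_forall fun x => ?_
    refine (norm_expInt_one_sub_le _ _).trans ?_
    rw [show (k : ℝ)⁻¹ * (x + s * σ) + 0 - ((k : ℝ)⁻¹ * x + 0) = s * σ / k by ring, abs_div, abs_mul,
      hσ, abs_of_pos hs, mul_one, abs_of_pos (pnat_pos k)]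
    have := pnat_pos k
    gcongr
  filter_upwards [lim.eventually_le_const hε] with n hn
  have e : (c • (1 : Op 2)) * (Einv k (.freq 0) B * N) - N * Einv k (.freq 0) B * (c • (1 : Op 2))
      = c • (Einv k (.freq 0) B * N - N * Einv k (.freq 0) B) := by
    rw [smul_mul_assoc, one_mul, mul_smul_comm, mul_one, smul_sub]
  have h1 : ‖E (h n) (.freq t) ((c • (1 : Op 2)) * (Einv k (.freq 0) B * N)
      - N * Einv k (.freq 0) B * (c • (1 : Op 2)))‖ ≤ ‖c‖ * (L * L) / k := by
    rw [norm_E, e, norm_smul]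
    calc _ ≤ ‖c‖ * (L * (L / k)) := by gcongr
      _ = _ := by ring
  have h2 := norm_add_le (R * E (h n) (.freq t) (Einv k (.freq 0) B) * E (h n) (.freq t) N
      - E (h n) (.freq t) N * (R * E (h n) (.freq t) (Einv k (.freq 0) B))
      - E (h n) (.freq t) ((c • (1 : Op 2)) * (Einv k (.freq 0) B * N)
      - N * Einv k (.freq 0) B * (c • (1 : Op 2)))) (E (h n) (.freq t) ((c • (1 : Op 2)) * (Einv k (.freq 0) B * N)
      - N * Einv k (.freq 0) B * (c • (1 : Op 2))))
  rw [sub_add_cancel] at h2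
  linarith

theorem IsSymbol.norm_commutator_le {lam : ℝ} {b : Linf} (hb : IsSymbol lam b) {R B N : Op 2}
    (hR : IsFM R b) (hB : IsAvg B) {L σ : ℝ} (hL : 0 ≤ L) (hσ : |σ| = 1) {h : ℕ+ → ℕ+}
    (hh : Tendsto (fun n => (h n : ℝ)) atTop atTop)
    (hlim : ∀ t, ∃ c d, SymLim (fun n x => b ((h n : ℝ)⁻¹ * x + t)) c d)
    (hN : IsMul N fun x => expInt L (σ * x)) {ε : ℝ} (hε : 0 < ε) :
    ∃ k : ℕ+, ∀ᶠ n in atTop,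
      ‖R * (1 - E (h n) (.freq lam) (Einv k (.freq 0) B)) * E (h n) (.freq lam) N
      - E (h n) (.freq lam) N * (R * (1 - E (h n) (.freq lam) (Einv k (.freq 0) B)))‖ ≤ ε := by
  classical
  choose c d hcd using hlim
  obtain ⟨F, hF, hk⟩ := hb.norm_commutator_comb_le hR hB hL hσ.le hh
    (M := fun n => E (h n) (.freq lam) N)
    (fun n => (hN.E (h n) (.freq lam)).congr (.of_forall fun x => by
      dsimp only [Dir.act]; rw [mul_assoc])) (half_pos hε)
  obtain ⟨k, hk1, hk2⟩ := (hk.and ((tendsto_const_div_pnat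
    (∑ t ∈ F.erase lam, ‖c t‖ * (L * L))).eventually_le_const (show 0 < ε / 4 by positivity))).exists
  refine ⟨k, ?_⟩
  have hev : ∀ᶠ n in atTop, ∀ t ∈ F.erase lam,
      ‖R * E (h n) (.freq t) (Einv k (.freq 0) B) * E (h n) (.freq lam) N
      - E (h n) (.freq lam) N * (R * E (h n) (.freq t) (Einv k (.freq 0) B))‖
        ≤ ‖c t‖ * (L * L) / k + ε / (4 * (F.card + 1)) := by
    rw [Filter.eventually_all_finset]
    intro t ht
    filter_upwards [hb.norm_commutator_le_of_ne hR hB hL hσ hh (Finset.ne_of_mem_erase ht) (hcd t) hN k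
      (ε := ε / (4 * (F.card + 1))) (by positivity)] with n hn
    rwa [E_freq_eq hN (h n) lam t]
  filter_upwards [hk1, hev] with n hn1 hn2
  set G := fun t : ℝ => E (h n) (.freq t) (Einv k (.freq 0) B) with hG
  set M := E (h n) (.freq lam) N with hM
  have e : R * (1 - G lam) * M - M * (R * (1 - G lam))
      = (R * (1 - ∑ t ∈ F, G t) * M - M * (R * (1 - ∑ t ∈ F, G t)))
        + ∑ t ∈ F.erase lam, (R * G t * M - M * (R * G t)) := by
    rw [Finset.sum_sub_distrib, ← Finset.sum_mul, ← Finset.mul_sum, ← Finset.mul_sum,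
      ← Finset.mul_sum, ← Finset.add_sum_erase F G hF]
    noncomm_ring
  change ‖R * (1 - G lam) * M - M * (R * (1 - G lam))‖ ≤ ε
  rw [e]
  refine (norm_add_le _ _).trans ?_
  have h1 : ‖∑ t ∈ F.erase lam, (R * G t * M - M * (R * G t))‖ ≤ ε / 4 + ε / 4 := by
    refine (norm_sum_le _ _).trans ((Finset.sum_le_sum hn2).trans ?_)
    rw [Finset.sum_add_distrib, ← Finset.sum_div, Finset.sum_const, nsmul_eq_mul]
    have h2 : ((F.erase lam).card : ℝ) ≤ F.card + 1 := by
      have : ((F.erase lam).card : ℝ) ≤ F.card := by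
        exact_mod_cast Finset.card_le_card (Finset.erase_subset _ _)
      linarith
    have h3 : ((F.erase lam).card : ℝ) * (ε / (4 * (F.card + 1))) ≤ (F.card + 1) * (ε / (4 * (F.card + 1))) := by
      gcongr
    have h4 : ((F.card : ℝ) + 1) * (ε / (4 * (F.card + 1))) = ε / 4 := by field_simp
    linarith
  linarith

theorem Between.ne_top {q r : ℝ≥0∞} (h : Between q r) : r ≠ ∞ := by
  rcases h with ⟨-, rfl⟩ | ⟨-, -, h⟩ | ⟨-, h, -⟩
  · norm_num
  · exact h
  · exact h.ne_top

/-- The commutator of a convolution with an inflated function is, up to a small error, a lifted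
compact operator. -/
theorem IsSymbol.exists_compact_near_commutator (hp1 : 1 < p) (hp : p ≠ ∞) {lam : ℝ} {b : Linf}
    (hb : IsSymbol lam b) {T : Op p} {R : Op 2} (hTR : Compat T R) (hR : IsFM R b) {r : ℝ≥0∞}
    (hr : Between p r) {C : ℝ≥0} (hC : BddOn r C R) {h : ℕ+ → ℕ+}
    (hh : Tendsto (fun n => (h n : ℝ)) atTop atTop)
    (hlim : ∀ t, ∃ c d, SymLim (fun n x => b ((h n : ℝ)⁻¹ * x + t)) c d) {W : Op p}
    (hW : StarStrongTendsto (fun n => Einv (h n) (.freq lam) T) W)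
    {L σ : ℝ} (hL : 0 ≤ L) (hσ : |σ| = 1) {N : Op p} (hN : IsMul N fun x => expInt L (σ * x))
    {η : ℝ} (hη : 0 < η) :
    ∃ K : Op p, IsCompactOperator K ∧ ∀ᶠ n in atTop,
      ‖T * E (h n) (.freq lam) N - E (h n) (.freq lam) N * T - E (h n) (.freq lam) K‖ ≤ η := by
  obtain ⟨B, hB⟩ := exists_isAvg hp
  obtain ⟨B2, hB2⟩ := exists_isAvg (p := 2) (by norm_num)
  obtain ⟨N2, hN2⟩ := exists_isMul (p := 2)
    ((continuous_expInt hL).comp (continuous_const_mul σ)).aestronglyMeasurable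
    (.of_forall fun x => norm_expInt_le hL (σ * x))
  have hBB := hB.compat hB2
  have hNN := hN.compat hN2
  have hr1 := hr.one_le
  have hB2r : BddOn r 1 B2 := hB2.bddOn hr1 hr.ne_top
  have hN2r : BddOn r L.toNNReal N2 := hN2.bddOn (.of_forall fun x => by
    rw [Real.coe_toNNReal _ hL]; exact norm_expInt_le hL _) r
  obtain ⟨ε, hε, hint⟩ := interpolate hp hr
    (C * (1 + 1) * L.toNNReal + L.toNNReal * (C * (1 + 1))) (half_pos hη)
  obtain ⟨k, hk⟩ := hb.norm_commutator_le hR hB2 hL hσ hh hlim hN2 hε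
  obtain ⟨c1, c2⟩ := isCompactOperator_dilated_avg hp1 hB hL hσ hN k
  have lim := tendsto_commutator_sub hW (fun n => by
    have h1 := (hTR.Einv (h n) (.freq lam)).mul (hBB.Einv k (.freq 0))
    have h2 := (hBB.Einv k (.freq 0)).mul (hTR.Einv (h n) (.freq lam))
    rw [(hR.Einv (h n) lam).commute (hB2.isFM.Einv k 0)] at h1
    exact h1.unique hp h2) c1 c2
  refine ⟨W * (Einv k (.freq 0) B * N) - N * Einv k (.freq 0) B * W,
    (c1.clm_comp W).sub (c2.comp_clm W), ?_⟩
  filter_upwards [hk, lim.eventually_le_const (half_pos hη)] with n hn1 hn2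
  set M := E (h n) (.freq lam) N
  have hG := (hBB.Einv k (.freq 0)).E (h n) (.freq lam)
  have hGr : BddOn r 1 (E (h n) (.freq lam) (Einv k (.freq 0) B2)) := (hB2r.Einv k _).E _ _
  have hMr : BddOn r L.toNNReal (E (h n) (.freq lam) N2) := hN2r.E _ _
  have hM := hNN.E (h n) (.freq lam)
  have hD := hint _ _ (((hTR.mul (compat_one.sub hG)).mul hM).sub (hM.mul (hTR.mul (compat_one.sub hG))))
    hn1 (((hC.mul ((bddOn_one r).sub hr1 hGr)).mul hMr).sub hr1
      (hMr.mul (hC.mul ((bddOn_one r).sub hr1 hGr))))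
  have e : ∀ G Y : Op p, T * M - M * T - Y
      = (T * (1 - G) * M - M * (T * (1 - G))) + (T * G * M - M * (T * G) - Y) := by
    intro G Y; noncomm_ring
  rw [e (E (h n) (.freq lam) (Einv k (.freq 0) B))]
  exact (norm_add_le _ _).trans (by linarith)

/-! ## Criteria for `P`-boundedness and `P`-strong convergence -/

theorem norm_mul_one_sub_P_antitone (A : Op p) {m n : ℕ+} (h : m ≤ n) :
    ‖A * (1 - P p n)‖ ≤ ‖A * (1 - P p m)‖ := by
  have e : A * (1 - P p n) = A * (1 - P p m) * (1 - P p n) := by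
    have := P_mul_one_sub (p := p) h
    rw [mul_assoc, sub_mul 1 (P p m), one_mul, this, sub_zero]
  rw [e]
  refine (norm_mul_le _ _).trans ?_
  exact mul_le_of_le_one_right (norm_nonneg _) (norm_one_sub_P_le n)

theorem norm_one_sub_P_mul_antitone (A : Op p) {m n : ℕ+} (h : m ≤ n) :
    ‖(1 - P p n) * A‖ ≤ ‖(1 - P p m) * A‖ := by
  have e : (1 - P p n) * A = (1 - P p n) * ((1 - P p m) * A) := by
    have := one_sub_mul_P (p := p) h
    rw [← mul_assoc, mul_sub (1 - P p n), mul_one, this, sub_zero]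
  rw [e]
  refine (norm_mul_le _ _).trans ?_
  exact mul_le_of_le_one_left (norm_nonneg _) (norm_one_sub_P_le n)

/-- An antitone sequence tends to zero if a subsequence does. -/
theorem tendsto_of_antitone_subseq {f : ℕ+ → ℝ} (hf : Antitone f) (h0 : ∀ n, 0 ≤ f n) {h : ℕ+ → ℕ+}
    (h1 : Tendsto (fun n => f (h n)) atTop (𝓝 0)) : Tendsto f atTop (𝓝 0) := by
  rw [Metric.tendsto_nhds]
  intro ε hε
  obtain ⟨n, hn⟩ := (h1.eventually_lt_const hε).exists
  filter_upwards [eventually_ge_atTop (h n)] with m hm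
  rw [dist_zero_right, Real.norm_of_nonneg (h0 m)]
  exact (hf hm).trans_lt hn

theorem pBounded_of_P {A : Op p}
    (h1 : ∀ m, Tendsto (fun n => ‖P p m * A * (1 - P p n)‖) atTop (𝓝 0))
    (h2 : ∀ m, Tendsto (fun n => ‖(1 - P p n) * A * P p m‖) atTop (𝓝 0)) : A ∈ PBounded p := by
  intro K hK
  refine ⟨⟨?_, ?_⟩, ?_, ?_⟩
  · refine squeeze_zero (fun _ => norm_nonneg _) (fun n => ?_) (by simpa using hK.1.const_mul ‖A‖)
    rw [mul_assoc]; exact norm_mul_le _ _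
  · rw [Metric.tendsto_nhds]
    intro ε hε
    obtain ⟨m, hm⟩ := ((hK.2.const_mul ‖A‖).eventually_lt_const
      (show ‖A‖ * 0 < ε / 2 by simpa using half_pos hε)).exists
    filter_upwards [((h2 m).mul_const ‖K‖).eventually_lt_const
      (show 0 * ‖K‖ < ε / 2 by simpa using half_pos hε)] with n hn
    rw [dist_zero_right, norm_norm]
    have e : (1 - P p n) * (A * K) = (1 - P p n) * A * P p m * K
        + (1 - P p n) * (A * ((1 - P p m) * K)) := by noncomm_ring
    rw [e]
    refine (norm_add_le _ _).trans_lt ?_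
    have i1 := norm_mul_le ((1 - P p n) * A * P p m) K
    have i2 := norm_mul_le (1 - P p n) (A * ((1 - P p m) * K))
    have i3 := norm_mul_le A ((1 - P p m) * K)
    have i4 : ‖1 - P p n‖ * ‖A * ((1 - P p m) * K)‖ ≤ ‖A * ((1 - P p m) * K)‖ :=
      mul_le_of_le_one_left (norm_nonneg _) (norm_one_sub_P_le n)
    linarith
  · rw [Metric.tendsto_nhds]
    intro ε hε
    obtain ⟨m, hm⟩ := ((hK.1.mul_const ‖A‖).eventually_lt_const
      (show 0 * ‖A‖ < ε / 2 by simpa using half_pos hε)).exists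
    filter_upwards [((h1 m).const_mul ‖K‖).eventually_lt_const
      (show ‖K‖ * 0 < ε / 2 by simpa using half_pos hε)] with n hn
    rw [dist_zero_right, norm_norm]
    have e : K * A * (1 - P p n) = K * (P p m * A * (1 - P p n))
        + K * (1 - P p m) * A * (1 - P p n) := by noncomm_ring
    rw [e]
    refine (norm_add_le _ _).trans_lt ?_
    have i1 := norm_mul_le K (P p m * A * (1 - P p n))
    have i2 := norm_mul_le (K * (1 - P p m) * A) (1 - P p n)
    have i3 := norm_mul_le (K * (1 - P p m)) A
    have i4 : ‖K * (1 - P p m) * A‖ * ‖1 - P p n‖ ≤ ‖K * (1 - P p m) * A‖ :=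
      mul_le_of_le_one_right (norm_nonneg _) (norm_one_sub_P_le n)
    linarith
  · refine squeeze_zero (fun _ => norm_nonneg _) (fun n => ?_) (by simpa using hK.2.mul_const ‖A‖)
    rw [← mul_assoc]; exact norm_mul_le _ _

theorem tendsto_P_mul_mul_one_sub {A : Op p} (hA : A ∈ PBounded p) (m : ℕ+) :
    Tendsto (fun n => ‖P p m * A * (1 - P p n)‖) atTop (𝓝 0) ∧
      Tendsto (fun n => ‖(1 - P p n) * A * P p m‖) atTop (𝓝 0) := by
  refine ⟨(hA _ (P_mem_PCompact m)).2.1, ?_⟩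
  simpa only [mul_assoc] using (hA _ (P_mem_PCompact m)).1.2

theorem IsMul.mem_pBounded {A : Op p} {f : ℝ → ℂ} (hA : IsMul A f) : A ∈ PBounded p := by
  refine pBounded_of_P (fun m => tendsto_const_nhds.congr' ?_) (fun m => tendsto_const_nhds.congr' ?_)
  · filter_upwards [eventually_ge_atTop m] with n hn
    rw [(isMul_P m).commute hA, mul_assoc, P_mul_one_sub hn, mul_zero, norm_zero]
  · filter_upwards [eventually_ge_atTop m] with n hn
    rw [mul_assoc, hA.commute (isMul_P m), ← mul_assoc, one_sub_mul_P hn, zero_mul, norm_zero]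

theorem pStrong_of_P {A : ℕ+ → Op p} {W : Op p} {c : ℝ} (hc : ∀ n, ‖A n‖ ≤ c)
    (h1 : ∀ m, Tendsto (fun n => ‖P p m * (A n - W)‖) atTop (𝓝 0))
    (h2 : ∀ m, Tendsto (fun n => ‖(A n - W) * P p m‖) atTop (𝓝 0)) : PStrongTendsto A W := by
  intro K hK
  have hc' : ∀ n, ‖A n - W‖ ≤ c + ‖W‖ := fun n => (norm_sub_le _ _).trans (by linarith [hc n])
  have c0 : 0 ≤ c + ‖W‖ := (norm_nonneg _).trans (hc' 1)
  rw [Metric.tendsto_nhds]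
  intro ε hε
  obtain ⟨m, hm1, hm2⟩ := (((hK.1.mul_const (c + ‖W‖)).eventually_lt_const
      (show 0 * (c + ‖W‖) < ε / 4 by rw [zero_mul]; positivity)).and
      ((hK.2.const_mul (c + ‖W‖)).eventually_lt_const
      (show (c + ‖W‖) * 0 < ε / 4 by rw [mul_zero]; positivity))).exists
  filter_upwards [((h1 m).const_mul ‖K‖).eventually_lt_const
      (show ‖K‖ * 0 < ε / 4 by rw [mul_zero]; positivity),
      ((h2 m).mul_const ‖K‖).eventually_lt_const
      (show 0 * ‖K‖ < ε / 4 by rw [zero_mul]; positivity)] with n hn1 hn2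
  rw [dist_zero_right, Real.norm_of_nonneg (by positivity)]
  have e1 : K * (A n - W) = K * (P p m * (A n - W)) + K * (1 - P p m) * (A n - W) := by noncomm_ring
  have e2 : (A n - W) * K = (A n - W) * P p m * K + (A n - W) * ((1 - P p m) * K) := by noncomm_ring
  have i1 := norm_add_le (K * (P p m * (A n - W))) (K * (1 - P p m) * (A n - W))
  have i2 := norm_add_le ((A n - W) * P p m * K) ((A n - W) * ((1 - P p m) * K))
  rw [← e1] at i1
  rw [← e2] at i2
  have i3 := norm_mul_le K (P p m * (A n - W))
  have i4 := norm_mul_le ((A n - W) * P p m) K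
  have i5 : ‖K * (1 - P p m) * (A n - W)‖ ≤ ‖K * (1 - P p m)‖ * (c + ‖W‖) :=
    (norm_mul_le _ _).trans (by gcongr; exact hc' n)
  have i6 : ‖(A n - W) * ((1 - P p m) * K)‖ ≤ (c + ‖W‖) * ‖(1 - P p m) * K‖ :=
    (norm_mul_le _ _).trans (by gcongr; exact hc' n)
  linarith

/-- Multiplication operators converge `P`-strongly if the functions converge uniformly on bounded
sets. -/
theorem pStrong_of_isMul {A : ℕ+ → Op p} {W : Op p} {f : ℕ+ → ℝ → ℂ} {g : ℝ → ℂ}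
    (hA : ∀ n, IsMul (A n) (f n)) (hW : IsMul W g) {c : ℝ} (hc : ∀ n, ‖A n‖ ≤ c)
    (h : ∀ m : ℝ, ∀ ε : ℝ, 0 < ε → ∀ᶠ n in atTop, ∀ᵐ x, |x| ≤ m → ‖f n x - g x‖ ≤ ε) :
    PStrongTendsto A W := by
  have key : ∀ m, Tendsto (fun n => ‖P p m * (A n - W)‖) atTop (𝓝 0) := by
    intro m
    rw [Metric.tendsto_nhds]
    intro ε hε
    filter_upwards [h m (ε / 2) (half_pos hε)] with n hn
    rw [dist_zero_right, norm_norm]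
    refine lt_of_le_of_lt (((isMul_P m).mul ((hA n).sub hW)).norm_le (half_pos hε).le ?_)
      (half_lt_self hε)
    filter_upwards [hn] with x hx
    rcases le_or_gt |x| m with hm | hm
    · rw [box_of_mem hm, one_mul]; exact hx hm
    · rw [box_of_notMem hm, zero_mul, norm_zero]; exact (half_pos hε).le
  refine pStrong_of_P hc key fun m => (key m).congr fun n => ?_
  rw [(isMul_P m).commute ((hA n).sub hW)]

/-! ## The sequences `{φ_{h_n} I}` -/

theorem OpSeq.ext {A B : OpSeq p} (h : ∀ n, A n = B n) : A = B :=
  BoundedContinuousFunction.ext (f := (A : ℕ+ →ᵇ Op p)) (g := B) h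

theorem OpSeq.sub_apply (A B : OpSeq p) (n : ℕ+) : (A - B) n = A n - B n := rfl

theorem OpSeq.smul_apply (c : ℂ) (A : OpSeq p) (n : ℕ+) : (c • A) n = c • A n := rfl

theorem OpSeq.one_apply (n : ℕ+) : (1 : OpSeq p) n = 1 := rfl

theorem OpSeq.zero_apply (n : ℕ+) : (0 : OpSeq p) n = 0 := rfl

theorem OpSeq.norm_le {A : OpSeq p} {c : ℝ} (hc : 0 ≤ c) (h : ∀ n, ‖A n‖ ≤ c) : ‖A‖ ≤ c :=
  (BoundedContinuousFunction.norm_le (f := (A : ℕ+ →ᵇ Op p)) hc).2 h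

/-- A bounded family of operators as an element of `OpSeq`. -/
def OpSeq.mk (f : ℕ+ → Op p) (c : ℝ) (h : ∀ n, ‖f n‖ ≤ c) : OpSeq p :=
  BoundedContinuousFunction.ofNormedAddCommGroupDiscrete f c h

theorem OpSeq.mk_apply (f : ℕ+ → Op p) (c : ℝ) (h : ∀ n, ‖f n‖ ≤ c) (n : ℕ+) :
    OpSeq.mk f c h n = f n := rfl

theorem isMul_cSeq (h : ℕ+ → ℕ+) (φ : C(OnePoint ℝ, ℂ)) (n : ℕ+) :
    IsMul (cSeq p h φ n) fun x => φ ((x / (h n : ℝ) : ℝ) : OnePoint ℝ) :=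
  (isMul_mulOp _).congr (MemLp.coeFn_toLp _)

theorem lift_apply (h : ℕ+ → ℕ+) (t : Dir) (K : Op p) (n : ℕ+) : lift h t K n = E (h n) t K := rfl

theorem norm_cSeq_le (h : ℕ+ → ℕ+) (φ : C(OnePoint ℝ, ℂ)) : ‖cSeq p h φ‖ ≤ ‖φ‖ :=
  OpSeq.norm_le (norm_nonneg _) fun _ => (norm_mulOp_le _).trans (norm_inflated φ _)

theorem cSeq_ext {h : ℕ+ → ℕ+} {A : OpSeq p} {φ : C(OnePoint ℝ, ℂ)}
    (hA : ∀ n, IsMul (A n) fun x => φ ((x / (h n : ℝ) : ℝ) : OnePoint ℝ)) : cSeq p h φ = A :=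
  OpSeq.ext fun n => (isMul_cSeq h φ n).ext (hA n) .rfl

theorem cSeq_mul (h : ℕ+ → ℕ+) (φ ψ : C(OnePoint ℝ, ℂ)) :
    cSeq p h (φ * ψ) = cSeq p h φ * cSeq p h ψ :=
  cSeq_ext fun n => (isMul_cSeq h φ n).mul (isMul_cSeq h ψ n)

theorem cSeq_add (h : ℕ+ → ℕ+) (φ ψ : C(OnePoint ℝ, ℂ)) :
    cSeq p h (φ + ψ) = cSeq p h φ + cSeq p h ψ :=
  cSeq_ext fun n => (isMul_cSeq h φ n).add (isMul_cSeq h ψ n)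

theorem cSeq_sub (h : ℕ+ → ℕ+) (φ ψ : C(OnePoint ℝ, ℂ)) :
    cSeq p h (φ - ψ) = cSeq p h φ - cSeq p h ψ :=
  cSeq_ext fun n => (isMul_cSeq h φ n).sub (isMul_cSeq h ψ n)

theorem cSeq_algebraMap (h : ℕ+ → ℕ+) (c : ℂ) :
    cSeq p h (algebraMap ℂ _ c) = algebraMap ℂ (OpSeq p) c :=
  cSeq_ext fun n => by
    rw [Algebra.algebraMap_eq_smul_one, OpSeq.smul_apply, OpSeq.one_apply]
    exact (isMul_one.smul c).congr (.of_forall fun x => by simp [Algebra.algebraMap_eq_smul_one])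

theorem cSeq_one (h : ℕ+ → ℕ+) : cSeq p h 1 = 1 :=
  cSeq_ext fun n => isMul_one.congr (.of_forall fun x => by simp)

/-- For `φ` continuous on `OnePoint ℝ`, the operator of multiplication by `φ`. -/
theorem exists_isMul_continuous (φ : C(OnePoint ℝ, ℂ)) :
    ∃ N : Op p, IsMul N fun x => φ (x : OnePoint ℝ) :=
  exists_isMul (φ.continuous.comp OnePoint.continuous_coe).aestronglyMeasurable
    (.of_forall fun _ => φ.norm_coe_le_norm _)

theorem E_freq_eq_cSeq {N : Op p} {φ : C(OnePoint ℝ, ℂ)} (hN : IsMul N fun x => φ (x : OnePoint ℝ))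
    (h : ℕ+ → ℕ+) (n : ℕ+) (t : ℝ) : E (h n) (.freq t) N = cSeq p h φ n :=
  (hN.E (h n) (.freq t)).ext (isMul_cSeq h φ n) (.of_forall fun x => by
    dsimp only [Dir.act]; rw [div_eq_inv_mul])

/-- A continuous function on `OnePoint ℝ` which is `1` near `a` and supported in
`[a - δ, a + δ]`. -/
def bump (a δ : ℝ) (hδ : 0 < δ) : C(OnePoint ℝ, ℂ) :=
  OnePoint.continuousMapMk
    ⟨fun x => ((max 0 (min 1 (2 - 2 * |x - a| / δ)) : ℝ) : ℂ), by fun_prop⟩ 0 (by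
      rw [coclosedCompact_eq_cocompact]
      refine tendsto_const_nhds.congr' ?_
      have : ∀ᶠ x in cocompact ℝ, x ∉ Icc (a - δ) (a + δ) := isCompact_Icc.compl_mem_cocompact
      filter_upwards [this] with x hx
      have h1 : δ ≤ |x - a| := by
        by_contra! h2
        obtain ⟨h3, h4⟩ := abs_lt.1 h2
        exact hx ⟨by linarith, by linarith⟩
      have h2 : 2 - 2 * |x - a| / δ ≤ 0 := by
        rw [sub_nonpos, le_div_iff₀ hδ]; linarith
      change (0 : ℂ) = ((max 0 (min 1 (2 - 2 * |x - a| / δ)) : ℝ) : ℂ)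
      rw [max_eq_left ((min_le_right _ _).trans h2), Complex.ofReal_zero])

theorem bump_coe (a δ : ℝ) (hδ : 0 < δ) (x : ℝ) :
    bump a δ hδ (x : OnePoint ℝ) = ((max 0 (min 1 (2 - 2 * |x - a| / δ)) : ℝ) : ℂ) := rfl

theorem bump_infty (a δ : ℝ) (hδ : 0 < δ) : bump a δ hδ OnePoint.infty = 0 := rfl

theorem bump_eq_one {a δ : ℝ} (hδ : 0 < δ) {x : ℝ} (h : |x - a| ≤ δ / 2) :
    bump a δ hδ (x : OnePoint ℝ) = 1 := by
  have h2 : 1 ≤ 2 - 2 * |x - a| / δ := by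
    rw [le_sub_comm, div_le_iff₀ hδ]; linarith
  rw [bump_coe, min_eq_left h2, max_eq_right zero_le_one, Complex.ofReal_one]

theorem bump_eq_zero {a δ : ℝ} (hδ : 0 < δ) {x : ℝ} (h : δ ≤ |x - a|) :
    bump a δ hδ (x : OnePoint ℝ) = 0 := by
  have h2 : 2 - 2 * |x - a| / δ ≤ 0 := by
    rw [sub_nonpos, le_div_iff₀ hδ]; linarith
  rw [bump_coe, max_eq_left ((min_le_right _ _).trans h2), Complex.ofReal_zero]

theorem norm_bump_le (a δ : ℝ) (hδ : 0 < δ) (x : ℝ) : ‖bump a δ hδ (x : OnePoint ℝ)‖ ≤ 1 := by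
  rw [bump_coe, Complex.norm_real, Real.norm_of_nonneg (le_max_left _ _)]
  exact max_le zero_le_one (min_le_left _ _)

/-! ## The part of `J_h` that belongs to frequencies -/

/-- The closed subspace spanned by all `{E_{h_n}^t(K)}` with `t ∈ ℝ`, `K` compact, and all null
sequences. -/
def Jfreq (p : ℝ≥0∞) [Fact (1 ≤ p)] (h : ℕ+ → ℕ+) : Submodule ℂ (OpSeq p) :=
  (Submodule.span ℂ ({G : OpSeq p | ∃ t : ℝ, ∃ K : Op p, IsCompactOperator K ∧ G = lift h (.freq t) K} ∪
    {G : OpSeq p | Tendsto (fun n => ‖G n‖) atTop (𝓝 0)})).topologicalClosure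

theorem Jfreq_isClosed (h : ℕ+ → ℕ+) : IsClosed (Jfreq p h : Set (OpSeq p)) :=
  Submodule.isClosed_topologicalClosure _

theorem Jfreq_le (h : ℕ+ → ℕ+) : Jfreq p h ≤ J p h := by
  refine Submodule.topologicalClosure_mono (Submodule.span_mono ?_)
  rintro G (⟨t, K, hK, rfl⟩ | hG)
  · exact Or.inl ⟨.freq t, K, hK, rfl⟩
  · exact Or.inr hG

theorem Jfreq_of_null {h : ℕ+ → ℕ+} {G : OpSeq p} (hG : Tendsto (fun n => ‖G n‖) atTop (𝓝 0)) :
    G ∈ Jfreq p h :=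
  Submodule.le_topologicalClosure _ (Submodule.subset_span (Or.inr hG))

theorem Jfreq_of_lift (h : ℕ+ → ℕ+) {t : ℝ} {K : Op p} (hK : IsCompactOperator K) :
    lift h (.freq t) K ∈ Jfreq p h :=
  Submodule.le_topologicalClosure _ (Submodule.subset_span (Or.inl ⟨t, K, hK, rfl⟩))

theorem Jfreq_induction {h : ℕ+ → ℕ+} {S : Submodule ℂ (OpSeq p)} (hS : IsClosed (S : Set (OpSeq p)))
    (h1 : ∀ t : ℝ, ∀ K : Op p, IsCompactOperator K → lift h (.freq t) K ∈ S)
    (h2 : ∀ G : OpSeq p, Tendsto (fun n => ‖G n‖) atTop (𝓝 0) → G ∈ S) : Jfreq p h ≤ S := by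
  refine Submodule.topologicalClosure_minimal _ (Submodule.span_le.2 ?_) hS
  rintro G (⟨t, K, hK, rfl⟩ | hG)
  · exact h1 t K hK
  · exact h2 G hG

/-- To map `Jfreq` into itself, a continuous linear map only has to map the generators there. -/
theorem Jfreq_map {h : ℕ+ → ℕ+} (f : OpSeq p →L[ℂ] OpSeq p)
    (h1 : ∀ t : ℝ, ∀ K : Op p, IsCompactOperator K → f (lift h (.freq t) K) ∈ Jfreq p h)
    (h2 : ∀ G : OpSeq p, Tendsto (fun n => ‖G n‖) atTop (𝓝 0) → f G ∈ Jfreq p h)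
    {B : OpSeq p} (hB : B ∈ Jfreq p h) : f B ∈ Jfreq p h :=
  Jfreq_induction (S := (Jfreq p h).comap (f : OpSeq p →ₗ[ℂ] OpSeq p))
    ((Jfreq_isClosed h).preimage f.continuous) h1 h2 hB

theorem Jfreq_mul_cSeq {h : ℕ+ → ℕ+} (φ : C(OnePoint ℝ, ℂ)) {B : OpSeq p} (hB : B ∈ Jfreq p h) :
    B * cSeq p h φ ∈ Jfreq p h ∧ cSeq p h φ * B ∈ Jfreq p h := by
  obtain ⟨N, hN⟩ := exists_isMul_continuous (p := p) φ
  have hφ : ∀ n, ‖cSeq p h φ n‖ ≤ ‖φ‖ := fun n => (OpSeq.norm_apply_le _ n).trans (norm_cSeq_le h φ)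
  constructor
  · refine Jfreq_map ((ContinuousLinearMap.mul ℂ (OpSeq p)).flip (cSeq p h φ)) (fun t K hK => ?_)
      (fun G hG => ?_) hB
    · change lift h (.freq t) K * cSeq p h φ ∈ Jfreq p h
      have : lift h (.freq t) K * cSeq p h φ = lift h (.freq t) (K * N) := OpSeq.ext fun n => by
        rw [OpSeq.mul_apply, lift_apply, lift_apply, ← E_freq_eq_cSeq hN h n t, E_mul_E]
      rw [this]
      exact Jfreq_of_lift h (hK.comp_clm N)
    · change G * cSeq p h φ ∈ Jfreq p h
      refine Jfreq_of_null (squeeze_zero (fun _ => norm_nonneg _) (fun n => ?_)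
        (by simpa using hG.mul_const ‖φ‖))
      exact (norm_mul_le _ _).trans (mul_le_mul_of_nonneg_left (hφ n) (norm_nonneg _))
  · refine Jfreq_map (ContinuousLinearMap.mul ℂ (OpSeq p) (cSeq p h φ)) (fun t K hK => ?_)
      (fun G hG => ?_) hB
    · change cSeq p h φ * lift h (.freq t) K ∈ Jfreq p h
      have : cSeq p h φ * lift h (.freq t) K = lift h (.freq t) (N * K) := OpSeq.ext fun n => by
        rw [OpSeq.mul_apply, lift_apply, lift_apply, ← E_freq_eq_cSeq hN h n t, E_mul_E]
      rw [this]
      exact Jfreq_of_lift h (hK.clm_comp N)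
    · change cSeq p h φ * G ∈ Jfreq p h
      refine Jfreq_of_null (squeeze_zero (fun _ => norm_nonneg _) (fun n => ?_)
        (by simpa using hG.const_mul ‖φ‖))
      exact (norm_mul_le _ _).trans (mul_le_mul_of_nonneg_right (hφ n) (norm_nonneg _))

/-- Approximation up to finitely many terms suffices for membership in `Jfreq`. -/
theorem Jfreq_of_near {h : ℕ+ → ℕ+} {G : OpSeq p}
    (hG : ∀ η : ℝ, 0 < η → ∃ Y ∈ Jfreq p h, ∀ᶠ n in atTop, ‖G n - Y n‖ ≤ η) : G ∈ Jfreq p h := by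
  classical
  have hcl : G ∈ closure (Jfreq p h : Set (OpSeq p)) := by
    rw [Metric.mem_closure_iff]
    intro ε hε
    obtain ⟨Y, hY, hev⟩ := hG (ε / 2) (half_pos hε)
    set D : OpSeq p := OpSeq.mk (fun n => if ‖G n - Y n‖ ≤ ε / 2 then 0 else G n - Y n) ‖G - Y‖
      (fun n => by
        split_ifs
        · rw [norm_zero]; exact norm_nonneg _
        · exact OpSeq.norm_apply_le (G - Y) n) with hD
    have hDn : D ∈ Jfreq p h := by
      refine Jfreq_of_null (tendsto_const_nhds.congr' ?_)
      filter_upwards [hev] with n hn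
      rw [hD, OpSeq.mk_apply, if_pos hn, norm_zero]
    refine ⟨Y + D, add_mem hY hDn, ?_⟩
    rw [dist_eq_norm]
    refine lt_of_le_of_lt (OpSeq.norm_le (half_pos hε).le fun n => ?_) (half_lt_self hε)
    rw [OpSeq.sub_apply, OpSeq.add_apply, hD, OpSeq.mk_apply]
    split_ifs with h1
    · rwa [add_zero]
    · rw [add_sub_cancel, sub_self, norm_zero]; exact (half_pos hε).le
  rwa [(Jfreq_isClosed h).closure_eq] at hcl

/-! ## Generators of `C(OnePoint ℝ, ℂ)` -/

/-- The function `x ↦ ∫_0^L e^{isσx} ds`, extended by `0` at infinity. -/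
def expC (L σ : ℝ) (hL : 0 < L) (hσ : |σ| = 1) : C(OnePoint ℝ, ℂ) :=
  OnePoint.continuousMapMk
    ⟨fun x => expInt L (σ * x), (continuous_expInt hL.le).comp (continuous_const_mul σ)⟩ 0 (by
      rw [coclosedCompact_eq_cocompact, tendsto_zero_iff_norm_tendsto_zero]
      refine squeeze_zero' (.of_forall fun _ => norm_nonneg _) ?_
        ((tendsto_const_nhds (x := (2 : ℝ))).div_atTop (tendsto_norm_cocompact_atTop (E := ℝ)))
      filter_upwards [(tendsto_norm_cocompact_atTop (E := ℝ)).eventually_gt_atTop 0] with x hx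
      rw [le_div_iff₀ hx]
      have := norm_expInt_mul_le hL.le (σ * x)
      rwa [abs_mul, hσ, one_mul] at this)

theorem expC_coe {L σ : ℝ} (hL : 0 < L) (hσ : |σ| = 1) (x : ℝ) :
    expC L σ hL hσ (x : OnePoint ℝ) = expInt L (σ * x) := rfl

theorem expC_infty {L σ : ℝ} (hL : 0 < L) (hσ : |σ| = 1) : expC L σ hL hσ OnePoint.infty = 0 := rfl

theorem expInt_neg (L x : ℝ) : expInt L (-x) = star (expInt L x) := by
  rw [expInt, expInt, RCLike.star_def, ← integral_conj]
  refine integral_congr_ae (.of_forall fun s => ?_)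
  dsimp only
  rw [← Complex.exp_conj, map_mul, Complex.conj_I, Complex.conj_ofReal]
  congr 1; push_cast; ring

theorem exists_expInt_ne_zero (y : ℝ) : ∃ L : ℝ, 0 < L ∧ expInt L y ≠ 0 := by
  refine ⟨1 / (1 + |y|), by positivity, fun h0 => ?_⟩
  have hL : (0 : ℝ) < 1 / (1 + |y|) := by positivity
  have h1 := norm_expInt_sub_le hL.le 0 y
  rw [h0, expInt_zero hL.le, sub_zero, Complex.norm_real, Real.norm_of_nonneg hL.le, zero_sub,
    abs_neg] at h1
  have h2 : 1 / (1 + |y|) * |y| < 1 := by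
    rw [div_mul_eq_mul_div, one_mul, div_lt_one (by positivity)]; linarith
  nlinarith

theorem hasDerivAt_expInt (x : ℝ) {L : ℝ} (hL : 0 < L) :
    HasDerivAt (fun L => expInt L x) (Complex.exp (Complex.I * (L * x : ℝ))) L := by
  have hc : Continuous fun s : ℝ => Complex.exp (Complex.I * (s * x : ℝ)) := by fun_prop
  refine (intervalIntegral.integral_hasDerivAt_right (hc.intervalIntegrable 0 L)
    (hc.stronglyMeasurableAtFilter _ _) hc.continuousAt).congr_of_eventuallyEq ?_
  filter_upwards [eventually_gt_nhds hL] with s hs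
  rw [expInt, intervalIntegral.integral_of_le hs.le]

theorem exists_expInt_ne {x y : ℝ} (hxy : x ≠ y) : ∃ L : ℝ, 0 < L ∧ expInt L x ≠ expInt L y := by
  by_contra! h
  have hpos : 0 < |x - y| := abs_pos.2 (sub_ne_zero.2 hxy)
  set L := 1 / |x - y| with hL
  have L0 : 0 < L := by positivity
  have h1 := (hasDerivAt_expInt x L0).unique ((hasDerivAt_expInt y L0).congr_of_eventuallyEq (by
    filter_upwards [eventually_gt_nhds L0] with s hs using h s hs))
  have h2 : Complex.exp (Complex.I * (L * x - L * y : ℝ)) = 1 := by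
    have e : Complex.I * ((L * x - L * y : ℝ) : ℂ)
        = Complex.I * ((L * x : ℝ) : ℂ) - Complex.I * ((L * y : ℝ) : ℂ) := by push_cast; ring
    rw [e, Complex.exp_sub, h1, div_self (Complex.exp_ne_zero _)]
  have h3 := congrArg Complex.re h2
  rw [mul_comm, Complex.exp_ofReal_mul_I_re, Complex.one_re, ← Real.cos_abs] at h3
  have h4 : |L * x - L * y| = 1 := by
    rw [← mul_sub, abs_mul, abs_of_pos L0, hL]; field_simp
  rw [h4] at h3
  linarith [Real.cos_one_le]

theorem continuous_cSeq (h : ℕ+ → ℕ+) : Continuous (cSeq p h) := by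
  refine (LipschitzWith.of_dist_le_mul (K := 1) fun φ ψ => ?_).continuous
  rw [dist_eq_norm, dist_eq_norm, ← cSeq_sub, NNReal.coe_one, one_mul]
  exact norm_cSeq_le h _

/-- The functions `φ` for which a sequence commutes with `{φ_{h_n} I}` modulo `Jfreq`. -/
def commutants (h : ℕ+ → ℕ+) (A : OpSeq p) : Subalgebra ℂ C(OnePoint ℝ, ℂ) where
  carrier := {φ | A * cSeq p h φ - cSeq p h φ * A ∈ Jfreq p h}
  add_mem' := by
    intro φ ψ hφ hψ
    rw [mem_ofPred_eq] at hφ hψ ⊢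
    have e : A * cSeq p h (φ + ψ) - cSeq p h (φ + ψ) * A
        = (A * cSeq p h φ - cSeq p h φ * A) + (A * cSeq p h ψ - cSeq p h ψ * A) := by
      rw [cSeq_add]; noncomm_ring
    rw [e]; exact add_mem hφ hψ
  mul_mem' := by
    intro φ ψ hφ hψ
    rw [mem_ofPred_eq] at hφ hψ ⊢
    have e : A * cSeq p h (φ * ψ) - cSeq p h (φ * ψ) * A
        = (A * cSeq p h φ - cSeq p h φ * A) * cSeq p h ψ
          + cSeq p h φ * (A * cSeq p h ψ - cSeq p h ψ * A) := by
      rw [cSeq_mul]; noncomm_ring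
    rw [e]; exact add_mem (Jfreq_mul_cSeq ψ hφ).1 (Jfreq_mul_cSeq φ hψ).2
  algebraMap_mem' c := by
    rw [mem_ofPred_eq, cSeq_algebraMap, Algebra.commutes c A, sub_self]; exact zero_mem _

theorem mem_commutants {h : ℕ+ → ℕ+} {A : OpSeq p} {φ : C(OnePoint ℝ, ℂ)} :
    φ ∈ commutants h A ↔ A * cSeq p h φ - cSeq p h φ * A ∈ Jfreq p h := Iff.rfl

theorem isClosed_commutants (h : ℕ+ → ℕ+) (A : OpSeq p) :
    IsClosed (commutants h A : Set C(OnePoint ℝ, ℂ)) := by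
  have hc := continuous_cSeq (p := p) h
  have : Continuous fun φ => A * cSeq p h φ - cSeq p h φ * A :=
    (continuous_const.mul hc).sub (hc.mul continuous_const)
  exact (Jfreq_isClosed h).preimage this

theorem commutants_eq_top {h : ℕ+ → ℕ+} {A : OpSeq p}
    (hA : ∀ (L σ : ℝ) (hL : 0 < L) (hσ : |σ| = 1), expC L σ hL hσ ∈ commutants h A)
    (φ : C(OnePoint ℝ, ℂ)) : φ ∈ commutants h A := by
  set G : Set C(OnePoint ℝ, ℂ) := {φ | ∃ L, ∃ hL : 0 < L, φ = expC L 1 hL abs_one} with hG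
  have hstar : ∀ L (hL : 0 < L), star (expC L 1 hL abs_one) = expC L (-1) hL (by simp) := by
    intro L hL
    ext x
    rw [ContinuousMap.star_apply]
    induction x using OnePoint.rec with
    | infty => rw [expC_infty, expC_infty, star_zero]
    | coe x => rw [expC_coe, expC_coe, neg_one_mul, one_mul, expInt_neg]
  have hle : (StarAlgebra.adjoin ℂ G).toSubalgebra ≤ commutants h A := by
    rw [StarAlgebra.adjoin_toSubalgebra, Algebra.adjoin_le_iff]
    rintro ψ (⟨L, hL, rfl⟩ | hψ)
    · exact hA _ _ _ _
    · obtain ⟨L, hL, e⟩ : star ψ ∈ G := hψ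
      have : ψ = expC L (-1) hL (by simp) := by rw [← hstar, ← e, star_star]
      rw [this]; exact hA _ _ _ _
  have hsep : (StarAlgebra.adjoin ℂ G).SeparatesPoints := by
    have mem : ∀ L (hL : 0 < L), expC L 1 hL abs_one ∈ StarAlgebra.adjoin ℂ G := fun L hL =>
      StarAlgebra.subset_adjoin ℂ G ⟨L, hL, rfl⟩
    intro x y hxy
    induction x using OnePoint.rec with
    | infty =>
      induction y using OnePoint.rec with
      | infty => exact absurd rfl hxy
      | coe y =>
        obtain ⟨L, hL, hne⟩ := exists_expInt_ne_zero y
        refine ⟨_, ⟨_, mem L hL, rfl⟩, ?_⟩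
        dsimp only; rw [expC_infty, expC_coe, one_mul]; exact hne.symm
    | coe x =>
      induction y using OnePoint.rec with
      | infty =>
        obtain ⟨L, hL, hne⟩ := exists_expInt_ne_zero x
        refine ⟨_, ⟨_, mem L hL, rfl⟩, ?_⟩
        dsimp only; rw [expC_infty, expC_coe, one_mul]; exact hne
      | coe y =>
        obtain ⟨L, hL, hne⟩ := exists_expInt_ne (x := x) (y := y) fun e => hxy (by rw [e])
        refine ⟨_, ⟨_, mem L hL, rfl⟩, ?_⟩
        dsimp only; rw [expC_coe, expC_coe, one_mul, one_mul]; exact hne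
  have htop := ContinuousMap.starSubalgebra_topologicalClosure_eq_top_of_separatesPoints _ hsep
  have h1 : φ ∈ (StarAlgebra.adjoin ℂ G).topologicalClosure := by rw [htop]; trivial
  have h2 : φ ∈ closure ((StarAlgebra.adjoin ℂ G : StarSubalgebra ℂ C(OnePoint ℝ, ℂ)) : Set C(OnePoint ℝ, ℂ)) := h1
  exact closure_minimal (fun ψ hψ => hle hψ) (isClosed_commutants h A) h2

/-! ## `P`-boundedness of convolutions -/

theorem tendsto_P_mul_of_mem_Jfreq (hp1 : 1 < p) (hp : p ≠ ∞) {h : ℕ+ → ℕ+}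
    (hh : Tendsto (fun n => (h n : ℝ)) atTop atTop) (m : ℕ+) {Y : OpSeq p} (hY : Y ∈ Jfreq p h) :
    Tendsto (fun n => ‖P p m * Y n‖) atTop (𝓝 0) ∧ Tendsto (fun n => ‖Y n * P p m‖) atTop (𝓝 0) := by
  set S : Submodule ℂ (OpSeq p) :=
    { carrier := {Y | Tendsto (fun n => ‖P p m * Y n‖) atTop (𝓝 0) ∧
        Tendsto (fun n => ‖Y n * P p m‖) atTop (𝓝 0)}
      zero_mem' := by
        simp only [mem_ofPred_eq, OpSeq.zero_apply, mul_zero, zero_mul, norm_zero]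
        exact ⟨tendsto_const_nhds, tendsto_const_nhds⟩
      add_mem' := by
        rintro A B ⟨h1, h2⟩ ⟨h3, h4⟩
        constructor
        · refine squeeze_zero (fun _ => norm_nonneg _) (fun n => ?_) (by simpa using h1.add h3)
          rw [OpSeq.add_apply, mul_add]; exact norm_add_le _ _
        · refine squeeze_zero (fun _ => norm_nonneg _) (fun n => ?_) (by simpa using h2.add h4)
          rw [OpSeq.add_apply, add_mul]; exact norm_add_le _ _
      smul_mem' := by
        rintro c A ⟨h1, h2⟩
        constructor
        · simpa [OpSeq.smul_apply, norm_smul] using h1.const_mul ‖c‖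
        · simpa [OpSeq.smul_apply, norm_smul] using h2.const_mul ‖c‖ } with hS
  have key : ∀ Y Z : OpSeq p, ∀ n, ‖P p m * Y n‖ ≤ ‖P p m * Z n‖ + ‖Y - Z‖ ∧
      ‖Y n * P p m‖ ≤ ‖Z n * P p m‖ + ‖Y - Z‖ := by
    intro Y Z n
    have h0 := OpSeq.norm_apply_le (Y - Z) n
    rw [OpSeq.sub_apply] at h0
    have hP := norm_P_le (p := p) m
    constructor
    · have e : P p m * Y n = P p m * Z n + P p m * (Y n - Z n) := by noncomm_ring
      rw [e]
      refine (norm_add_le _ _).trans (add_le_add le_rfl ((norm_mul_le _ _).trans ?_))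
      exact (mul_le_of_le_one_left (norm_nonneg _) hP).trans h0
    · have e : Y n * P p m = Z n * P p m + (Y n - Z n) * P p m := by noncomm_ring
      rw [e]
      refine (norm_add_le _ _).trans (add_le_add le_rfl ((norm_mul_le _ _).trans ?_))
      exact (mul_le_of_le_one_right (norm_nonneg _) hP).trans h0
  have hcl : IsClosed (S : Set (OpSeq p)) := by
    refine isClosed_of_closure_subset fun Y hY => ?_
    rw [Metric.mem_closure_iff] at hY
    constructor <;>
    · rw [Metric.tendsto_nhds]
      intro ε hε
      obtain ⟨Z, ⟨hZ1, hZ2⟩, hd⟩ := hY (ε / 2) (half_pos hε)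
      rw [dist_eq_norm] at hd
      filter_upwards [hZ1.eventually_lt_const (half_pos hε), hZ2.eventually_lt_const (half_pos hε)]
        with n h1 h2
      rw [dist_zero_right, norm_norm]
      have := key Y Z n
      linarith [this.1, this.2]
  refine Jfreq_induction hcl (fun t K hK => ?_) (fun G hG => ?_) hY
  · have hm : ∀ n, IsMul (Einv (h n) (.freq t) (P p m)) fun x => box m ((h n : ℝ) * x) := fun n =>
      (isMul_P m).Einv (h n) (.freq t)
    have hC : ∀ n, ∀ᵐ x, ‖box m ((h n : ℝ) * x)‖ ≤ 1 := fun n => .of_forall fun x => norm_box_le _ _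
    have h0 : ∀ᵐ x : ℝ, Tendsto (fun n => box m ((h n : ℝ) * x)) atTop (𝓝 0) := by
      have : ∀ᵐ x : ℝ, x ≠ 0 := by
        rw [ae_iff]
        simp
      filter_upwards [this] with x hx
      refine tendsto_const_nhds.congr' ?_
      have h1 : Tendsto (fun n => (h n : ℝ) * |x|) atTop atTop := hh.atTop_mul_const (abs_pos.2 hx)
      filter_upwards [h1.eventually_gt_atTop (m : ℝ)] with n hn
      rw [box_of_notMem]
      rwa [abs_mul, abs_of_pos (pnat_pos _)]
    have hd : ∀ n, ‖Einv (h n) (.freq t) (P p m)‖ ≤ 1 := fun n =>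
      (norm_Einv_le _ _ _).trans (norm_P_le m)
    constructor
    · refine (tendsto_mul_compact hd hK fun u => tendsto_isMul_apply hp hm hC h0 u).congr fun n => ?_
      rw [lift_apply, mul_E, norm_E]
    · refine (tendsto_compact_mul hd hK fun F => tendsto_dual_comp_isMul hp1 hp hm hC h0 F).congr
        fun n => ?_
      rw [lift_apply, E_mul, norm_E]
  · constructor
    · refine squeeze_zero (fun _ => norm_nonneg _) (fun n => (norm_mul_le _ _).trans ?_) hG
      exact mul_le_of_le_one_left (norm_nonneg _) (norm_P_le m)
    · refine squeeze_zero (fun _ => norm_nonneg _) (fun n => (norm_mul_le _ _).trans ?_) hG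
      exact mul_le_of_le_one_right (norm_nonneg _) (norm_P_le m)

theorem pBounded_of_commutants (hp1 : 1 < p) (hp : p ≠ ∞) {h : ℕ+ → ℕ+}
    (hh : Tendsto (fun n => (h n : ℝ)) atTop atTop) {T : Op p}
    (hT : ∀ φ, φ ∈ commutants h (lift h .center T)) : T ∈ PBounded p := by
  set φ := bump 0 1 one_pos with hφ
  have hJ : ∀ m, _ := fun m => tendsto_P_mul_of_mem_Jfreq hp1 hp hh m (mem_commutants.1 (hT φ))
  have hφ1 : ∀ m : ℕ+, ∀ᶠ n in atTop, P p m * cSeq p h φ n = P p m := by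
    intro m
    filter_upwards [hh.eventually_ge_atTop (2 * m : ℝ)] with n hn
    refine ((isMul_P m).mul (isMul_cSeq h φ n)).ext (isMul_P m) (.of_forall fun x => ?_)
    dsimp only
    have := pnat_pos (h n)
    rcases le_or_gt |x| m with hx | hx
    · rw [hφ, bump_eq_one, mul_one]
      rw [sub_zero, abs_div, abs_of_pos this, div_le_iff₀ this]; linarith
    · rw [box_of_notMem hx, zero_mul]
  have hφ2 : ∀ n, cSeq p h φ n * (1 - P p (h n)) = 0 := fun n =>
    ((isMul_cSeq h φ n).mul (isMul_one_sub_P (h n))).ext isMul_zero (.of_forall fun x => by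
      dsimp only
      have := pnat_pos (h n)
      rcases le_or_gt |x| (h n) with hx | hx
      · rw [box_of_mem hx, sub_self, mul_zero]
      · rw [hφ, bump_eq_zero, zero_mul]
        rw [sub_zero, abs_div, abs_of_pos this, le_div_iff₀ this]; linarith)
  have hcomm : ∀ n, (lift h .center T * cSeq p h φ - cSeq p h φ * lift h .center T) n
      = T * cSeq p h φ n - cSeq p h φ n * T := fun n => by
    rw [OpSeq.sub_apply, OpSeq.mul_apply, OpSeq.mul_apply, lift_apply, E_center]
  refine pBounded_of_P (fun m => ?_) fun m => ?_
  · refine tendsto_of_antitone_subseq (f := fun n => ‖P p m * T * (1 - P p n)‖)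
      (fun n n' hn => norm_mul_one_sub_P_antitone _ hn) (fun _ => norm_nonneg _) (h := h) ?_
    refine squeeze_zero' (.of_forall fun _ => norm_nonneg _) ?_ (hJ m).1
    filter_upwards [hφ1 m] with n hn
    rw [hcomm]
    have e : P p m * T * (1 - P p (h n)) = -(P p m * (T * cSeq p h φ n - cSeq p h φ n * T))
        * (1 - P p (h n)) := by
      have e2 : -(P p m * (T * cSeq p h φ n - cSeq p h φ n * T)) * (1 - P p (h n))
        = P p m * cSeq p h φ n * T * (1 - P p (h n))
          - P p m * T * (cSeq p h φ n * (1 - P p (h n))) := by noncomm_ring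
      rw [e2, hφ2, mul_zero, sub_zero, hn]
    rw [e]
    refine (norm_mul_le _ _).trans ?_
    rw [norm_neg]
    exact mul_le_of_le_one_right (norm_nonneg _) (norm_one_sub_P_le _)
  · refine tendsto_of_antitone_subseq (f := fun n => ‖(1 - P p n) * T * P p m‖)
      (fun n n' hn => by
        dsimp only
        rw [mul_assoc, mul_assoc]; exact norm_one_sub_P_mul_antitone _ hn) (fun _ => norm_nonneg _)
      (h := h) ?_
    refine squeeze_zero' (.of_forall fun _ => norm_nonneg _) ?_ (hJ m).2
    filter_upwards [hφ1 m] with n hn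
    rw [hcomm]
    have hn' : cSeq p h φ n * P p m = P p m := by
      rw [(isMul_cSeq h φ n).commute (isMul_P m), hn]
    have hφ2' : (1 - P p (h n)) * cSeq p h φ n = 0 := by
      rw [(isMul_one_sub_P (h n)).commute (isMul_cSeq h φ n), hφ2]
    have e : (1 - P p (h n)) * T * P p m = (1 - P p (h n)) *
        ((T * cSeq p h φ n - cSeq p h φ n * T) * P p m) := by
      have e2 : (1 - P p (h n)) * ((T * cSeq p h φ n - cSeq p h φ n * T) * P p m)
        = (1 - P p (h n)) * T * (cSeq p h φ n * P p m)
          - (1 - P p (h n)) * cSeq p h φ n * (T * P p m) := by noncomm_ring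
      rw [e2, hφ2', zero_mul, sub_zero, hn']
    rw [e]
    refine (norm_mul_le _ _).trans ?_
    exact mul_le_of_le_one_left (norm_nonneg _) (norm_one_sub_P_le _)

/-! ## Convolutions are of local type -/

theorem exists_between_bddOn (hp1 : 1 < p) (hp : p ≠ ∞) {b : Linf} (hb : b ∈ Mnear p) {R : Op 2}
    (hR : IsFM R b) : ∃ r, ∃ C : ℝ≥0, Between p r ∧ BddOn r C R := by
  have h1 := one_lt_toReal hp1 hp
  by_cases h2 : p = 2
  · exact ⟨2, ‖b‖₊, Or.inl ⟨h2, rfl⟩,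
      bddOn_two (hR.norm_le (norm_nonneg _) (ae_norm_le_norm b))⟩
  obtain ⟨-, δ, hδ, hM⟩ := hb.resolve_left h2
  rcases lt_or_gt_of_ne h2 with h3 | h3
  · set r := max ((1 + p.toReal) / 2) (p.toReal - δ / 2) with hr
    have r1 : 1 < r := lt_max_of_lt_left (by linarith)
    have r2 : r < p.toReal := max_lt (by linarith) (by linarith)
    have r3 : p.toReal - δ / 2 ≤ r := le_max_right _ _
    obtain ⟨C, hC⟩ := (isMultiplier_iff hR _).1 (hM r r1 (by rw [abs_lt]; constructor <;> linarith))
    refine ⟨_, C, Or.inr (Or.inr ⟨?_, ?_, h3⟩), hC⟩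
    · rw [ENNReal.one_le_ofReal]; exact r1.le
    · rwa [ENNReal.ofReal_lt_iff_lt_toReal (by linarith) hp]
  · obtain ⟨C, hC⟩ := (isMultiplier_iff hR _).1 (hM (p.toReal + δ / 2) (by linarith)
      (by rw [add_sub_cancel_left, abs_of_pos (half_pos hδ)]; exact half_lt_self hδ))
    refine ⟨_, C, Or.inr (Or.inl ⟨h3, ?_, ENNReal.ofReal_ne_top⟩), hC⟩
    rw [ENNReal.lt_ofReal_iff_toReal_lt hp]; linarith

/-- Convolutions commute with shifts. -/
theorem Einv_eq_self_of_isFM (hp : p ≠ ∞) {T : Op p} {R : Op 2} {f : ℝ → ℂ} (hTR : Compat T R)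
    (hR : IsFM R f) {t : Dir} (ht : ∀ s, t ≠ .freq s) (n : ℕ+) : Einv n t T = T := by
  have h1 := hTR.Einv n t
  have h2 : Einv n t R = R := by
    cases t with
    | freq s => exact absurd rfl (ht s)
    | center => exact (E_center n R ▸ Einv_E n .center R :)
    | minus =>
      rw [Einv_eq_conj, show frame 2 n .minus = V 2 (-(n : ℝ)) from rfl, V_symm]
      exact hR.V _
    | plus =>
      rw [Einv_eq_conj, show frame 2 n .plus = V 2 (n : ℝ) from rfl, V_symm]
      exact hR.V _
  rw [h2] at h1
  exact h1.unique hp hTR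

theorem convolution_mem_localType (hp1 : 1 < p) (hp : p ≠ ∞) {lam : ℝ} {b : Linf}
    (hb : IsSymbol lam b) {T : Op p} {R : Op 2} (hTR : Compat T R) (hR : IsFM R b) {r : ℝ≥0∞}
    (hr : Between p r) {C : ℝ≥0} (hC : BddOn r C R) {h : ℕ+ → ℕ+}
    (hh : Tendsto (fun n => (h n : ℝ)) atTop atTop)
    (hlim : ∀ t, ∃ c d, SymLim (fun n x => b ((h n : ℝ)⁻¹ * x + t)) c d) :
    lift h .center T ∈ localType p h ∧ T ∈ PBounded p := by
  have hW : ∀ t, ∃ W, StarStrongTendsto (fun n => Einv (h n) (.freq t) T) W := by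
    intro t
    obtain ⟨c, d, hcd⟩ := hlim t
    obtain ⟨S, hS⟩ := exists_isFM (stronglyMeasurable_step c d).aestronglyMeasurable
      (.of_forall (norm_step_le c d))
    obtain ⟨h1, h2⟩ := starStrong_two hR hcd hS
    exact exists_starStrong hp1 hp hr (fun n => hTR.Einv (h n) _) (fun n => hC.Einv (h n) _)
      (fun n => norm_Einv_le _ _ T) h1 h2
  have hcomm : ∀ φ, φ ∈ commutants h (lift h .center T) := by
    refine commutants_eq_top fun L σ hL hσ => mem_commutants.2 (Jfreq_of_near fun η hη => ?_)
    obtain ⟨N, hN⟩ := exists_isMul_continuous (p := p) (expC L σ hL hσ)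
    obtain ⟨W, hW⟩ := hW lam
    obtain ⟨K, hK, hev⟩ := hb.exists_compact_near_commutator hp1 hp hTR hR hr hC hh hlim hW hL.le hσ hN hη
    refine ⟨lift h (.freq lam) K, Jfreq_of_lift h hK, ?_⟩
    filter_upwards [hev] with n hn
    rwa [OpSeq.sub_apply, OpSeq.mul_apply, OpSeq.mul_apply, lift_apply, lift_apply, E_center,
      ← E_freq_eq_cSeq hN h n lam]
  have hPB := pBounded_of_commutants hp1 hp hh hcomm
  refine ⟨⟨fun t => ?_, fun φ => Jfreq_le h (hcomm φ)⟩, hPB⟩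
  have hconst : ∀ t : Dir, (∀ s, t ≠ .freq s) →
      PStrongTendsto (fun n => Einv (h n) t (lift h .center T n)) T := by
    intro t ht K _
    simp only [lift_apply, E_center, Einv_eq_self_of_isFM hp hTR hR ht, sub_self, mul_zero, zero_mul,
      norm_zero, add_zero]
    exact tendsto_const_nhds
  cases t with
  | freq s =>
    obtain ⟨W, hW⟩ := hW s
    refine ⟨W, ?_⟩
    simpa only [HasSnapshot, lift_apply, E_center] using hW
  | minus => exact ⟨T, hconst _ (by simp), hPB⟩
  | center => exact ⟨T, hconst _ (by simp), hPB⟩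
  | plus => exact ⟨T, hconst _ (by simp), hPB⟩

/-! ## Snapshots: uniqueness, bounds, closedness -/

/-- The directions `-`, `c`, `+`. -/
def Dir.IsShift (t : Dir) : Prop := ∀ s, t ≠ .freq s

theorem hasSnapshot_iff {h : ℕ+ → ℕ+} {A : OpSeq p} {t : Dir} (ht : t.IsShift) {W : Op p} :
    HasSnapshot h A t W ↔ PStrongTendsto (fun n => Einv (h n) t (A n)) W ∧ W ∈ PBounded p := by
  cases t with
  | freq s => exact absurd rfl (ht s)
  | _ => exact Iff.rfl

theorem compactAt_eq {t : Dir} (ht : t.IsShift) : compactAt p t = PCompact p := by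
  cases t with
  | freq s => exact absurd rfl (ht s)
  | _ => rfl

theorem PStrongTendsto.tendsto_P_mul {A : ℕ+ → Op p} {W : Op p} (hA : PStrongTendsto A W) (m : ℕ+) :
    Tendsto (fun n => P p m * A n) atTop (𝓝 (P p m * W)) := by
  rw [tendsto_iff_norm_sub_tendsto_zero]
  refine squeeze_zero (fun _ => norm_nonneg _) (fun n => ?_) (hA _ (P_mem_PCompact m))
  rw [← mul_sub]
  exact le_add_of_nonneg_right (norm_nonneg _)

theorem norm_le_of_P_mul (hp : p ≠ ∞) {W : Op p} {c : ℝ} (hc : 0 ≤ c) (h : ∀ m, ‖P p m * W‖ ≤ c) :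
    ‖W‖ ≤ c := by
  refine ContinuousLinearMap.opNorm_le_bound _ hc fun u => ?_
  refine le_of_tendsto (tendsto_P_apply hp (W u)).norm (.of_forall fun m => ?_)
  exact ((P p m * W).le_of_opNorm_le (h m) u)

theorem PStrongTendsto.norm_le (hp : p ≠ ∞) {A : ℕ+ → Op p} {W : Op p} (hA : PStrongTendsto A W)
    {c : ℝ} (hc : ∀ n, ‖A n‖ ≤ c) : ‖W‖ ≤ c := by
  have c0 : 0 ≤ c := (norm_nonneg _).trans (hc 1)
  refine norm_le_of_P_mul hp c0 fun m => ?_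
  refine le_of_tendsto (hA.tendsto_P_mul m).norm (.of_forall fun n => ?_)
  exact (norm_mul_le _ _).trans ((mul_le_of_le_one_left (norm_nonneg _) (norm_P_le m)).trans (hc n))

theorem HasSnapshot.norm_le (hp : p ≠ ∞) {h : ℕ+ → ℕ+} {A : OpSeq p} {t : Dir} {W : Op p}
    (hA : HasSnapshot h A t W) : ‖W‖ ≤ ‖A‖ := by
  have hn : ∀ n, ‖Einv (h n) t (A n)‖ ≤ ‖A‖ := fun n =>
    (norm_Einv_le _ _ _).trans (A.norm_apply_le n)
  cases t with
  | freq s =>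
    refine ContinuousLinearMap.opNorm_le_bound _ (norm_nonneg _) fun u => ?_
    exact le_of_tendsto (hA.1 u).norm (.of_forall fun n => ContinuousLinearMap.le_of_opNorm_le _ (hn n) u)
  | _ => exact hA.1.norm_le hp hn

theorem HasSnapshot.smul {h : ℕ+ → ℕ+} {A : OpSeq p} {t : Dir} {W : Op p}
    (hA : HasSnapshot h A t W) (c : ℂ) : HasSnapshot h (c • A) t (c • W) := by
  have := (hasSnapshot_scalar (p := p) h t c).mul hA
  rwa [Algebra.algebraMap_eq_smul_one, Algebra.algebraMap_eq_smul_one, smul_mul_assoc, one_mul,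
    smul_mul_assoc, one_mul] at this

theorem HasSnapshot.sub {h : ℕ+ → ℕ+} {A B : OpSeq p} {t : Dir} {W W' : Op p}
    (hA : HasSnapshot h A t W) (hB : HasSnapshot h B t W') : HasSnapshot h (A - B) t (W - W') := by
  have := hA.add (hB.smul (-1))
  rwa [neg_one_smul, neg_one_smul, ← sub_eq_add_neg, ← sub_eq_add_neg] at this

theorem HasSnapshot.unique (hp : p ≠ ∞) {h : ℕ+ → ℕ+} {A : OpSeq p} {t : Dir} {W W' : Op p}
    (hA : HasSnapshot h A t W) (hA' : HasSnapshot h A t W') : W = W' := by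
  have := (hA.sub hA').norm_le hp
  rw [sub_self, norm_zero] at this
  exact sub_eq_zero.1 (norm_le_zero_iff.1 this)

theorem snapshot_eq (hp : p ≠ ∞) {h : ℕ+ → ℕ+} {A : OpSeq p} {t : Dir} {W : Op p}
    (hA : HasSnapshot h A t W) : snapshot h A t = W := by
  have hex : ∃ W, HasSnapshot h A t W := ⟨W, hA⟩
  rw [snapshot, dif_pos hex]
  exact hex.choose_spec.unique hp hA

theorem isClosed_PCompact : IsClosed (PCompact p) := by
  refine isClosed_of_closure_subset fun K hK => ?_
  rw [Metric.mem_closure_iff] at hK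
  constructor <;>
  · rw [Metric.tendsto_nhds]
    intro ε hε
    obtain ⟨L, hL, hd⟩ := hK (ε / 2) (half_pos hε)
    rw [dist_eq_norm] at hd
    filter_upwards [hL.1.eventually_lt_const (half_pos hε), hL.2.eventually_lt_const (half_pos hε)]
      with n h1 h2
    rw [dist_zero_right, norm_norm]
    have hq := norm_one_sub_P_le (p := p) n
    have e1 : K * (1 - P p n) = L * (1 - P p n) + (K - L) * (1 - P p n) := by noncomm_ring
    have e2 : (1 - P p n) * K = (1 - P p n) * L + (1 - P p n) * (K - L) := by noncomm_ring
    have i1 : ‖(K - L) * (1 - P p n)‖ ≤ ‖K - L‖ :=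
      (norm_mul_le _ _).trans (mul_le_of_le_one_right (norm_nonneg _) hq)
    have i2 : ‖(1 - P p n) * (K - L)‖ ≤ ‖K - L‖ :=
      (norm_mul_le _ _).trans (mul_le_of_le_one_left (norm_nonneg _) hq)
    first
    | rw [e1]; linarith [norm_add_le (L * (1 - P p n)) ((K - L) * (1 - P p n))]
    | rw [e2]; linarith [norm_add_le ((1 - P p n) * L) ((1 - P p n) * (K - L))]

theorem isClosed_PBounded : IsClosed (PBounded p) := by
  have : PBounded p = ⋂ K ∈ PCompact p, {A | A * K ∈ PCompact p} ∩ {A | K * A ∈ PCompact p} := by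
    ext A; simp [PBounded, forall_and]
  rw [this]
  exact isClosed_biInter fun K _ => (isClosed_PCompact.preimage (continuous_mul_const K)).inter
    (isClosed_PCompact.preimage (continuous_const_mul K))

theorem hasSnapshot_of_tendsto {h : ℕ+ → ℕ+} {A : ℕ → OpSeq p} {B : OpSeq p} {t : Dir}
    {W : ℕ → Op p} {V : Op p} (hA : ∀ k, HasSnapshot h (A k) t (W k))
    (hB : Tendsto A atTop (𝓝 B)) (hV : Tendsto W atTop (𝓝 V)) : HasSnapshot h B t V := by
  have near : ∀ ε : ℝ, 0 < ε → ∃ k, (∀ n, ‖Einv (h n) t (B n) - Einv (h n) t (A k n)‖ ≤ ε) ∧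
      ‖V - W k‖ ≤ ε := by
    intro ε hε
    obtain ⟨k, h1, h2⟩ := (((tendsto_iff_norm_sub_tendsto_zero.1 hB).eventually_le_const hε).and
      ((tendsto_iff_norm_sub_tendsto_zero.1 hV).eventually_le_const hε)).exists
    refine ⟨k, fun n => ?_, by rwa [norm_sub_rev]⟩
    rw [← Einv_sub]
    refine (norm_Einv_le _ _ _).trans ?_
    rw [norm_sub_rev]
    exact (OpSeq.norm_apply_le (A k - B) n).trans h1
  have bound : ∀ ε : ℝ, 0 < ε → ∃ k, ∀ n, ‖(Einv (h n) t (B n) - V)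
      - (Einv (h n) t (A k n) - W k)‖ ≤ ε := by
    intro ε hε
    obtain ⟨k, h1, h2⟩ := near (ε / 2) (half_pos hε)
    refine ⟨k, fun n => ?_⟩
    rw [sub_sub_sub_comm]
    exact (norm_sub_le _ _).trans (by linarith [h1 n])
  have shift : (∀ k, PStrongTendsto (fun n => Einv (h n) t (A k n)) (W k)) →
      PStrongTendsto (fun n => Einv (h n) t (B n)) V := by
    intro hk K hK
    rw [Metric.tendsto_nhds]
    intro ε hε
    obtain ⟨k, h1⟩ := bound (ε / (4 * (‖K‖ + 1))) (by positivity)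
    filter_upwards [(hk k K hK).eventually_lt_const (half_pos hε)] with n hn
    rw [dist_zero_right, Real.norm_of_nonneg (by positivity)]
    set X := Einv (h n) t (B n) - V
    set Y := Einv (h n) t (A k n) - W k
    have e1 : K * X = K * Y + K * (X - Y) := by noncomm_ring
    have e2 : X * K = Y * K + (X - Y) * K := by noncomm_ring
    have i0 : (‖K‖ + 1) * (ε / (4 * (‖K‖ + 1))) = ε / 4 := by field_simp
    have i1 : ‖K * (X - Y)‖ ≤ (‖K‖ + 1) * (ε / (4 * (‖K‖ + 1))) :=
      (norm_mul_le _ _).trans (mul_le_mul (by linarith) (h1 n) (norm_nonneg _) (by positivity))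
    have i2 : ‖(X - Y) * K‖ ≤ (‖K‖ + 1) * (ε / (4 * (‖K‖ + 1))) := by
      rw [mul_comm (‖K‖ + 1)]
      exact (norm_mul_le _ _).trans (mul_le_mul (h1 n) (by linarith) (norm_nonneg _) (by positivity))
    have i3 := norm_add_le (K * Y) (K * (X - Y))
    have i4 := norm_add_le (Y * K) ((X - Y) * K)
    rw [← e1] at i3
    rw [← e2] at i4
    linarith
  cases t with
  | freq s =>
    constructor
    · intro u
      rw [tendsto_iff_norm_sub_tendsto_zero, Metric.tendsto_nhds]
      intro ε hε
      obtain ⟨k, h1⟩ := bound (ε / (2 * (‖u‖ + 1))) (by positivity)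
      have h2 := tendsto_iff_norm_sub_tendsto_zero.1 ((hA k).1 u)
      filter_upwards [h2.eventually_lt_const (half_pos hε)] with n hn
      rw [dist_zero_right, norm_norm]
      set X := Einv (h n) (.freq s) (B n) - V with hX
      set Y := Einv (h n) (.freq s) (A k n) - W k with hY
      change ‖X u‖ < ε
      change ‖Y u‖ < ε / 2 at hn
      have e1 : X u = Y u + (X - Y) u := by simp
      have i1 : ‖(X - Y) u‖ ≤ (ε / (2 * (‖u‖ + 1))) * (‖u‖ + 1) :=
        ((X - Y).le_of_opNorm_le (h1 n) u).trans (by gcongr; linarith)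
      have i0 : (ε / (2 * (‖u‖ + 1))) * (‖u‖ + 1) = ε / 2 := by field_simp
      rw [e1]
      linarith [norm_add_le (Y u) ((X - Y) u)]
    · intro f
      rw [tendsto_iff_norm_sub_tendsto_zero, Metric.tendsto_nhds]
      intro ε hε
      obtain ⟨k, h1⟩ := bound (ε / (2 * (‖f‖ + 1))) (by positivity)
      have h2 := tendsto_iff_norm_sub_tendsto_zero.1 ((hA k).2 f)
      filter_upwards [h2.eventually_lt_const (half_pos hε)] with n hn
      rw [dist_zero_right, norm_norm]
      rw [← ContinuousLinearMap.comp_sub] at hn ⊢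
      set X := Einv (h n) (.freq s) (B n) - V with hX
      set Y := Einv (h n) (.freq s) (A k n) - W k with hY
      have e1 : f.comp X = f.comp Y + f.comp (X - Y) := by
        rw [← ContinuousLinearMap.comp_add, add_sub_cancel]
      have i1 : ‖f.comp (X - Y)‖ ≤ (‖f‖ + 1) * (ε / (2 * (‖f‖ + 1))) :=
        (ContinuousLinearMap.opNorm_comp_le _ _).trans
          (mul_le_mul (by linarith) (h1 n) (norm_nonneg _) (by positivity))
      have i0 : (‖f‖ + 1) * (ε / (2 * (‖f‖ + 1))) = ε / 2 := by field_simp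
      rw [e1]
      linarith [norm_add_le (f.comp Y) (f.comp (X - Y))]
  | _ =>
    exact ⟨shift fun k => (hA k).1, isClosed_PBounded.mem_of_tendsto hV (.of_forall fun k => (hA k).2)⟩

theorem cauchySeq_snapshot (hp : p ≠ ∞) {h : ℕ+ → ℕ+} {A : ℕ → OpSeq p} {t : Dir}
    {W : ℕ → Op p} (hA : ∀ k, HasSnapshot h (A k) t (W k)) (hB : CauchySeq A) : CauchySeq W := by
  rw [Metric.cauchySeq_iff] at hB ⊢
  intro ε hε
  obtain ⟨N, hN⟩ := hB ε hε
  refine ⟨N, fun m hm n hn => lt_of_le_of_lt ?_ (hN m hm n hn)⟩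
  rw [dist_eq_norm, dist_eq_norm]
  exact ((hA m).sub (hA n)).norm_le hp

theorem isClosed_structured (hp : p ≠ ∞) (h : ℕ+ → ℕ+) : IsClosed (structured p h : Set (OpSeq p)) := by
  refine isClosed_of_closure_subset fun B hB t => ?_
  obtain ⟨A, hA, hlim⟩ := mem_closure_iff_seq_limit.1 hB
  choose W hW using fun k => (hA k : ∀ t, ∃ W, HasSnapshot h (A k) t W) t
  obtain ⟨V, hV⟩ := cauchySeq_tendsto_of_complete (cauchySeq_snapshot hp hW hlim.cauchySeq)
  exact ⟨V, hasSnapshot_of_tendsto hW hlim hV⟩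

theorem isClosed_localType (hp : p ≠ ∞) (h : ℕ+ → ℕ+) : IsClosed (localType p h : Set (OpSeq p)) := by
  have e : (localType p h : Set (OpSeq p)) = (structured p h : Set (OpSeq p)) ∩
      ⋂ φ : C(OnePoint ℝ, ℂ), {A | A * cSeq p h φ - cSeq p h φ * A ∈ J p h} := by
    ext A
    rw [mem_inter_iff, mem_iInter]
    exact Iff.rfl
  rw [e]
  exact (isClosed_structured hp h).inter (isClosed_iInter fun φ =>
    (J_isClosed h).preimage ((continuous_mul_const (cSeq p h φ)).sub (continuous_const_mul _)))

/-! ## Lifted sequences -/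

theorem lift_add (h : ℕ+ → ℕ+) (t : Dir) (A B : Op p) : lift h t (A + B) = lift h t A + lift h t B :=
  OpSeq.ext fun _ => E_add _ _ _ _

theorem lift_sub (h : ℕ+ → ℕ+) (t : Dir) (A B : Op p) : lift h t (A - B) = lift h t A - lift h t B :=
  OpSeq.ext fun _ => E_sub _ _ _ _

theorem lift_mul (h : ℕ+ → ℕ+) (t : Dir) (A B : Op p) : lift h t (A * B) = lift h t A * lift h t B :=
  OpSeq.ext fun _ => E_mul_E _ _ _ _

theorem lift_smul (h : ℕ+ → ℕ+) (t : Dir) (c : ℂ) (A : Op p) : lift h t (c • A) = c • lift h t A :=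
  OpSeq.ext fun _ => E_smul _ _ _ _

theorem lift_one (h : ℕ+ → ℕ+) (t : Dir) : lift h t (1 : Op p) = 1 :=
  OpSeq.ext fun _ => E_one _ _

theorem norm_lift_le (h : ℕ+ → ℕ+) (t : Dir) (A : Op p) : ‖lift h t A‖ ≤ ‖A‖ :=
  OpSeq.norm_le (norm_nonneg _) fun _ => norm_E_le _ _ _

theorem continuous_lift (h : ℕ+ → ℕ+) (t : Dir) : Continuous (lift (p := p) h t) := by
  refine (LipschitzWith.of_dist_le_mul (K := 1) fun A B => ?_).continuous
  rw [dist_eq_norm, dist_eq_norm, ← lift_sub, NNReal.coe_one, one_mul]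
  exact norm_lift_le h t _

theorem hasSnapshot_lift_self {h : ℕ+ → ℕ+} {t : Dir} (ht : t.IsShift) {W : Op p} (hW : W ∈ PBounded p) :
    HasSnapshot h (lift h t W) t W := by
  rw [hasSnapshot_iff ht]
  refine ⟨fun K _ => ?_, hW⟩
  simp only [lift_apply, Einv_E, sub_self, mul_zero, zero_mul, norm_zero, add_zero]
  exact tendsto_const_nhds

theorem pCompact_mul {K : Op p} (hK : K ∈ PCompact p) {L : Op p} (hL : L ∈ PCompact p) :
    K * L ∈ PCompact p := by
  constructor
  · refine squeeze_zero (fun _ => norm_nonneg _) (fun n => ?_) (by simpa using hL.1.const_mul ‖K‖)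
    rw [mul_assoc]; exact norm_mul_le _ _
  · refine squeeze_zero (fun _ => norm_nonneg _) (fun n => ?_) (by simpa using hK.2.mul_const ‖L‖)
    rw [← mul_assoc]; exact norm_mul_le _ _

theorem PCompact_subset : PCompact p ⊆ PBounded p := fun _ hK _ hL =>
  ⟨pCompact_mul hK hL, pCompact_mul hL hK⟩

theorem zero_mem_PBounded : (0 : Op p) ∈ PBounded p := by
  have := pBounded_scalar (p := p) 0
  rwa [map_zero] at this

theorem isMul_Einv_E_P (h : ℕ+ → ℕ+) (s t : Dir) (m n : ℕ+) :
    IsMul (Einv (h n) s (E (h n) t (P p m))) fun x => box m (t.act (h n) (s.actInv (h n) x)) :=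
  ((isMul_P m).E (h n) t).Einv (h n) s

/-- A lifted `P`-compact operator is invisible from the other directions. -/
theorem hasSnapshot_lift_zero (hp1 : 1 < p) (hp : p ≠ ∞) {h : ℕ+ → ℕ+}
    (hh : Tendsto (fun n => (h n : ℝ)) atTop atTop) {t : Dir} (ht : t.IsShift) {K : Op p}
    (hK : K ∈ PCompact p) {s : Dir} (hs : s ≠ t) : HasSnapshot h (lift h t K) s 0 := by
  have shift : s.IsShift → HasSnapshot h (lift h t K) s 0 := by
    intro hs'
    rw [hasSnapshot_iff hs']
    have disj : ∀ m k : ℕ+, ∀ᶠ n in atTop, Einv (h n) t (E (h n) s (P p m)) * P p k = 0 := by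
      intro m k
      filter_upwards [hh.eventually_gt_atTop ((m : ℝ) + k)] with n hn
      refine ((isMul_Einv_E_P h t s m n).mul (isMul_P k)).ext isMul_zero (.of_forall fun x => ?_)
      dsimp only
      rcases le_or_gt |x| k with hx | hx
      · rw [box_of_notMem, zero_mul]
        have hk := pnat_pos k
        have hm := pnat_pos m
        obtain ⟨hx1, hx2⟩ := abs_le.1 hx
        rw [lt_abs]
        cases s with
        | freq s => exact absurd rfl (hs' s)
        | _ =>
          cases t with
          | freq t => exact absurd rfl (ht t)
          | _ =>
            first
            | exact absurd rfl hs
            | left; simp only [Dir.act, Dir.actInv]; linarith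
            | right; simp only [Dir.act, Dir.actInv]; linarith
      · rw [box_of_notMem hx, mul_zero]
    have disj' : ∀ m k : ℕ+, ∀ᶠ n in atTop, P p k * Einv (h n) t (E (h n) s (P p m)) = 0 := by
      intro m k
      filter_upwards [disj m k] with n hn
      rwa [(isMul_P k).commute (isMul_Einv_E_P h t s m n)]
    have hQ : ∀ m n, ‖Einv (h n) t (E (h n) s (P p m))‖ ≤ 1 := fun m n =>
      (norm_Einv_le _ _ _).trans ((norm_E_le _ _ _).trans (norm_P_le m))
    refine ⟨pStrong_of_P (c := ‖K‖) (fun n => (norm_Einv_le _ _ _).trans (norm_E_le _ _ _))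
      (fun m => ?_) (fun m => ?_), zero_mem_PBounded⟩
    · rw [Metric.tendsto_nhds]
      intro ε hε
      obtain ⟨k, hk⟩ := (hK.2.eventually_lt_const hε).exists
      filter_upwards [disj m k] with n hn
      have e : ‖P p m * (Einv (h n) s (E (h n) t K) - 0)‖
          = ‖Einv (h n) t (E (h n) s (P p m)) * ((1 - P p k) * K)‖ := by
        rw [sub_zero, ← norm_E (h n) s, E_mul_E, E_Einv, mul_E, norm_E]
        congr 1
        rw [sub_mul, one_mul, mul_sub, ← mul_assoc _ (P p k), hn, zero_mul, sub_zero]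
      rw [dist_zero_right, norm_norm, lift_apply, e]
      refine lt_of_le_of_lt ((norm_mul_le _ _).trans ?_) hk
      exact mul_le_of_le_one_left (norm_nonneg _) (hQ m n)
    · rw [Metric.tendsto_nhds]
      intro ε hε
      obtain ⟨k, hk⟩ := (hK.1.eventually_lt_const hε).exists
      filter_upwards [disj' m k] with n hn
      have e : ‖(Einv (h n) s (E (h n) t K) - 0) * P p m‖
          = ‖K * (1 - P p k) * Einv (h n) t (E (h n) s (P p m))‖ := by
        rw [sub_zero, ← norm_E (h n) s, E_mul_E, E_Einv, E_mul, norm_E]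
        congr 1
        rw [mul_sub, mul_one, sub_mul, mul_assoc K, hn, mul_zero, sub_zero]
      rw [dist_zero_right, norm_norm, lift_apply, e]
      refine lt_of_le_of_lt ((norm_mul_le _ _).trans ?_) hk
      exact mul_le_of_le_one_right (norm_nonneg _) (hQ m n)
  cases s with
  | freq s =>
    have hm : ∀ k n, IsMul (Einv (h n) (.freq s) (E (h n) t (P p k)))
        fun x => box k (t.act (h n) ((h n : ℝ) * x)) := fun k n => isMul_Einv_E_P h (.freq s) t k n
    have hC : ∀ k n, ∀ᵐ x, ‖box k (t.act (h n) ((h n : ℝ) * x))‖ ≤ 1 := fun k n =>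
      .of_forall fun x => norm_box_le _ _
    have h0 : ∀ k : ℕ+, ∀ᵐ x : ℝ, Tendsto (fun n => box k (t.act (h n) ((h n : ℝ) * x))) atTop (𝓝 0) := by
      intro k
      obtain ⟨a, ha⟩ : ∃ a : ℝ, ∀ n x, t.act (h n) ((h n : ℝ) * x) = h n * (x - a) := by
        cases t with
        | freq t => exact absurd rfl (ht t)
        | minus => exact ⟨-1, fun n x => by simp only [Dir.act]; ring⟩
        | center => exact ⟨0, fun n x => by simp only [Dir.act]; ring⟩
        | plus => exact ⟨1, fun n x => by simp only [Dir.act]; ring⟩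
      have : ∀ᵐ x : ℝ, x ≠ a := by
        rw [ae_iff]
        simp
      filter_upwards [this] with x hx
      refine tendsto_const_nhds.congr' ?_
      have h1 : Tendsto (fun n => (h n : ℝ) * |x - a|) atTop atTop :=
        hh.atTop_mul_const (abs_pos.2 (sub_ne_zero.2 hx))
      filter_upwards [h1.eventually_gt_atTop (k : ℝ)] with n hn
      rw [ha, box_of_notMem]
      rwa [abs_mul, abs_of_pos (pnat_pos _)]
    set G : ℕ+ → Op p := fun n => Einv (h n) (.freq s) (E (h n) t K) with hG
    set Q : ℕ+ → ℕ+ → Op p := fun k n => Einv (h n) (.freq s) (E (h n) t (P p k)) with hQ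
    have hGQ : ∀ k n, G n - G n * Q k n = Einv (h n) (.freq s) (E (h n) t (K * (1 - P p k))) := by
      intro k n
      rw [mul_sub, mul_one, E_sub, Einv_sub, E_mul_E, Einv_mul]
    have hQG : ∀ k n, G n - Q k n * G n = Einv (h n) (.freq s) (E (h n) t ((1 - P p k) * K)) := by
      intro k n
      rw [sub_mul, one_mul, E_sub, Einv_sub, E_mul_E, Einv_mul]
    have nG : ∀ n, ‖G n‖ ≤ ‖K‖ := fun n => (norm_Einv_le _ _ _).trans (norm_E_le _ _ _)
    constructor
    · intro u
      change Tendsto (fun n => G n u) atTop (𝓝 ((0 : Op p) u))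
      rw [_root_.zero_apply, tendsto_zero_iff_norm_tendsto_zero, Metric.tendsto_nhds]
      intro ε hε
      obtain ⟨k, hk⟩ := ((hK.1.mul_const ‖u‖).eventually_lt_const
        (show 0 * ‖u‖ < ε / 2 by rw [zero_mul]; exact half_pos hε)).exists
      have h1 := ((tendsto_isMul_apply hp (hm k) (hC k) (h0 k) u).norm.const_mul ‖K‖).eventually_lt_const
        (show ‖K‖ * ‖(0 : X p)‖ < ε / 2 by rw [norm_zero, mul_zero]; exact half_pos hε)
      filter_upwards [h1] with n hn
      rw [dist_zero_right, norm_norm]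
      have e : G n u = (G n - G n * Q k n) u + G n (Q k n u) := by simp
      have i1 : ‖(G n - G n * Q k n) u‖ ≤ ‖K * (1 - P p k)‖ * ‖u‖ := by
        rw [hGQ]
        exact ContinuousLinearMap.le_of_opNorm_le _ ((norm_Einv_le _ _ _).trans (norm_E_le _ _ _)) u
      have i2 : ‖G n (Q k n u)‖ ≤ ‖K‖ * ‖Q k n u‖ := ContinuousLinearMap.le_of_opNorm_le _ (nG n) _
      rw [e]
      linarith [norm_add_le ((G n - G n * Q k n) u) (G n (Q k n u))]
    · intro f
      change Tendsto (fun n => f.comp (G n)) atTop (𝓝 (f.comp (0 : Op p)))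
      rw [ContinuousLinearMap.comp_zero, tendsto_zero_iff_norm_tendsto_zero, Metric.tendsto_nhds]
      intro ε hε
      obtain ⟨k, hk⟩ := ((hK.2.const_mul ‖f‖).eventually_lt_const
        (show ‖f‖ * 0 < ε / 2 by rw [mul_zero]; exact half_pos hε)).exists
      have h1 := ((tendsto_dual_comp_isMul hp1 hp (hm k) (hC k) (h0 k) f).norm.mul_const
        ‖K‖).eventually_lt_const
        (show ‖(0 : StrongDual ℂ (X p))‖ * ‖K‖ < ε / 2 by rw [norm_zero, zero_mul]; exact half_pos hε)
      filter_upwards [h1] with n hn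
      rw [dist_zero_right, norm_norm]
      have e : f.comp (G n) = f.comp (G n - Q k n * G n) + (f.comp (Q k n)).comp (G n) := by
        ext u; simp
      have i1 : ‖f.comp (G n - Q k n * G n)‖ ≤ ‖f‖ * ‖(1 - P p k) * K‖ := by
        rw [hQG]
        refine (ContinuousLinearMap.opNorm_comp_le _ _).trans ?_
        gcongr
        exact (norm_Einv_le _ _ _).trans (norm_E_le _ _ _)
      have i2 : ‖(f.comp (Q k n)).comp (G n)‖ ≤ ‖f.comp (Q k n)‖ * ‖K‖ :=
        (ContinuousLinearMap.opNorm_comp_le _ _).trans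
          (mul_le_mul_of_nonneg_left (nG n) (norm_nonneg _))
      rw [e]
      linarith [norm_add_le (f.comp (G n - Q k n * G n)) ((f.comp (Q k n)).comp (G n))]
  | _ => exact shift (by simp [Dir.IsShift])

/-! ## The local ideals -/

theorem mem_localType_iff {h : ℕ+ → ℕ+} {A : OpSeq p} : A ∈ localType p h ↔
    (∀ t, ∃ W, HasSnapshot h A t W) ∧ ∀ φ, A * cSeq p h φ - cSeq p h φ * A ∈ J p h := Iff.rfl

theorem tendsto_cast_of_strictMono {h : ℕ+ → ℕ+} (hh : StrictMono h) :
    Tendsto (fun n => (h n : ℝ)) atTop atTop :=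
  tendsto_pnat_cast.comp (tendsto_atTop_mono (fun _ => hh.le_apply) tendsto_id)

/-- The position at which a direction looks. -/
def Dir.pos : Dir → ℝ
  | .minus => -1
  | .plus => 1
  | _ => 0

theorem Dir.actInv_div {t : Dir} (ht : t.IsShift) (n : ℕ+) (x : ℝ) :
    t.actInv n x / n = t.pos + x / n := by
  have := pnat_pos n
  cases t with
  | freq s => exact absurd rfl (ht s)
  | _ => simp only [Dir.actInv, Dir.pos]; field_simp; try ring

theorem cSeq_mem_localType {h : ℕ+ → ℕ+} (hh : Tendsto (fun n => (h n : ℝ)) atTop atTop)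
    (φ : C(OnePoint ℝ, ℂ)) : cSeq p h φ ∈ localType p h := by
  refine mem_localType_iff.2 ⟨fun t => ?_, fun ψ => ?_⟩
  · have shift : t.IsShift → HasSnapshot h (cSeq p h φ) t (φ (t.pos : OnePoint ℝ) • 1) := by
      intro ht
      have hW : IsMul (φ (t.pos : OnePoint ℝ) • (1 : Op p)) fun _ => φ (t.pos : OnePoint ℝ) :=
        (isMul_one.smul _).congr (.of_forall fun x => by simp)
      rw [hasSnapshot_iff ht]
      refine ⟨pStrong_of_isMul (fun n => (isMul_cSeq h φ n).Einv (h n) t) hW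
        (fun n => (norm_Einv_le _ _ _).trans (OpSeq.norm_apply_le _ n)) fun m ε hε => ?_, hW.mem_pBounded⟩
      have hc : Continuous fun y : ℝ => φ (y : OnePoint ℝ) := φ.continuous.comp OnePoint.continuous_coe
      obtain ⟨δ, hδ, hφ⟩ := Metric.continuousAt_iff.1 (hc.continuousAt (x := t.pos)) ε hε
      have lim : Tendsto (fun n => m / (h n : ℝ)) atTop (𝓝 0) := tendsto_const_nhds.div_atTop hh
      filter_upwards [lim.eventually_lt_const hδ] with n hn
      refine .of_forall fun x hx => ?_
      have hp := pnat_pos (h n)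
      rw [Dir.actInv_div ht, ← dist_eq_norm]
      refine (hφ ?_).le
      rw [Real.dist_eq, add_sub_cancel_left, abs_div, abs_of_pos hp]
      exact lt_of_le_of_lt (by gcongr) hn
    cases t with
    | freq s =>
      obtain ⟨N, hN⟩ := exists_isMul_continuous (p := p) φ
      refine ⟨N, ?_⟩
      have e : ∀ n, Einv (h n) (.freq s) (cSeq p h φ n) = N := fun n => by
        rw [← E_freq_eq_cSeq hN h n s, Einv_E]
      simp only [HasSnapshot, e]
      exact ⟨fun _ => tendsto_const_nhds, fun _ => tendsto_const_nhds⟩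
    | _ => exact ⟨_, shift (by simp [Dir.IsShift])⟩
  · rw [← cSeq_mul, ← cSeq_mul, mul_comm, sub_self]
    exact zero_mem _

theorem lift_mem_localType_of_pCompact (hp1 : 1 < p) (hp : p ≠ ∞) {h : ℕ+ → ℕ+}
    (hh : Tendsto (fun n => (h n : ℝ)) atTop atTop) {t : Dir} (ht : t.IsShift) {K : Op p}
    (hK : K ∈ PCompact p) : lift h t K ∈ localType p h := by
  have hJ : lift h t K ∈ J p h := J_of_lift h (by rwa [compactAt_eq ht])
  refine mem_localType_iff.2 ⟨fun s => ?_, fun φ => ?_⟩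
  · by_cases hs : s = t
    · subst hs; exact ⟨K, hasSnapshot_lift_self ht (PCompact_subset hK)⟩
    · exact ⟨0, hasSnapshot_lift_zero hp1 hp hh ht hK hs⟩
  · have hφ := localType_le (cSeq_mem_localType (p := p) hh φ)
    exact sub_mem (J_mul_structured hφ hJ) (structured_mul_J hφ hJ)

/-- The sequence `X` vanishes in the local algebra at `s`. -/
def LocZero (h : ℕ+ → ℕ+) (s : OnePoint ℝ) (X : OpSeq p) : Prop :=
  ∃ hX : X ∈ localType p h, coset hX ∈ localIdeal p h s

theorem Phi_eq_iff {h : ℕ+ → ℕ+} {s : OnePoint ℝ} {A B : OpSeq p} (hA : A ∈ localType p h)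
    (hB : B ∈ localType p h) : Phi p h s (coset hA) = Phi p h s (coset hB) ↔ LocZero h s (A - B) := by
  have e : coset hA - coset hB = coset (sub_mem hA hB) :=
    (map_sub ((jIdeal p h).ringCon.mk') ⟨A, hA⟩ ⟨B, hB⟩).symm
  have h1 : Phi p h s (coset hA) = Phi p h s (coset hB) ↔ coset hA - coset hB ∈ localIdeal p h s :=
    (RingCon.eq _).trans (TwoSidedIdeal.rel_iff _ _ _)
  rw [h1, e]
  exact ⟨fun h => ⟨_, h⟩, fun ⟨_, h⟩ => h⟩

theorem LocZero.add {h : ℕ+ → ℕ+} {s : OnePoint ℝ} {A B : OpSeq p} (hA : LocZero h s A)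
    (hB : LocZero h s B) : LocZero h s (A + B) := by
  obtain ⟨h1, h2⟩ := hA
  obtain ⟨h3, h4⟩ := hB
  exact ⟨add_mem h1 h3, (localIdeal p h s).add_mem h2 h4⟩

theorem LocZero.mul_left {h : ℕ+ → ℕ+} {s : OnePoint ℝ} {A B : OpSeq p} (hA : A ∈ localType p h)
    (hB : LocZero h s B) : LocZero h s (A * B) := by
  obtain ⟨h3, h4⟩ := hB
  exact ⟨mul_mem hA h3, (localIdeal p h s).mul_mem_left (coset hA) _ h4⟩

theorem LocZero.mul_right {h : ℕ+ → ℕ+} {s : OnePoint ℝ} {A B : OpSeq p} (hA : LocZero h s A)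
    (hB : B ∈ localType p h) : LocZero h s (A * B) := by
  obtain ⟨h3, h4⟩ := hA
  exact ⟨mul_mem h3 hB, (localIdeal p h s).mul_mem_right _ (coset hB) h4⟩

theorem LocZero.of_J {h : ℕ+ → ℕ+} {s : OnePoint ℝ} {A : OpSeq p} (hA : A ∈ localType p h)
    (hJ : A ∈ J p h) : LocZero h s A := by
  refine ⟨hA, ?_⟩
  have : coset hA = 0 := by
    refine (RingCon.eq (jIdeal p h).ringCon (b := 0)).2 ((TwoSidedIdeal.rel_iff _ _ _).2 ?_)
    rw [sub_zero, jIdeal, TwoSidedIdeal.mem_mk']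
    exact hJ
  rw [this]
  exact (localIdeal p h s).zero_mem

theorem LocZero.cSeq {h : ℕ+ → ℕ+} (hh : Tendsto (fun n => (h n : ℝ)) atTop atTop)
    {s : OnePoint ℝ} {φ : C(OnePoint ℝ, ℂ)} (hφ : φ s = 0) : LocZero h s (cSeq p h φ) := by
  refine ⟨cSeq_mem_localType hh φ, ?_⟩
  rw [localIdeal, TwoSidedIdeal.mem_sInf]
  exact fun I hI => hI.2 φ hφ _

theorem LocZero.of_tendsto {h : ℕ+ → ℕ+} {s : OnePoint ℝ} {A : ℕ → OpSeq p} {B : OpSeq p}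
    (hA : ∀ k, LocZero h s (A k)) (hB : B ∈ localType p h) (hlim : Tendsto A atTop (𝓝 B)) :
    LocZero h s B := by
  refine ⟨hB, ?_⟩
  rw [localIdeal, TwoSidedIdeal.mem_sInf]
  intro I hI
  have hlim' : Tendsto (fun k => (⟨A k, (hA k).1⟩ : localType p h)) atTop (𝓝 ⟨B, hB⟩) :=
    tendsto_subtype_rng.2 hlim
  refine hI.1.mem_of_tendsto hlim' (.of_forall fun k => ?_)
  have := (hA k).2
  rw [localIdeal, TwoSidedIdeal.mem_sInf] at this
  exact this I hI

/-- Allan–Douglas type principle: a sequence of local type that vanishes near `s` vanishes in the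
local algebra at `s`. -/
theorem LocZero.of_mul_cSeq {h : ℕ+ → ℕ+} (hh : Tendsto (fun n => (h n : ℝ)) atTop atTop)
    {s : OnePoint ℝ} {A : OpSeq p} (hA : A ∈ localType p h) {φ : C(OnePoint ℝ, ℂ)} (hφ : φ s = 1)
    (hJ : Tendsto (fun n => ‖A n * ConvType.cSeq p h φ n‖) atTop (𝓝 0)) : LocZero h s A := by
  have e : A = A * ConvType.cSeq p h φ + A * ConvType.cSeq p h (1 - φ) := by
    rw [← mul_add, ← cSeq_add, add_sub_cancel, cSeq_one, mul_one]
  rw [e]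
  refine (LocZero.of_J (mul_mem hA (cSeq_mem_localType hh φ)) (J_of_null hJ)).add
    (LocZero.mul_left hA (LocZero.cSeq hh ?_))
  rw [ContinuousMap.sub_apply, ContinuousMap.one_apply, hφ, sub_self]

theorem smul_Phi_one {h : ℕ+ → ℕ+} {s : OnePoint ℝ} (c : ℂ)
    (hc : (c • 1 : OpSeq p) ∈ localType p h) : c • Phi p h s 1 = Phi p h s (coset hc) := rfl

/-! ## Sequences described locally by their snapshots -/

/-- The points of `OnePoint ℝ` at which a direction determines the local behaviour. -/
def Dir.Sees : Dir → OnePoint ℝ → Prop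
  | .minus, s => s = ((-1 : ℝ) : OnePoint ℝ)
  | .center, s => ∃ x : ℝ, s = x ∧ |x| < 1
  | .plus, s => s = ((1 : ℝ) : OnePoint ℝ)
  | .freq _, _ => False

/-- Sequences of local type which, at every point of `[-1, 1]`, look like one of their lifted
snapshots. -/
structure IsGood (h : ℕ+ → ℕ+) (B : OpSeq p) : Prop where
  mem : B ∈ localType p h
  snap : ∀ t : Dir, t.IsShift → ∃ W, HasSnapshot h B t W ∧ lift h t W ∈ localType p h ∧
    ∀ s, t.Sees s → LocZero h s (B - lift h t W)

theorem locZero_zero (h : ℕ+ → ℕ+) (s : OnePoint ℝ) : LocZero h s (0 : OpSeq p) :=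
  LocZero.of_J (zero_mem _) (zero_mem _)

/-- The algebra of good sequences. -/
def goodAlg (p : ℝ≥0∞) [Fact (1 ≤ p)] (h : ℕ+ → ℕ+) : Subalgebra ℂ (OpSeq p) where
  carrier := {B | IsGood h B}
  add_mem' := by
    rintro A B ⟨hA, hA'⟩ ⟨hB, hB'⟩
    refine ⟨add_mem hA hB, fun t ht => ?_⟩
    obtain ⟨W, h1, h2, h3⟩ := hA' t ht
    obtain ⟨V, h4, h5, h6⟩ := hB' t ht
    refine ⟨W + V, h1.add h4, ?_, fun s hs => ?_⟩
    · rw [lift_add]; exact add_mem h2 h5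
    · rw [lift_add, add_sub_add_comm]; exact (h3 s hs).add (h6 s hs)
  mul_mem' := by
    rintro A B ⟨hA, hA'⟩ ⟨hB, hB'⟩
    refine ⟨mul_mem hA hB, fun t ht => ?_⟩
    obtain ⟨W, h1, h2, h3⟩ := hA' t ht
    obtain ⟨V, h4, h5, h6⟩ := hB' t ht
    refine ⟨W * V, h1.mul h4, ?_, fun s hs => ?_⟩
    · rw [lift_mul]; exact mul_mem h2 h5
    · have e : A * B - lift h t (W * V) = (A - lift h t W) * B + lift h t W * (B - lift h t V) := by
        rw [lift_mul]; noncomm_ring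
      rw [e]
      exact ((h3 s hs).mul_right hB).add (LocZero.mul_left h2 (h6 s hs))
  algebraMap_mem' c := by
    refine ⟨Subalgebra.algebraMap_mem _ c, fun t _ => ⟨_, hasSnapshot_scalar h t c, ?_, fun s _ => ?_⟩⟩ <;>
      have e : lift h t (algebraMap ℂ (Op p) c) = algebraMap ℂ (OpSeq p) c := by
        rw [Algebra.algebraMap_eq_smul_one, Algebra.algebraMap_eq_smul_one, lift_smul, lift_one]
    · rw [e]; exact Subalgebra.algebraMap_mem _ c
    · rw [e, sub_self]; exact locZero_zero h s

theorem mem_goodAlg {h : ℕ+ → ℕ+} {B : OpSeq p} : B ∈ goodAlg p h ↔ IsGood h B := Iff.rfl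

theorem isClosed_goodAlg (hp : p ≠ ∞) (h : ℕ+ → ℕ+) : IsClosed (goodAlg p h : Set (OpSeq p)) := by
  refine isClosed_of_closure_subset fun B hB => ?_
  obtain ⟨A, hA, hlim⟩ := mem_closure_iff_seq_limit.1 hB
  replace hA : ∀ k, IsGood h (A k) := hA
  have hmem : B ∈ localType p h :=
    (isClosed_localType hp h).mem_of_tendsto hlim (.of_forall fun k => (hA k).mem)
  refine ⟨hmem, fun t ht => ?_⟩
  choose W h1 h2 h3 using fun k => (hA k).snap t ht
  obtain ⟨V, hV⟩ := cauchySeq_tendsto_of_complete (cauchySeq_snapshot hp h1 hlim.cauchySeq)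
  have hlift : Tendsto (fun k => lift h t (W k)) atTop (𝓝 (lift h t V)) :=
    ((continuous_lift h t).tendsto V).comp hV
  have hVm : lift h t V ∈ localType p h :=
    (isClosed_localType hp h).mem_of_tendsto hlift (.of_forall h2)
  exact ⟨V, hasSnapshot_of_tendsto h1 hlim hV, hVm, fun s hs =>
    LocZero.of_tendsto (fun k => h3 k s hs) (sub_mem hmem hVm) (hlim.sub hlift)⟩

theorem subseq_apply (A : OpSeq p) (h : ℕ+ → ℕ+) (n : ℕ+) : subseq A h n = A (h n) := rfl

theorem norm_subseq_le (A : OpSeq p) (h : ℕ+ → ℕ+) : ‖subseq A h‖ ≤ ‖A‖ :=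
  OpSeq.norm_le (norm_nonneg _) fun n => A.norm_apply_le (h n)

/-- Sequences whose subsequences `A_h` are good as soon as countably many bounded scalar sequences
converge along `h`. -/
def generic (p : ℝ≥0∞) [Fact (1 ≤ p)] : Subalgebra ℂ (OpSeq p) where
  carrier := {A | ∃ S : Set (ℕ+ → ℂ), S.Countable ∧ (∀ f ∈ S, ∃ c : ℝ, ∀ n, ‖f n‖ ≤ c) ∧
    ∀ h : ℕ+ → ℕ+, StrictMono h → (∀ f ∈ S, ∃ l, Tendsto (fun n => f (h n)) atTop (𝓝 l)) →
      subseq A h ∈ goodAlg p h}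
  add_mem' := by
    rintro A B ⟨S, h1, h2, h3⟩ ⟨S', h4, h5, h6⟩
    refine ⟨S ∪ S', h1.union h4, fun f hf => hf.elim (h2 f) (h5 f), fun h hh hl => ?_⟩
    exact add_mem (h3 h hh fun f hf => hl f (.inl hf)) (h6 h hh fun f hf => hl f (.inr hf))
  mul_mem' := by
    rintro A B ⟨S, h1, h2, h3⟩ ⟨S', h4, h5, h6⟩
    refine ⟨S ∪ S', h1.union h4, fun f hf => hf.elim (h2 f) (h5 f), fun h hh hl => ?_⟩
    exact mul_mem (h3 h hh fun f hf => hl f (.inl hf)) (h6 h hh fun f hf => hl f (.inr hf))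
  algebraMap_mem' c := ⟨∅, countable_empty, by simp, fun h _ _ =>
    Subalgebra.algebraMap_mem (goodAlg p h) c⟩

theorem mem_generic {A : OpSeq p} : A ∈ generic p ↔
    ∃ S : Set (ℕ+ → ℂ), S.Countable ∧ (∀ f ∈ S, ∃ c : ℝ, ∀ n, ‖f n‖ ≤ c) ∧
    ∀ h : ℕ+ → ℕ+, StrictMono h → (∀ f ∈ S, ∃ l, Tendsto (fun n => f (h n)) atTop (𝓝 l)) →
      subseq A h ∈ goodAlg p h := Iff.rfl

theorem isClosed_generic (hp : p ≠ ∞) : IsClosed (generic p : Set (OpSeq p)) := by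
  refine isClosed_of_closure_subset fun B hB => ?_
  obtain ⟨A, hA, hlim⟩ := mem_closure_iff_seq_limit.1 hB
  choose S h1 h2 h3 using fun k => mem_generic.1 (hA k)
  refine ⟨⋃ k, S k, countable_iUnion h1, fun f hf => ?_, fun h hh hl => ?_⟩
  · obtain ⟨k, hk⟩ := mem_iUnion.1 hf
    exact h2 k f hk
  · have hlim' : Tendsto (fun k => subseq (A k) h) atTop (𝓝 (subseq B h)) := by
      rw [tendsto_iff_norm_sub_tendsto_zero] at hlim ⊢
      refine squeeze_zero (fun _ => norm_nonneg _) (fun k => ?_) hlim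
      exact norm_subseq_le (A k - B) h
    exact (isClosed_goodAlg hp h).mem_of_tendsto hlim' (.of_forall fun k =>
      h3 k h hh fun f hf => hl f (mem_iUnion.2 ⟨k, hf⟩))

/-! ## Multiplication operators are good -/

theorem mulSeq_mem_localType {h : ℕ+ → ℕ+} {B : OpSeq p} {f : ℕ+ → ℝ → ℂ}
    (hB : ∀ n, IsMul (B n) (f n)) (hs : ∀ t, ∃ W, HasSnapshot h B t W) : B ∈ localType p h := by
  refine mem_localType_iff.2 ⟨hs, fun φ => ?_⟩
  have : B * cSeq p h φ = cSeq p h φ * B := OpSeq.ext fun n => (hB n).commute (isMul_cSeq h φ n)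
  rw [this, sub_self]
  exact zero_mem _

theorem LocZero.of_isMul {h : ℕ+ → ℕ+} (hh : Tendsto (fun n => (h n : ℝ)) atTop atTop)
    {s : OnePoint ℝ} {A : OpSeq p} (hA : A ∈ localType p h) {f : ℕ+ → ℝ → ℂ}
    (hf : ∀ n, IsMul (A n) (f n)) {φ : C(OnePoint ℝ, ℂ)} (hφ : φ s = 1)
    (h0 : ∀ ε : ℝ, 0 < ε → ∀ᶠ n in atTop, ∀ᵐ x,
      ‖f n x * φ ((x / (h n : ℝ) : ℝ) : OnePoint ℝ)‖ ≤ ε) : LocZero h s A := by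
  refine LocZero.of_mul_cSeq hh hA hφ ?_
  rw [Metric.tendsto_nhds]
  intro ε hε
  filter_upwards [h0 (ε / 2) (half_pos hε)] with n hn
  rw [dist_zero_right, norm_norm]
  exact lt_of_le_of_lt (((hf n).mul (isMul_cSeq h φ n)).norm_le (half_pos hε).le hn)
    (half_lt_self hε)

/-- Sequences of multiplications by `G(x / h_n)` are of local type as soon as they have snapshots in
the directions `-`, `c`, `+`. -/
theorem scaled_mem_localType {h : ℕ+ → ℕ+}
    {B : OpSeq p} {G : ℝ → ℂ} (hB : ∀ n, IsMul (B n) fun x => G (x / (h n : ℝ)))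
    (hsnap : ∀ t : Dir, t.IsShift → ∃ W : Op p, HasSnapshot h B t W) : B ∈ localType p h := by
  refine mulSeq_mem_localType hB fun t => ?_
  cases t with
  | freq s =>
    have e : ∀ n, Einv (h n) (.freq s) (B n) = Einv (h 1) (.freq s) (B 1) := fun n =>
      ((hB n).Einv (h n) (.freq s)).ext ((hB 1).Einv (h 1) (.freq s)) (.of_forall fun x => by
        have h1 := (pnat_pos (h n)).ne'
        have h2 := (pnat_pos (h 1)).ne'
        simp only [Dir.actInv]
        rw [mul_div_cancel_left₀ _ h1, mul_div_cancel_left₀ _ h2])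
    refine ⟨Einv (h 1) (.freq s) (B 1), ?_⟩
    simp only [HasSnapshot, e]
    exact ⟨fun _ => tendsto_const_nhds, fun _ => tendsto_const_nhds⟩
  | _ => exact hsnap _ (by simp [Dir.IsShift])

/-- If `G` is homogeneous of degree zero around the position of a direction, then multiplication by
`G(x / h_n)` has a snapshot there. -/
theorem hasSnapshot_scaled {h : ℕ+ → ℕ+} (hh : Tendsto (fun n => (h n : ℝ)) atTop atTop)
    {B : OpSeq p} {G : ℝ → ℂ} (hB : ∀ n, IsMul (B n) fun x => G (x / (h n : ℝ)))
    {t : Dir} (ht : t.IsShift) {W : Op p} {g : ℝ → ℂ} (hW : IsMul W g) {δ : ℝ} (hδ : 0 < δ)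
    (hg : ∀ y : ℝ, |y| < δ → ∀ r : ℝ, 0 < r → G (t.pos + y) = g (r * y)) :
    HasSnapshot h B t W := by
  rw [hasSnapshot_iff ht]
  refine ⟨pStrong_of_isMul (fun n => (hB n).Einv (h n) t) hW
    (fun n => (norm_Einv_le _ _ _).trans (OpSeq.norm_apply_le B n)) fun m ε hε => ?_, hW.mem_pBounded⟩
  have lim : Tendsto (fun n => m / (h n : ℝ)) atTop (𝓝 0) := tendsto_const_nhds.div_atTop hh
  filter_upwards [lim.eventually_lt_const hδ] with n hn
  refine .of_forall fun x hx => ?_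
  have hp := pnat_pos (h n)
  rw [Dir.actInv_div ht, hg (x / (h n : ℝ)) (by
    rw [abs_div, abs_of_pos hp]
    exact lt_of_le_of_lt (by gcongr) hn) (h n) hp, mul_div_cancel₀ _ hp.ne', sub_self, norm_zero]
  exact hε.le

theorem exists_isMul_indicator {S : Set ℝ} (hS : MeasurableSet S) :
    ∃ W : Op p, IsMul W (S.indicator fun _ => 1) :=
  exists_isMul (aestronglyMeasurable_const.indicator hS) (c := 1) (.of_forall fun x => by
    refine (norm_indicator_le_norm_self _ _).trans ?_; simp)

theorem indicator_congr {α β : Type*} {S : Set α} {S' : Set β} {x : α} {y : β} (h : x ∈ S ↔ y ∈ S') :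
    S.indicator (fun _ => (1 : ℂ)) x = S'.indicator (fun _ => 1) y := by
  by_cases hx : x ∈ S
  · rw [indicator_of_mem hx, indicator_of_mem (h.1 hx)]
  · rw [indicator_of_notMem hx, indicator_of_notMem fun hy => hx (h.2 hy)]

/-- The sequence `{P_n}`. -/
def seqP (p : ℝ≥0∞) [Fact (1 ≤ p)] : OpSeq p := OpSeq.mk (fun n => P p n) 1 norm_P_le

theorem isMul_subseq_seqP (h : ℕ+ → ℕ+) (n : ℕ+) :
    IsMul (subseq (seqP p) h n) fun x => (Icc (-1 : ℝ) 1).indicator (fun _ => 1) (x / (h n : ℝ)) :=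
  (isMul_P (h n)).congr (.of_forall fun x => by
    have := pnat_pos (h n)
    refine indicator_congr ?_
    rw [mem_Icc, mem_Icc, le_div_iff₀ this, div_le_iff₀ this, neg_one_mul, one_mul])

theorem subseq_seqP_mem (h : ℕ+ → ℕ+) (hh : Tendsto (fun n => (h n : ℝ)) atTop atTop) :
    subseq (seqP p) h ∈ goodAlg p h := by
  obtain ⟨Wp, hWp⟩ := exists_isMul_indicator (p := p) (measurableSet_Iic (a := (0 : ℝ)))
  obtain ⟨Wm, hWm⟩ := exists_isMul_indicator (p := p) (measurableSet_Ici (a := (0 : ℝ)))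
  have hB := isMul_subseq_seqP (p := p) h
  have sgn : ∀ {r y : ℝ}, 0 < r → (r * y ≤ 0 ↔ y ≤ 0) ∧ (0 ≤ r * y ↔ 0 ≤ y) := fun {r y} hr =>
    ⟨⟨fun h => by by_contra! h'; nlinarith [mul_pos hr h'],
      fun h => mul_nonpos_of_nonneg_of_nonpos hr.le h⟩, mul_nonneg_iff_of_pos_left hr⟩
  have h1 : IsMul (1 : Op p) (univ.indicator fun _ => (1 : ℂ)) :=
    isMul_one.congr (.of_forall fun x => by simp)
  have sc : HasSnapshot h (subseq (seqP p) h) .center 1 := by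
    refine hasSnapshot_scaled hh hB (by simp [Dir.IsShift]) h1 one_pos fun y hy r hr => ?_
    refine indicator_congr ?_
    obtain ⟨h2, h3⟩ := abs_lt.1 hy
    simp only [Dir.pos, mem_Icc, mem_univ, iff_true]
    constructor <;> linarith
  have sp : HasSnapshot h (subseq (seqP p) h) .plus Wp := by
    refine hasSnapshot_scaled hh hB (by simp [Dir.IsShift]) hWp one_pos fun y hy r hr => ?_
    refine indicator_congr ?_
    obtain ⟨h2, h3⟩ := abs_lt.1 hy
    simp only [Dir.pos, mem_Icc, mem_Iic, (sgn hr).1]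
    exact ⟨fun h => by linarith [h.2], fun h => ⟨by linarith, by linarith⟩⟩
  have sm : HasSnapshot h (subseq (seqP p) h) .minus Wm := by
    refine hasSnapshot_scaled hh hB (by simp [Dir.IsShift]) hWm one_pos fun y hy r hr => ?_
    refine indicator_congr ?_
    obtain ⟨h2, h3⟩ := abs_lt.1 hy
    simp only [Dir.pos, mem_Icc, mem_Ici, (sgn hr).2]
    exact ⟨fun h => by linarith [h.1], fun h => ⟨by linarith, by linarith⟩⟩
  have lp : ∀ n, IsMul (lift h .plus Wp n) fun x => (Iic (1 : ℝ)).indicator (fun _ => 1) (x / (h n : ℝ)) :=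
    fun n => (hWp.E (h n) .plus).congr (.of_forall fun x => by
      have := pnat_pos (h n)
      refine indicator_congr ?_
      simp only [Dir.act, mem_Iic, div_le_iff₀ this, one_mul, sub_nonpos])
  have lm : ∀ n, IsMul (lift h .minus Wm n) fun x => (Ici (-1 : ℝ)).indicator (fun _ => 1) (x / (h n : ℝ)) :=
    fun n => (hWm.E (h n) .minus).congr (.of_forall fun x => by
      have := pnat_pos (h n)
      refine indicator_congr ?_
      simp only [Dir.act, mem_Ici, le_div_iff₀ this, neg_one_mul, sub_nonneg])
  have mB : subseq (seqP p) h ∈ localType p h := by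
    refine scaled_mem_localType hB fun t ht => ?_
    cases t with
    | freq s => exact absurd rfl (ht s)
    | minus => exact ⟨_, sm⟩
    | center => exact ⟨_, sc⟩
    | plus => exact ⟨_, sp⟩
  have mp : lift h .plus Wp ∈ localType p h := by
    refine scaled_mem_localType lp fun t ht => ?_
    cases t with
    | freq s => exact absurd rfl (ht s)
    | plus => exact ⟨_, hasSnapshot_lift_self (by simp [Dir.IsShift]) hWp.mem_pBounded⟩
    | _ =>
      refine ⟨1, hasSnapshot_scaled hh lp ht h1 one_pos fun y hy r hr => indicator_congr ?_⟩
      obtain ⟨h2, h3⟩ := abs_lt.1 hy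
      simp only [Dir.pos, mem_Iic, mem_univ, iff_true]
      linarith
  have mm : lift h .minus Wm ∈ localType p h := by
    refine scaled_mem_localType lm fun t ht => ?_
    cases t with
    | freq s => exact absurd rfl (ht s)
    | minus => exact ⟨_, hasSnapshot_lift_self (by simp [Dir.IsShift]) hWm.mem_pBounded⟩
    | _ =>
      refine ⟨1, hasSnapshot_scaled hh lm ht h1 one_pos fun y hy r hr => indicator_congr ?_⟩
      obtain ⟨h2, h3⟩ := abs_lt.1 hy
      simp only [Dir.pos, mem_Ici, mem_univ, iff_true]
      linarith
  refine mem_goodAlg.2 ⟨mB, fun t ht => ?_⟩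
  cases t with
  | freq s => exact absurd rfl (ht s)
  | center =>
    refine ⟨1, sc, by rw [lift_one]; exact one_mem _, ?_⟩
    rintro s ⟨x, rfl, hx⟩
    have hδ : 0 < 1 - |x| := by linarith
    rw [lift_one]
    refine LocZero.of_isMul hh (sub_mem mB (one_mem _)) (fun n => (hB n).sub isMul_one)
      (φ := bump x (1 - |x|) hδ) (bump_eq_one hδ (by rw [sub_self, abs_zero]; positivity))
      fun ε hε => .of_forall fun n => .of_forall fun y => ?_
    set z := y / (h n : ℝ)
    by_cases hz : z ∈ Icc (-1 : ℝ) 1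
    · rw [indicator_of_mem hz, sub_self, zero_mul, norm_zero]; exact hε.le
    · rw [bump_eq_zero, mul_zero, norm_zero]
      · exact hε.le
      · by_contra! hlt
        refine hz (abs_le.1 ?_)
        have := abs_sub_abs_le_abs_sub z x
        linarith
  | plus =>
    refine ⟨Wp, sp, mp, ?_⟩
    rintro s rfl
    refine LocZero.of_isMul hh (sub_mem mB mp) (fun n => (hB n).sub (lp n))
      (φ := bump 1 1 one_pos) (bump_eq_one one_pos (by norm_num))
      fun ε hε => .of_forall fun n => .of_forall fun y => ?_
    set z := y / (h n : ℝ)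
    rcases le_or_gt 0 z with hz | hz
    · rw [indicator_congr (S := Icc (-1 : ℝ) 1) (S' := Iic (1 : ℝ)) (x := z) (y := z)
        ⟨fun h => h.2, fun h => ⟨by linarith, h⟩⟩, sub_self, zero_mul, norm_zero]
      exact hε.le
    · rw [bump_eq_zero, mul_zero, norm_zero]
      · exact hε.le
      · rw [abs_sub_comm]; exact le_trans (by linarith) (le_abs_self _)
  | minus =>
    refine ⟨Wm, sm, mm, ?_⟩
    rintro s rfl
    refine LocZero.of_isMul hh (sub_mem mB mm) (fun n => (hB n).sub (lm n))
      (φ := bump (-1) 1 one_pos) (bump_eq_one one_pos (by norm_num))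
      fun ε hε => .of_forall fun n => .of_forall fun y => ?_
    set z := y / (h n : ℝ)
    rcases le_or_gt z 0 with hz | hz
    · rw [indicator_congr (S := Icc (-1 : ℝ) 1) (S' := Ici (-1 : ℝ)) (x := z) (y := z)
        ⟨fun h => h.1, fun h => ⟨h, by linarith⟩⟩, sub_self, zero_mul, norm_zero]
      exact hε.le
    · rw [bump_eq_zero, mul_zero, norm_zero]
      · exact hε.le
      · exact le_trans (by linarith) (le_abs_self _)

/-! ## The generators -/

theorem seqP_mem_generic : seqP p ∈ generic p :=
  mem_generic.2 ⟨∅, countable_empty, by simp, fun h hh _ =>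
    subseq_seqP_mem h (tendsto_cast_of_strictMono hh)⟩

theorem subseq_const {A : OpSeq p} {T : Op p} (hA : ∀ n, A n = T) (h : ℕ+ → ℕ+) :
    subseq A h = lift h .center T :=
  OpSeq.ext fun n => by rw [subseq_apply, hA, lift_apply, E_center]

theorem Dir.isShift_center : Dir.center.IsShift := fun _ => nofun

theorem Dir.isShift_plus : Dir.plus.IsShift := fun _ => nofun

theorem Dir.isShift_minus : Dir.minus.IsShift := fun _ => nofun

/-- A constant sequence of local type, which at `± 1` looks like the lift of a second operator. -/
theorem isGood_center {h : ℕ+ → ℕ+} {T : Op p} (hT : lift h .center T ∈ localType p h)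
    (hT' : T ∈ PBounded p)
    (hs : ∀ t : Dir, t.IsShift → |t.pos| = 1 → ∃ W, HasSnapshot h (lift h .center T) t W ∧
      lift h t W ∈ localType p h ∧ LocZero h (t.pos : ℝ) (lift h .center T - lift h t W)) :
    lift h .center T ∈ goodAlg p h := by
  refine mem_goodAlg.2 ⟨hT, fun t ht => ?_⟩
  cases t with
  | freq s => exact absurd rfl (ht s)
  | center =>
    exact ⟨T, hasSnapshot_lift_self ht hT', hT, fun s _ => by rw [sub_self]; exact locZero_zero h s⟩
  | plus =>
    obtain ⟨W, h1, h2, h3⟩ := hs .plus ht (by simp [Dir.pos])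
    exact ⟨W, h1, h2, by rintro s rfl; exact h3⟩
  | minus =>
    obtain ⟨W, h1, h2, h3⟩ := hs .minus ht (by simp [Dir.pos])
    exact ⟨W, h1, h2, by rintro s rfl; exact h3⟩

theorem const_pCompact_mem_generic (hp1 : 1 < p) (hp : p ≠ ∞) {A : OpSeq p} {K : Op p}
    (hK : K ∈ PCompact p) (hA : ∀ n, A n = K) : A ∈ generic p := by
  refine mem_generic.2 ⟨∅, countable_empty, by simp, fun h hh _ => ?_⟩
  have hh := tendsto_cast_of_strictMono hh
  rw [subseq_const hA]
  have hm := lift_mem_localType_of_pCompact hp1 hp hh Dir.isShift_center hK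
  refine isGood_center hm (PCompact_subset hK) fun t ht ht1 =>
    ⟨0, hasSnapshot_lift_zero hp1 hp hh Dir.isShift_center hK ?_, ?_, ?_⟩
  · rintro rfl
    simp [Dir.pos] at ht1
  · have : lift h t (0 : Op p) = 0 := OpSeq.ext fun n => by simp [lift_apply, E, OpSeq.zero_apply]
    rw [this]; exact zero_mem _
  · have : lift h t (0 : Op p) = 0 := OpSeq.ext fun n => by simp [lift_apply, E, OpSeq.zero_apply]
    rw [this, sub_zero]
    exact LocZero.of_J hm (J_of_lift h (by rw [compactAt_eq Dir.isShift_center]; exact hK))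

theorem ae_norm_dilate_le (a : Linf) (n : ℕ+) : ∀ᵐ x, ‖a ((n : ℝ) * x)‖ ≤ ‖a‖ :=
  (quasi_mul (pnat_pos n).ne').ae (ae_norm_le_norm a)

theorem hasSnapshot_freq_of_symLim (hp1 : 1 < p) (hp : p ≠ ∞) {a : Linf} {h : ℕ+ → ℕ+} {c d : ℂ}
    (hl : SymLim (fun n x => a ((h n : ℝ) * x)) c d) (s : ℝ) :
    ∃ W, HasSnapshot h (lift h .center (mulOp p a)) (.freq s) W := by
  obtain ⟨W, hW⟩ := exists_isMul (p := p) (stronglyMeasurable_step c d).aestronglyMeasurable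
    (.of_forall (norm_step_le c d))
  refine ⟨W, ?_⟩
  have hD : ∀ n, IsMul (Einv (h n) (.freq s) (mulOp p a) - W)
      fun x => a ((h n : ℝ) * x) - step c d x := fun n =>
    ((isMul_mulOp a).Einv (h n) (.freq s)).sub hW
  have hb : ∀ n, ∀ᵐ x, ‖a ((h n : ℝ) * x) - step c d x‖ ≤ ‖a‖ + max ‖c‖ ‖d‖ := fun n => by
    filter_upwards [ae_norm_dilate_le a (h n)] with x hx
    exact (norm_sub_le _ _).trans (add_le_add hx (norm_step_le c d x))
  simp only [HasSnapshot, lift_apply, E_center]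
  refine ⟨fun u => ?_, fun f => ?_⟩
  · have := (tendsto_isMul_apply hp hD hb hl.ae_tendsto u).add_const (W u)
    simpa using this
  · have := (tendsto_dual_comp_isMul hp1 hp hD hb hl.ae_tendsto f).add_const (f.comp W)
    simpa [ContinuousLinearMap.comp_sub] using this

theorem const_mulOp_mem_generic (hp1 : 1 < p) (hp : p ≠ ∞) {a : Linf}
    (ha : a ∈ closedAlg (PC ∪ SO ∪ Linf0)) {A : OpSeq p} (hA : ∀ n, A n = mulOp p a) :
    A ∈ generic p := by
  have hms : ∀ n : ℕ+, AEStronglyMeasurable (fun x => a ((n : ℝ) * x)) volume := fun n =>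
    (Lp.aestronglyMeasurable a).comp_quasiMeasurePreserving (quasi_mul (pnat_pos n).ne')
  refine mem_generic.2 ⟨{fun n : ℕ+ => mean (fun x => a ((n : ℝ) * x)) 1,
    fun n : ℕ+ => mean (fun x => a ((n : ℝ) * x)) (-2)}, by simp, fun f hf => ⟨‖a‖, ?_⟩,
    fun h hh hl => ?_⟩
  · rcases hf with rfl | rfl <;> exact fun n => norm_mean_le (hms n) (ae_norm_dilate_le a n)
  have hh := tendsto_cast_of_strictMono hh
  obtain ⟨c, hc⟩ := hl _ (.inl rfl)
  obtain ⟨d, hd⟩ := hl _ (.inr rfl)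
  have hcd : SymLim (fun n x => a ((h n : ℝ) * x)) c d :=
    (windowed_multiplication ha hh).symLim (fun n => hms (h n)) hc hd
  have hPB : mulOp p a ∈ PBounded p := (isMul_mulOp a).mem_pBounded
  have near : ∀ σ : ℝ, |σ| = 1 → ∀ ε : ℝ, 0 < ε → ∀ᶠ n in atTop, ∀ᵐ y, |y - σ| ≤ 1 / 2 →
      ‖a ((h n : ℝ) * y) - step c d σ‖ ≤ ε := fun σ hσ ε hε => by
    filter_upwards [hcd ε hε 2 (by norm_num)] with n hn
    filter_upwards [hn] with y hy hyσ
    obtain ⟨h1, h2⟩ := abs_le.1 hyσ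
    rcases eq_or_eq_neg_of_abs_eq hσ with rfl | rfl
    · rw [step, if_pos one_pos]
      exact hy.1 ⟨by linarith, by linarith⟩
    · rw [step, if_neg (by norm_num)]
      exact hy.2 ⟨by linarith, by linarith⟩
  have snap : ∀ t : Dir, t.IsShift → |t.pos| = 1 →
      HasSnapshot h (lift h .center (mulOp p a)) t (step c d t.pos • 1) := fun t ht ht1 => by
    have hW : IsMul (step c d t.pos • 1 : Op p) fun _ => step c d t.pos :=
      (isMul_one.smul _).congr (.of_forall fun x => mul_one _)
    rw [hasSnapshot_iff ht]
    simp only [lift_apply, E_center]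
    refine ⟨pStrong_of_isMul (fun n => (isMul_mulOp a).Einv (h n) t) hW
      (fun n => norm_Einv_le _ _ _) fun m ε hε => ?_, hW.mem_pBounded⟩
    have lim : Tendsto (fun n => m / (h n : ℝ)) atTop (𝓝 0) := tendsto_const_nhds.div_atTop hh
    filter_upwards [near _ ht1 ε hε, lim.eventually_lt_const (show (0 : ℝ) < 1 / 2 by norm_num)]
      with n hn hm
    have hp := pnat_pos (h n)
    filter_upwards [(quasi_affine (inv_pos.2 hp).ne' t.pos).ae hn] with x hx hxm
    have e : (h n : ℝ) * ((h n : ℝ)⁻¹ * x + t.pos) = t.actInv (h n) x := by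
      have := Dir.actInv_div ht (h n) x
      rw [div_eq_iff hp.ne'] at this
      rw [this]; ring
    rw [e] at hx
    refine hx ?_
    rw [add_sub_cancel_right, abs_mul, abs_of_pos (inv_pos.2 hp), inv_mul_eq_div]
    exact ((div_le_div_iff_of_pos_right hp).2 hxm).trans hm.le
  have mem : lift h .center (mulOp p a) ∈ localType p h := by
    refine mulSeq_mem_localType (f := fun _ => a) (fun n => ?_) fun t => ?_
    · rw [lift_apply, E_center]; exact isMul_mulOp a
    · cases t with
      | freq s => exact hasSnapshot_freq_of_symLim hp1 hp hcd s
      | center => exact ⟨_, hasSnapshot_lift_self Dir.isShift_center hPB⟩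
      | plus => exact ⟨_, snap _ Dir.isShift_plus (by simp [Dir.pos])⟩
      | minus => exact ⟨_, snap _ Dir.isShift_minus (by simp [Dir.pos])⟩
  rw [subseq_const hA]
  refine isGood_center mem hPB fun t ht ht1 => ?_
  have hm : lift h t (step c d t.pos • (1 : Op p)) ∈ localType p h := by
    rw [lift_smul, lift_one]; exact Subalgebra.smul_mem _ (one_mem _) _
  refine ⟨_, snap t ht ht1, hm, ?_⟩
  refine LocZero.of_isMul hh (sub_mem mem hm) (f := fun _ x => a x - step c d t.pos) (fun n => ?_)
    (φ := bump t.pos (1 / 2) (by norm_num)) (bump_eq_one _ (by rw [sub_self, abs_zero]; norm_num))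
    fun ε hε => ?_
  · rw [lift_smul, lift_one, OpSeq.sub_apply, lift_apply, E_center]
    exact (isMul_mulOp a).sub ((isMul_one.smul _).congr (.of_forall fun x => mul_one _))
  · filter_upwards [near _ ht1 ε hε] with n hn
    have hp := pnat_pos (h n)
    filter_upwards [(quasi_mul (inv_pos.2 hp).ne').ae hn] with x hx
    rw [mul_inv_cancel_left₀ hp.ne', inv_mul_eq_div] at hx
    rcases le_or_gt |x / (h n : ℝ) - t.pos| (1 / 2) with hle | hgt
    · rw [norm_mul]
      exact (mul_le_of_le_one_right (norm_nonneg _) (norm_bump_le _ _ _ _)).trans (hx hle)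
    · rw [bump_eq_zero _ hgt.le, mul_zero, norm_zero]; exact hε.le

theorem const_convolution_mem_generic_of_mnear (hp1 : 1 < p) (hp : p ≠ ∞) {lam : ℝ} {b : Linf}
    (hb : b ∈ closedAlg (PCat (lam : OnePoint ℝ) ∪ SO ∪ BUC)) (hbM : b ∈ Mnear p) {T : Op p}
    (hT : IsW0 b T) {A : OpSeq p} (hA : ∀ n, A n = T) : A ∈ generic p := by
  obtain ⟨R, hR⟩ := isFM_exists b
  have hTR : Compat T R := (isW0_iff hR T).1 hT
  obtain ⟨r, C, hr, hC⟩ := exists_between_bddOn hp1 hp hbM hR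
  have hsym : IsSymbol lam b := isSymbol_of_mem hb
  obtain ⟨D, hD, hloc⟩ := hsym.exists_countable
  have hm : ∀ (n : ℕ+) (t : ℝ), AEStronglyMeasurable (fun x => b ((n : ℝ)⁻¹ * x + t)) volume :=
    fun n t => aestronglyMeasurable_affine b (inv_pos.2 (pnat_pos n)).ne' t
  set S : ℝ → ℝ → ℕ+ → ℂ := fun a t n => mean (fun x => b ((n : ℝ)⁻¹ * x + t)) a with hS
  refine mem_generic.2 ⟨S 1 '' D ∪ S (-2) '' D, (hD.image _).union (hD.image _), fun f hf => ⟨‖b‖, ?_⟩,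
    fun h hh hl => ?_⟩
  · have : ∀ a t n, ‖S a t n‖ ≤ ‖b‖ := fun a t n => norm_mean_le (hm n t)
      ((quasi_affine (inv_pos.2 (pnat_pos n)).ne' t).ae (ae_norm_le_norm b))
    rcases hf with ⟨t, _, rfl⟩ | ⟨t, _, rfl⟩ <;> exact this _ _
  have hh := tendsto_cast_of_strictMono hh
  have conv : ∀ t, (∃ c, Tendsto (fun n => S 1 t (h n)) atTop (𝓝 c)) ∧
      ∃ c, Tendsto (fun n => S (-2) t (h n)) atTop (𝓝 c) := fun t => by
    by_cases ht : t ∈ D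
    · exact ⟨hl _ (.inl ⟨t, ht, rfl⟩), hl _ (.inr ⟨t, ht, rfl⟩)⟩
    · exact ⟨mean_converges (hloc t ht) hh 1, mean_converges (hloc t ht) hh (-2)⟩
  have hlim : ∀ t, ∃ c d, SymLim (fun n x => b ((h n : ℝ)⁻¹ * x + t)) c d := fun t => by
    obtain ⟨⟨c, hc⟩, d, hd⟩ := conv t
    exact ⟨c, d, (hsym.windowed t hh).symLim (fun n => hm (h n) t) hc hd⟩
  obtain ⟨mem, hPB⟩ := convolution_mem_localType hp1 hp hsym hTR hR hr hC hh hlim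
  rw [subseq_const hA]
  refine isGood_center mem hPB fun t ht _ => ?_
  have e : lift h t T = lift h .center T := OpSeq.ext fun n => by
    rw [lift_apply, lift_apply, E_center, ← Einv_eq_self_of_isFM hp hTR hR ht (h n), E_Einv,
      Einv_eq_self_of_isFM hp hTR hR ht (h n)]
  refine ⟨T, e ▸ hasSnapshot_lift_self ht hPB, e ▸ mem, ?_⟩
  rw [e, sub_self]
  exact locZero_zero h _

theorem const_convolution_mem_generic (hp1 : 1 < p) (hp : p ≠ ∞) {lam : ℝ} {b : Linf}
    (hb : b ∈ multClosure p (closedAlg (PCat (lam : OnePoint ℝ) ∪ SO ∪ BUC))) {T : Op p}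
    (hT : IsW0 b T) {A : OpSeq p} (hA : ∀ n, A n = T) : A ∈ generic p := by
  obtain ⟨T', hT', hnear⟩ := hb
  obtain ⟨R, hR⟩ := isFM_exists b
  obtain rfl : T = T' := Compat.unique hp ((isW0_iff hR T).1 hT) ((isW0_iff hR T').1 hT')
  refine (isClosed_generic hp).closure_subset (Metric.mem_closure_iff.2 fun ε hε => ?_)
  obtain ⟨c, ⟨hc1, hc2⟩, S, hS, hTS⟩ := hnear (ε / 2) (half_pos hε)
  refine ⟨OpSeq.mk (fun _ => S) ‖S‖ fun _ => le_rfl,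
    const_convolution_mem_generic_of_mnear hp1 hp hc1 hc2 hS fun n => rfl, ?_⟩
  rw [dist_eq_norm]
  refine lt_of_le_of_lt (OpSeq.norm_le (half_pos hε).le fun n => ?_) (half_lt_self hε)
  rw [OpSeq.sub_apply, hA, OpSeq.mk_apply]
  exact hTS.le

theorem A1_le_generic (hp1 : 1 < p) (hp : p ≠ ∞) : A1 p ≤ generic p := by
  refine Subalgebra.topologicalClosure_minimal (Algebra.adjoin_le ?_) (isClosed_generic hp)
  rintro A (((⟨a, ha, hA⟩ | ⟨lam, b, hb, T, hT, hA⟩) | ⟨K, hK, hA⟩) | hA)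
  · exact const_mulOp_mem_generic hp1 hp ha hA
  · exact const_convolution_mem_generic hp1 hp hb hT hA
  · exact const_pCompact_mem_generic hp1 hp hK hA
  · have : A = seqP p := OpSeq.ext hA
    rw [this]; exact seqP_mem_generic

theorem FA1_le_generic (hp1 : 1 < p) (hp : p ≠ ∞) : FA1 p ≤ generic p := by
  refine Subalgebra.topologicalClosure_minimal (Algebra.adjoin_le ?_) (isClosed_generic hp)
  rintro S ⟨A, hA, hS⟩
  have : S = seqP p * A * seqP p + (1 - seqP p) := OpSeq.ext hS
  rw [this]
  exact add_mem (mul_mem (mul_mem seqP_mem_generic (A1_le_generic hp1 hp hA)) seqP_mem_generic)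
    (sub_mem (one_mem _) seqP_mem_generic)

/-! ## The scalar part -/

/-- The sequences which act as one scalar on the complement of `[-n, n]`. -/
def scalarOff (p : ℝ≥0∞) [Fact (1 ≤ p)] : Subalgebra ℂ (OpSeq p) where
  carrier := {A | (A * (1 - seqP p), (1 - seqP p) * A) ∈ Submodule.span ℂ {(1 - seqP p, 1 - seqP p)}}
  add_mem' {A B} hA hB := by
    have := Submodule.add_mem (Submodule.span ℂ {((1 - seqP p : OpSeq p), (1 - seqP p : OpSeq p))}) hA hB
    rwa [Prod.mk_add_mk, ← add_mul, ← mul_add] at this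
  mul_mem' {A B} hA hB := by
    obtain ⟨μ, hμ⟩ := Submodule.mem_span_singleton.1 hA
    obtain ⟨ν, hν⟩ := Submodule.mem_span_singleton.1 hB
    obtain ⟨h1, h2⟩ := Prod.mk.inj hμ
    obtain ⟨h3, h4⟩ := Prod.mk.inj hν
    refine Submodule.mem_span_singleton.2 ⟨μ * ν, Prod.ext ?_ ?_⟩
    · change (μ * ν) • (1 - seqP p) = A * B * (1 - seqP p)
      rw [mul_assoc, ← h3, mul_smul_comm, ← h1, smul_smul, mul_comm]
    · change (μ * ν) • (1 - seqP p) = (1 - seqP p) * (A * B)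
      rw [← mul_assoc, ← h2, smul_mul_assoc, ← h4, smul_smul]
  algebraMap_mem' c := Submodule.mem_span_singleton.2 ⟨c, Prod.ext (Algebra.smul_def _ _)
    ((Algebra.smul_def _ _).trans (Algebra.commutes _ _))⟩

theorem mem_scalarOff {A : OpSeq p} : A ∈ scalarOff p ↔
    ∃ μ : ℂ, μ • (1 - seqP p) = A * (1 - seqP p) ∧ μ • (1 - seqP p) = (1 - seqP p) * A :=
  Submodule.mem_span_singleton.trans (exists_congr fun _ => Prod.mk_inj)

theorem isClosed_scalarOff : IsClosed (scalarOff p : Set (OpSeq p)) :=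
  (Submodule.closed_of_finiteDimensional (Submodule.span ℂ {(1 - seqP p, 1 - seqP p)})).preimage
    (f := fun A : OpSeq p => (A * (1 - seqP p), (1 - seqP p) * A)) (by fun_prop)

theorem seqP_mul_self : seqP p * seqP p = seqP p := OpSeq.ext fun n => P_mul_self n

theorem FA1_le_scalarOff : FA1 p ≤ scalarOff p := by
  refine Subalgebra.topologicalClosure_minimal (Algebra.adjoin_le ?_) isClosed_scalarOff
  rintro S ⟨A, -, hS⟩
  have : S = seqP p * A * seqP p + (1 - seqP p) := OpSeq.ext hS
  have h := seqP_mul_self (p := p)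
  refine mem_scalarOff.2 ⟨1, ?_, ?_⟩
  · rw [this, one_smul, add_mul, mul_assoc (seqP p * A), mul_sub, mul_one, h, sub_self, mul_zero,
      zero_add, mul_sub, mul_one, sub_mul, one_mul, h, sub_self, sub_zero]
  · rw [this, one_smul, mul_add, mul_assoc, ← mul_assoc (1 - seqP p), sub_mul, one_mul, h, sub_self,
      zero_mul, zero_add, mul_sub, mul_one, sub_mul, one_mul, h, sub_self, sub_zero]

/-- Elements of the finite section algebra are scalar outside `[-n, n]`. -/
theorem exists_scalar {A : OpSeq p} (hA : A ∈ FA1 p) :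
    ∃ μ : ℂ, A = seqP p * A * seqP p + μ • (1 - seqP p) := by
  obtain ⟨μ, h1, h2⟩ := mem_scalarOff.1 (FA1_le_scalarOff hA)
  refine ⟨μ, ?_⟩
  have e : A = seqP p * A * seqP p + seqP p * (A * (1 - seqP p)) + (1 - seqP p) * A := by
    noncomm_ring
  rw [← h1, ← h2, mul_smul_comm, mul_sub, mul_one, seqP_mul_self, sub_self, smul_zero,
    add_zero] at e
  exact e

theorem locZero_subseq_seqP {h : ℕ+ → ℕ+} (hh : Tendsto (fun n => (h n : ℝ)) atTop atTop)
    {s : OnePoint ℝ} (hs : s = OnePoint.infty ∨ ∃ x : ℝ, s = x ∧ 1 < |x|) :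
    LocZero h s (subseq (seqP p) h) := by
  have key : ∀ φ : C(OnePoint ℝ, ℂ), φ s = 1 → (∀ z : ℝ, |z| ≤ 1 → φ z = 0) →
      LocZero h s (subseq (seqP p) h) := fun φ h1 h0 =>
    LocZero.of_isMul hh (mem_goodAlg.1 (subseq_seqP_mem h hh)).mem (isMul_subseq_seqP h) h1
      fun ε hε => .of_forall fun n => .of_forall fun x => by
        by_cases hx : x / (h n : ℝ) ∈ Icc (-1 : ℝ) 1
        · rw [h0 _ (abs_le.2 hx), mul_zero, norm_zero]; exact hε.le
        · rw [indicator_of_notMem hx, zero_mul, norm_zero]; exact hε.le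
  rcases hs with rfl | ⟨x, rfl, hx⟩
  · refine key (1 - bump 0 2 two_pos) ?_ fun z hz => ?_
    · rw [ContinuousMap.sub_apply, bump_infty, ContinuousMap.one_apply, sub_zero]
    · rw [ContinuousMap.sub_apply, bump_eq_one two_pos (by simpa using hz), ContinuousMap.one_apply,
        sub_self]
  · refine key (bump x (|x| - 1) (by linarith)) (bump_eq_one _ ?_) fun z hz => bump_eq_zero _ ?_
    · rw [sub_self, abs_zero]; linarith
    · have := abs_sub_abs_le_abs_sub x z
      rw [abs_sub_comm]; linarith

/-- Countably many bounded scalar sequences have a common subsequence along which they converge. -/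
theorem exists_common_subseq {S : Set (ℕ+ → ℂ)} (hS : S.Countable)
    (hb : ∀ f ∈ S, ∃ c : ℝ, ∀ n, ‖f n‖ ≤ c) (g : ℕ+ → ℕ+) :
    ∃ k : ℕ+ → ℕ+, StrictMono k ∧ ∀ f ∈ S, ∃ l, Tendsto (fun n => f (g (k n))) atTop (𝓝 l) := by
  have := hS.to_subtype
  choose! c hc using hb
  have hK : IsCompact (univ.pi fun f : S => Metric.closedBall (0 : ℂ) (c f)) :=
    isCompact_univ_pi fun f => isCompact_closedBall _ _
  let e := OrderIso.pnatIsoNat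
  obtain ⟨a, -, φ, hφ, hlim⟩ := hK.tendsto_subseq (x := fun m (f : S) => f.1 (g (e.symm m)))
    fun m f _ => by simpa using hc f.1 f.2 _
  refine ⟨fun n => e.symm (φ (e n)), fun m n hmn => e.symm.strictMono (hφ (e.strictMono hmn)),
    fun f hf => ⟨a ⟨f, hf⟩, ?_⟩⟩
  exact ((tendsto_pi_nhds.1 hlim) ⟨f, hf⟩).comp e.tendsto_atTop

/-! ## Regularizers -/

/-- Pinching: block sums over disjoint projections do not increase the norm. -/
theorem norm_sum_blocks_le (A : Op p) {D D' : ℕ → Op p}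
    (hD : ∀ i j, D i * D j = if i = j then D i else 0)
    (hD' : ∀ i j, D' i * D' j = if i = j then D' i else 0)
    (h1 : ∀ i, ‖1 - (D i + D i)‖ ≤ 1) (h1' : ∀ i, ‖1 - (D' i + D' i)‖ ≤ 1) (N : ℕ)
    (h2 : ‖∑ i ∈ Finset.range N, D i‖ ≤ 1) :
    ‖∑ i ∈ Finset.range N, D i * A * D' i‖ ≤ ‖A‖ := by
  set e : ℕ → Op p := fun N => ∑ i ∈ Finset.range N, D i with he
  set e' : ℕ → Op p := fun N => ∑ i ∈ Finset.range N, D' i with he'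
  set Y : ℕ → Op p := fun N => ∑ i ∈ Finset.range N, D i * A * D' i with hY
  have de : ∀ N, D N * e N = 0 := fun N => by
    rw [he, Finset.mul_sum]
    exact Finset.sum_eq_zero fun i hi => by rw [hD, if_neg (Finset.mem_range.1 hi).ne']
  have de' : ∀ N, e' N * D' N = 0 := fun N => by
    rw [he', Finset.sum_mul]
    exact Finset.sum_eq_zero fun i hi => by rw [hD', if_neg (Finset.mem_range.1 hi).ne]
  have dY : ∀ N, D N * Y N = 0 := fun N => by
    rw [hY, Finset.mul_sum]
    exact Finset.sum_eq_zero fun i hi => by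
      rw [← mul_assoc, ← mul_assoc, hD, if_neg (Finset.mem_range.1 hi).ne', zero_mul, zero_mul]
  have dY' : ∀ N, Y N * D' N = 0 := fun N => by
    rw [hY, Finset.sum_mul]
    exact Finset.sum_eq_zero fun i hi => by
      rw [mul_assoc, hD', if_neg (Finset.mem_range.1 hi).ne, mul_zero]
  have de1 : ∀ N, D N * (1 - e N) = D N := fun N => by rw [mul_sub, mul_one, de, sub_zero]
  have de1' : ∀ N, (1 - e' N) * D' N = D' N := fun N => by rw [sub_mul, one_mul, de', sub_zero]
  have key : ∀ N, ‖Y N + (1 - e N) * A * (1 - e' N)‖ ≤ ‖A‖ := fun N => by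
    induction N with
    | zero => simp [hY, he, he']
    | succ N ih =>
      set Q := Y N + (1 - e N) * A * (1 - e' N) with hQ
      set d := D N with hd
      set d' := D' N with hd'
      have sY : Y (N + 1) = Y N + d * A * d' := Finset.sum_range_succ _ _
      have se : e (N + 1) = e N + d := Finset.sum_range_succ _ _
      have se' : e' (N + 1) = e' N + d' := Finset.sum_range_succ _ _
      have dQ : d * Q = d * A * (1 - e' N) := by
        rw [hQ, mul_add, dY, zero_add, ← mul_assoc, ← mul_assoc, de1]
      have dQ' : Q * d' = (1 - e N) * A * d' := by
        rw [hQ, add_mul, dY', zero_add, mul_assoc, de1']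
      have dQd : d * Q * d' = d * A * d' := by
        rw [dQ, mul_assoc, de1']
      have eq : (2 : ℂ) • (Y (N + 1) + (1 - e (N + 1)) * A * (1 - e' (N + 1)))
          = Q + (1 - (d + d)) * Q * (1 - (d' + d')) := by
        have r : Q + (1 - (d + d)) * Q * (1 - (d' + d'))
            = 2 * Q - 2 * (d * Q) - 2 * (Q * d') + 4 * (d * Q * d') := by noncomm_ring
        rw [r, dQd, dQ, dQ', hQ, sY, se, se', two_smul]
        noncomm_ring
      have n1 : ‖(1 - (d + d)) * Q * (1 - (d' + d'))‖ ≤ ‖A‖ := by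
        calc _ ≤ ‖1 - (d + d)‖ * ‖Q‖ * ‖1 - (d' + d')‖ := norm_mul₃_le
          _ ≤ 1 * ‖A‖ * 1 := by gcongr <;> first | exact h1 N | exact h1' N
          _ = ‖A‖ := by ring
      have n2 : ‖(2 : ℂ) • (Y (N + 1) + (1 - e (N + 1)) * A * (1 - e' (N + 1)))‖ ≤ ‖A‖ + ‖A‖ := by
        rw [eq]; exact (norm_add_le _ _).trans (add_le_add ih n1)
      rw [norm_smul, Complex.norm_ofNat] at n2
      linarith
  have ee : e N * e N = e N := by
    rw [he, Finset.sum_mul]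
    refine Finset.sum_congr rfl fun i hi => ?_
    rw [Finset.mul_sum, Finset.sum_eq_single i (fun j _ hj => by rw [hD, if_neg hj.symm])
      (fun h => absurd hi h), hD, if_pos rfl]
  have eY : e N * Y N = Y N := by
    rw [he, hY, Finset.mul_sum]
    refine Finset.sum_congr rfl fun i hi => ?_
    rw [Finset.sum_mul, Finset.sum_eq_single i (fun j _ hj => by
      rw [← mul_assoc, ← mul_assoc, hD, if_neg hj, zero_mul, zero_mul]) (fun h => absurd hi h),
      ← mul_assoc, ← mul_assoc, hD, if_pos rfl]
  have : Y N = e N * (Y N + (1 - e N) * A * (1 - e' N)) := by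
    have e0 : e N * (1 - e N) = 0 := by rw [mul_sub, mul_one, ee, sub_self]
    rw [mul_add, eY, ← mul_assoc, ← mul_assoc, e0, zero_mul, zero_mul, add_zero]
  change ‖Y N‖ ≤ ‖A‖
  rw [this]
  calc _ ≤ ‖e N‖ * ‖Y N + (1 - e N) * A * (1 - e' N)‖ := norm_mul_le _ _
    _ ≤ 1 * ‖A‖ := by gcongr; exact key N
    _ = ‖A‖ := one_mul _

/-- An operator in `L(X, P)` almost commutes with slowly varying cut-offs. -/
theorem exists_cutoff {A : Op p} (hA : A ∈ PBounded p) (m : ℕ+) {η : ℝ} (hη : 0 < η) :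
    ∃ F : Op p, ∃ n₀ : ℕ+, ‖A * F - F * A‖ ≤ η ∧ ‖1 - F‖ ≤ 2 ∧ P p m * F = P p m ∧
      F * P p m = P p m ∧ ∀ n, n₀ ≤ n → F * (1 - P p n) = 0 ∧ (1 - P p n) * F = 0 := by
  have next : ∀ k : ℕ+, ∃ k', k < k' ∧ ‖P p k * A * (1 - P p k')‖ ≤ η / 8 ∧
      ‖(1 - P p k') * A * P p k‖ ≤ η / 8 := fun k => by
    obtain ⟨t1, t2⟩ := tendsto_P_mul_mul_one_sub hA k
    have pos : 0 < η / 8 := by positivity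
    obtain ⟨k', a1, a2, a3⟩ := ((eventually_gt_atTop k).and
      ((t1.eventually_le_const pos).and (t2.eventually_le_const pos))).exists
    exact ⟨k', a1, a2, a3⟩
  choose f hf1 hf2 hf3 using next
  set k : ℕ → ℕ+ := fun i => f^[i] m with hk
  have ks : ∀ i, k (i + 1) = f (k i) := fun i => Function.iterate_succ_apply' f i m
  have klt : ∀ i, k i < k (i + 1) := fun i => by rw [ks]; exact hf1 _
  have km : Monotone k := monotone_nat_of_le_succ fun i => (klt i).le
  have PP : ∀ {i j}, i ≤ j → P p (k i) * P p (k j) = P p (k i) ∧ P p (k j) * P p (k i) = P p (k i) :=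
    fun hij => ⟨P_mul_P (km hij), P_mul_P' (km hij)⟩
  set D : ℕ → Op p := fun i => P p (k (i + 1)) - P p (k i) with hDdef
  have hD : ∀ i j, D i * D j = if i = j then D i else 0 := fun i j => by
    simp only [hDdef, sub_mul, mul_sub]
    rcases lt_trichotomy i j with h | rfl | h
    · rw [if_neg h.ne, (PP (show i + 1 ≤ j + 1 by omega)).1, (PP (show i + 1 ≤ j by omega)).1,
        (PP (show i ≤ j + 1 by omega)).1, (PP h.le).1]
      abel
    · rw [if_pos rfl, (PP le_rfl).1, (PP le_rfl).1, (PP (Nat.le_succ i)).1, (PP (Nat.le_succ i)).2]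
      abel
    · rw [if_neg h.ne', (PP (show j + 1 ≤ i + 1 by omega)).2, (PP (show j ≤ i + 1 by omega)).2,
        (PP (show j + 1 ≤ i by omega)).2, (PP h.le).2]
      abel
  have h1 : ∀ i, ‖1 - (D i + D i)‖ ≤ 1 := fun i => by
    have hm : IsMul (D i) _ := (isMul_P (k (i + 1))).sub (isMul_P (k i))
    refine (isMul_one.sub (hm.add hm)).norm_le zero_le_one (.of_forall fun x => ?_)
    have hlt : ((k i : ℕ+) : ℝ) < (k (i + 1) : ℝ) := by exact_mod_cast klt i
    rcases le_or_gt |x| (k i : ℝ) with h | h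
    · rw [box_of_mem h, box_of_mem (h.trans hlt.le)]; simp
    · rcases le_or_gt |x| (k (i + 1) : ℝ) with h' | h'
      · rw [box_of_mem h', box_of_notMem h]; norm_num
      · rw [box_of_notMem h, box_of_notMem h']; simp
  have h2 : ∀ a N, ‖∑ i ∈ Finset.range N, D (i + a)‖ ≤ 1 := fun a N => by
    have : ∑ i ∈ Finset.range N, D (i + a) = P p (k (N + a)) * (1 - P p (k a)) := by
      rw [mul_sub, mul_one, (PP (Nat.le_add_left a N)).2]
      have := Finset.sum_range_sub (fun i => P p (k (i + a))) N
      simp only [zero_add] at this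
      rw [← this]
      exact Finset.sum_congr rfl fun i _ => by rw [hDdef, add_right_comm]
    rw [this]
    exact (norm_mul_le _ _).trans (mul_le_one₀ (norm_P_le _) (norm_nonneg _) (norm_one_sub_P_le _))
  have blocks : ∀ N, ‖∑ i ∈ Finset.range N, D (i + 1) * A * D i‖ ≤ ‖A‖ ∧
      ‖∑ i ∈ Finset.range N, D i * A * D (i + 1)‖ ≤ ‖A‖ := fun N =>
    ⟨norm_sum_blocks_le A (fun i j => by rw [hD]; simp) hD (fun i => h1 _) h1 N (h2 1 N),
      norm_sum_blocks_le A hD (fun i j => by rw [hD]; simp) h1 (fun i => h1 _) N (h2 0 N)⟩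
  obtain ⟨N, hN⟩ := exists_nat_gt (4 * ‖A‖ / η)
  have N0 : (0 : ℝ) < N := lt_of_le_of_lt (by positivity) hN
  rw [div_lt_iff₀ hη] at hN
  set G := ∑ i ∈ Finset.range N, P p (k (i + 1)) with hG
  have normN : ‖(N : ℂ)⁻¹‖ = (N : ℝ)⁻¹ := by rw [norm_inv, Complex.norm_natCast]
  have Nc : (N : ℂ) ≠ 0 := by exact_mod_cast N0.ne'
  have comm : ‖A * G - G * A‖ ≤ N * (η / 2) + 2 * ‖A‖ := by
    have e : A * G - G * A
        = (∑ i ∈ Finset.range N, ((1 - P p (k (i + 2))) * A * P p (k (i + 1))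
            + P p (k (i + 2)) * ((1 - P p (k (i + 1))) * A * P p (k i))
            - P p (k (i + 1)) * A * (1 - P p (k (i + 2)))
            - P p (k i) * A * (1 - P p (k (i + 1))) * P p (k (i + 2))))
          + ∑ i ∈ Finset.range N, D (i + 1) * A * D i
          - ∑ i ∈ Finset.range N, D i * A * D (i + 1) := by
      rw [hG, Finset.mul_sum, Finset.sum_mul, ← Finset.sum_sub_distrib, ← Finset.sum_add_distrib,
        ← Finset.sum_sub_distrib]
      refine Finset.sum_congr rfl fun i _ => ?_
      have r1 : P p (k (i + 2)) * (1 - P p (k (i + 1))) = D (i + 1) := by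
        rw [mul_sub, mul_one, (PP (show i + 1 ≤ i + 2 by omega)).2]
      have r2 : (1 - P p (k (i + 1))) * P p (k (i + 2)) = D (i + 1) := by
        rw [sub_mul, one_mul, (PP (show i + 1 ≤ i + 2 by omega)).1]
      have r3 : P p (k (i + 2)) * ((1 - P p (k (i + 1))) * A * P p (k i))
          = D (i + 1) * A * P p (k i) := by rw [← r1]; simp only [mul_assoc]
      have r4 : P p (k i) * A * (1 - P p (k (i + 1))) * P p (k (i + 2))
          = P p (k i) * A * D (i + 1) := by rw [← r2]; simp only [mul_assoc]
      rw [r3, r4]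
      simp only [hDdef]
      noncomm_ring
    have s1 : ‖∑ i ∈ Finset.range N, ((1 - P p (k (i + 2))) * A * P p (k (i + 1))
            + P p (k (i + 2)) * ((1 - P p (k (i + 1))) * A * P p (k i))
            - P p (k (i + 1)) * A * (1 - P p (k (i + 2)))
            - P p (k i) * A * (1 - P p (k (i + 1))) * P p (k (i + 2)))‖ ≤ N * (η / 2) := by
      refine (norm_sum_le_of_le _ (f := _) (fun i _ => ?_)).trans_eq
        (b := ∑ i ∈ Finset.range N, η / 2) (by simp)
      have b1 : ‖(1 - P p (k (i + 2))) * A * P p (k (i + 1))‖ ≤ η / 8 := by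
        rw [ks (i + 1)]; exact hf3 _
      have b2 : ‖(1 - P p (k (i + 1))) * A * P p (k i)‖ ≤ η / 8 := by rw [ks]; exact hf3 _
      have b3 : ‖P p (k (i + 1)) * A * (1 - P p (k (i + 2)))‖ ≤ η / 8 := by
        rw [ks (i + 1)]; exact hf2 _
      have b4 : ‖P p (k i) * A * (1 - P p (k (i + 1)))‖ ≤ η / 8 := by rw [ks]; exact hf2 _
      have b2' := (norm_mul_le (P p (k (i + 2))) ((1 - P p (k (i + 1))) * A * P p (k i))).trans
        (mul_le_of_le_one_left (norm_nonneg _) (norm_P_le _))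
      have b4' := (norm_mul_le (P p (k i) * A * (1 - P p (k (i + 1)))) (P p (k (i + 2)))).trans
        (mul_le_of_le_one_right (norm_nonneg _) (norm_P_le _))
      refine (norm_sub_le _ _).trans ?_
      refine (add_le_add_left ((norm_sub_le _ _).trans (add_le_add_left (norm_add_le _ _) _)) _).trans ?_
      linarith
    rw [e]
    refine (norm_sub_le _ _).trans ?_
    have := norm_add_le (∑ i ∈ Finset.range N, ((1 - P p (k (i + 2))) * A * P p (k (i + 1))
            + P p (k (i + 2)) * ((1 - P p (k (i + 1))) * A * P p (k i))
            - P p (k (i + 1)) * A * (1 - P p (k (i + 2)))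
            - P p (k i) * A * (1 - P p (k (i + 1))) * P p (k (i + 2))))
          (∑ i ∈ Finset.range N, D (i + 1) * A * D i)
    linarith [(blocks N).1, (blocks N).2]
  have mk : ∀ i, m ≤ k i := fun i => km (Nat.zero_le i)
  refine ⟨(N : ℂ)⁻¹ • G, k N, ?_, ?_, ?_, ?_, fun n hn => ⟨?_, ?_⟩⟩
  · rw [mul_smul_comm, smul_mul_assoc, ← smul_sub, norm_smul, normN, inv_mul_le_iff₀ N0]
    linarith
  · have : ‖G‖ ≤ N := (norm_sum_le_of_le _ fun i _ => norm_P_le _).trans_eq (by simp)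
    refine (norm_sub_le _ _).trans ?_
    have n1 : ‖(1 : Op p)‖ ≤ 1 := ContinuousLinearMap.norm_id_le
    have n2 : ‖(N : ℂ)⁻¹ • G‖ ≤ 1 := by
      rw [norm_smul, normN, inv_mul_le_iff₀ N0, mul_one]; exact this
    linarith
  · rw [mul_smul_comm, hG, Finset.mul_sum, Finset.sum_congr rfl fun i _ => P_mul_P (mk (i + 1)),
      Finset.sum_const, Finset.card_range, ← Nat.cast_smul_eq_nsmul ℂ, smul_smul,
      inv_mul_cancel₀ Nc, one_smul]
  · rw [smul_mul_assoc, hG, Finset.sum_mul, Finset.sum_congr rfl fun i _ => P_mul_P' (mk (i + 1)),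
      Finset.sum_const, Finset.card_range, ← Nat.cast_smul_eq_nsmul ℂ, smul_smul,
      inv_mul_cancel₀ Nc, one_smul]
  · rw [smul_mul_assoc, hG, Finset.sum_mul, Finset.sum_eq_zero, smul_zero]
    exact fun i hi => P_mul_one_sub ((km (Finset.mem_range.1 hi)).trans hn)
  · rw [mul_smul_comm, hG, Finset.mul_sum, Finset.sum_eq_zero, smul_zero]
    exact fun i hi => one_sub_mul_P ((km (Finset.mem_range.1 hi)).trans hn)

/-- The commutator of a regularizer, in terms of the commutator of the operator. -/
theorem regularizer_commutator {R : Type*} [Ring R] {A B K L : R} (hK : A * B - 1 = K)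
    (hL : B * A - 1 = L) (C : R) :
    B * C - C * B = L * C * B - B * C * K - B * (A * C - C * A) * B := by
  subst hK hL
  noncomm_ring

/-- `L(X, P)` is closed under passing to regularizers. -/
theorem pBounded_of_isPRegularizer {A B : Op p} (hA : A ∈ PBounded p) (hAB : IsPRegularizer A B) :
    B ∈ PBounded p := by
  have main : ∀ (m : ℕ+) (ε : ℝ), 0 < ε → ∃ n₀ : ℕ+, ∀ n, n₀ ≤ n →
      ‖P p m * B * (1 - P p n)‖ ≤ ε ∧ ‖(1 - P p n) * B * P p m‖ ≤ ε := fun m ε hε => by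
    obtain ⟨hK, hL⟩ := hAB
    set K := A * B - 1 with hKdef
    set L := B * A - 1 with hLdef
    set c := ‖B‖ + 1 with hc
    have c0 : 0 < c := by positivity
    have Bc : ‖B‖ ≤ c := by linarith
    have δ0 : 0 < ε / (8 * c) := by positivity
    obtain ⟨m', hm, k1, k2⟩ := ((eventually_ge_atTop m).and
      ((hL.1.eventually_le_const δ0).and (hK.2.eventually_le_const δ0))).exists
    obtain ⟨F, n₀, f1, f2, f3, f4, f5⟩ := exists_cutoff hA m' (show 0 < ε / (2 * c ^ 2) by positivity)
    have g1 : P p m * F = P p m := by rw [← P_mul_P hm, mul_assoc, f3]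
    have g2 : F * P p m = P p m := by rw [← P_mul_P' hm, ← mul_assoc, f4]
    have comm : ‖B * F - F * B‖ ≤ ε := by
      have e0 : L * B = B * K := by rw [hLdef, hKdef]; noncomm_ring
      have e1 : B * F - F * B
          = B * (1 - P p m') * 0 + (B * (1 - F) * ((1 - P p m') * K)
            - L * (1 - P p m') * (1 - F) * B - B * (A * F - F * A) * B) := by
        have r1 : (1 - F) * ((1 - P p m') * K) = (1 - F) * K := by
          have : (1 - F) * (1 - P p m') = 1 - F := by
            rw [mul_sub, mul_one, sub_mul, one_mul, f4, sub_self, sub_zero]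
          rw [← mul_assoc, this]
        have r2 : (1 - P p m') * (1 - F) = 1 - F := by
          rw [sub_mul, one_mul, mul_sub (P p m'), mul_one, f3, sub_self, sub_zero]
        rw [mul_assoc B (1 - F), r1, mul_assoc L, r2, mul_zero, zero_add,
          regularizer_commutator hKdef.symm hLdef.symm F]
        have : L * F * B - B * F * K = B * ((1 - F) * K) - L * (1 - F) * B + (L * B - B * K) := by
          noncomm_ring
        rw [this, e0, sub_self, add_zero]
      rw [e1, mul_zero, zero_add]
      have n1 : ‖B * (1 - F) * ((1 - P p m') * K)‖ ≤ c * 2 * (ε / (8 * c)) :=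
        norm_mul₃_le.trans (by gcongr)
      have n2 : ‖L * (1 - P p m') * (1 - F) * B‖ ≤ ε / (8 * c) * 2 * c :=
        norm_mul₃_le.trans (by gcongr)
      have n3 : ‖B * (A * F - F * A) * B‖ ≤ c * (ε / (2 * c ^ 2)) * c :=
        norm_mul₃_le.trans (by gcongr)
      have v1 : c * 2 * (ε / (8 * c)) = ε / 4 := by field_simp; norm_num
      have v2 : ε / (8 * c) * 2 * c = ε / 4 := by field_simp; norm_num
      have v3 : c * (ε / (2 * c ^ 2)) * c = ε / 2 := by field_simp
      rw [v1] at n1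
      rw [v2] at n2
      rw [v3] at n3
      refine (norm_sub_le _ _).trans ((add_le_add_left (norm_sub_le _ _) _).trans ?_)
      linarith
    refine ⟨n₀, fun n hn => ?_⟩
    obtain ⟨z1, z2⟩ := f5 n hn
    have q1 : P p m * B * (1 - P p n) = -(P p m * (B * F - F * B) * (1 - P p n)) := by
      have : P p m * (B * F - F * B) * (1 - P p n)
          = P p m * B * (F * (1 - P p n)) - P p m * F * B * (1 - P p n) := by noncomm_ring
      rw [this, z1, g1, mul_zero, zero_sub, neg_neg]
    have q2 : (1 - P p n) * B * P p m = (1 - P p n) * (B * F - F * B) * P p m := by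
      have : (1 - P p n) * (B * F - F * B) * P p m
          = (1 - P p n) * B * (F * P p m) - (1 - P p n) * F * B * P p m := by noncomm_ring
      rw [this, z2, g2, zero_mul, zero_mul, sub_zero]
    have b : ∀ Q Q' : Op p, ‖Q‖ ≤ 1 → ‖Q'‖ ≤ 1 → ‖Q * (B * F - F * B) * Q'‖ ≤ ε := fun Q Q' h h' =>
      calc _ ≤ ‖Q‖ * ‖B * F - F * B‖ * ‖Q'‖ := norm_mul₃_le
        _ ≤ 1 * ε * 1 := by gcongr
        _ = ε := by ring
    rw [q1, q2, norm_neg]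
    exact ⟨b _ _ (norm_P_le _) (norm_one_sub_P_le _), b _ _ (norm_one_sub_P_le _) (norm_P_le _)⟩
  refine pBounded_of_P (fun m => ?_) fun m => ?_ <;>
  · rw [Metric.tendsto_nhds]
    intro ε hε
    obtain ⟨n₀, h⟩ := main m (ε / 2) (half_pos hε)
    filter_upwards [eventually_ge_atTop n₀] with n hn
    rw [dist_zero_right, norm_norm]
    first
      | exact (h n hn).1.trans_lt (half_lt_self hε)
      | exact (h n hn).2.trans_lt (half_lt_self hε)

/-- A closed subspace is separated from a point by a functional. -/
theorem exists_dual_eq_zero {E : Type*} [NormedAddCommGroup E] [NormedSpace ℂ E] {S : Submodule ℂ E}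
    (hS : IsClosed (S : Set E)) {x : E} (hx : x ∉ S) :
    ∃ f : StrongDual ℂ E, (∀ y ∈ S, f y = 0) ∧ f x ≠ 0 := by
  have hx' : ‖S.mkQL x‖ ≠ 0 := fun h => hx (by
    have := (QuotientAddGroup.norm_mk_eq_zero_iff_mem_closure (S := S.toAddSubgroup) (m := x)).1 h
    rwa [Submodule.coe_toAddSubgroup, hS.closure_eq] at this)
  obtain ⟨g, -, hg⟩ := exists_dual_vector ℂ _ hx'
  refine ⟨g.comp S.mkQL, fun y hy => ?_, ?_⟩
  · have : S.mkQL y = 0 := (Submodule.Quotient.mk_eq_zero S).2 hy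
    rw [ContinuousLinearMap.comp_apply, this, map_zero]
  · rw [ContinuousLinearMap.comp_apply, hg]
    exact Complex.ofReal_ne_zero.2 hx'

/-- Asymptotic inverses converge to the inverse of the limit. -/
theorem StarStrongTendsto.inverse {a b : ℕ+ → Op p} {W : Op p} {c : ℝ} (hb : ∀ n, ‖b n‖ ≤ c)
    (ha : StarStrongTendsto a W) (hab : StarStrongTendsto (fun n => a n * b n - 1) 0)
    (hba : StarStrongTendsto (fun n => b n * a n - 1) 0) :
    ∃ W' : Op p, W * W' = 1 ∧ W' * W = 1 ∧ StarStrongTendsto b W' := by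
  have c0 : 0 ≤ c := (norm_nonneg _).trans (hb 1)
  have low : ∀ u, ‖u‖ ≤ c * ‖W u‖ := fun u => by
    have l1 : Tendsto (fun n => b n (a n u)) atTop (𝓝 u) := by
      simpa using (hba.1 u).add_const u
    refine le_of_tendsto_of_tendsto l1.norm ((ha.1 u).norm.const_mul c) (.of_forall fun n => ?_)
    exact ((b n).le_opNorm _).trans (mul_le_mul_of_nonneg_right (hb n) (norm_nonneg _))
  have low' : ∀ f : StrongDual ℂ (X p), ‖f‖ ≤ c * ‖f.comp W‖ := fun f => by
    have l1 : Tendsto (fun n => (f.comp (a n)).comp (b n)) atTop (𝓝 f) := by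
      have := (hab.2 f).add_const f
      simp only [ContinuousLinearMap.comp_zero, zero_add] at this
      refine this.congr fun n => ?_
      ext u; simp
    refine le_of_tendsto_of_tendsto l1.norm ((ha.2 f).norm.const_mul c) (.of_forall fun n => ?_)
    change _ ≤ c * ‖f.comp (a n)‖
    rw [mul_comm c]
    exact (ContinuousLinearMap.opNorm_comp_le _ _).trans
      (mul_le_mul_of_nonneg_left (hb n) (norm_nonneg _))
  have anti : AntilipschitzWith ⟨c, c0⟩ W :=
    W.antilipschitz_of_bound fun u => low u
  have hclosed : IsClosed (LinearMap.range (W : X p →ₗ[ℂ] X p) : Set (X p)) :=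
    anti.isClosed_range W.uniformContinuous
  have hsurj : LinearMap.range (W : X p →ₗ[ℂ] X p) = ⊤ := by
    by_contra hne
    obtain ⟨x, hx⟩ : ∃ x, x ∉ LinearMap.range (W : X p →ₗ[ℂ] X p) := by
      by_contra! h
      exact hne (eq_top_iff.2 fun x _ => h x)
    obtain ⟨f, hf, hfx⟩ : ∃ f : StrongDual ℂ (X p), f.comp W = 0 ∧ f x ≠ 0 := by
      obtain ⟨f, hf, hfx⟩ := exists_dual_eq_zero hclosed hx
      exact ⟨f, ContinuousLinearMap.ext fun u => hf _ ⟨u, rfl⟩, hfx⟩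
    have := low' f
    rw [hf, norm_zero, mul_zero] at this
    exact hfx (by rw [norm_le_zero_iff.1 this]; rfl)
  let e : X p ≃L[ℂ] X p := ContinuousLinearEquiv.ofBijective W
    (LinearMap.ker_eq_bot.2 anti.injective) hsurj
  let W' : Op p := e.symm
  have e1 : W * W' = 1 := by
    ext1 u; exact e.apply_symm_apply u
  have e2 : W' * W = 1 := by
    ext1 u; exact e.symm_apply_apply u
  refine ⟨W', e1, e2, fun u => ?_, fun f => ?_⟩
  · have i : ∀ n, b n u - W' u = (b n * a n - 1) (W' u) - b n (a n (W' u) - W (W' u)) := fun n => by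
      have : W (W' u) = u := e.apply_symm_apply u
      rw [this]; simp
    rw [tendsto_iff_norm_sub_tendsto_zero]
    have l1 := (hba.1 (W' u)).norm
    have l2 := (tendsto_iff_norm_sub_tendsto_zero.1 (ha.1 (W' u))).const_mul c
    rw [_root_.zero_apply, norm_zero] at l1
    refine squeeze_zero (fun _ => norm_nonneg _) (fun n => ?_) (by simpa using l1.add l2)
    rw [i]
    refine (norm_sub_le _ _).trans (add_le_add_right ?_ _)
    exact ((b n).le_opNorm _).trans (mul_le_mul_of_nonneg_right (hb n) (norm_nonneg _))
  · set g := f.comp W' with hg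
    have hgW : g.comp W = f := by
      ext u; exact congrArg f (e.symm_apply_apply u)
    have i : ∀ n, f.comp (b n) - g = g.comp (a n * b n - 1) - (g.comp (a n) - g.comp W).comp (b n) := fun n => by
      rw [hgW]; ext u; simp
    rw [tendsto_iff_norm_sub_tendsto_zero]
    have l1 := (hab.2 g).norm
    have l2 := (tendsto_iff_norm_sub_tendsto_zero.1 (ha.2 g)).mul_const c
    rw [ContinuousLinearMap.comp_zero, norm_zero] at l1
    refine squeeze_zero (fun _ => norm_nonneg _) (fun n => ?_) (by rw [← add_zero (0 : ℝ)]; nth_rw 2 [← zero_mul c]; exact l1.add l2)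
    rw [i]
    refine (norm_sub_le _ _).trans (add_le_add_right ?_ _)
    exact (ContinuousLinearMap.opNorm_comp_le _ _).trans
      (mul_le_mul_of_nonneg_left (hb n) (norm_nonneg _))

theorem tendsto_comp_P (hp1 : 1 < p) (hp : p ≠ ∞) (f : StrongDual ℂ (X p)) :
    Tendsto (fun m => f.comp (1 - P p m)) atTop (𝓝 0) := by
  refine tendsto_dual_comp_isMul hp1 hp isMul_one_sub_P (C := 1)
    (fun n => .of_forall (norm_one_sub_box_le _)) (.of_forall fun x => ?_) f
  refine tendsto_const_nhds.congr' ?_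
  filter_upwards [tendsto_pnat_cast.eventually_ge_atTop |x|] with n hn
  rw [box_of_mem hn, sub_self]

/-- For bounded sequences, `P`-strong convergence is stronger than `*`-strong convergence. -/
theorem PStrongTendsto.starStrong (hp1 : 1 < p) (hp : p ≠ ∞) {a : ℕ+ → Op p} {W : Op p} {c : ℝ}
    (hc : ∀ n, ‖a n‖ ≤ c) (ha : PStrongTendsto a W) : StarStrongTendsto a W := by
  have hd : ∀ n, ‖a n - W‖ ≤ c + ‖W‖ := fun n => (norm_sub_le _ _).trans (by gcongr; exact hc n)
  set d := c + ‖W‖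
  have d0 : 0 ≤ d := (norm_nonneg _).trans (hd 1)
  constructor
  · intro u
    rw [Metric.tendsto_nhds]
    intro ε hε
    obtain ⟨m, hm⟩ := ((tendsto_one_sub_P_apply hp u).norm.eventually_lt_const
      (show ‖(0 : X p)‖ < ε / (2 * (d + 1)) by rw [norm_zero]; positivity)).exists
    have l := ((ha _ (P_mem_PCompact m)).mul_const ‖u‖).eventually_lt_const
      (show 0 * ‖u‖ < ε / 2 by rw [zero_mul]; positivity)
    filter_upwards [l] with n hn
    rw [dist_eq_norm]
    have e : a n u - W u = ((a n - W) * P p m) u + (a n - W) ((1 - P p m) u) := by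
      simp only [mul_apply_eq_comp, _root_.sub_apply, one_apply_eq_self, map_sub]; abel
    rw [e]
    have i1 : ‖((a n - W) * P p m) u‖ < ε / 2 := by
      refine (((a n - W) * P p m).le_opNorm u).trans_lt (lt_of_le_of_lt ?_ hn)
      gcongr
      exact le_add_of_nonneg_left (norm_nonneg _)
    have i2 : ‖(a n - W) ((1 - P p m) u)‖ ≤ d * (ε / (2 * (d + 1))) :=
      ((a n - W).le_opNorm _).trans (mul_le_mul (hd n) hm.le (norm_nonneg _) d0)
    have i3 : d * (ε / (2 * (d + 1))) ≤ ε / 2 := by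
      rw [mul_div_assoc', div_le_div_iff₀ (by positivity) (by positivity)]; nlinarith
    linarith [norm_add_le (((a n - W) * P p m) u) ((a n - W) ((1 - P p m) u))]
  · intro f
    rw [Metric.tendsto_nhds]
    intro ε hε
    obtain ⟨m, hm⟩ := ((tendsto_comp_P hp1 hp f).norm.eventually_lt_const
      (show ‖(0 : StrongDual ℂ (X p))‖ < ε / (2 * (d + 1)) by rw [norm_zero]; positivity)).exists
    have l := ((ha _ (P_mem_PCompact m)).const_mul ‖f‖).eventually_lt_const
      (show ‖f‖ * 0 < ε / 2 by rw [mul_zero]; positivity)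
    filter_upwards [l] with n hn
    rw [dist_eq_norm]
    have e : f.comp (a n) - f.comp W
        = f.comp (P p m * (a n - W)) + (f.comp (1 - P p m)).comp (a n - W) := by
      ext u
      simp only [ContinuousLinearMap.comp_apply, mul_apply_eq_comp, _root_.sub_apply, _root_.add_apply, one_apply_eq_self, map_sub]; ring
    rw [e]
    have i1 : ‖f.comp (P p m * (a n - W))‖ < ε / 2 := by
      refine (ContinuousLinearMap.opNorm_comp_le _ _).trans_lt (lt_of_le_of_lt ?_ hn)
      gcongr
      exact le_add_of_nonneg_right (norm_nonneg _)
    have i2 : ‖(f.comp (1 - P p m)).comp (a n - W)‖ ≤ ε / (2 * (d + 1)) * d :=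
      (ContinuousLinearMap.opNorm_comp_le _ _).trans
        (mul_le_mul hm.le (hd n) (norm_nonneg _) (by positivity))
    have i3 : ε / (2 * (d + 1)) * d ≤ ε / 2 := by
      rw [div_mul_eq_mul_div, div_le_div_iff₀ (by positivity) (by positivity)]; nlinarith
    linarith [norm_add_le (f.comp (P p m * (a n - W))) ((f.comp (1 - P p m)).comp (a n - W))]

theorem HasSnapshot.starStrong (hp1 : 1 < p) (hp : p ≠ ∞) {h : ℕ+ → ℕ+} {A : OpSeq p} {t : Dir}
    {W : Op p} (hA : HasSnapshot h A t W) : StarStrongTendsto (fun n => Einv (h n) t (A n)) W := by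
  cases t
  case freq s => exact hA
  all_goals
    exact hA.1.starStrong hp1 hp fun n => (norm_Einv_le _ _ _).trans (A.norm_apply_le n)

/-- Asymptotic inverses of sequences with a snapshot have a snapshot. -/
theorem HasSnapshot.inverse (hp1 : 1 < p) (hp : p ≠ ∞) {h : ℕ+ → ℕ+} {A B : OpSeq p} {t : Dir}
    {W : Op p} (hA : HasSnapshot h A t W) (hAB : HasSnapshot h (A * B - 1) t 0)
    (hBA : HasSnapshot h (B * A - 1) t 0) : ∃ W', HasSnapshot h B t W' := by
  have one : ∀ n, Einv n t (1 : Op p) = 1 := fun n => by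
    simpa using Einv_algebraMap (p := p) n t 1
  have eAB : ∀ n, Einv (h n) t ((A * B - 1) n) = Einv (h n) t (A n) * Einv (h n) t (B n) - 1 :=
    fun n => by rw [OpSeq.sub_apply, OpSeq.mul_apply, OpSeq.one_apply, Einv_sub, Einv_mul, one]
  have eBA : ∀ n, Einv (h n) t ((B * A - 1) n) = Einv (h n) t (B n) * Einv (h n) t (A n) - 1 :=
    fun n => by rw [OpSeq.sub_apply, OpSeq.mul_apply, OpSeq.one_apply, Einv_sub, Einv_mul, one]
  have hb : ∀ n, ‖Einv (h n) t (B n)‖ ≤ ‖B‖ := fun n =>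
    (norm_Einv_le _ _ _).trans (B.norm_apply_le n)
  have s1 := hAB.starStrong hp1 hp
  have s2 := hBA.starStrong hp1 hp
  simp only [eAB] at s1
  simp only [eBA] at s2
  obtain ⟨W', w1, w2, hW'⟩ := (hA.starStrong hp1 hp).inverse hb s1 s2
  refine ⟨W', ?_⟩
  by_cases ht : t.IsShift
  swap
  · cases t
    case freq s => exact hW'
    all_goals exact absurd (fun _ => nofun) ht
  rw [hasSnapshot_iff ht] at hA hAB hBA ⊢
  have zero : (0 : Op p) ∈ PCompact p := by simp [PCompact]
  have hPB : W' ∈ PBounded p := pBounded_of_isPRegularizer hA.2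
    ⟨by rw [w1, sub_self]; exact zero, by rw [w2, sub_self]; exact zero⟩
  refine ⟨fun K hK => ?_, hPB⟩
  obtain ⟨K1, K2⟩ := hPB K hK
  have l1 := (hA.1 _ K2).mul_const ‖B‖
  have l2 := hAB.1 _ K2
  have l3 := (hA.1 _ K1).const_mul ‖B‖
  have l4 := hBA.1 _ K1
  simp only [eAB, sub_zero] at l2
  simp only [eBA, sub_zero] at l4
  refine squeeze_zero (fun _ => by positivity) (fun n => ?_)
    (by simpa using (l1.add l2).add (l3.add l4))
  set a := Einv (h n) t (A n)
  set b := Einv (h n) t (B n)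
  have q1 : K * (b - W') = K * W' * (a * b - 1) - K * W' * (a - W) * b := by
    have : K * W' * (a * b - 1) - K * W' * (a - W) * b = K * (W' * W) * b - K * W' := by noncomm_ring
    rw [this, w2, mul_one, mul_sub]
  have q2 : (b - W') * K = (b * a - 1) * (W' * K) - b * ((a - W) * (W' * K)) := by
    have : (b * a - 1) * (W' * K) - b * ((a - W) * (W' * K)) = b * (W * W') * K - W' * K := by
      noncomm_ring
    rw [this, w1, mul_one, sub_mul]
  rw [q1, q2]
  have i1 : ‖K * W' * (a - W) * b‖ ≤ ‖K * W' * (a - W)‖ * ‖B‖ :=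
    (norm_mul_le _ _).trans (mul_le_mul_of_nonneg_left (hb n) (norm_nonneg _))
  have i2 : ‖b * ((a - W) * (W' * K))‖ ≤ ‖B‖ * ‖(a - W) * (W' * K)‖ :=
    (norm_mul_le _ _).trans (mul_le_mul_of_nonneg_right (hb n) (norm_nonneg _))
  have j1 := norm_sub_le (K * W' * (a * b - 1)) (K * W' * (a - W) * b)
  have j2 := norm_sub_le ((b * a - 1) * (W' * K)) (b * ((a - W) * (W' * K)))
  have z1 : 0 ≤ ‖(a - W) * (K * W')‖ * ‖B‖ := by positivity
  have z2 : 0 ≤ ‖B‖ * ‖W' * K * (a - W)‖ := by positivity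
  have z3 := norm_nonneg ((a * b - 1) * (K * W'))
  have z4 := norm_nonneg (W' * K * (b * a - 1))
  rw [add_mul, mul_add]
  linarith

/-- Lifted regularizers are of local type. -/
theorem lift_mem_localType_of_isPRegularizer (hp1 : 1 < p) (hp : p ≠ ∞) {h : ℕ+ → ℕ+}
    (hh : Tendsto (fun n => (h n : ℝ)) atTop atTop) {t : Dir} (ht : t.IsShift) {A B : Op p}
    (hA : lift h t A ∈ localType p h) (hAb : A ∈ PBounded p) (hAB : IsPRegularizer A B) :
    lift h t B ∈ localType p h := by
  have kK : lift h t A * lift h t B - 1 = lift h t (A * B - 1) := by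
    rw [lift_sub, lift_mul, lift_one]
  have kL : lift h t B * lift h t A - 1 = lift h t (B * A - 1) := by
    rw [lift_sub, lift_mul, lift_one]
  obtain ⟨hA1, hA2⟩ := mem_localType_iff.1 hA
  have hB : lift h t B ∈ structured p h := fun s => by
    by_cases hs : s = t
    · subst hs
      exact ⟨B, hasSnapshot_lift_self ht (pBounded_of_isPRegularizer hAb hAB)⟩
    · obtain ⟨W, hW⟩ := hA1 s
      refine hW.inverse hp1 hp ?_ ?_
      · rw [kK]; exact hasSnapshot_lift_zero hp1 hp hh ht hAB.1 hs
      · rw [kL]; exact hasSnapshot_lift_zero hp1 hp hh ht hAB.2 hs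
  refine mem_localType_iff.2 ⟨hB, fun φ => ?_⟩
  have hC : cSeq p h φ ∈ structured p h := localType_le (cSeq_mem_localType hh φ)
  have JK : lift h t (A * B - 1) ∈ J p h := J_of_lift h (by rw [compactAt_eq ht]; exact hAB.1)
  have JL : lift h t (B * A - 1) ∈ J p h := J_of_lift h (by rw [compactAt_eq ht]; exact hAB.2)
  rw [regularizer_commutator kK kL]
  refine sub_mem (sub_mem ?_ ?_) ?_
  · exact J_mul_structured hB (J_mul_structured hC JL)
  · exact structured_mul_J (mul_mem hB hC) JK
  · exact J_mul_structured hB (structured_mul_J hB (hA2 φ))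

end ConvType

end

theorem mainTheorem9 (p : ℝ≥0∞) [Fact (1 ≤ p)] (hp1 : 1 < p) (hp : p ≠ ∞)
    (A : OpSeq p) (hA : A ∈ FA1 p) :
    ∃ μ : ℂ, (∀ n, A n = P p n * A n * P p n + μ • (1 - P p n)) ∧
      ∀ g : ℕ+ → ℕ+, StrictMono g → ∃ h : ℕ+ → ℕ+,
        (∃ k : ℕ+ → ℕ+, StrictMono k ∧ h = g ∘ k) ∧
        ∃ (hL : subseq A h ∈ localType p h)
          (hc : lift h .center (snapshot h (subseq A h) .center) ∈ localType p h)
          (hplus : lift h .plus (snapshot h (subseq A h) .plus) ∈ localType p h)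
          (hminus : lift h .minus (snapshot h (subseq A h) .minus) ∈ localType p h),
          (∀ s : ℝ, |s| < 1 → Phi p h s (coset hL) = Phi p h s (coset hc)) ∧
          Phi p h (1 : ℝ) (coset hL) = Phi p h (1 : ℝ) (coset hplus) ∧
          Phi p h (-1 : ℝ) (coset hL) = Phi p h (-1 : ℝ) (coset hminus) ∧
          (∀ s : OnePoint ℝ, (s = OnePoint.infty ∨ ∃ x : ℝ, s = x ∧ 1 < |x|) →
            Phi p h s (coset hL) = μ • Phi p h s 1) ∧
          (∀ B : Op p, IsPRegularizer (snapshot h (subseq A h) .center) B →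
            lift h .center B ∈ localType p h) ∧
          (∀ B : Op p, IsPRegularizer (snapshot h (subseq A h) .plus) B →
            lift h .plus B ∈ localType p h) ∧
          (∀ B : Op p, IsPRegularizer (snapshot h (subseq A h) .minus) B →
            lift h .minus B ∈ localType p h) := by
  obtain ⟨μ, hμ⟩ := exists_scalar hA
  refine ⟨μ, fun n => DFunLike.congr_fun hμ n, fun g hg => ?_⟩
  obtain ⟨S, hS, hSb, hgen⟩ := mem_generic.1 (FA1_le_generic hp1 hp hA)
  obtain ⟨k, hk, hlim⟩ := exists_common_subseq hS hSb g
  have hgk : StrictMono (g ∘ k) := hg.comp hk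
  have hh := tendsto_cast_of_strictMono hgk
  have good := mem_goodAlg.1 (hgen (g ∘ k) hgk hlim)
  refine ⟨g ∘ k, ⟨k, hk, rfl⟩, good.mem, ?_⟩
  set h := g ∘ k
  obtain ⟨Wc, c1, c2, c3⟩ := good.snap .center Dir.isShift_center
  obtain ⟨Wp, p1, p2, p3⟩ := good.snap .plus Dir.isShift_plus
  obtain ⟨Wm, m1, m2, m3⟩ := good.snap .minus Dir.isShift_minus
  rw [snapshot_eq hp c1, snapshot_eq hp p1, snapshot_eq hp m1]
  refine ⟨c2, p2, m2, fun s hs => (Phi_eq_iff _ _).2 (c3 _ ⟨s, rfl, hs⟩),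
    (Phi_eq_iff _ _).2 (p3 _ rfl), (Phi_eq_iff _ _).2 (m3 _ rfl), fun s hs => ?_,
    fun B hB => lift_mem_localType_of_isPRegularizer hp1 hp hh Dir.isShift_center c2
      ((hasSnapshot_iff Dir.isShift_center).1 c1).2 hB,
    fun B hB => lift_mem_localType_of_isPRegularizer hp1 hp hh Dir.isShift_plus p2
      ((hasSnapshot_iff Dir.isShift_plus).1 p1).2 hB,
    fun B hB => lift_mem_localType_of_isPRegularizer hp1 hp hh Dir.isShift_minus m2
      ((hasSnapshot_iff Dir.isShift_minus).1 m1).2 hB⟩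
  have hc : (μ • 1 : OpSeq p) ∈ localType p h := Subalgebra.smul_mem _ (one_mem _) _
  have hP : subseq (seqP p) h ∈ localType p h := (mem_goodAlg.1 (subseq_seqP_mem h hh)).mem
  rw [smul_Phi_one μ hc]
  refine (Phi_eq_iff _ _).2 ?_
  have e : subseq A h - μ • 1 = (subseq (seqP p) h * subseq A h - μ • 1) * subseq (seqP p) h := by
    have e1 : subseq A h = subseq (seqP p) h * subseq A h * subseq (seqP p) h
        + μ • (1 - subseq (seqP p) h) :=
      OpSeq.ext fun n => DFunLike.congr_fun hμ (h n)
    rw [sub_mul, smul_mul_assoc, one_mul]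
    nth_rw 1 [e1]
    rw [smul_sub]
    abel
  rw [e]
  exact LocZero.mul_left (sub_mem (mul_mem hP good.mem) hc) (locZero_subseq_seqP hh hs)
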